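/- **Conventions.** Indices $i,\ell,k$ lie in $\{0,1,2\}=\mathbb Z/3$ and $n\ge 3$, $0\le d\le n$. Put $\xi=e^{i\pi/3}$ and let $T\subset\mathbb C$ be the closed triangle with vertices $0,1,\xi$. A point $v=v_1+v_2\xi$ has coordinates $(v_0,v_1,v_2)$ with $v_0=1-v_1-v_2$; put $\partial_iT=\{v\in T: v_i=0\}$. A line of *type* $\ell$ has direction $e^{2\pi i(\ell+1)/3}$; the coordinate $v_\ell$ is constant on it, and for a segment $e$ of type $\ell$ this constant is its *height* $L(e)$. **Graphs.** All graphs have edges coloured by $\{0,1,3\}$ and an ordered set of *boundary vertices* (the univalent ones); isomorphisms preserve the colours and the order of the boundary vertices. $\Omega^1(G)$ is the space of functions $\omega$ on oriented edges of $G$ with $\omega(v,v')=-\omega(v',v)$, and for $\varphi:V\to\mathbb R$, $\mathcal F_G(\varphi)$ is the set of $\omega\in\Omega^1(G)$ with $\sum_{v'\sim v}\omega(v,v')=\varphi(v)$ for all $v$. **Honeycombs.** A *honeycomb* of $T$ is a finite set $h$ of non-trivial segments in $T$, each with one colour in $\{0,1,3\}$, such that (a) if the relative interiors of two distinct segments meet,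 then one of them has colour $0$, the other has colour $1$, and the oriented angle from the line of the first to the line of the second is $\pi/3$; (b) if two segments have exactly one common endpoint $v$ then, after exchanging them if necessary, their colours $(c,c')$ belong to $\{(0,0),(1,1),(0,1),(1,3),(3,0)\}$ and the oriented angle at $v$ from the first to the second is $2\pi/3$ (angles are counterclockwise, in $(0,\pi)$). Its *structure graph* $G(h)$ has the endpoints of segments as vertices and the segments as edges. The honeycomb is *triangular of size $n$* if all vertices of $G(h)$ have degree $1$ or $3$; the union $t(h)$ of the segments meets $\partial T$ exactly in the univalent vertices; every segment has a type; each $\partial_iT$ contains exactly $n$ points of $t(h)$; a segment with an endpoint on $\partial_iT$ has either colour $0$ and type $i+1$, or colour $1$ and type $i+2$; and along $\partial_iT$ the colour does not decrease when the coordinate $v_{i+1}$ increases. Boundary vertices are ordered counterclockwise: those on $\partial_0T$, then $\partial_1T$, then $\partial_2T$, and on $\partial_iT$ by decreasing $v_{i+1}$. Let $\mathrm{HONEY}_{n,d}$ be the set of triangular honeycombs of size $n$ such that exactly $d$ segments of colour $1$ meet one (and thus each) side, and $\mathrm{HONEY}^G_{n,d}$ the subset of those with $G(h)\cong G$. Let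 $\mathcal H_{reg}=\{\theta\in\mathbb R^n: 1>\theta_1>\dots>\theta_n\ge 0\}$. For $\alpha,\beta,\gamma\in\mathcal H_{reg}$ put $a_0=\beta$, $a_1=\alpha$, $a_2=(1-\gamma_n,\dots,1-\gamma_1)$ and let $\mathrm{HONEY}^G_{n,d}(\alpha,\beta,\gamma)$ be the set of $h\in\mathrm{HONEY}^G_{n,d}$ such that, for each $i$, the coordinates $v_{i+1}$ of the points of $t(h)\cap\partial_iT$ are $a_{i,1}>\dots>a_{i,n}$. **Flow of a honeycomb.** A trivalent vertex of a triangular honeycomb has sign $s(v)=1$ if its edges leave it in the directions $-e^{2\pi i(\ell+1)/3}$ and $s(v)=-1$ if they leave it in the directions $e^{2\pi i(\ell+1)/3}$; a univalent vertex has the sign opposite to that of its neighbour. For $h\in \mathrm{HONEY}^G_{n,d}$, $\mathcal L[h]\in\Omega^1(G)$ is defined, after identification of $G$ with $G(h)$, by $\mathcal L[h](v,v')=s(v)\,L([v,v'])$. **Dual hives.** Let $R_{d,n}=\{v\in\mathbb Z^3: 0\le v_i\le n,\ v_0+v_1+v_2=n+d\}$, and let $\varepsilon_0,\varepsilon_1,\varepsilon_2$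 be the standard basis. The set $E_{d,n}$ of edges consists of the pairs $e=\{v,\,v+\varepsilon_\ell-\varepsilon_{\ell+1}\}\subset R_{d,n}$; such an edge has *start* $v$, *type* $\ell$ and *height* $v_\ell$. The triangular faces are the *upper* ones $\{u+\varepsilon_0,u+\varepsilon_1,u+\varepsilon_2\}$ and the *lower* ones $\{w-\varepsilon_0,w-\varepsilon_1,w-\varepsilon_2\}$; a face $f$ has one edge $f^\ell$ of each type $\ell$, and the types $\ell,\ell+2,\ell+1$ follow each other clockwise. An edge of type $\ell$, start $v$ is *outer* if $v_{\ell+2}=0$ (long side) or $v_{\ell+2}=n$ (short side). The outer edges *belonging to* $\partial_iT$ are: the $d$ edges of type $i+2$ on short sides, the one of height $r$ having rank $r+1$ $(0\le r<d)$; and the $n-d$ edges of type $i+1$ on long sides, the one of height $r$ having rank $n+d-r$ $(d\le r<n)$. A *colour map* is a map $C:E_{d,n}\to\{0,1,3,m\}$ such that, around every triangular face, the colours in clockwise order are, up to rotation, $(0,0,0)$, $(1,1,1)$, $(1,0,3)$ or $(0,1,m)$. A *dual hive with colour map $C$ and boundary $(\alpha,\beta,\gamma)$* is a map $L:E_{d,n}\to(0,\infty)$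 such that (i) $L(f^0)+L(f^1)+L(f^2)=1$ for every face $f$; (ii) if two distinct faces $f,g$ share an edge of type $k$, and $\ell\ne k$, then $L(f^\ell)=L(g^\ell)$ if the shared edge has colour $m$, while if it has another colour and $f^\ell$ has larger height than $g^\ell$ then $L(f^\ell)>L(g^\ell)$; (iii) an outer edge belonging to $\partial_iT$ of rank $j$ has colour $0$ and $L(e)=a_{i,j}$ if it is on a long side, and has colour $1$ and $L(e)=1-a_{i,j}$ if it is on a short side. The set of these is denoted $\mathrm{DUAL}^C(\alpha,\beta,\gamma)$. **The graph $G^C$ and the map $\rho_C$.** Let $\Gamma$ be the graph whose vertices are the faces and the outer edges (*outer vertices*), with one edge dual to each $e\in E_{d,n}$: it joins the two faces containing $e$ or, if $e$ is outer, the face containing $e$ and the outer vertex $e$. A *chain* of colour $c\in\{0,1,3\}$ is a path in $\Gamma$ whose edges are dual to edges $e_1,\dots,e_{2r+1}$ of colours $c,m,c,m,\dots,c$. The vertices of $G^C$ are the outer vertices and the faces without edge of colour $m$; two distinct vertices of $G^C$ are joined by an edge of colour $c$ if they are the ends of a chain of colour $c$ (a *maximal chain*). The boundary vertices of $G^C$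 are the outer vertices, ordered by the side $\partial_iT$ to which they belong, then by rank. For $L\in\mathrm{DUAL}^C(\alpha,\beta,\gamma)$, let $x_f\in T$ be the point with coordinates $(L(f^0),L(f^1),L(f^2))$ for a face $f$; for an outer edge $e$ of type $\ell$ belonging to $\partial_iT$, let $x_e\in\partial_iT$ be the point whose coordinate of index $\ell$ is $L(e)$. Then $\rho_C(L)$ is the set of coloured segments obtained as follows: for every maximal chain, take the union of the segments $[x_v,x_{v'}]$ over the edges $\{v,v'\}$ of the chain, with the colour of the chain. Finally let $\varphi_{\alpha,\beta,\gamma}$ be the function on the vertices of $G^C$ equal to $1$ on upper faces, $-1$ on lower faces, and, at the outer vertex of rank $j$ belonging to $\partial_iT$, equal to $1-a_{i,j}$ if the outer edge has colour $1$ and to $-a_{i,j}$ otherwise. **Proposition (colour map indexing).** Let $n\ge3$ and $0\le d\le n$. 1. $\mathrm{HONEY}_{n,d}=\bigsqcup_{C}\mathrm{HONEY}_{n,d}^{G^C}$, a disjoint union over all colour maps $C$ of $E_{d,n}$. 2. For every colour map $C$ and all $\alpha,\beta,\gamma\in\mathcal H_{reg}$, $\rho_C$ is a bijection from $\mathrm{DUAL}^C(\alpha,\beta,\gamma)$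 onto $\mathrm{HONEY}_{n,d}^{G^C}(\alpha,\beta,\gamma)$. 3. For every colour map $C$ there is a linear map $M:\Omega^1(G^C)\to\mathbb R^{E_{d,n}}$, whose matrix in the canonical bases has integer entries, such that for all $\alpha,\beta,\gamma\in\mathcal H_{reg}$ and all $L\in \mathrm{DUAL}^C(\alpha,\beta,\gamma)$ the flow $\mathcal L[\rho_C(L)]$ is well defined (it does not depend on the identification of $G^C$ with the structure graph), belongs to $\mathcal F_{G^C}(\varphi_{\alpha,\beta,\gamma})$, and satisfies $M(\mathcal L[\rho_C(L)])=L$. In other words, $(\mathcal L\circ\rho_C)^{-1}$ is the restriction of $M$. -/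

import Mathlib

noncomputable section

namespace HoneyHive

/-! ### Colours -/

/-- The colours `0`, `1`, `3` of the segments of a honeycomb. -/
inductive SegColor where
  | zero
  | one
  | three

/-- The colour as an integer. -/
def SegColor.toNat : SegColor → ℕ
  | .zero => 0
  | .one => 1
  | .three => 3

/-- The colours `0`, `1`, `3`, `m` of the edges of a dual hive. -/
inductive HiveColor where
  | seg (c : SegColor)
  | m

/-! ### Edge-coloured graphs with ordered boundary, and flows on them -/

/-- A graph with coloured edges (`edge c u v`: there is an edge of colour `c` between `u` and `v`)
together with a relation `bdryLT` that orders its boundary (that is, univalent) vertices. -/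
structure ColoredGraph where
  V : Type
  edge : SegColor → V → V → Prop
  edge_symm : ∀ c u v, edge c u v → edge c v u
  edge_irrefl : ∀ c u, ¬ edge c u u
  bdryLT : V → V → Prop

namespace ColoredGraph

/-- Adjacency, colours forgotten. -/
def Adj (G : ColoredGraph) (u v : G.V) : Prop := ∃ c, G.edge c u v

/-- The number of neighbours of a vertex. -/
def degree (G : ColoredGraph) (v : G.V) : ℕ := {w | G.Adj v w}.ncard

/-- Isomorphisms of coloured graphs with ordered boundary. -/
structure Iso (G G' : ColoredGraph) where
  toEquiv : G.V ≃ G'.V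
  edge_iff : ∀ c u v, G'.edge c (toEquiv u) (toEquiv v) ↔ G.edge c u v
  bdryLT_iff : ∀ u v, G.degree u = 1 → G.degree v = 1 →
    (G'.bdryLT (toEquiv u) (toEquiv v) ↔ G.bdryLT u v)

/-- `Ω¹(G)`: antisymmetric real functions on the oriented edges of `G`
(extended by `0` to pairs of vertices which are not adjacent). -/
def flows (G : ColoredGraph) : Submodule ℝ (G.V → G.V → ℝ) where
  carrier := {ω | (∀ a b, ω a b = -ω b a) ∧ ∀ a b, ¬ G.Adj a b → ω a b = 0}
  add_mem' := by
    rintro x y ⟨hx, hx'⟩ ⟨hy, hy'⟩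
    refine ⟨fun a b => ?_, fun a b h => ?_⟩
    · simp only [Pi.add_apply]
      rw [hx a b, hy a b]
      ring
    · simp [hx' a b h, hy' a b h]
  zero_mem' := by simp
  smul_mem' := by
    rintro r x ⟨hx, hx'⟩
    refine ⟨fun a b => ?_, fun a b h => ?_⟩
    · simp only [Pi.smul_apply, smul_eq_mul]
      rw [hx a b]
      ring
    · simp [hx' a b h]

theorem Adj.symm {G : ColoredGraph} {u v : G.V} (h : G.Adj u v) : G.Adj v u :=
  h.imp fun c hc => G.edge_symm c u v hc

open Classical in
/-- The canonical basis element `δ_(a,b)` of `Ω¹(G)`: it is `1` at the oriented edge `(a,b)`,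
`-1` at `(b,a)` and `0` elsewhere. -/
def deltaFlow (G : ColoredGraph) (a b : G.V) (hab : G.Adj a b) : G.flows :=
  ⟨fun x y => (if x = a ∧ y = b then 1 else 0) - (if x = b ∧ y = a then 1 else 0), by
    refine ⟨fun x y => ?_, fun x y h => ?_⟩
    · simp only [and_comm (a := y = a), and_comm (a := y = b)]
      ring
    · have h1 : ¬ (x = a ∧ y = b) := by
        rintro ⟨rfl, rfl⟩
        exact h hab
      have h2 : ¬ (x = b ∧ y = a) := by
        rintro ⟨rfl, rfl⟩
        exact h hab.symm
      simp [h1, h2]⟩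

/-- `𝓕_G(φ)`: the flows with divergence `φ`. -/
def flowsWithDiv (G : ColoredGraph) (φ : G.V → ℝ) : Set G.flows :=
  {ω | ∀ v, ∑ᶠ x, ω.1 v x = φ v}

/-- A linear map `Ω¹(G) → ℝ^E` whose matrix in the canonical bases has integer entries. -/
def IsIntegral (G : ColoredGraph) {E : Type} (M : G.flows →ₗ[ℝ] (E → ℝ)) : Prop :=
  ∀ (a b : G.V) (hab : G.Adj a b) (e : E), ∃ k : ℤ, M (G.deltaFlow a b hab) e = k

end ColoredGraph

/-! ### Segments and honeycombs in the plane -/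

/-- A coloured collection of subsets of the plane. -/
abbrev ColoredSegments := Set (Set ℂ × SegColor)

/-- `∂e` for a segment `e`. -/
def endpoints (e : Set ℂ) : Set ℂ := {v | ∃ w, e = segment ℝ v w}

/-- The interior of a segment: the segment minus its endpoints. -/
def segInterior (e : Set ℂ) : Set ℂ := e \ endpoints e

/-- `e` is a non-trivial segment of `S`. -/
def IsSegmentOf (S : Set ℂ) (e : Set ℂ) : Prop :=
  ∃ v ∈ S, ∃ w ∈ S, v ≠ w ∧ e = segment ℝ v w

/-- `u` is the unit vector tangent to `e` at its endpoint `v`, pointing from `v` into `e`. -/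
def IsTangentAt (e : Set ℂ) (v u : ℂ) : Prop :=
  ‖u‖ = 1 ∧ ∃ r : ℝ, 0 < r ∧ e = segment ℝ v (v + r * u)

/-- `u` is one of the two unit vectors tangent to `e`. -/
def IsTangent (e : Set ℂ) (u : ℂ) : Prop := ∃ v, IsTangentAt e v u

/-- The oriented angle condition for two unit vectors: `det (u, u') > 0` and the angle is `θ`. -/
def VecAngle (u u' : ℂ) (θ : ℝ) : Prop :=
  0 < u.re * u'.im - u.im * u'.re ∧ Real.arccos (inner ℝ u u') = θ

/-- The angle from the (unoriented) segment `e` to the segment `e'` is `θ`. -/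
def SegAngle (e e' : Set ℂ) (θ : ℝ) : Prop :=
  ∃ u u', IsTangent e u ∧ IsTangent e' u' ∧ VecAngle u u' θ

/-- The angle from `e` to `e'` at their common endpoint `v` is `θ`. -/
def SegAngleAt (v : ℂ) (e e' : Set ℂ) (θ : ℝ) : Prop :=
  ∃ u u', IsTangentAt e v u ∧ IsTangentAt e' v u' ∧ VecAngle u u' θ

/-- The pairs of colours which are allowed for two segments meeting at a common endpoint,
the second one following the first one counterclockwise. -/
def allowedPairs : Set (SegColor × SegColor) :=
  {(.zero, .zero), (.one, .one), (.zero, .one), (.one, .three), (.three, .zero)}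

/-- An allowed crossing of `p` and `q`. -/
def CrossOK (p q : Set ℂ × SegColor) : Prop :=
  p.2 = .zero ∧ q.2 = .one ∧ SegAngle p.1 q.1 (Real.pi / 3)

/-- An allowed meeting of `p` and `q` at the common endpoint `v`. -/
def MeetOK (v : ℂ) (p q : Set ℂ × SegColor) : Prop :=
  (p.2, q.2) ∈ allowedPairs ∧ SegAngleAt v p.1 q.1 (2 * Real.pi / 3)

/-- Non-degenerate honeycombs of a domain `S` of the plane. -/
structure IsHoneycomb (S : Set ℂ) (h : ColoredSegments) : Prop where
  finite : h.Finite
  segments : ∀ p ∈ h, IsSegmentOf S p.1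
  color_unique : ∀ e c c', (e, c) ∈ h → (e, c') ∈ h → c = c'
  cross : ∀ p ∈ h, ∀ q ∈ h, p ≠ q → (segInterior p.1 ∩ segInterior q.1).Nonempty →
    CrossOK p q ∨ CrossOK q p
  meet : ∀ p ∈ h, ∀ q ∈ h, ∀ v, endpoints p.1 ∩ endpoints q.1 = {v} →
    MeetOK v p q ∨ MeetOK v q p

/-- `t(h)`: the union of the segments of `h`. -/
def support (h : ColoredSegments) : Set ℂ := ⋃ p ∈ h, p.1

/-- The set of endpoints of the segments of `h`. -/
def vertexSet (h : ColoredSegments) : Set ℂ := ⋃ p ∈ h, endpoints p.1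

/-! ### The equilateral triangle -/

/-- `e^{iπ/3}`. -/
def zeta : ℂ := Complex.exp (Complex.I * (Real.pi / 3 : ℝ))

/-- `e^{2πi(ℓ+1)/3}`, the direction of the lines of type `ℓ`. -/
def typeDir (l : Fin 3) : ℂ := Complex.exp (2 * Real.pi * Complex.I * ((l : ℕ) + 1) / 3)

/-- The triangle with vertices `0`, `1`, `e^{iπ/3}`. -/
def triangle : Set ℂ :=
  {z | ∃ x y : ℝ, 0 ≤ x ∧ x ≤ 1 ∧ 0 ≤ y ∧ y ≤ 1 ∧ x + y ≤ 1 ∧ z = x + y * zeta}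

/-- The coordinates `(v₀, v₁, v₂)` of `v`, where `v = v₁ + v₂ e^{iπ/3}` and `v₀ = 1 - v₁ - v₂`. -/
def coord (v : ℂ) : Fin 3 → ℝ :=
  ![1 - (v.re - v.im / √3) - 2 * v.im / √3, v.re - v.im / √3, 2 * v.im / √3]

/-- The point with coordinates `(x₀, x₁, x₂)` (where `x₀ + x₁ + x₂ = 1`). -/
def ofCoord (x : Fin 3 → ℝ) : ℂ := x 1 + x 2 * zeta

theorem coord_add_mul_zeta (x y : ℝ) : coord (x + y * zeta) = ![1 - x - y, x, y] := by
  have hz : zeta = ⟨1 / 2, √3 / 2⟩ := by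
    have h : Complex.I * ((Real.pi / 3 : ℝ) : ℂ) = ((Real.pi / 3 : ℝ) : ℂ) * Complex.I :=
      mul_comm _ _
    rw [zeta, h]
    apply Complex.ext
    · rw [Complex.exp_ofReal_mul_I_re, Real.cos_pi_div_three]
    · rw [Complex.exp_ofReal_mul_I_im, Real.sin_pi_div_three]
  have h3 : √3 ≠ 0 := by positivity
  have him : ((x : ℂ) + y * zeta).im = y * (√3 / 2) := by simp [hz]
  have hre : ((x : ℂ) + y * zeta).re = x + y * (1 / 2) := by simp [hz]
  rw [coord, him, hre]
  have e1 : x + y * (1 / 2) - y * (√3 / 2) / √3 = x := by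
    field_simp
    ring
  have e2 : 2 * (y * (√3 / 2)) / √3 = y := by
    field_simp
  rw [e1, e2]

/-- The side `∂ᵢT = {v ∈ T | vᵢ = 0}`. -/
def side (i : Fin 3) : Set ℂ := {v | v ∈ triangle ∧ coord v i = 0}

/-- The boundary `∂T`. -/
def triangleBoundary : Set ℂ := ⋃ i, side i

/-- `e` is contained in a line of type `ℓ`. -/
def HasType (e : Set ℂ) (l : Fin 3) : Prop :=
  ∃ x ∈ triangle, ∀ z ∈ e, ∃ r : ℝ, z = x + r * typeDir l

/-- The type of a segment of a triangular honeycomb. -/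
def segType (e : Set ℂ) : Fin 3 := Classical.epsilon fun l => HasType e l

/-- The height of a segment of a triangular honeycomb: the common value of the coordinate
`x_ℓ` of its points `x`, where `ℓ` is the type of the segment. -/
def segHeight (e : Set ℂ) : ℝ := Classical.epsilon fun a => ∀ x ∈ e, coord x (segType e) = a

/-! ### Triangular honeycombs -/

/-- The structure graph of a honeycomb. Its boundary vertices are ordered counterclockwise:
first those on `∂₀T`, then those on `∂₁T`, then those on `∂₂T`, and those on `∂ᵢT` by
decreasing coordinate of index `i + 1`. -/
def structureGraph (h : ColoredSegments) : ColoredGraph where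
  V := {v : ℂ // v ∈ vertexSet h}
  edge c u v := u ≠ v ∧ (segment ℝ u.1 v.1, c) ∈ h
  edge_symm c u v := by
    rintro ⟨h1, h2⟩
    exact ⟨h1.symm, by rwa [segment_symm]⟩
  edge_irrefl c u := fun h => h.1 rfl
  bdryLT u v := ∃ i j : Fin 3, u.1 ∈ side i ∧ v.1 ∈ side j ∧
    (i < j ∨ i = j ∧ coord v.1 (i + 1) < coord u.1 (i + 1))

/-- Triangular honeycombs of size `n`. -/
structure IsTriangular (n : ℕ) (h : ColoredSegments) : Prop where
  honeycomb : IsHoneycomb triangle h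
  degrees : ∀ v, (structureGraph h).degree v = 1 ∨ (structureGraph h).degree v = 3
  boundary : support h ∩ triangleBoundary = {z | ∃ v, (structureGraph h).degree v = 1 ∧ v.1 = z}
  types : ∀ p ∈ h, ∃ l, HasType p.1 l
  side_card : ∀ i, (support h ∩ side i).ncard = n
  side_edges : ∀ i, ∀ p ∈ h, ∀ v ∈ endpoints p.1, v ∈ side i →
    (p.2 = .zero ∧ HasType p.1 (i + 1)) ∨ (p.2 = .one ∧ HasType p.1 (i + 2))
  side_mono : ∀ i, ∀ p ∈ h, ∀ q ∈ h, ∀ x ∈ p.1 ∩ side i, ∀ y ∈ q.1 ∩ side i,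
    coord x (i + 1) < coord y (i + 1) → p.2.toNat ≤ q.2.toNat

/-- The triangular honeycombs of size `n` such that `d` edges of colour `1` meet one
(and thus each) side of the triangle. -/
def honey (n d : ℕ) : Set ColoredSegments :=
  {h | IsTriangular n h ∧
    ∃ i, {p | p ∈ h ∧ p.2 = .one ∧ (p.1 ∩ side i).Nonempty}.ncard = d}

/-- The boundary values of `h` are `a`: for each `i`, the coordinates of index `i + 1` of the
points of `t(h)` on `∂ᵢT` are `a i 0 > a i 1 > ⋯`. -/
def HasBoundary {n : ℕ} (h : ColoredSegments) (a : Fin 3 → Fin n → ℝ) : Prop :=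
  ∀ i, StrictAnti (a i) ∧ (fun v => coord v (i + 1)) '' (support h ∩ side i) = Set.range (a i)

/-- The elements of `honey n d` with structure graph isomorphic to `G`. -/
def honeyOn (n d : ℕ) (G : ColoredGraph) : Set ColoredSegments :=
  {h | h ∈ honey n d ∧ Nonempty (G.Iso (structureGraph h))}

/-- The elements of `honey n d` with structure graph isomorphic to `G` and boundary `a`. -/
def honeyOnBdry {n : ℕ} (d : ℕ) (G : ColoredGraph) (a : Fin 3 → Fin n → ℝ) :
    Set ColoredSegments :=
  {h | h ∈ honeyOn n d G ∧ HasBoundary h a}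

/-! ### The flow of a honeycomb -/

open Classical in
/-- The sign of a trivalent vertex `v`: it is `1` if the edges at `v` leave `v` in the directions
`-e^{2πi(ℓ+1)/3}`, and `-1` if they leave `v` in the directions `e^{2πi(ℓ+1)/3}`. -/
def innerSign (h : ColoredSegments) (v : (structureGraph h).V) : ℝ :=
  if ∀ w, (structureGraph h).Adj v w →
    ∃ (l : Fin 3) (r : ℝ), 0 ≤ r ∧ w.1 = v.1 - r * typeDir l then 1 else -1

open Classical in
/-- The sign `s(v)` of a vertex; for a univalent vertex it is the opposite of the sign of
the vertex adjacent to it. -/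
def vertexSign (h : ColoredSegments) (v : (structureGraph h).V) : ℝ :=
  if (structureGraph h).degree v = 1 then
    (if ∃ w, (structureGraph h).Adj v w ∧ innerSign h w = 1 then -1 else 1)
  else innerSign h v

/-- `ω` is the flow `𝓛[h] ∈ Ω¹(G)` of `h`, with `G` identified with the structure graph of `h`:
its value at the oriented edge `(v, v')` is `s(v) L({v, v'})`, with `L` the height. -/
def IsFlowOf (G : ColoredGraph) (h : ColoredSegments) (ω : G.flows) : Prop :=
  ∃ ι : G.Iso (structureGraph h), ∀ a b, G.Adj a b →
    ω.1 a b = vertexSign h (ι.toEquiv a) *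
      segHeight (segment ℝ (ι.toEquiv a).1 (ι.toEquiv b).1)

/-! ### The hexagonal piece of the triangular lattice -/

/-- Lattice points `r + s e^{iπ/3}` are given by their coordinates `(n + d - r - s, r, s)`. -/
abbrev Pt := Fin 3 → ℤ

/-- The standard basis vectors of `ℤ³`. -/
def eps (i : Fin 3) : Pt := Pi.single i 1

/-- The vertices of `H_{d,n}`. -/
def hiveVertices (n d : ℕ) : Set Pt :=
  {v | (∀ i, 0 ≤ v i ∧ v i ≤ n) ∧ v 0 + v 1 + v 2 = n + d}

/-- The edges of `H_{d,n}`. The edge of type `ℓ` starting at `v` goes from `v` to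
`v - e^{2πiℓ/3}`, which has coordinates `v + ε_ℓ - ε_{ℓ+1}`. -/
@[ext]
structure HiveEdge (n d : ℕ) where
  start : Pt
  type : Fin 3
  start_mem : start ∈ hiveVertices n d
  end_mem : start + eps type - eps (type + 1) ∈ hiveVertices n d

/-- The height `v_ℓ` of the edge of type `ℓ` starting at `v`. -/
def HiveEdge.height {n d : ℕ} (e : HiveEdge n d) : ℤ := e.start e.type

/-- The triangular faces of `H_{d,n}`: upper ones, with vertices `u + ε₀`, `u + ε₁`, `u + ε₂`
(lower left, lower right and top), and lower ones, with vertices `w - ε₀`, `w - ε₁`, `w - ε₂`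
(upper right, upper left and bottom). -/
inductive HiveFace (n d : ℕ) where
  | upper (u : Pt) (hu : ∀ i, u + eps i ∈ hiveVertices n d)
  | lower (w : Pt) (hw : ∀ i, w - eps i ∈ hiveVertices n d)

/-- The edge of type `ℓ` of a triangular face. -/
def HiveFace.edge {n d : ℕ} : HiveFace n d → Fin 3 → HiveEdge n d
  | .upper u hu, l =>
      ⟨u + eps (l + 1), l, hu _, by
        have h : u + eps (l + 1) + eps l - eps (l + 1) = u + eps l := by abel
        rw [h]
        exact hu l⟩
  | .lower w hw, l =>
      ⟨w - eps l, l, hw _, by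
        have h : w - eps l + eps l - eps (l + 1) = w - eps (l + 1) := by abel
        rw [h]
        exact hw (l + 1)⟩

/-- The edge lies on one of the three boundary sides `∂^{(ℓ,ℓ)}` of `H_{d,n}` of length `n - d`
(an edge of type `ℓ` has constant coordinate of index `ℓ + 2`). -/
def HiveEdge.OnLongSide {n d : ℕ} (e : HiveEdge n d) : Prop := e.start (e.type + 2) = 0

/-- The edge lies on one of the three boundary sides `∂^{(ℓ,ℓ+1)}` of `H_{d,n}` of length `d`. -/
def HiveEdge.OnShortSide {n d : ℕ} (e : HiveEdge n d) : Prop := e.start (e.type + 2) = n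

/-- Outer edges: those on the boundary of the hexagon. -/
def HiveEdge.IsOuter {n d : ℕ} (e : HiveEdge n d) : Prop := e.OnLongSide ∨ e.OnShortSide

open Classical in
/-- The index `i` of the side `∂ᵢT` that corresponds to an outer edge. -/
def HiveEdge.outerSide {n d : ℕ} (e : HiveEdge n d) : Fin 3 :=
  if e.OnLongSide then e.type + 2 else e.type + 1

open Classical in
/-- The rank in `{0, …, n - 1}` of an outer edge among those with the same `outerSide`,
in counterclockwise order: first the `d` edges on the short side, by increasing height,
then the `n - d` edges on the long side, by decreasing height. -/
def HiveEdge.outerRank {n d : ℕ} (e : HiveEdge n d) : ℕ :=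
  if e.OnLongSide then (n + d - 1 - e.height).toNat else e.height.toNat

/-- The boundary value attached to an outer edge by a boundary condition `a`. -/
def bdryValue {n d : ℕ} (a : Fin 3 → Fin n → ℝ) (e : HiveEdge n d) : ℝ :=
  if hr : e.outerRank < n then a e.outerSide ⟨e.outerRank, hr⟩ else 0

/-! ### Colour maps and dual hives -/

/-- The allowed colours around a triangular face in clockwise order, up to rotation. -/
def allowedTriples : Set (HiveColor × HiveColor × HiveColor) :=
  {(.seg .zero, .seg .zero, .seg .zero), (.seg .one, .seg .one, .seg .one),
    (.seg .one, .seg .zero, .seg .three), (.seg .zero, .seg .one, .m)}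

/-- Colour maps. In every triangular face, the edges of type `ℓ`, `ℓ + 2`, `ℓ + 1` follow each
other in clockwise order. -/
def IsColorMap {n d : ℕ} (C : HiveEdge n d → HiveColor) : Prop :=
  ∀ f : HiveFace n d, ∃ l : Fin 3,
    (C (f.edge l), C (f.edge (l + 2)), C (f.edge (l + 1))) ∈ allowedTriples

/-- The type of colour maps. -/
abbrev ColorMap (n d : ℕ) := {C : HiveEdge n d → HiveColor // IsColorMap C}

/-- The boundary `(β, α, γ̃)`, with `γ̃ = (1 - γ_n, …, 1 - γ_1)`. -/
def hiveBoundary {n : ℕ} (α β γ : Fin n → ℝ) : Fin 3 → Fin n → ℝ :=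
  ![β, α, fun j => 1 - γ j.rev]

/-- `(C, L)` is a dual hive with boundary `(α, β, γ)`. In the fields `eq_of_m` and `lt_of_ne_m`,
`f` and `g` are the two faces of a lozenge with middle edge of type `k`. -/
structure IsDualHive {n d : ℕ} (α β γ : Fin n → ℝ) (C : HiveEdge n d → HiveColor)
    (L : HiveEdge n d → ℝ) : Prop where
  colorMap : IsColorMap C
  pos : ∀ e, 0 < L e
  sum_face : ∀ f : HiveFace n d, L (f.edge 0) + L (f.edge 1) + L (f.edge 2) = 1
  eq_of_m : ∀ (f g : HiveFace n d) (k l : Fin 3), f ≠ g → f.edge k = g.edge k → l ≠ k →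
    C (f.edge k) = .m → L (f.edge l) = L (g.edge l)
  lt_of_ne_m : ∀ (f g : HiveFace n d) (k l : Fin 3), f ≠ g → f.edge k = g.edge k → l ≠ k →
    C (f.edge k) ≠ .m → (g.edge l).height < (f.edge l).height → L (g.edge l) < L (f.edge l)
  long_side : ∀ e : HiveEdge n d, e.OnLongSide →
    C e = .seg .zero ∧ L e = bdryValue (hiveBoundary α β γ) e
  short_side : ∀ e : HiveEdge n d, e.OnShortSide →
    C e = .seg .one ∧ L e = 1 - bdryValue (hiveBoundary α β γ) e

/-- The dual hives with colour map `C` and boundary `(α, β, γ)`, given by their label maps. -/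
def dualHives {n d : ℕ} (C : ColorMap n d) (α β γ : Fin n → ℝ) : Set (HiveEdge n d → ℝ) :=
  {L | IsDualHive α β γ C.1 L}

/-! ### The dual graph, maximal chains and the reduced graph -/

/-- The vertices of the dual graph `Γ_{d,n}`. -/
inductive DualVertex (n d : ℕ) where
  | face (f : HiveFace n d)
  | outer (e : HiveEdge n d) (he : e.IsOuter)

/-- The edge of `Γ_{d,n}` dual to `e` is incident to the given vertex. -/
def DualVertex.Incident {n d : ℕ} (e : HiveEdge n d) : DualVertex n d → Prop
  | .face f => ∃ l, f.edge l = e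
  | .outer e' _ => e' = e

/-- The edge of `Γ_{d,n}` dual to `e` joins `x` and `y`. -/
def Joins {n d : ℕ} (e : HiveEdge n d) (x y : DualVertex n d) : Prop :=
  x ≠ y ∧ x.Incident e ∧ y.Incident e

/-- `IsChain C c x [e₁, …, e_{2r+1}] y`: in `Γ_{d,n}`, the edges dual to `e₁, …, e_{2r+1}` form a
path from `x` to `y`, and the `e_i` have colours `c, m, c, m, …, c`. -/
inductive IsChain {n d : ℕ} (C : HiveEdge n d → HiveColor) (c : SegColor) :
    DualVertex n d → List (HiveEdge n d) → DualVertex n d → Prop where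
  | single (e : HiveEdge n d) (x y : DualVertex n d) (he : Joins e x y) (hc : C e = .seg c) :
      IsChain C c x [e] y
  | cons (e f : HiveEdge n d) (x z w y : DualVertex n d) (es : List (HiveEdge n d))
      (he : Joins e x z) (hc : C e = .seg c) (hf : Joins f z w) (hm : C f = .m)
      (hes : IsChain C c w es y) : IsChain C c x (e :: f :: es) y

/-- The vertices of the reduced graph: the outer vertices of `Γ_{d,n}`, and the faces without
an edge coloured `m`. -/
def InReduced {n d : ℕ} (C : HiveEdge n d → HiveColor) : DualVertex n d → Prop
  | .face f => ∀ l, C (f.edge l) ≠ .m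
  | .outer _ _ => True

/-- A maximal chain: a chain between two vertices of the reduced graph. -/
def IsMaxChain {n d : ℕ} (C : HiveEdge n d → HiveColor) (c : SegColor) (x : DualVertex n d)
    (es : List (HiveEdge n d)) (y : DualVertex n d) : Prop :=
  InReduced C x ∧ InReduced C y ∧ IsChain C c x es y

/-- The counterclockwise order on the outer vertices of `Γ_{d,n}`. -/
def outerLT {n d : ℕ} : DualVertex n d → DualVertex n d → Prop
  | .outer e _, .outer e' _ => e.outerSide < e'.outerSide ∨
      e.outerSide = e'.outerSide ∧ e.outerRank < e'.outerRank
  | _, _ => False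

/-- The reduced graph `G^C`. -/
def reducedGraph {n d : ℕ} (C : HiveEdge n d → HiveColor) : ColoredGraph where
  V := {x : DualVertex n d // InReduced C x}
  edge c x y := x ≠ y ∧ ∃ es, IsMaxChain C c x.1 es y.1 ∨ IsMaxChain C c y.1 es x.1
  edge_symm c x y := by
    rintro ⟨h1, es, h2⟩
    exact ⟨h1.symm, es, h2.symm⟩
  edge_irrefl c x := fun h => h.1 rfl
  bdryLT x y := outerLT x.1 y.1

/-- The divergence `φ` on the vertices of `G^C` for the boundary condition `a`: it is `1` at upper
faces and `-1` at lower faces (the sign of the corresponding honeycomb vertex), and at an outer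
vertex with boundary value `t` it is `-t` if its edge has colour `0` and `1 - t` if its edge has
colour `1`. -/
def divergence {n d : ℕ} (C : HiveEdge n d → HiveColor) (a : Fin 3 → Fin n → ℝ)
    (x : (reducedGraph C).V) : ℝ :=
  match x.1 with
  | .face (.upper _ _) => 1
  | .face (.lower _ _) => -1
  | .outer e _ =>
    match C e with
    | .seg .one => 1 - bdryValue a e
    | _ => -bdryValue a e

/-! ### From dual hives to honeycombs -/

open Classical in
/-- The point `x_v` of the triangle attached to a vertex `v` of `Γ_{d,n}`. For a face it has
coordinates `(L(e⁰), L(e¹), L(e²))`; for an outer edge `e` of type `ℓ` it is the point of the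
side `∂ᵢT` that corresponds to `e` whose coordinate of index `ℓ` is `L(e)`. -/
def dualPoint {n d : ℕ} (L : HiveEdge n d → ℝ) : DualVertex n d → ℂ
  | .face f => ofCoord fun l => L (f.edge l)
  | .outer e _ => ofCoord fun l =>
      if l = e.type then L e else if l = e.outerSide then 0 else 1 - L e

/-- `Φ(e) = [x_v, x_v']`, where `v`, `v'` are the endpoints of the edge of `Γ_{d,n}` dual to
`e`. -/
def dualSegment {n d : ℕ} (L : HiveEdge n d → ℝ) (e : HiveEdge n d) : Set ℂ :=
  {z | ∃ v v', Joins e v v' ∧ z ∈ segment ℝ (dualPoint L v) (dualPoint L v')}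

/-- The map `ρ_C`: every maximal chain gives the union of the `Φ(e)` over the edges `e` of the
chain, with the colour of the chain. -/
def rho {n d : ℕ} (C : HiveEdge n d → HiveColor) (L : HiveEdge n d → ℝ) : ColoredSegments :=
  {p | ∃ x es y, IsMaxChain C p.2 x es y ∧ p.1 = ⋃ e ∈ es, dualSegment L e}

/-- `𝓗_reg` -/
def regularSpectra (n : ℕ) : Set (Fin n → ℝ) :=
  {θ | StrictAnti θ ∧ ∀ i, 0 ≤ θ i ∧ θ i < 1}

end HoneyHive

end

open HoneyHive

/-!
The proof rests on a duality between dual hives and convex piecewise linear functions.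

**From hives to honeycombs.** Because the labels around a face have sum `1`, the numbers `1/3 - L e`
are the differences of a function on the lattice points of the hexagon (`exists_potential`). The
conditions on adjacent faces say that adding any linear function to it gives a function
`hivePsi L z` that is concave, strictly except across edges of colour `m` (`Hive`, `StrictHive`). For such a
function a local maximum is global (`local_max`), so that its maximal set is a vertex, an edge, a
face or a lozenge. Hence every point `z` of the triangle is on the segment dual to an edge `e`
exactly when `hivePsi L z` is maximal at both ends of `e` (`onEdge_iff`), and the shape of the
maximal set at `z` shows how segments can meet at `z`. This gives `Hive.rho_honeycomb`,
`Hive.dual_injective`, the isomorphism `Hive.iso` from the reduced graph to the structure graph,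
and `Hive.rho_mem`.

**From honeycombs to hives.** The segments of a honeycomb, oriented by their types, form a `Web`.
Its vertices and segments define a piecewise linear function `Web.pot` on the triangle; the
directional slopes of `pot` at a point are the support function of a point, an edge, a triangle or
a lozenge of the lattice (`Web.exists_germ`), so `pot` is convex, and the lattice points of these
sets are its subgradients. For every face of the hexagon exactly one point of the triangle has the
vertices of the face as subgradients (`exists_face_point`): it minimizes `pot` minus a linear
function. The coordinates of these points are the labels of a dual hive whose honeycomb is the
given one (`exists_hive`).

**The flow.** At a vertex of the honeycomb the flow along a chain is, up to sign, the label of the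
edge of the chain (`flow_divergence`). A label of an edge of colour `m` is an integer combination of
labels of edges of other colours, because the labels around every face have sum `1`, and `1` is the
divergence of the flow at a vertex (`exists_integral_inverse`).

**Uniqueness of the colour map.** Let `φ` be an isomorphism from the reduced graph of a dual hive
with colour map `C` to that of a colour map `C'`. The order of the boundary vertices forces `φ` to
fix them (`Hive.iso_outer`). The remaining steps are instances of a summation by parts over the
honeycomb (`virial`): for vectors attached to the ends of the chains which are opposite at the two
ends and balanced at the vertices, the inner products with the displacements along the chains have
sum zero, so that they all vanish if none is negative. The choice of the vectors shows that `φ`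
preserves the types of edges (`transport_type`), the positions of edges of colour `3`
(`transport_three`) and of colour `m` (`color_m_iff`); these determine the colour map (`color_eq`).
The same method shows that a reduced graph has no automorphism but the identity (`iso_eq_id`), which
makes the flow well defined and, with the integral inverse, `rho C` injective.
-/

noncomputable section
namespace HoneyHive

section

/-! ### Points and edges of the hexagon -/

variable {n d : ℕ}

section Index

variable (l : Fin 3)

@[simp] theorem idx_one_one : l + 1 + 1 = l + 2 := by fin_cases l <;> rfl
@[simp] theorem idx_one_two : l + 1 + 2 = l := by fin_cases l <;> rfl
@[simp] theorem idx_two_one : l + 2 + 1 = l := by fin_cases l <;> rfl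
@[simp] theorem idx_two_two : l + 2 + 2 = l + 1 := by fin_cases l <;> rfl
@[simp] theorem idx_ne_one : l ≠ l + 1 := by fin_cases l <;> decide
@[simp] theorem idx_ne_two : l ≠ l + 2 := by fin_cases l <;> decide
@[simp] theorem idx_one_ne : l + 1 ≠ l := by fin_cases l <;> decide
@[simp] theorem idx_two_ne : l + 2 ≠ l := by fin_cases l <;> decide
@[simp] theorem idx_one_ne_two : l + 1 ≠ l + 2 := by fin_cases l <;> decide
@[simp] theorem idx_two_ne_one : l + 2 ≠ l + 1 := by fin_cases l <;> decide

/-- The three indices, counted from `l`. -/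
theorem idx_cases (k : Fin 3) : k = l ∨ k = l + 1 ∨ k = l + 2 := by
  revert l k; decide

theorem forall_idx {P : Fin 3 → Prop} : (∀ k, P k) ↔ P l ∧ P (l + 1) ∧ P (l + 2) :=
  ⟨fun h => ⟨h _, h _, h _⟩, fun ⟨h0, h1, h2⟩ k => by
    rcases idx_cases l k with rfl | rfl | rfl <;> assumption⟩

theorem sum_rot {A : Type*} [AddCommMonoid A] (f : Fin 3 → A) :
    f l + f (l + 1) + f (l + 2) = f 0 + f 1 + f 2 := by
  fin_cases l
  · rfl
  · change f 1 + f 2 + f 0 = _; abel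
  · change f 2 + f 0 + f 1 = _; abel

end Index

theorem eps_apply (i j : Fin 3) : eps i j = if j = i then 1 else 0 := by
  simp [eps, Pi.single_apply]

theorem pt_ext (l : Fin 3) {v w : Pt} (h0 : v l = w l) (h1 : v (l + 1) = w (l + 1))
    (h2 : v (l + 2) = w (l + 2)) : v = w :=
  funext ((forall_idx l).2 ⟨h0, h1, h2⟩)

theorem mem_hive (l : Fin 3) {v : Pt} : v ∈ hiveVertices n d ↔
    (0 ≤ v l ∧ v l ≤ n) ∧ (0 ≤ v (l + 1) ∧ v (l + 1) ≤ n) ∧ (0 ≤ v (l + 2) ∧ v (l + 2) ≤ n) ∧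
      v l + v (l + 1) + v (l + 2) = n + d := by
  rw [sum_rot l v]
  simp only [hiveVertices, Set.mem_ofPred_eq, forall_idx l]
  tauto

theorem hiveVertices_finite : (hiveVertices n d).Finite :=
  (Set.finite_Icc (0 : Pt) (fun _ => (n : ℤ))).subset fun _ hv =>
    ⟨fun i => (hv.1 i).1, fun i => (hv.1 i).2⟩

instance : Finite (HiveEdge n d) := by
  have : Finite (hiveVertices n d) := hiveVertices_finite
  refine Finite.of_injective
    (fun e : HiveEdge n d => ((⟨e.start, e.start_mem⟩ : hiveVertices n d), e.type)) ?_
  intro a b h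
  simp only [Prod.mk.injEq, Subtype.mk.injEq] at h
  exact HiveEdge.ext h.1 h.2

/-- The end of an edge. -/
def HiveEdge.finish (e : HiveEdge n d) : Pt := e.start + eps e.type - eps (e.type + 1)

theorem HiveEdge.finish_mem (e : HiveEdge n d) : e.finish ∈ hiveVertices n d := e.end_mem

@[simp] theorem upper_start (u : Pt) (hu) (l : Fin 3) :
    ((HiveFace.upper u hu : HiveFace n d).edge l).start = u + eps (l + 1) := rfl
@[simp] theorem upper_type (u : Pt) (hu) (l : Fin 3) :
    ((HiveFace.upper u hu : HiveFace n d).edge l).type = l := rfl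
@[simp] theorem lower_start (u : Pt) (hu) (l : Fin 3) :
    ((HiveFace.lower u hu : HiveFace n d).edge l).start = u - eps l := rfl
@[simp] theorem lower_type (u : Pt) (hu) (l : Fin 3) :
    ((HiveFace.lower u hu : HiveFace n d).edge l).type = l := rfl
@[simp] theorem face_type (f : HiveFace n d) (l : Fin 3) : (f.edge l).type = l := by
  cases f <;> rfl

theorem edge_injective (f : HiveFace n d) {k l : Fin 3} (h : f.edge k = f.edge l) : k = l := by
  have := congrArg HiveEdge.type h
  simpa using this

theorem HiveEdge.up_mem (e : HiveEdge n d) (h : ¬ e.OnShortSide) :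
    ∀ i, e.start - eps (e.type + 1) + eps i ∈ hiveVertices n d := by
  have h1 := (mem_hive e.type).1 e.start_mem
  have h2 := (mem_hive e.type).1 e.end_mem
  have h3 : e.start (e.type + 2) ≠ n := h
  simp [eps_apply] at h2
  refine (forall_idx e.type).2 ⟨?_, ?_, ?_⟩ <;> rw [mem_hive e.type] <;>
    simp [eps_apply] <;> omega

/-- The upper face which contains an edge. -/
def HiveEdge.up (e : HiveEdge n d) (h : ¬ e.OnShortSide) : HiveFace n d :=
  .upper (e.start - eps (e.type + 1)) (e.up_mem h)

theorem HiveEdge.low_mem (e : HiveEdge n d) (h : ¬ e.OnLongSide) :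
    ∀ i, e.start + eps e.type - eps i ∈ hiveVertices n d := by
  have h1 := (mem_hive e.type).1 e.start_mem
  have h2 := (mem_hive e.type).1 e.end_mem
  have h3 : e.start (e.type + 2) ≠ 0 := h
  simp [eps_apply] at h2
  refine (forall_idx e.type).2 ⟨?_, ?_, ?_⟩ <;> rw [mem_hive e.type] <;>
    simp [eps_apply] <;> omega

/-- The lower face which contains an edge. -/
def HiveEdge.low (e : HiveEdge n d) (h : ¬ e.OnLongSide) : HiveFace n d :=
  .lower (e.start + eps e.type) (e.low_mem h)

@[simp] theorem up_edge (e : HiveEdge n d) (h) : (e.up h).edge e.type = e := by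
  apply HiveEdge.ext <;> simp [HiveEdge.up]

@[simp] theorem low_edge (e : HiveEdge n d) (h) : (e.low h).edge e.type = e := by
  apply HiveEdge.ext <;> simp [HiveEdge.low]

theorem not_short_upper (u : Pt) (hu) (l : Fin 3) :
    ¬ ((HiveFace.upper u hu : HiveFace n d).edge l).OnShortSide := by
  intro h
  have h1 := (mem_hive l).1 (hu (l + 2))
  simp [eps_apply] at h1
  simp [HiveEdge.OnShortSide, eps_apply] at h
  omega

theorem not_long_lower (u : Pt) (hu) (l : Fin 3) :
    ¬ ((HiveFace.lower u hu : HiveFace n d).edge l).OnLongSide := by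
  intro h
  have h1 := (mem_hive l).1 (hu (l + 2))
  simp [eps_apply] at h1
  simp [HiveEdge.OnLongSide, eps_apply] at h
  omega

open Classical in
/-- The vertex of the dual graph on the upper side of an edge: segments leave it in the direction
of increasing coordinate of index `type + 1`. -/
def HiveEdge.plus (e : HiveEdge n d) : DualVertex n d :=
  if h : e.OnShortSide then .outer e (Or.inr h) else .face (e.up h)

open Classical in
/-- The vertex of the dual graph on the lower side of an edge. -/
def HiveEdge.minus (e : HiveEdge n d) : DualVertex n d :=
  if h : e.OnLongSide then .outer e (Or.inl h) else .face (e.low h)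

@[simp] theorem plus_upper (u : Pt) (hu) (l : Fin 3) :
    ((HiveFace.upper u hu : HiveFace n d).edge l).plus = .face (.upper u hu) := by
  rw [HiveEdge.plus, dif_neg (not_short_upper u hu l)]
  simp [HiveEdge.up]

@[simp] theorem minus_lower (u : Pt) (hu) (l : Fin 3) :
    ((HiveFace.lower u hu : HiveFace n d).edge l).minus = .face (.lower u hu) := by
  rw [HiveEdge.minus, dif_neg (not_long_lower u hu l)]
  simp [HiveEdge.low]

theorem plus_incident (e : HiveEdge n d) : e.plus.Incident e := by
  unfold HiveEdge.plus
  split_ifs with h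
  · rfl
  · exact ⟨_, up_edge e h⟩

theorem minus_incident (e : HiveEdge n d) : e.minus.Incident e := by
  unfold HiveEdge.minus
  split_ifs with h
  · rfl
  · exact ⟨_, low_edge e h⟩

theorem plus_ne_minus (hn : 0 < n) (e f : HiveEdge n d) : e.plus ≠ f.minus := by
  unfold HiveEdge.plus HiveEdge.minus
  split_ifs with h h'
  · rintro ⟨⟩
    simp only [HiveEdge.OnShortSide, HiveEdge.OnLongSide] at h h'
    omega
  all_goals simp [HiveEdge.up, HiveEdge.low]

theorem incident_iff {e : HiveEdge n d} {x : DualVertex n d} :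
    x.Incident e ↔ x = e.plus ∨ x = e.minus := by
  constructor
  · cases x with
    | face f =>
      rintro ⟨l, rfl⟩
      cases f with
      | upper u hu => left; simp
      | lower u hu => right; simp
    | outer e' he =>
      rintro (rfl : e' = e)
      rcases he with he | he
      · right; rw [HiveEdge.minus, dif_pos he]
      · left; rw [HiveEdge.plus, dif_pos he]
  · rintro (rfl | rfl)
    · exact plus_incident e
    · exact minus_incident e

theorem joins_iff (hn : 0 < n) {e : HiveEdge n d} {x y : DualVertex n d} :
    Joins e x y ↔ (x = e.plus ∧ y = e.minus) ∨ (x = e.minus ∧ y = e.plus) := by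
  unfold Joins
  rw [incident_iff, incident_iff]
  have := plus_ne_minus hn e e
  constructor
  · rintro ⟨h, rfl | rfl, rfl | rfl⟩ <;> simp_all
  · rintro (⟨rfl, rfl⟩ | ⟨rfl, rfl⟩) <;> simp_all [Ne.symm]

theorem plus_eq_upper {e : HiveEdge n d} {u : Pt} {hu} (h : e.plus = .face (.upper u hu)) :
    (HiveFace.upper u hu : HiveFace n d).edge e.type = e := by
  have := plus_incident e
  rw [h] at this
  obtain ⟨l, hl⟩ := this
  rw [← hl]
  simp

theorem minus_eq_lower {e : HiveEdge n d} {u : Pt} {hu} (h : e.minus = .face (.lower u hu)) :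
    (HiveFace.lower u hu : HiveFace n d).edge e.type = e := by
  have := minus_incident e
  rw [h] at this
  obtain ⟨l, hl⟩ := this
  rw [← hl]
  simp

/-- The upper side of an edge is an upper face or an outer vertex on a short side. -/
theorem plus_cases (e : HiveEdge n d) : (∃ u hu, e.plus = .face (.upper u hu)) ∨
    ∃ h : e.OnShortSide, e.plus = .outer e (Or.inr h) := by
  unfold HiveEdge.plus
  split_ifs with h
  · exact Or.inr ⟨h, rfl⟩
  · exact Or.inl ⟨_, e.up_mem h, rfl⟩

/-- The lower side of an edge is a lower face or an outer vertex on a long side. -/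
theorem minus_cases (e : HiveEdge n d) : (∃ u hu, e.minus = .face (.lower u hu)) ∨
    ∃ h : e.OnLongSide, e.minus = .outer e (Or.inl h) := by
  unfold HiveEdge.minus
  split_ifs with h
  · exact Or.inr ⟨h, rfl⟩
  · exact Or.inl ⟨_, e.low_mem h, rfl⟩

theorem face_eq_of_edges {f g : HiveFace n d} (h0 : f.edge 0 = g.edge 0)
    (h1 : f.edge 1 = g.edge 1) : f = g := by
  have a0 := congrArg HiveEdge.start h0
  have a1 := congrFun (congrArg HiveEdge.start h1) 0
  rcases f with ⟨u, hu⟩ | ⟨u, hu⟩ <;> rcases g with ⟨w, hw⟩ | ⟨w, hw⟩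
  · obtain rfl := add_right_cancel a0; rfl
  · have := congrFun a0 0
    simp [eps_apply] at this a1
    omega
  · have := congrFun a0 0
    simp [eps_apply] at this a1
    omega
  · obtain rfl := sub_left_injective a0; rfl

instance : Finite (HiveFace n d) :=
  Finite.of_injective (fun f : HiveFace n d => (f.edge 0, f.edge 1)) fun _ _ h =>
    face_eq_of_edges (congrArg Prod.fst h) (congrArg Prod.snd h)

instance : Finite (DualVertex n d) := by
  refine Finite.of_injective (β := HiveFace n d ⊕ HiveEdge n d) (fun x => match x with
    | .face f => .inl f
    | .outer e _ => .inr e) ?_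
  rintro (f | ⟨e, he⟩) (g | ⟨e', he'⟩) h <;> simp_all

/-- A discrete Poincaré lemma: a function on the edges of the hexagon whose sum around every face
vanishes is the difference of a function on the vertices. Subtracting partial sums along the edges
of type `1`, one may assume that it vanishes on these edges; then the values on all the edges of
type `2` between two consecutive lines of type `1` are equal. -/
theorem exists_potential {A : Type*} [AddCommGroup A] (s : HiveEdge n d → A)
    (hs : ∀ f : HiveFace n d, s (f.edge 0) + s (f.edge 1) + s (f.edge 2) = 0) :
    ∃ c : Pt → A, ∀ e : HiveEdge n d, c e.finish - c e.start = s e := by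
  classical
  have coords : ∀ e : HiveEdge n d, 0 ≤ e.start 0 ∧ 0 ≤ e.start 1 ∧ 0 ≤ e.finish 0 ∧
      e.start 0 + e.start 1 + e.start 2 = n + d := fun e => by
    have h1 := (mem_hive 0).1 e.start_mem
    have h2 := (mem_hive 0).1 e.finish_mem
    simp only [zero_add] at h1 h2
    omega
  have uniq : ∀ e e' : HiveEdge n d, e.type = e'.type → e.start 0 = e'.start 0 →
      e.start 1 = e'.start 1 → e = e' := fun e e' h h0 h1 => by
    have h2 := coords e
    have h3 := coords e'
    exact HiveEdge.ext (pt_ext 0 h0 h1 (by simp only [zero_add]; omega)) h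
  let s₁ : ℤ → ℕ → A := fun i k =>
    if h : ∃ e : HiveEdge n d, e.type = 1 ∧ e.start 0 = i ∧ e.start 1 = k then s h.choose else 0
  let c₁ : Pt → A := fun v => ∑ k ∈ Finset.range (v 1).toNat, s₁ (v 0) k
  let r : HiveEdge n d → A := fun e => s e - (c₁ e.finish - c₁ e.start)
  have hr1 : ∀ e : HiveEdge n d, e.type = 1 → r e = 0 := by
    intro e he
    have h0 := coords e
    have h1 : e.finish 0 = e.start 0 ∧ e.finish 1 = e.start 1 + 1 := by
      simp [HiveEdge.finish, he, eps_apply]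
    have h2 : ∃ e' : HiveEdge n d, e'.type = 1 ∧ e'.start 0 = e.start 0 ∧
        e'.start 1 = (e.start 1).toNat := ⟨e, he, rfl, by omega⟩
    obtain ⟨h3, h4, h5⟩ := h2.choose_spec
    simp only [r, c₁, h1]
    rw [show (e.start 1 + 1).toNat = (e.start 1).toNat + 1 by omega, Finset.sum_range_succ,
      add_sub_cancel_left, sub_eq_zero]
    rw [show s₁ (e.start 0) (e.start 1).toNat = s h2.choose from dif_pos h2,
      uniq _ e (h3.trans he.symm) h4 (by omega)]
  have hrf : ∀ f : HiveFace n d, r (f.edge 0) + r (f.edge 2) = 0 := by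
    intro f
    rw [← hs f, ← add_zero (r _ + r _), ← hr1 (f.edge 1) (face_type f 1)]
    have h2 : (2 : Fin 3) + 1 = 0 := rfl
    have h3 : (1 : Fin 3) + 1 = 2 := rfl
    rcases f with ⟨u, hu⟩ | ⟨u, hu⟩
    · have h : ∀ l, ((HiveFace.upper u hu : HiveFace n d).edge l).finish = u + eps l := fun l => by
        rw [HiveEdge.finish, upper_start, face_type]; abel
      simp only [r, h, upper_start, zero_add, h3, h2]
      abel
    · have h : ∀ l, ((HiveFace.lower u hu : HiveFace n d).edge l).finish = u - eps (l + 1) :=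
        fun l => by rw [HiveEdge.finish, lower_start, face_type]; abel
      simp only [r, h, lower_start, zero_add, h3, h2]
      abel
  have step : ∀ k : ℕ, ∀ e e' : HiveEdge n d, e.type = 2 → e'.type = 2 → e'.start 0 = e.start 0 →
      e'.start 1 = e.start 1 + k → r e' = r e := by
    intro k
    induction k with
    | zero => exact fun e e' h h' h0 h1 => congrArg r (uniq _ _ (h'.trans h.symm) h0 (by simpa using
        h1))
    | succ k ih =>
      intro e e' h h' h0 h1
      have i1 := (mem_hive 0).1 e.start_mem
      have i2 := (mem_hive 0).1 e.finish_mem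
      have i3 := (mem_hive 0).1 e'.start_mem
      have i4 := (mem_hive 0).1 e'.finish_mem
      simp [HiveEdge.finish, h, h', eps_apply] at i1 i2 i3 i4
      obtain ⟨m, hm, hm'⟩ : ∃ m : HiveEdge n d, m.type = 2 ∧ m.start = e.start + eps 1 - eps 2 :=
        ⟨⟨_, 2, (mem_hive 0).2 (by simp [eps_apply]; omega),
          (mem_hive 0).2 (by simp [eps_apply]; omega)⟩, rfl, rfl⟩
      have hs : ¬ e.OnShortSide := by rw [HiveEdge.OnShortSide, h]; simp; omega
      have hl : ¬ m.OnLongSide := by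
        rw [HiveEdge.OnLongSide, hm, hm']; simp [eps_apply]; omega
      have h2 := hrf (e.up hs)
      have h3 := hrf (m.low hl)
      have h4 : (e.up hs).edge 0 = (m.low hl).edge 0 := by
        refine HiveEdge.ext ?_ (by simp [HiveEdge.up, HiveEdge.low, h, hm])
        simp [HiveEdge.up, HiveEdge.low, h, hm, hm']
        abel
      have h5 := up_edge e hs
      have h6 := low_edge m hl
      rw [h] at h5
      rw [hm] at h6
      rw [h5, h4] at h2
      rw [h6] at h3
      rw [ih m e' hm h' (by simp [hm', h0, eps_apply]) (by simp [hm', h1, eps_apply]; ring)]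
      exact add_left_cancel (h3.trans h2.symm)
  have const : ∀ e e' : HiveEdge n d, e.type = 2 → e'.type = 2 → e'.start 0 = e.start 0 →
      r e' = r e := by
    intro e e' h h' h0
    rcases le_total (e.start 1) (e'.start 1) with h1 | h1 <;> obtain ⟨k, hk⟩ := Int.le.dest h1
    · exact step k e e' h h' h0 hk.symm
    · exact (step k e' e h' h h0.symm hk.symm).symm
  let ρ : ℕ → A := fun k =>
    if h : ∃ e : HiveEdge n d, e.type = 2 ∧ e.start 0 = k + 1 then -r h.choose else 0
  have hρ : ∀ (e : HiveEdge n d) (k : ℕ), e.type = 2 → e.start 0 = k + 1 → ρ k = -r e := by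
    intro e k h h0
    have hex : ∃ e : HiveEdge n d, e.type = 2 ∧ e.start 0 = k + 1 := ⟨e, h, h0⟩
    have h1 := hex.choose_spec
    exact (dif_pos hex).trans (congrArg _ (const _ _ h h1.1 (h1.2.trans h0.symm)))
  refine ⟨fun v => c₁ v + ∑ k ∈ Finset.range (v 0).toNat, ρ k, fun e => ?_⟩
  suffices H : ∑ k ∈ Finset.range (e.finish 0).toNat, ρ k -
      ∑ k ∈ Finset.range (e.start 0).toNat, ρ k = r e by
    rw [add_sub_add_comm, H]; simp only [r]; abel
  have h0 := coords e
  rcases idx_cases 0 e.type with h | h | h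
  · obtain ⟨f, hf⟩ : ∃ f : HiveFace n d, f.edge 0 = e ∧ (f.edge 2).start 0 = e.start 0 + 1 := by
      by_cases hsd : e.OnShortSide
      · by_cases hl : e.OnLongSide
        · have h1 := (mem_hive 0).1 e.start_mem
          have h2 := (mem_hive 0).1 e.finish_mem
          simp only [HiveEdge.OnShortSide, HiveEdge.OnLongSide, h, HiveEdge.finish] at h1 h2 hsd hl
          simp [eps_apply] at h1 h2 hsd hl
          omega
        · refine ⟨e.low hl, by rw [← h, low_edge], by simp [HiveEdge.low, h, eps_apply]⟩
      · refine ⟨e.up hsd, by rw [← h, up_edge], by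
          simp [HiveEdge.up, h, eps_apply, show (2 : Fin 3) + 1 = 0 from rfl]⟩
    have h1 := hrf f
    have h2 : e.finish 0 = e.start 0 + 1 := by simp [HiveEdge.finish, h, eps_apply]
    rw [hf.1] at h1
    rw [h2, show (e.start 0 + 1).toNat = (e.start 0).toNat + 1 by omega, Finset.sum_range_succ,
      add_sub_cancel_left, hρ _ _ (face_type f 2) (by rw [hf.2]; omega), neg_eq_of_add_eq_zero_left
          h1]
  · have h2 : e.finish 0 = e.start 0 := by simp [HiveEdge.finish, h, eps_apply]
    rw [h2, sub_self, hr1 e h]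
  · have h2 : e.finish 0 = e.start 0 - 1 := by simp [HiveEdge.finish, h, eps_apply]
    rw [h2] at h0 ⊢
    rw [show (e.start 0).toNat = (e.start 0 - 1).toNat + 1 by omega, Finset.sum_range_succ,
      hρ e _ h (by omega)]
    abel

end

section

variable {n d : ℕ}

/-! ### Colours around a face, and runs of lozenges -/

variable {C : HiveEdge n d → HiveColor} {c : SegColor}

theorem face_cases (hC : IsColorMap C) (f : HiveFace n d) :
    (∀ l, C (f.edge l) = .seg .zero) ∨ (∀ l, C (f.edge l) = .seg .one) ∨
    (∃ l, C (f.edge l) = .seg .one ∧ C (f.edge (l + 1)) = .seg .three ∧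
      C (f.edge (l + 2)) = .seg .zero) ∨
    (∃ l, C (f.edge l) = .seg .zero ∧ C (f.edge (l + 1)) = .m ∧
      C (f.edge (l + 2)) = .seg .one) := by
  obtain ⟨l, hl⟩ := hC f
  simp only [allowedTriples, Set.mem_insert_iff, Set.mem_singleton_iff, Prod.mk.injEq] at hl
  rcases hl with h | h | h | h
  · left; rw [forall_idx l]; tauto
  · right; left; rw [forall_idx l]; tauto
  · right; right; left; exact ⟨l, by tauto⟩
  · right; right; right; exact ⟨l, by tauto⟩

theorem m_face (hC : IsColorMap C) {f : HiveFace n d} {t : Fin 3} (h : C (f.edge t) = .m) :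
    C (f.edge (t + 1)) = .seg .one ∧ C (f.edge (t + 2)) = .seg .zero := by
  rcases face_cases hC f with h1 | h1 | ⟨l, h1, h2, h3⟩ | ⟨l, h1, h2, h3⟩
  · simp [h1] at h
  · simp [h1] at h
  · rcases idx_cases l t with rfl | rfl | rfl <;> simp_all
  · rcases idx_cases l t with rfl | rfl | rfl <;> simp_all

theorem three_face (hC : IsColorMap C) {f : HiveFace n d} {t : Fin 3}
    (h : C (f.edge t) = .seg .three) :
    C (f.edge (t + 1)) = .seg .zero ∧ C (f.edge (t + 2)) = .seg .one := by
  rcases face_cases hC f with h1 | h1 | ⟨l, h1, h2, h3⟩ | ⟨l, h1, h2, h3⟩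
  · simp [h1] at h
  · simp [h1] at h
  · rcases idx_cases l t with rfl | rfl | rfl <;> simp_all
  · rcases idx_cases l t with rfl | rfl | rfl <;> simp_all

/-- The type of the edge coloured `m` in a face with an edge of type `l` and colour `c`. -/
def mType (c : SegColor) (l : Fin 3) : Fin 3 :=
  match c with
  | .zero => l + 1
  | .one => l + 2
  | .three => l

theorem m_face_type (hC : IsColorMap C) {f : HiveFace n d} {t k : Fin 3} (h : C (f.edge t) = .m)
    (hk : C (f.edge k) = .seg c) : t = mType c k ∧ c ≠ .three := by
  obtain ⟨h1, h2⟩ := m_face hC h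
  rcases idx_cases t k with rfl | rfl | rfl
  · simp [h] at hk
  · rw [h1] at hk
    cases hk
    simp [mType]
  · rw [h2] at hk
    cases hk
    simp [mType]

theorem m_face_color (hC : IsColorMap C) {f : HiveFace n d} {k : Fin 3} (hc : c ≠ .three)
    (h : C (f.edge (mType c k)) = .m) : C (f.edge k) = .seg c := by
  obtain ⟨h1, h2⟩ := m_face hC h
  cases c with
  | zero => simpa [mType] using h2
  | one => simpa [mType] using h1
  | three => exact absurd rfl hc

theorem plus_eq_outer {e f : HiveEdge n d} {h} (h1 : e.plus = .outer f h) : e = f := by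
  rcases plus_cases e with ⟨u, hu, h2⟩ | ⟨h0, h2⟩ <;> rw [h2] at h1
  · cases h1
  · exact DualVertex.outer.inj h1

theorem minus_eq_outer {e f : HiveEdge n d} {h} (h1 : e.minus = .outer f h) : e = f := by
  rcases minus_cases e with ⟨u, hu, h2⟩ | ⟨h0, h2⟩ <;> rw [h2] at h1
  · cases h1
  · exact DualVertex.outer.inj h1

/-- `LozengeStep C c μ e e'`: the edges `e` and `e'` of colour `c` are opposite sides of the lozenge
around the edge `μ` of colour `m`, and `e` is a side of its lower face. -/
def LozengeStep (C : HiveEdge n d → HiveColor) (c : SegColor) (μ e e' : HiveEdge n d) : Prop :=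
  C e = .seg c ∧ C e' = .seg c ∧ C μ = .m ∧ μ.minus = e.minus ∧ μ.plus = e'.plus

/-- One step of a chain of colour `c`, from its upper end to its lower end. -/
def RunStep (C : HiveEdge n d → HiveColor) (c : SegColor) (e e' : HiveEdge n d) : Prop :=
  ∃ μ, LozengeStep C c μ e e'

/-- `Run C c e e'`: there is a chain of colour `c` from the upper side of `e` to the lower side of
`e'`. -/
def Run (C : HiveEdge n d → HiveColor) (c : SegColor) : HiveEdge n d → HiveEdge n d → Prop :=
  Relation.ReflTransGen (RunStep C c)

theorem LozengeStep.faces (hC : IsColorMap C) {μ e e' : HiveEdge n d}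
    (h : LozengeStep C c μ e e') : ∃ u hu w hw, w = u + eps μ.type + eps (μ.type + 1) ∧
      μ = (HiveFace.upper u hu : HiveFace n d).edge μ.type ∧
      μ = (HiveFace.lower w hw : HiveFace n d).edge μ.type ∧
      e = (HiveFace.lower w hw : HiveFace n d).edge e.type ∧
      e' = (HiveFace.upper u hu : HiveFace n d).edge e'.type ∧
      e'.type = e.type ∧ μ.type = mType c e.type ∧ c ≠ .three := by
  obtain ⟨h1, h2, h3, h4, h5⟩ := h
  have hne : e ≠ μ := by rintro rfl; simp [h1] at h3
  have hne' : e' ≠ μ := by rintro rfl; simp [h2] at h3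
  rcases minus_cases μ with ⟨w, hw, hm⟩ | ⟨h0, hm⟩
  swap
  · exact absurd (minus_eq_outer (h4.symm.trans hm)) hne
  rcases plus_cases μ with ⟨u, hu, hp⟩ | ⟨h0, hp⟩
  swap
  · exact absurd (plus_eq_outer (h5.symm.trans hp)) hne'
  have a1 := plus_eq_upper hp
  have a2 := minus_eq_lower hm
  have a3 := minus_eq_lower (h4.symm.trans hm)
  have a4 := plus_eq_upper (h5.symm.trans hp)
  have b1 := m_face_type hC (f := .lower w hw) (t := μ.type) (k := e.type) (c := c)
    (by rw [a2, h3]) (by rw [a3, h1])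
  have b2 := m_face_type hC (f := .upper u hu) (t := μ.type) (k := e'.type) (c := c)
    (by rw [a1, h3]) (by rw [a4, h2])
  refine ⟨u, hu, w, hw, ?_, a1.symm, a2.symm, a3.symm, a4.symm, ?_, b1.1, b1.2⟩
  · have := congrArg HiveEdge.start (a1.trans a2.symm)
    simp only [upper_start, lower_start] at this
    rw [eq_sub_iff_add_eq] at this
    rw [← this]; abel
  · have := b1.1.symm.trans b2.1
    cases c with
    | zero => exact (add_right_cancel this).symm
    | one => exact (add_right_cancel this).symm
    | three => exact absurd rfl b1.2

/-- The translation of an edge of type `l` along a chain of colour `c`. -/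
def runShift (c : SegColor) (l : Fin 3) : Pt :=
  match c with
  | .zero => eps l - eps (l + 2)
  | .one => eps (l + 1) - eps (l + 2)
  | .three => 0

theorem RunStep.coords (hC : IsColorMap C) {e e' : HiveEdge n d} (h : RunStep C c e e') :
    e'.type = e.type ∧ e'.start = e.start + runShift c e.type ∧ c ≠ .three := by
  obtain ⟨μ, h⟩ := h
  obtain ⟨u, hu, w, hw, h1, h2, h3, h4, h5, h6, h7, h8⟩ := h.faces hC
  refine ⟨h6, ?_, h8⟩
  have e1 : e.start = w - eps e.type := congrArg HiveEdge.start h4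
  have e2 : e'.start = u + eps (e.type + 1) := by
    rw [h6] at h5
    exact congrArg HiveEdge.start h5
  rw [e1, e2, h1, h7]
  cases c with
  | zero => simp [mType, runShift]
  | one => simp [mType, runShift]
  | three => exact absurd rfl h8

theorem RunStep.decreasing (hC : IsColorMap C) {e e' : HiveEdge n d} (h : RunStep C c e e') :
    e'.start (e.type + 2) = e.start (e.type + 2) - 1 := by
  obtain ⟨-, h2, h3⟩ := h.coords hC
  rw [h2]
  cases c with
  | zero => simp [runShift, eps_apply]; ring
  | one => simp [runShift, eps_apply]; ring
  | three => exact absurd rfl h3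

theorem Run.type_eq (hC : IsColorMap C) {e e' : HiveEdge n d} (h : Run C c e e') :
    e'.type = e.type := by
  induction h with
  | refl => rfl
  | tail _ h ih => rw [(h.coords hC).1, ih]

theorem Run.color {e e' : HiveEdge n d} (h : Run C c e e') (he : C e = .seg c) :
    C e' = .seg c := by
  induction h with
  | refl => exact he
  | tail _ h ih => obtain ⟨μ, h⟩ := h; exact h.2.1

/-- A colour map without edges coloured `m` on the boundary of the hexagon. -/
def NoOuterM (C : HiveEdge n d → HiveColor) : Prop := ∀ e : HiveEdge n d, e.IsOuter → C e ≠ .m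

theorem exists_runStep (hC : IsColorMap C) (hm : NoOuterM C) {e : HiveEdge n d}
    (he : C e = .seg c) (h : ¬ InReduced C e.minus) : ∃ e', RunStep C c e e' := by
  rcases minus_cases e with ⟨w, hw, h1⟩ | ⟨h0, h1⟩
  swap
  · exact absurd trivial (by rwa [h1] at h)
  rw [h1] at h
  simp only [InReduced, not_forall, not_not] at h
  obtain ⟨t, ht⟩ := h
  set μ := (HiveFace.lower w hw : HiveFace n d).edge t with hμ
  have h2 := minus_eq_lower h1
  have h3 := m_face_type hC ht (k := e.type) (c := c) (by rw [h2, he])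
  rcases plus_cases μ with ⟨u, hu, hp⟩ | ⟨h0, hp⟩
  swap
  · exact absurd ht (hm _ (Or.inr h0))
  have h4 := plus_eq_upper hp
  refine ⟨(HiveFace.upper u hu : HiveFace n d).edge e.type, μ, he, ?_, ht, ?_, ?_⟩
  · apply m_face_color hC h3.2
    rw [← h3.1]
    have : μ.type = t := by simp [hμ]
    rw [← this, h4, ht]
  · rw [h1, hμ, minus_lower]
  · rw [hp, plus_upper]

theorem exists_runStep_back (hC : IsColorMap C) (hm : NoOuterM C) {e : HiveEdge n d}
    (he : C e = .seg c) (h : ¬ InReduced C e.plus) : ∃ e', RunStep C c e' e := by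
  rcases plus_cases e with ⟨w, hw, h1⟩ | ⟨h0, h1⟩
  swap
  · exact absurd trivial (by rwa [h1] at h)
  rw [h1] at h
  simp only [InReduced, not_forall, not_not] at h
  obtain ⟨t, ht⟩ := h
  set μ := (HiveFace.upper w hw : HiveFace n d).edge t with hμ
  have h2 := plus_eq_upper h1
  have h3 := m_face_type hC ht (k := e.type) (c := c) (by rw [h2, he])
  rcases minus_cases μ with ⟨u, hu, hp⟩ | ⟨h0, hp⟩
  swap
  · exact absurd ht (hm _ (Or.inl h0))
  have h4 := minus_eq_lower hp
  refine ⟨(HiveFace.lower u hu : HiveFace n d).edge e.type, μ, ?_, he, ht, ?_, ?_⟩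
  · apply m_face_color hC h3.2
    rw [← h3.1]
    have : μ.type = t := by simp [hμ]
    rw [← this, h4, ht]
  · rw [hp, minus_lower]
  · rw [h1, hμ, plus_upper]

theorem LozengeStep.not_reduced {μ e e' : HiveEdge n d} (h : LozengeStep C c μ e e') :
    ¬ InReduced C e.minus ∧ ¬ InReduced C e'.plus := by
  obtain ⟨h1, h2, h3, h4, h5⟩ := h
  constructor
  · rw [← h4]
    rcases minus_cases μ with ⟨w, hw, hm⟩ | ⟨h0, hm⟩
    · rw [hm]
      exact fun h => h _ (by rw [minus_eq_lower hm, h3])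
    · have := minus_eq_outer (h4.symm.trans hm)
      rw [this, h3] at h1; cases h1
  · rw [← h5]
    rcases plus_cases μ with ⟨w, hw, hm⟩ | ⟨h0, hm⟩
    · rw [hm]
      exact fun h => h _ (by rw [plus_eq_upper hm, h3])
    · have := plus_eq_outer (h5.symm.trans hm)
      rw [this, h3] at h2; cases h2

theorem RunStep.unique (hC : IsColorMap C) {e e₁ e₂ : HiveEdge n d} (h₁ : RunStep C c e e₁)
    (h₂ : RunStep C c e e₂) : e₁ = e₂ := by
  obtain ⟨a1, a2, -⟩ := h₁.coords hC
  obtain ⟨b1, b2, -⟩ := h₂.coords hC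
  exact HiveEdge.ext (a2.trans b2.symm) (a1.trans b1.symm)

theorem RunStep.unique_back (hC : IsColorMap C) {e e₁ e₂ : HiveEdge n d} (h₁ : RunStep C c e₁ e)
    (h₂ : RunStep C c e₂ e) : e₁ = e₂ := by
  obtain ⟨a1, a2, -⟩ := h₁.coords hC
  obtain ⟨b1, b2, -⟩ := h₂.coords hC
  refine HiveEdge.ext ?_ (a1.symm.trans b1)
  rw [← a1] at a2
  rw [← b1] at b2
  exact add_right_cancel (a2.symm.trans b2)

/-- The runs between two vertices of the reduced graph. -/
structure MaxRun (C : HiveEdge n d → HiveColor) (c : SegColor) (e e' : HiveEdge n d) : Prop where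
  color : C e = .seg c
  run : Run C c e e'
  plus : InReduced C e.plus
  minus : InReduced C e'.minus

theorem exists_run_minus (hC : IsColorMap C) (hm : NoOuterM C) (e : HiveEdge n d)
    (he : C e = .seg c) : ∃ e', Run C c e e' ∧ InReduced C e'.minus := by
  have key : ∀ k : ℕ, ∀ e : HiveEdge n d, C e = .seg c → e.start (e.type + 2) = k →
      ∃ e', Run C c e e' ∧ InReduced C e'.minus := by
    intro k
    induction k with
    | zero =>
      intro e he hk
      refine ⟨e, .refl, ?_⟩
      rw [HiveEdge.minus, dif_pos (by simpa [HiveEdge.OnLongSide] using hk)]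
      trivial
    | succ k ih =>
      intro e he hk
      by_cases h : InReduced C e.minus
      · exact ⟨e, .refl, h⟩
      · obtain ⟨e', h'⟩ := exists_runStep hC hm he h
        have h2 := h'.decreasing hC
        rw [← (h'.coords hC).1] at h2
        obtain ⟨e'', h3, h4⟩ := ih e' (by obtain ⟨μ, h'⟩ := h'; exact h'.2.1) (by
          rw [h2, (h'.coords hC).1, hk]; push_cast; ring)
        exact ⟨e'', Relation.ReflTransGen.head h' h3, h4⟩
  exact key (e.start (e.type + 2)).toNat e he
    (Int.toNat_of_nonneg (e.start_mem.1 _).1).symm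

theorem exists_run_plus (hC : IsColorMap C) (hm : NoOuterM C) (e : HiveEdge n d)
    (he : C e = .seg c) : ∃ e', Run C c e' e ∧ InReduced C e'.plus ∧ C e' = .seg c := by
  have key : ∀ k : ℕ, ∀ e : HiveEdge n d, C e = .seg c → n - e.start (e.type + 2) = k →
      ∃ e', Run C c e' e ∧ InReduced C e'.plus ∧ C e' = .seg c := by
    intro k
    induction k with
    | zero =>
      intro e he hk
      refine ⟨e, .refl, ?_, he⟩
      rw [HiveEdge.plus, dif_pos (by simp [HiveEdge.OnShortSide]; push_cast at hk; linarith)]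
      trivial
    | succ k ih =>
      intro e he hk
      by_cases h : InReduced C e.plus
      · exact ⟨e, .refl, h, he⟩
      · obtain ⟨e', h'⟩ := exists_runStep_back hC hm he h
        have h2 := h'.decreasing hC
        obtain ⟨e'', h3, h4⟩ := ih e' (by obtain ⟨μ, h'⟩ := h'; exact h'.1) (by
          rw [(h'.coords hC).1] at hk
          push_cast at hk; linarith)
        exact ⟨e'', Relation.ReflTransGen.tail h3 h', h4⟩
  exact key (n - e.start (e.type + 2)).toNat e he
    (Int.toNat_of_nonneg (by have := (e.start_mem.1 (e.type + 2)).2; linarith)).symm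

/-- Every edge with a colour other than `m` lies in a maximal run. -/
theorem exists_maxRun (hC : IsColorMap C) (hm : NoOuterM C) (e : HiveEdge n d)
    (he : C e = .seg c) : ∃ e₁ e₂, MaxRun C c e₁ e₂ ∧ Run C c e₁ e ∧ Run C c e e₂ := by
  obtain ⟨e₁, h1, h2, h3⟩ := exists_run_plus hC hm e he
  obtain ⟨e₂, h4, h5⟩ := exists_run_minus hC hm e he
  exact ⟨e₁, e₂, ⟨h3, h1.trans h4, h2, h5⟩, h1, h4⟩

theorem Run.eq_of_reduced {e e' : HiveEdge n d} (h : Run C c e e') (hr : InReduced C e.minus) :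
    e = e' := by
  rcases h.cases_head with h | ⟨b, ⟨μ, h⟩, -⟩
  · exact h
  · exact absurd hr h.not_reduced.1

theorem Run.eq_of_reduced_plus {e e' : HiveEdge n d} (h : Run C c e e')
    (hr : InReduced C e'.plus) : e = e' := by
  rcases h.cases_tail with h | ⟨b, -, ⟨μ, h⟩⟩
  · exact h.symm
  · exact absurd hr h.not_reduced.2

theorem Run.unique_minus (hC : IsColorMap C) {e e₁ e₂ : HiveEdge n d} (h₁ : Run C c e e₁)
    (h₂ : Run C c e e₂) (r₁ : InReduced C e₁.minus) (r₂ : InReduced C e₂.minus) : e₁ = e₂ := by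
  have U : Relator.RightUnique (RunStep C c) := fun _ _ _ h h' => RunStep.unique hC h h'
  rcases Relation.ReflTransGen.total_of_right_unique U h₁ h₂ with h | h
  · exact Run.eq_of_reduced h r₁
  · exact (Run.eq_of_reduced h r₂).symm

theorem Run.unique_plus (hC : IsColorMap C) {e e₁ e₂ : HiveEdge n d} (h₁ : Run C c e₁ e)
    (h₂ : Run C c e₂ e) (r₁ : InReduced C e₁.plus) (r₂ : InReduced C e₂.plus) : e₁ = e₂ := by
  have h₁' := Relation.reflTransGen_swap.2 h₁
  have h₂' := Relation.reflTransGen_swap.2 h₂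
  have U : Relator.RightUnique (Function.swap (RunStep C c)) :=
    fun _ _ _ h h' => RunStep.unique_back hC h h'
  rcases Relation.ReflTransGen.total_of_right_unique U h₁' h₂' with h | h
  · exact (Run.eq_of_reduced_plus (Relation.reflTransGen_swap.1 h) r₁).symm
  · exact Run.eq_of_reduced_plus (Relation.reflTransGen_swap.1 h) r₂

/-- Chains are runs, read in one of the two directions. -/
theorem IsChain.exists_run (hn : 0 < n) {x y : DualVertex n d} {es : List (HiveEdge n d)}
    {R : HiveEdge n d → HiveEdge n d → List (HiveEdge n d) → Prop}
    (single : ∀ e, C e = .seg c → R e e [e])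
    (front : ∀ μ e e₁ e' es, LozengeStep C c μ e e₁ → Run C c e₁ e' → R e₁ e' es →
      R e e' (e :: μ :: es))
    (back : ∀ μ e e₁ e' es, Run C c e e₁ → LozengeStep C c μ e₁ e' → C e = .seg c → R e e₁ es →
      R e e' (e' :: μ :: es))
    (h : IsChain C c x es y) : ∃ e e', C e = .seg c ∧ Run C c e e' ∧ R e e' es ∧
      ((x = e.plus ∧ y = e'.minus) ∨ (x = e'.minus ∧ y = e.plus)) := by
  induction h with
  | single e x y he hc =>
    exact ⟨e, e, hc, .refl, single e hc, (joins_iff hn).1 he⟩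
  | cons e f x z w y es he hc hf hm hes ih =>
    obtain ⟨e₁, e', h1, h2, h3, h4⟩ := ih
    have hef : e ≠ f := by rintro rfl; simp [hc] at hm
    have hef1 : e₁ ≠ f := by rintro rfl; simp [h1] at hm
    have hef' : e' ≠ f := by rintro rfl; rw [h2.color h1] at hm; simp at hm
    rcases (joins_iff hn).1 he with ⟨rfl, rfl⟩ | ⟨rfl, rfl⟩
    · rcases (joins_iff hn).1 hf with ⟨h5, rfl⟩ | ⟨h5, rfl⟩
      · exact absurd h5.symm (plus_ne_minus hn _ _)
      · rcases h4 with ⟨h6, rfl⟩ | ⟨h6, rfl⟩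
        · have hs : LozengeStep C c f e e₁ := ⟨hc, h1, hm, h5.symm, h6⟩
          exact ⟨e, e', hc, .head ⟨f, hs⟩ h2, front f e e₁ e' es hs h2 h3, .inl ⟨rfl, rfl⟩⟩
        · exact absurd h6 (plus_ne_minus hn _ _)
    · rcases (joins_iff hn).1 hf with ⟨h5, rfl⟩ | ⟨h5, rfl⟩
      · rcases h4 with ⟨h6, rfl⟩ | ⟨h6, rfl⟩
        · exact absurd h6.symm (plus_ne_minus hn _ _)
        · have hs : LozengeStep C c f e' e := ⟨h2.color h1, hc, hm, h6, h5.symm⟩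
          exact ⟨e₁, e, h1, .tail h2 ⟨f, hs⟩, back f e₁ e' e es h2 hs h1 h3, .inr ⟨rfl, rfl⟩⟩
      · exact absurd h5 (plus_ne_minus hn _ _)

theorem Run.exists_chain (hn : 0 < n) {e e' : HiveEdge n d} (h : Run C c e e')
    (he : C e = .seg c) : ∃ es, IsChain C c e.plus es e'.minus := by
  induction h using Relation.ReflTransGen.head_induction_on with
  | refl =>
    exact ⟨_, .single e' _ _ ((joins_iff hn).2 (.inl ⟨rfl, rfl⟩)) he⟩
  | head h1 h2 ih =>
    obtain ⟨μ, h1⟩ := h1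
    obtain ⟨es, hes⟩ := ih h1.2.1
    refine ⟨_, .cons _ μ _ _ _ _ es ((joins_iff hn).2 (.inl ⟨rfl, rfl⟩)) he
      ((joins_iff hn).2 (.inr ⟨h1.2.2.2.1.symm, h1.2.2.2.2.symm⟩)) h1.2.2.1 hes⟩

theorem reducedGraph_edge_iff (hn : 0 < n) {x y : (reducedGraph C).V} :
    (reducedGraph C).edge c x y ↔ ∃ e e', MaxRun C c e e' ∧
      ((x.1 = e.plus ∧ y.1 = e'.minus) ∨ (x.1 = e'.minus ∧ y.1 = e.plus)) := by
  have aux : ∀ {x y : DualVertex n d} {es}, IsMaxChain C c x es y → ∃ e e', MaxRun C c e e' ∧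
      ((x = e.plus ∧ y = e'.minus) ∨ (x = e'.minus ∧ y = e.plus)) := by
    rintro x y es ⟨h1, h2, h3⟩
    obtain ⟨e, e', h4, h5, -, h6⟩ := h3.exists_run (R := fun _ _ _ => True) hn
      (by simp) (by simp) (by simp)
    rcases h6 with ⟨rfl, rfl⟩ | ⟨rfl, rfl⟩
    · exact ⟨e, e', ⟨h4, h5, h1, h2⟩, .inl ⟨rfl, rfl⟩⟩
    · exact ⟨e, e', ⟨h4, h5, h2, h1⟩, .inr ⟨rfl, rfl⟩⟩
  constructor
  · rintro ⟨-, es, h | h⟩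
    · exact aux h
    · obtain ⟨e, e', h1, h2⟩ := aux h
      exact ⟨e, e', h1, by tauto⟩
  · rintro ⟨e, e', h1, h2⟩
    obtain ⟨es, hes⟩ := h1.run.exists_chain hn h1.color
    have hm : IsMaxChain C c e.plus es e'.minus := ⟨h1.plus, h1.minus, hes⟩
    rcases h2 with ⟨h2, h3⟩ | ⟨h2, h3⟩
    · refine ⟨fun h => ?_, es, .inl ?_⟩
      · rw [h, h3] at h2
        exact plus_ne_minus hn _ _ h2.symm
      · rwa [h2, h3]
    · refine ⟨fun h => ?_, es, .inr ?_⟩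
      · rw [h, h3] at h2
        exact plus_ne_minus hn _ _ h2
      · rwa [h2, h3]

end

section

variable {n d : ℕ}

/-! ### Coordinates in the plane -/

theorem zeta_eq : zeta = ⟨1 / 2, √3 / 2⟩ := by
  have h : Complex.I * ((Real.pi / 3 : ℝ) : ℂ) = ((Real.pi / 3 : ℝ) : ℂ) * Complex.I :=
    mul_comm _ _
  rw [zeta, h]
  apply Complex.ext
  · rw [Complex.exp_ofReal_mul_I_re, Real.cos_pi_div_three]
  · rw [Complex.exp_ofReal_mul_I_im, Real.sin_pi_div_three]

theorem typeDir_zero : typeDir 0 = ⟨-1 / 2, √3 / 2⟩ := by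
  have h : 2 * (Real.pi : ℂ) * Complex.I * (((0 : Fin 3) : ℕ) + 1) / 3 =
      ((2 * Real.pi / 3 : ℝ) : ℂ) * Complex.I := by
    push_cast; simp; ring
  have h2 : 2 * Real.pi / 3 = Real.pi - Real.pi / 3 := by ring
  rw [typeDir, h]
  apply Complex.ext
  · rw [Complex.exp_ofReal_mul_I_re, h2, Real.cos_pi_sub, Real.cos_pi_div_three]; norm_num
  · rw [Complex.exp_ofReal_mul_I_im, h2, Real.sin_pi_sub, Real.sin_pi_div_three]

theorem typeDir_one : typeDir 1 = ⟨-1 / 2, -√3 / 2⟩ := by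
  have h : 2 * (Real.pi : ℂ) * Complex.I * (((1 : Fin 3) : ℕ) + 1) / 3 =
      ((Real.pi / 3 + Real.pi : ℝ) : ℂ) * Complex.I := by
    simp; ring
  rw [typeDir, h]
  apply Complex.ext
  · rw [Complex.exp_ofReal_mul_I_re, Real.cos_add_pi, Real.cos_pi_div_three]; norm_num
  · rw [Complex.exp_ofReal_mul_I_im, Real.sin_add_pi, Real.sin_pi_div_three]; simp; ring

theorem typeDir_two : typeDir 2 = 1 := by
  have h : 2 * (Real.pi : ℂ) * Complex.I * (((2 : Fin 3) : ℕ) + 1) / 3 =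
      2 * (Real.pi : ℂ) * Complex.I := by
    simp; ring
  rw [typeDir, h, Complex.exp_two_pi_mul_I]

theorem coord_zero (v : ℂ) : coord v 0 = 1 - (v.re - v.im / √3) - 2 * v.im / √3 := rfl
theorem coord_one (v : ℂ) : coord v 1 = v.re - v.im / √3 := rfl
theorem coord_two (v : ℂ) : coord v 2 = 2 * v.im / √3 := rfl

theorem sqrt_three_ne : √3 ≠ 0 := by positivity

theorem coord_sum (l : Fin 3) (v : ℂ) :
    coord v l + coord v (l + 1) + coord v (l + 2) = 1 := by
  rw [sum_rot l (coord v), coord_zero, coord_one, coord_two]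
  ring

theorem coord_ofCoord {x : Fin 3 → ℝ} (h : x 0 + x 1 + x 2 = 1) : coord (ofCoord x) = x := by
  rw [ofCoord, coord_add_mul_zeta]
  funext i
  fin_cases i
  · change 1 - x 1 - x 2 = x 0; linarith
  · rfl
  · rfl

theorem ofCoord_coord (v : ℂ) : ofCoord (coord v) = v := by
  have := sqrt_three_ne
  have h2 : √3 * √3 = 3 := Real.mul_self_sqrt (by norm_num)
  rw [ofCoord, coord_one, coord_two, zeta_eq]
  apply Complex.ext
  · simp; ring
  · simp; field_simp

theorem coord_injective : Function.Injective coord := fun v w h => by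
  rw [← ofCoord_coord v, h, ofCoord_coord]

theorem coord_ext (l : Fin 3) {v w : ℂ} (h0 : coord v l = coord w l)
    (h2 : coord v (l + 2) = coord w (l + 2)) : v = w := by
  have h1 : coord v (l + 1) = coord w (l + 1) := by
    have := coord_sum l v
    have := coord_sum l w
    linarith
  exact coord_injective (funext ((forall_idx l).2 ⟨h0, h1, h2⟩))

theorem mem_triangle {v : ℂ} : v ∈ triangle ↔ ∀ i, 0 ≤ coord v i := by
  constructor
  · rintro ⟨x, y, h1, h2, h3, h4, h5, rfl⟩
    rw [coord_add_mul_zeta, forall_idx 0]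
    refine ⟨?_, h1, h3⟩
    change 0 ≤ 1 - x - y
    linarith
  · intro h
    have := coord_sum 0 v
    simp only [zero_add] at this
    have h0 := h 0
    have h1 := h 1
    have h2 := h 2
    refine ⟨coord v 1, coord v 2, h1, by linarith, h2, by linarith, by linarith, ?_⟩
    exact (ofCoord_coord v).symm

theorem mem_side {i : Fin 3} {v : ℂ} : v ∈ side i ↔ (∀ k, 0 ≤ coord v k) ∧ coord v i = 0 := by
  rw [← mem_triangle]; rfl

theorem mem_triangleBoundary {v : ℂ} : v ∈ triangleBoundary ↔ ∃ i, v ∈ side i := by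
  simp [triangleBoundary]

theorem coord_combo {a b : ℝ} (h : a + b = 1) (v w : ℂ) (k : Fin 3) :
    coord (a • v + b • w) k = a * coord v k + b * coord w k := by
  have h1 : coord (a • v + b • w) 1 = a * coord v 1 + b * coord w 1 := by
    simp [coord_one]; ring
  have h2 : coord (a • v + b • w) 2 = a * coord v 2 + b * coord w 2 := by
    simp [coord_two]; ring
  have e0 := coord_sum 0 (a • v + b • w)
  have e1 := coord_sum 0 v
  have e2 := coord_sum 0 w
  simp only [zero_add] at e0 e1 e2
  revert k
  rw [forall_idx 0]
  refine ⟨?_, h1, h2⟩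
  have : coord (a • v + b • w) 0 = 1 - (a * coord v 1 + b * coord w 1)
    - (a * coord v 2 + b * coord w 2) := by rw [← h1, ← h2]; linarith
  rw [this, show coord v 0 = 1 - coord v 1 - coord v 2 by linarith,
    show coord w 0 = 1 - coord w 1 - coord w 2 by linarith, ← h]
  have : a = 1 - b := by linarith
  subst this; ring

theorem coord_add_typeDir (v : ℂ) (r : ℝ) (l : Fin 3) :
    coord (v + r * typeDir l) l = coord v l ∧
    coord (v + r * typeDir l) (l + 1) = coord v (l + 1) - r ∧
    coord (v + r * typeDir l) (l + 2) = coord v (l + 2) + r := by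
  have h3 := sqrt_three_ne
  have h2 : √3 * √3 = 3 := Real.mul_self_sqrt (by norm_num)
  fin_cases l
  · change coord _ 0 = coord v 0 ∧ coord _ 1 = coord v 1 - r ∧ coord _ 2 = coord v 2 + r
    change coord (v + r * typeDir 0) 0 = _ ∧ coord (v + r * typeDir 0) 1 = _ ∧
      coord (v + r * typeDir 0) 2 = _
    rw [typeDir_zero]
    simp [coord_zero, coord_one, coord_two]
    refine ⟨?_, ?_, ?_⟩ <;> field_simp <;> ring
  · change coord (v + r * typeDir 1) 1 = coord v 1 ∧ coord (v + r * typeDir 1) 2 = coord v 2 - r ∧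
      coord (v + r * typeDir 1) 0 = coord v 0 + r
    rw [typeDir_one]
    simp [coord_zero, coord_one, coord_two]
    refine ⟨?_, ?_, ?_⟩ <;> field_simp <;> ring
  · change coord (v + r * typeDir 2) 2 = coord v 2 ∧ coord (v + r * typeDir 2) 0 = coord v 0 - r ∧
      coord (v + r * typeDir 2) 1 = coord v 1 + r
    rw [typeDir_two]
    simp [coord_zero, coord_one, coord_two]
    refine ⟨?_, ?_⟩ <;> ring

theorem norm_typeDir (l : Fin 3) : ‖typeDir l‖ = 1 := by
  have h : 2 * (Real.pi : ℂ) * Complex.I * ((l : ℕ) + 1) / 3 =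
      ((2 * Real.pi * ((l : ℕ) + 1) / 3 : ℝ) : ℂ) * Complex.I := by
    push_cast; ring
  rw [typeDir, h, Complex.norm_exp_ofReal_mul_I]

/-! ### Typed segments -/

/-- `w` is reached from `v` in the direction `typeDir l`. -/
def Arrow (l : Fin 3) (v w : ℂ) : Prop :=
  coord v l = coord w l ∧ coord v (l + 2) < coord w (l + 2)

namespace Arrow

variable {l k : Fin 3} {v w z v' w' : ℂ}

theorem iff_exists : Arrow l v w ↔ ∃ r : ℝ, 0 < r ∧ w = v + r * typeDir l := by
  constructor
  · rintro ⟨h1, h2⟩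
    refine ⟨coord w (l + 2) - coord v (l + 2), by linarith, ?_⟩
    obtain ⟨h3, h4, h5⟩ := coord_add_typeDir v (coord w (l + 2) - coord v (l + 2)) l
    refine coord_ext l ?_ ?_
    · rw [h3, h1]
    · rw [h5]; ring
  · rintro ⟨r, hr, rfl⟩
    obtain ⟨h3, h4, h5⟩ := coord_add_typeDir v r l
    exact ⟨h3.symm, by rw [h5]; linarith⟩

theorem ne (h : Arrow l v w) : v ≠ w := by
  rintro rfl
  exact lt_irrefl _ h.2

theorem coord_one (h : Arrow l v w) : coord w (l + 1) < coord v (l + 1) := by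
  have := coord_sum l v
  have := coord_sum l w
  have := h.1
  have := h.2
  linarith

theorem mem_segment (h : Arrow l v w) : z ∈ segment ℝ v w ↔
    coord z l = coord v l ∧ coord v (l + 2) ≤ coord z (l + 2) ∧
      coord z (l + 2) ≤ coord w (l + 2) := by
  obtain ⟨h1, h2⟩ := h
  constructor
  · rintro ⟨a, b, ha, hb, hab, rfl⟩
    rw [coord_combo hab, coord_combo hab, ← h1]
    obtain rfl : a = 1 - b := by linarith
    refine ⟨by ring, by nlinarith, by nlinarith⟩
  · rintro ⟨h3, h4, h5⟩
    set t := (coord z (l + 2) - coord v (l + 2)) / (coord w (l + 2) - coord v (l + 2)) with ht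
    have hpos : 0 < coord w (l + 2) - coord v (l + 2) := by linarith
    have hab : 1 - t + t = 1 := by ring
    refine ⟨1 - t, t, ?_, ?_, hab, ?_⟩
    · rw [sub_nonneg, ht, div_le_one hpos]; linarith
    · exact div_nonneg (by linarith) hpos.le
    · refine coord_ext l ?_ ?_
      · rw [coord_combo hab, h3, ← h1]; ring
      · rw [coord_combo hab, ht]; field_simp; ring

theorem segment_eq (h : Arrow l v w) {x y : ℂ} (hxy : segment ℝ x y = segment ℝ v w) :
    (x = v ∧ y = w) ∨ (x = w ∧ y = v) := by
  have hx := h.mem_segment.1 (hxy ▸ left_mem_segment ℝ x y)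
  have hy := h.mem_segment.1 (hxy ▸ right_mem_segment ℝ x y)
  obtain ⟨a, b, ha, hb, hab, hv⟩ : v ∈ segment ℝ x y := hxy ▸ left_mem_segment ℝ v w
  obtain ⟨a', b', ha', hb', hab', hw⟩ : w ∈ segment ℝ x y := hxy ▸ right_mem_segment ℝ v w
  have h1 := coord_combo hab x y (l + 2)
  have h2 := coord_combo hab' x y (l + 2)
  rw [hv] at h1
  rw [hw] at h2
  have h3 := h.2
  have ev : ∀ u, coord u l = coord v l → coord u (l + 2) = coord v (l + 2) → u = v :=
    fun u a b => coord_ext l a b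
  have ew : ∀ u, coord u l = coord v l → coord u (l + 2) = coord w (l + 2) → u = w :=
    fun u a b => coord_ext l (a.trans h.1) b
  obtain rfl : a = 1 - b := by linarith
  obtain rfl : a' = 1 - b' := by linarith
  rcases le_total (coord x (l + 2)) (coord y (l + 2)) with hle | hle
  · left
    exact ⟨ev x hx.1 (by nlinarith), ew y hy.1 (by nlinarith)⟩
  · right
    exact ⟨ew x hx.1 (by nlinarith), ev y hy.1 (by nlinarith)⟩

theorem endpoints_eq (h : Arrow l v w) : endpoints (segment ℝ v w) = {v, w} := by
  ext x
  simp only [endpoints, Set.mem_ofPred_eq, Set.mem_insert_iff, Set.mem_singleton_iff]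
  constructor
  · rintro ⟨y, hy⟩
    rcases h.segment_eq hy.symm with ⟨h1, -⟩ | ⟨h1, -⟩ <;> simp [h1]
  · rintro (rfl | rfl)
    · exact ⟨w, rfl⟩
    · exact ⟨v, segment_symm ℝ _ _⟩

/-- The type of an arrow is determined by its ends. -/
theorem type_unique (h : Arrow l v w) (h' : Arrow k v w) : k = l := by
  have a := h.coord_one
  have b := h.2
  have c := h.1
  rcases idx_cases l k with rfl | rfl | rfl
  · rfl
  · exact absurd h'.1 a.ne'
  · exact absurd h'.1 b.ne

theorem not_symm (h : Arrow l v w) : ¬ Arrow k w v := by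
  intro h'
  have a := h.coord_one
  have b := h.2
  have c := h.1
  rcases idx_cases l k with rfl | rfl | rfl
  · exact lt_asymm b h'.2
  · exact absurd h'.1 a.ne
  · exact absurd h'.1 b.ne'

/-- An arrow is determined by its segment. -/
theorem unique (h : Arrow l v w) (h' : Arrow k v' w') (he : segment ℝ v w = segment ℝ v' w') :
    v = v' ∧ w = w' ∧ l = k := by
  rcases h'.segment_eq he with ⟨rfl, rfl⟩ | ⟨rfl, rfl⟩
  · exact ⟨rfl, rfl, h'.type_unique h⟩
  · exact absurd h' h.not_symm

theorem isSegmentOf (h : Arrow l v w) (hv : v ∈ triangle) (hw : w ∈ triangle) :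
    IsSegmentOf triangle (segment ℝ v w) := ⟨v, hv, w, hw, h.ne, rfl⟩

theorem hasType_iff (h : Arrow l v w) (hv : v ∈ triangle) :
    HasType (segment ℝ v w) k ↔ k = l := by
  constructor
  · rintro ⟨x, hx, hz⟩
    obtain ⟨r, hr⟩ := hz v (left_mem_segment ℝ v w)
    obtain ⟨s, hs⟩ := hz w (right_mem_segment ℝ v w)
    have e : coord v k = coord w k := by
      rw [hr, hs, (coord_add_typeDir x r k).1, (coord_add_typeDir x s k).1]
    have a := h.coord_one
    have b := h.2
    rcases idx_cases l k with rfl | rfl | rfl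
    · rfl
    · exact absurd e a.ne'
    · exact absurd e b.ne
  · rintro rfl
    refine ⟨v, hv, fun z hz => ⟨coord z (k + 2) - coord v (k + 2), ?_⟩⟩
    obtain ⟨h3, h4, h5⟩ := coord_add_typeDir v (coord z (k + 2) - coord v (k + 2)) k
    refine coord_ext k ?_ ?_
    · rw [h3, (h.mem_segment.1 hz).1]
    · rw [h5]; ring

theorem segType_eq (h : Arrow l v w) (hv : v ∈ triangle) : segType (segment ℝ v w) = l := by
  have := Classical.epsilon_spec (p := fun k => HasType (segment ℝ v w) k)
    ⟨l, (h.hasType_iff hv).2 rfl⟩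
  exact (h.hasType_iff hv).1 this

theorem segHeight_eq (h : Arrow l v w) (hv : v ∈ triangle) :
    segHeight (segment ℝ v w) = coord v l := by
  have h2 : ∀ x ∈ segment ℝ v w, coord x (segType (segment ℝ v w)) = coord v l := by
    rw [h.segType_eq hv]
    exact fun x hx => (h.mem_segment.1 hx).1
  have := Classical.epsilon_spec
    (p := fun a => ∀ x ∈ segment ℝ v w, coord x (segType (segment ℝ v w)) = a) ⟨_, h2⟩
  exact (this v (left_mem_segment ℝ v w)).symm.trans (h2 v (left_mem_segment ℝ v w))

theorem isTangentAt_iff (h : Arrow l v w) {u : ℂ} : IsTangentAt (segment ℝ v w) z u ↔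
    (z = v ∧ u = typeDir l) ∨ (z = w ∧ u = -typeDir l) := by
  obtain ⟨r, hr, hw⟩ := iff_exists.1 h
  constructor
  · rintro ⟨h1, s, hs, h2⟩
    have h1' : (‖u‖ : ℝ) = 1 := h1
    have key : ∀ t : ℂ, ‖t‖ = 1 → (s : ℂ) * u = r * t → u = t := by
      intro t ht hst
      have hn := congrArg norm hst
      rw [norm_mul, norm_mul, h1', ht, mul_one, mul_one, Complex.norm_real, Complex.norm_real,
        Real.norm_of_nonneg hs.le, Real.norm_of_nonneg hr.le] at hn
      rw [hn] at hst
      exact mul_left_cancel₀ (by exact_mod_cast hr.ne') hst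
    rcases h.segment_eq h2.symm with ⟨rfl, h4⟩ | ⟨rfl, h4⟩
    · left
      refine ⟨rfl, key _ (norm_typeDir l) ?_⟩
      rw [hw] at h4
      exact add_left_cancel h4
    · right
      refine ⟨rfl, key _ (by rw [norm_neg, norm_typeDir]) ?_⟩
      rw [hw] at h4
      linear_combination h4
  · rintro (⟨rfl, rfl⟩ | ⟨rfl, rfl⟩)
    · exact ⟨norm_typeDir l, r, hr, by rw [hw]⟩
    · refine ⟨by rw [norm_neg, norm_typeDir], r, hr, ?_⟩
      rw [segment_symm, hw]
      congr 1
      ring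

theorem isTangent_iff (h : Arrow l v w) {u : ℂ} : IsTangent (segment ℝ v w) u ↔
    u = typeDir l ∨ u = -typeDir l := by
  constructor
  · rintro ⟨z, hz⟩
    rcases h.isTangentAt_iff.1 hz with ⟨-, h⟩ | ⟨-, h⟩ <;> simp [h]
  · rintro (rfl | rfl)
    · exact ⟨v, h.isTangentAt_iff.2 (.inl ⟨rfl, rfl⟩)⟩
    · exact ⟨w, h.isTangentAt_iff.2 (.inr ⟨rfl, rfl⟩)⟩

end Arrow

/-- A segment of the triangle with a type is an arrow, read in one of the two directions. -/
theorem exists_arrow {e : Set ℂ} {l : Fin 3} (h : IsSegmentOf triangle e) (hl : HasType e l) :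
    ∃ v ∈ triangle, ∃ w ∈ triangle, Arrow l v w ∧ e = segment ℝ v w := by
  obtain ⟨v, hv, w, hw, hne, rfl⟩ := h
  obtain ⟨x, hx, hz⟩ := hl
  obtain ⟨r, hr⟩ := hz v (left_mem_segment ℝ v w)
  obtain ⟨s, hs⟩ := hz w (right_mem_segment ℝ v w)
  have e : coord v l = coord w l := by
    rw [hr, hs, (coord_add_typeDir x r l).1, (coord_add_typeDir x s l).1]
  rcases lt_trichotomy (coord v (l + 2)) (coord w (l + 2)) with h | h | h
  · exact ⟨v, hv, w, hw, ⟨e, h⟩, rfl⟩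
  · exact absurd (coord_ext l e h) hne
  · exact ⟨w, hw, v, hv, ⟨e.symm, h⟩, segment_symm ℝ _ _⟩

/-! ### Angles -/

theorem inner_typeDir_self (l : Fin 3) : (inner ℝ (typeDir l) (typeDir l) : ℝ) = 1 := by
  rw [real_inner_self_eq_norm_sq, norm_typeDir]; norm_num

theorem inner_typeDir (l : Fin 3) : (inner ℝ (typeDir l) (typeDir (l + 1)) : ℝ) = -1 / 2 ∧
    (inner ℝ (typeDir l) (typeDir (l + 2)) : ℝ) = -1 / 2 := by
  have h2 : √3 * √3 = 3 := Real.mul_self_sqrt (by norm_num)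
  fin_cases l
  · change (inner ℝ (typeDir 0) (typeDir 1) : ℝ) = _ ∧ (inner ℝ (typeDir 0) (typeDir 2) : ℝ) = _
    rw [typeDir_zero, typeDir_one, typeDir_two]
    constructor <;> simp [Complex.inner] <;> nlinarith
  · change (inner ℝ (typeDir 1) (typeDir 2) : ℝ) = _ ∧ (inner ℝ (typeDir 1) (typeDir 0) : ℝ) = _
    rw [typeDir_zero, typeDir_one, typeDir_two]
    constructor <;> simp [Complex.inner] <;> nlinarith
  · change (inner ℝ (typeDir 2) (typeDir 0) : ℝ) = _ ∧ (inner ℝ (typeDir 2) (typeDir 1) : ℝ) = _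
    rw [typeDir_zero, typeDir_one, typeDir_two]
    constructor <;> simp [Complex.inner]

theorem det_typeDir (l : Fin 3) :
    (typeDir l).re * (typeDir (l + 1)).im - (typeDir l).im * (typeDir (l + 1)).re = √3 / 2 := by
  fin_cases l
  · change (typeDir 0).re * (typeDir 1).im - (typeDir 0).im * (typeDir 1).re = _
    rw [typeDir_zero, typeDir_one]; simp; ring
  · change (typeDir 1).re * (typeDir 2).im - (typeDir 1).im * (typeDir 2).re = _
    rw [typeDir_one, typeDir_two]; simp; ring
  · change (typeDir 2).re * (typeDir 0).im - (typeDir 2).im * (typeDir 0).re = _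
    rw [typeDir_two, typeDir_zero]; simp

theorem arccos_neg_half : Real.arccos (-1 / 2) = 2 * Real.pi / 3 := by
  rw [show (-1 / 2 : ℝ) = -(1 / 2) by ring, Real.arccos_neg, ← Real.cos_pi_div_three,
    Real.arccos_cos] <;> linarith [Real.pi_pos]

theorem arccos_half : Real.arccos (1 / 2) = Real.pi / 3 := by
  rw [← Real.cos_pi_div_three, Real.arccos_cos] <;> linarith [Real.pi_pos]

/-- The two senses in which a typed segment leaves a point. -/
def sgn (b : Bool) : ℂ := if b then 1 else -1

theorem vecAngle_iff {b b' : Bool} {l k : Fin 3} :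
    (VecAngle (sgn b * typeDir l) (sgn b' * typeDir k) (2 * Real.pi / 3) ↔ b = b' ∧ k = l + 1) ∧
    (VecAngle (sgn b * typeDir l) (sgn b' * typeDir k) (Real.pi / 3) ↔ b ≠ b' ∧ k = l + 2) := by
  have hpi := Real.pi_pos
  have h3 : 0 < √3 := by positivity
  have i0 := inner_typeDir_self l
  obtain ⟨i1, i2⟩ := inner_typeDir l
  have d1 := det_typeDir l
  have d2 := det_typeDir (l + 2)
  simp only [idx_two_one] at d2
  have a0 : Real.arccos 1 = 0 := Real.arccos_one
  have a1 := arccos_neg_half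
  have a2 := arccos_half
  have a1' : Real.arccos (-(1 / 2)) = 2 * Real.pi / 3 := by rw [← a1]; norm_num
  have a3 : Real.arccos (-1) = Real.pi := Real.arccos_neg_one
  have e1 : (2 * Real.pi / 3 ≠ Real.pi / 3) := by intro h; linarith
  have mneg : ∀ z : ℂ, sgn true * z = z := fun z => by simp [sgn]
  have mneg' : ∀ z : ℂ, sgn false * z = -z := fun z => by simp [sgn]
  unfold VecAngle
  rcases idx_cases l k with rfl | rfl | rfl
  · cases b <;> cases b' <;> simp [mneg, mneg', mul_comm]
  · cases b <;> cases b' <;>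
      simp only [mneg, mneg', inner_neg_left, inner_neg_right, i1, neg_neg, Complex.neg_re,
        Complex.neg_im, neg_mul, mul_neg, neg_div, a2, a1'] <;>
      simp <;> linarith
  · cases b <;> cases b' <;>
      simp only [mneg, mneg', inner_neg_left, inner_neg_right, i2, neg_neg, Complex.neg_re,
        Complex.neg_im, neg_mul, mul_neg, neg_div, a2, a1'] <;>
      simp <;> linarith

namespace Arrow

variable {l k : Fin 3} {v w z v' w' : ℂ} {c c' : SegColor}

theorem meetOK_iff (h : Arrow l v w) (h' : Arrow k v' w') :
    MeetOK z (segment ℝ v w, c) (segment ℝ v' w', c') ↔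
      (c, c') ∈ allowedPairs ∧ k = l + 1 ∧ (z = v ∧ z = v' ∨ z = w ∧ z = w') := by
  have hp : ∀ b b', VecAngle (sgn b * typeDir l) (sgn b' * typeDir k) (2 * Real.pi / 3) ↔
    b = b' ∧ k = l + 1 := fun b b' => vecAngle_iff.1
  have e1 : typeDir l = sgn true * typeDir l := by simp [sgn]
  have e2 : -typeDir l = sgn false * typeDir l := by simp [sgn]
  have e1' : typeDir k = sgn true * typeDir k := by simp [sgn]
  have e2' : -typeDir k = sgn false * typeDir k := by simp [sgn]
  unfold MeetOK SegAngleAt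
  refine and_congr_right fun _ => ⟨?_, ?_⟩
  · rintro ⟨u, u', hu, hu', ha⟩
    rcases h.isTangentAt_iff.1 hu with ⟨rfl, rfl⟩ | ⟨rfl, rfl⟩ <;>
    rcases h'.isTangentAt_iff.1 hu' with ⟨rfl, rfl⟩ | ⟨rfl, rfl⟩
    · rw [e1, e1', hp] at ha; exact ⟨ha.2, by simp⟩
    · rw [e1, e2', hp] at ha; exact absurd ha.1 (by simp)
    · rw [e2, e1', hp] at ha; exact absurd ha.1 (by simp)
    · rw [e2, e2', hp] at ha; exact ⟨ha.2, by simp⟩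
  · rintro ⟨hk, ⟨h1, h2⟩ | ⟨h1, h2⟩⟩
    · exact ⟨_, _, h.isTangentAt_iff.2 (.inl ⟨h1, rfl⟩), h'.isTangentAt_iff.2 (.inl ⟨h2, rfl⟩), by
        rw [e1, e1', hp]; exact ⟨rfl, hk⟩⟩
    · exact ⟨_, _, h.isTangentAt_iff.2 (.inr ⟨h1, rfl⟩), h'.isTangentAt_iff.2 (.inr ⟨h2, rfl⟩), by
        rw [e2, e2', hp]; exact ⟨rfl, hk⟩⟩

theorem crossOK_iff (h : Arrow l v w) (h' : Arrow k v' w') :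
    CrossOK (segment ℝ v w, c) (segment ℝ v' w', c') ↔
      c = .zero ∧ c' = .one ∧ k = l + 2 := by
  have hp : ∀ b b', VecAngle (sgn b * typeDir l) (sgn b' * typeDir k) (Real.pi / 3) ↔
    b ≠ b' ∧ k = l + 2 := fun b b' => vecAngle_iff.2
  have e1 : typeDir l = sgn true * typeDir l := by simp [sgn]
  have e2 : -typeDir l = sgn false * typeDir l := by simp [sgn]
  have e1' : typeDir k = sgn true * typeDir k := by simp [sgn]
  have e2' : -typeDir k = sgn false * typeDir k := by simp [sgn]
  unfold CrossOK SegAngle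
  refine and_congr_right fun _ => and_congr_right fun _ => ⟨?_, ?_⟩
  · rintro ⟨u, u', hu, hu', ha⟩
    rcases h.isTangent_iff.1 hu with rfl | rfl <;> rcases h'.isTangent_iff.1 hu' with rfl | rfl
    · rw [e1, e1', hp] at ha; exact ha.2
    · rw [e1, e2', hp] at ha; exact ha.2
    · rw [e2, e1', hp] at ha; exact ha.2
    · rw [e2, e2', hp] at ha; exact ha.2
  · intro hk
    exact ⟨_, _, h.isTangent_iff.2 (.inl rfl), h'.isTangent_iff.2 (.inr rfl), by
      rw [e1, e2', hp]; exact ⟨by simp, hk⟩⟩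

end Arrow

end

section

variable {n d : ℕ}

/-! ### Concave functions on the hexagon -/

theorem row_le {H : ℕ → ℝ} {p : ℕ} (hc : ∀ s, s + 1 < p → H s + H (s + 2) < 2 * H (s + 1))
    (h : 0 < p → H 1 ≤ H 0) : ∀ s ≤ p, H s ≤ H 0 ∧ (2 ≤ s → H s < H 0) := by
  have key : ∀ s, s < p → H (s + 1) ≤ H s ∧ (1 ≤ s → H (s + 1) < H s) := by
    intro s
    induction s with
    | zero => exact fun hp => ⟨h hp, fun h => absurd h (by norm_num)⟩
    | succ s ih =>
      intro hs
      have h1 := (ih (by omega)).1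
      have h2 := hc s hs
      have : H (s + 1 + 1) < H (s + 1) := by linarith
      exact ⟨this.le, fun _ => this⟩
  intro s
  induction s with
  | zero => exact fun _ => ⟨le_rfl, fun h => absurd h (by norm_num)⟩
  | succ s ih =>
    intro hs
    have h1 := (ih (by omega)).1
    have h2 := key s (by omega)
    exact ⟨h2.1.trans h1, fun h3 => (h2.2 (by omega)).trans_le h1⟩

theorem grid_le {G : ℕ → ℕ → ℝ} {p q : ℕ}
    (sub : ∀ s < p, ∀ t < q, G s t + G (s + 1) (t + 1) ≤ G (s + 1) t + G s (t + 1))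
    (l1 : ∀ s, s + 1 < p → G s 0 + G (s + 2) 0 < 2 * G (s + 1) 0)
    (l2 : ∀ t, t + 1 < q → G 0 t + G 0 (t + 2) < 2 * G 0 (t + 1))
    (h1 : 0 < p → G 1 0 ≤ G 0 0) (h2 : 0 < q → G 0 1 ≤ G 0 0) :
    G p q ≤ G 0 0 ∧ (G p q = G 0 0 → p ≤ 1 ∧ q ≤ 1) := by
  have r1 := row_le l1 h1 p le_rfl
  have r2 := row_le l2 h2 q le_rfl
  have key : ∀ s ≤ p, ∀ t ≤ q, G s t ≤ G s 0 + G 0 t - G 0 0 := by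
    intro s hs
    induction s with
    | zero => intro t _; linarith
    | succ s ih =>
      intro t ht
      have h3 : ∀ t ≤ q, G (s + 1) t - G s t ≤ G (s + 1) 0 - G s 0 := by
        intro t
        induction t with
        | zero => intro _; linarith
        | succ t ih2 =>
          intro ht
          have := ih2 (by omega)
          have := sub s (by omega) t (by omega)
          linarith
      have := h3 t ht
      have := ih (by omega) t ht
      linarith
  have hk := key p le_rfl q le_rfl
  refine ⟨by linarith, fun he => ⟨?_, ?_⟩⟩
  · by_contra hp
    have := r1.2 (by omega)
    linarith
  · by_contra hp
    have := r2.2 (by omega)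
    linarith

/-- Two lattice directions at an angle of `π / 3`. The edge that joins their ends has type `i + 1`,
and leads from the end of `x` to the end of `y`. -/
def AcuteAt (i : Fin 3) (x y : Pt) : Prop :=
  (x = eps i - eps (i + 1) ∧ y = eps i - eps (i + 2)) ∨
    (x = eps (i + 2) - eps i ∧ y = eps (i + 1) - eps i)

/-- Two lattice directions at an angle of `π / 3`, in any order. -/
def Acute (x y : Pt) : Prop := ∃ i, AcuteAt i x y ∨ AcuteAt i y x

theorem acute_eps (i : Fin 3) : Acute (eps i - eps (i + 1)) (eps i - eps (i + 2)) :=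
  ⟨i, .inl (.inl ⟨rfl, rfl⟩)⟩

namespace Acute

variable {x y : Pt}

theorem symm (h : Acute x y) : Acute y x := h.imp fun _ => Or.symm

theorem neg (h : Acute x y) : Acute (-x) (-y) := by
  obtain ⟨i, (⟨rfl, rfl⟩ | ⟨rfl, rfl⟩) | ⟨rfl, rfl⟩ | ⟨rfl, rfl⟩⟩ := h <;> refine ⟨i, ?_⟩ <;>
    simp [AcuteAt]

theorem sub (h : Acute x y) : Acute x (x - y) := by
  obtain ⟨i, (⟨rfl, rfl⟩ | ⟨rfl, rfl⟩) | ⟨rfl, rfl⟩ | ⟨rfl, rfl⟩⟩ := h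
  · exact ⟨i + 1, .inl (.inr (by simp))⟩
  · exact ⟨i + 2, .inl (.inl (by simp))⟩
  · exact ⟨i + 2, .inr (.inr (by simp))⟩
  · exact ⟨i + 1, .inr (.inl (by simp))⟩

theorem ne (h : Acute x y) : x ≠ y := by
  obtain ⟨i, (⟨rfl, rfl⟩ | ⟨rfl, rfl⟩) | ⟨rfl, rfl⟩ | ⟨rfl, rfl⟩⟩ := h <;> revert i <;> decide

/-- The six lattice directions. -/
theorem cases (h : Acute x y) {x' y' : Pt} (h' : Acute x' y') :
    x' = x ∨ x' = y ∨ x' = x - y ∨ x' = -x ∨ x' = -y ∨ x' = -(x - y) := by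
  obtain ⟨i, (⟨rfl, rfl⟩ | ⟨rfl, rfl⟩) | ⟨rfl, rfl⟩ | ⟨rfl, rfl⟩⟩ := h <;>
    obtain ⟨j, (⟨rfl, rfl⟩ | ⟨rfl, rfl⟩) | ⟨rfl, rfl⟩ | ⟨rfl, rfl⟩⟩ := h' <;>
      revert i j <;> decide

theorem mem (h : Acute x y) {v : Pt} (h1 : v ∈ hiveVertices n d)
    (h2 : v + x + y ∈ hiveVertices n d) : v + x ∈ hiveVertices n d := by
  obtain ⟨i, (⟨rfl, rfl⟩ | ⟨rfl, rfl⟩) | ⟨rfl, rfl⟩ | ⟨rfl, rfl⟩⟩ := h <;>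
    rw [mem_hive i] at h1 h2 ⊢ <;> simp [eps_apply] at h2 ⊢ <;> omega

end Acute

/-- Strictly concave functions on the hexagon: on every unit rhombus the sum of the values at the
ends of the short diagonal is at least the sum at the ends of the long one, with equality only if
the ends of the short diagonal satisfy `M`; and the function is strictly concave on the lines of the
lattice. -/
structure StrictHive (n d : ℕ) (g : Pt → ℝ) (M : Pt → Pt → Prop) : Prop where
  rhombus : ∀ {x y}, Acute x y → ∀ {v}, v ∈ hiveVertices n d → v + x + y ∈ hiveVertices n d →
    g v + g (v + x + y) ≤ g (v + x) + g (v + y)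
  flat : ∀ {x y}, Acute x y → ∀ {v}, v ∈ hiveVertices n d → v + x + y ∈ hiveVertices n d →
    g v + g (v + x + y) = g (v + x) + g (v + y) → M (v + x) (v + y)
  line : ∀ {x y}, Acute x y → ∀ {v}, v ∈ hiveVertices n d → v + x + x ∈ hiveVertices n d →
    g v + g (v + x + x) < 2 * g (v + x)

/-- The points of the hexagon at which a function is maximal. -/
def maxSet (n d : ℕ) (g : Pt → ℝ) : Set Pt :=
  {v | v ∈ hiveVertices n d ∧ ∀ w ∈ hiveVertices n d, g w ≤ g v}

theorem maxSet_eq {g : Pt → ℝ} {v w : Pt} (hv : v ∈ maxSet n d g) (hw : w ∈ maxSet n d g) :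
    g v = g w := le_antisymm (hw.2 v hv.1) (hv.2 w hw.1)

theorem mem_maxSet_of_eq {g : Pt → ℝ} {v w : Pt} (hv : v ∈ maxSet n d g)
    (hw : w ∈ hiveVertices n d) (h : g v ≤ g w) : w ∈ maxSet n d g :=
  ⟨hw, fun u hu => (hv.2 u hu).trans h⟩

namespace StrictHive

variable {g : Pt → ℝ} {M : Pt → Pt → Prop}

/-- A local maximum is a global one: an arbitrary point is the far corner of a parallelogram whose
sides at the given point are lattice lines meeting at an angle of `π / 3`. If the function takes
the maximal value at the far corner, the parallelogram is a point, an edge or a rhombus. -/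
theorem local_max (h : StrictHive n d g M) {v : Pt} (hv : v ∈ hiveVertices n d)
    (hl : ∀ x y, Acute x y → v + x ∈ hiveVertices n d → g (v + x) ≤ g v)
    {w : Pt} (hw : w ∈ hiveVertices n d) : g w ≤ g v ∧ (g w = g v →
      w = v ∨ ∃ x y, Acute x y ∧ (w = v + x ∨ w = v + x + y)) := by
  have hv0 := (mem_hive 0).1 hv
  have hw0 := (mem_hive 0).1 hw
  simp only [zero_add] at hv0 hw0
  obtain ⟨i, hi⟩ : ∃ i, (w (i + 1) ≤ v (i + 1) ∧ w (i + 2) ≤ v (i + 2)) ∨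
      (v (i + 1) ≤ w (i + 1) ∧ v (i + 2) ≤ w (i + 2)) := by
    rcases le_total (v 0) (w 0) with h0 | h0 <;> rcases le_total (v 1) (w 1) with h1 | h1 <;>
      rcases le_total (v 2) (w 2) with h2 | h2
    all_goals first
      | exact ⟨0, .inl ⟨h1, h2⟩⟩ | exact ⟨0, .inr ⟨h1, h2⟩⟩ | exact ⟨1, .inl ⟨h2, h0⟩⟩
      | exact ⟨1, .inr ⟨h2, h0⟩⟩ | exact ⟨2, .inl ⟨h0, h1⟩⟩ | exact ⟨2, .inr ⟨h0, h1⟩⟩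
  have hvi := (mem_hive i).1 hv
  have hwi := (mem_hive i).1 hw
  obtain ⟨x, y, p, q, hA, hpq⟩ : ∃ x y, ∃ p q : ℕ, AcuteAt i x y ∧
      w = v + ((p : ℤ) • x + (q : ℤ) • y) := by
    rcases hi with ⟨h1, h2⟩ | ⟨h1, h2⟩
    · exact ⟨_, _, (v (i + 1) - w (i + 1)).toNat, (v (i + 2) - w (i + 2)).toNat, .inl ⟨rfl, rfl⟩,
        by refine pt_ext i ?_ ?_ ?_ <;> simp [eps_apply] <;> omega⟩
    · exact ⟨_, _, (w (i + 2) - v (i + 2)).toNat, (w (i + 1) - v (i + 1)).toNat, .inr ⟨rfl, rfl⟩,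
        by refine pt_ext i ?_ ?_ ?_ <;> simp [eps_apply] <;> omega⟩
  have hxy : Acute x y := ⟨i, .inl hA⟩
  let P : ℕ → ℕ → Pt := fun s t => v + ((s : ℤ) • x + (t : ℤ) • y)
  have hP : ∀ s ≤ p, ∀ t ≤ q, P s t ∈ hiveVertices n d := by
    intro s hs t ht
    rw [hpq] at hwi
    rcases hA with ⟨rfl, rfl⟩ | ⟨rfl, rfl⟩ <;> rw [mem_hive i] <;>
      simp [P, eps_apply] at hwi ⊢ <;> omega
  have hx : ∀ s t, P (s + 1) t = P s t + x := fun s t => by simp only [P]; push_cast; module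
  have hy : ∀ s t, P s (t + 1) = P s t + y := fun s t => by simp only [P]; push_cast; module
  have h0 : P 0 0 = v := by simp [P]
  have := grid_le (G := fun s t => g (P s t)) (p := p) (q := q) (fun s hs t ht => ?_)
    (fun s hs => ?_) (fun s hs => ?_) (fun hp => ?_) (fun hp => ?_)
  · rw [hpq]
    rw [h0] at this
    refine ⟨this.1, fun he => ?_⟩
    obtain ⟨hp1, hq1⟩ := this.2 he
    interval_cases p <;> interval_cases q
    · exact .inl h0
    · exact .inr ⟨y, x, hxy.symm, .inl (by simp)⟩
    · exact .inr ⟨x, y, hxy, .inl (by simp)⟩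
    · exact .inr ⟨x, y, hxy, .inr (by simp [add_assoc])⟩
  · have := hP (s + 1) hs (t + 1) ht
    rw [hy, hx] at this ⊢
    rw [hy]
    exact h.rhombus hxy (hP s hs.le t ht.le) this
  · have := hP (s + 1 + 1) hs 0 (by omega)
    simp only [hx] at this ⊢
    exact h.line hxy (hP s (by omega) 0 (by omega)) this
  · have := hP 0 (by omega) (s + 1 + 1) hs
    simp only [hy] at this ⊢
    exact h.line hxy.symm (hP 0 (by omega) s (by omega)) this
  · have := hP 1 hp 0 (by omega)
    rw [hx, h0] at this ⊢
    exact hl _ _ hxy this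
  · have := hP 0 (by omega) 1 hp
    rw [hy, h0] at this ⊢
    exact hl _ _ hxy.symm this

/-- Two points at which the function is maximal are the ends of an edge, or the ends of the long
diagonal of a flat rhombus, on which the function is constant. -/
theorem maxSet_pair (h : StrictHive n d g M) {v w : Pt} (hv : v ∈ maxSet n d g)
    (hw : w ∈ maxSet n d g) : w = v ∨ ∃ x y, Acute x y ∧ (w = v + x ∨ (w = v + x + y ∧
      v + x ∈ maxSet n d g ∧ v + y ∈ maxSet n d g ∧ M (v + x) (v + y))) := by
  have hvw := maxSet_eq hv hw
  rcases (h.local_max hv.1 (fun _ _ _ hm => hv.2 _ hm) hw.1).2 hvw.symm with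
    h1 | ⟨x, y, hA, h1 | rfl⟩
  · exact .inl h1
  · exact .inr ⟨x, y, hA, .inl h1⟩
  · have m1 := hA.mem hv.1 hw.1
    have m2 := hA.symm.mem hv.1 (add_right_comm v x y ▸ hw.1)
    have hr := h.rhombus hA hv.1 hw.1
    have a1 := hv.2 _ m1
    have a2 := hv.2 _ m2
    exact .inr ⟨x, y, hA, .inr ⟨rfl, mem_maxSet_of_eq hv m1 (by linarith),
      mem_maxSet_of_eq hv m2 (by linarith), h.flat hA hv.1 hw.1 (by linarith)⟩⟩

/-- The rhombus whose short diagonal leads from `v` to `v + (x - y)`. -/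
theorem edge_step (h : StrictHive n d g M) {v x y : Pt} (hA : Acute x y)
    (hw : v + x ∈ hiveVertices n d) (hm : v + -y ∈ hiveVertices n d) :
    v + (x - y) ∈ hiveVertices n d ∧ g (v + x) + g (v + -y) ≤ g v + g (v + (x - y)) := by
  have e1 : v + x + -x = v := by abel
  have e2 : v + x + -y = v + (x - y) := by abel
  have e3 : v + x + -y + -x = v + -y := by abel
  have e4 : v + x + -x + -y = v + -y := by abel
  have h1 := hA.neg.symm.mem hw (e3 ▸ hm)
  have h2 := h.rhombus hA.neg hw (e4 ▸ hm)
  rw [e2] at h1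
  rw [e4, e1, e2] at h2
  exact ⟨h1, h2⟩

theorem edge_back (h : StrictHive n d g M) {v x y : Pt} (hA : Acute x y)
    (hw : v + x ∈ hiveVertices n d) (hm : v + -x ∈ hiveVertices n d) :
    g (v + -x) + g (v + x) < 2 * g v := by
  have := h.line hA hm (by simpa using hw)
  simpa using this

theorem edge_max (h : StrictHive n d g M) {v x y : Pt} (hA : Acute x y)
    (hv : v ∈ hiveVertices n d) (hw : v + x ∈ hiveVertices n d) (he : g (v + x) = g v)
    (h1 : v + y ∈ hiveVertices n d → g (v + y) ≤ g v)
    (h2 : v + (x - y) ∈ hiveVertices n d → g (v + (x - y)) ≤ g v) : v ∈ maxSet n d g := by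
  refine ⟨hv, fun u hu => (h.local_max hv (fun x' y' hA' hm => ?_) hu).1⟩
  rcases hA.cases hA' with rfl | rfl | rfl | rfl | rfl | rfl
  · exact he.le
  · exact h1 hm
  · exact h2 hm
  · linarith [h.edge_back hA hw hm]
  · have := h.edge_step hA hw hm
    linarith [h2 this.1]
  · have := h.edge_step hA.sub hw hm
    rw [sub_sub_cancel] at this
    linarith [h1 this.1]

/-- If the function is maximal at the ends of an edge and at a third point, it is maximal on a
triangle with this edge. -/
theorem third_vertex (h : StrictHive n d g M) {v t x y : Pt} (hA : Acute x y)
    (hv : v ∈ maxSet n d g) (hw : v + x ∈ maxSet n d g) (ht : t ∈ maxSet n d g) (h1 : t ≠ v)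
    (h2 : t ≠ v + x) : v + y ∈ maxSet n d g ∨ v + (x - y) ∈ maxSet n d g := by
  have unit : ∀ x' y', Acute x' y' → x' ≠ x → v + x' ∈ maxSet n d g →
      v + y ∈ maxSet n d g ∨ v + (x - y) ∈ maxSet n d g := by
    intro x' y' hA' hne hx
    have e1 := maxSet_eq hv hw
    have e2 := maxSet_eq hv hx
    rcases hA.cases hA' with rfl | rfl | rfl | rfl | rfl | rfl
    · exact absurd rfl hne
    · exact .inl hx
    · exact .inr hx
    · linarith [h.edge_back hA hw.1 hx.1]
    · have := h.edge_step hA hw.1 hx.1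
      exact .inr (mem_maxSet_of_eq hv this.1 (by linarith))
    · have := h.edge_step hA.sub hw.1 hx.1
      rw [sub_sub_cancel] at this
      exact .inl (mem_maxSet_of_eq hv this.1 (by linarith))
  rcases h.maxSet_pair hv ht with h3 | ⟨x', y', hA', rfl | ⟨-, h3, h4, -⟩⟩
  · exact absurd h3 h1
  · exact unit x' y' hA' (fun h => h2 (h ▸ rfl)) ht
  · by_cases hx : x' = x
    · exact unit y' x' hA'.symm (fun h => hA'.ne (hx.trans h.symm)) h4
    · exact unit x' y' hA' hx h3

theorem maxSet_dist (h : StrictHive n d g M) {v w : Pt} (hv : v ∈ maxSet n d g)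
    (hw : w ∈ maxSet n d g) (a b : Fin 3) : w a - v a ≤ w b - v b + 3 := by
  rcases h.maxSet_pair hv hw with rfl | ⟨x, y, hA, hw⟩
  · omega
  · have : (x a ≤ x b + 3) ∧ (x + y) a ≤ (x + y) b + 3 := by
      obtain ⟨i, (⟨rfl, rfl⟩ | ⟨rfl, rfl⟩) | ⟨rfl, rfl⟩ | ⟨rfl, rfl⟩⟩ := hA <;>
        clear hw <;> revert i a b <;> decide
    simp only [Pi.add_apply] at this
    rcases hw with rfl | ⟨rfl, -⟩ <;> simp only [Pi.add_apply] <;> omega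

/-- If the function is maximal at the vertices of a triangle, the other points at which it is
maximal are the reflections of the vertices in the sides which satisfy `M`. -/
theorem maxSet_face (h : StrictHive n d g M) {u t : Pt} {s : ℤ} (hs : s = 1 ∨ s = -1)
    (hu : ∀ l, u + s • eps l ∈ maxSet n d g) (ht : t ∈ maxSet n d g) :
    (∃ l, t = u + s • eps l) ∨ ∃ k, t = u + s • eps k + s • eps (k + 1) - s • eps (k + 2) ∧
      M (u + s • eps k) (u + s • eps (k + 1)) := by
  have hd : ∀ a b, t a - u a ≤ t b - u b + 2 := by
    intro a b
    have h1 := h.maxSet_dist (hu a) ht a b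
    have h2 := h.maxSet_dist (hu b) ht a b
    by_cases hab : a = b
    · rw [hab]; omega
    · rcases hs with rfl | rfl <;> simp [eps_apply, hab, Ne.symm hab] at h1 h2 <;> omega
  have hsum := ((mem_hive 0).1 (hu 0).1).2.2.2
  have hsum' := ((mem_hive 0).1 ht.1).2.2.2
  simp [eps_apply] at hsum hsum'
  have hcase : (∃ l, t l = u l + s ∧ t (l + 1) = u (l + 1) ∧ t (l + 2) = u (l + 2)) ∨
      ∃ k, t k = u k + s ∧ t (k + 1) = u (k + 1) + s ∧ t (k + 2) = u (k + 2) - s := by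
    by_contra hc
    simp only [not_or, not_exists, forall_idx 0, zero_add, Fin.isValue, Fin.reduceAdd] at hc
    have := hd 0 1
    have := hd 0 2
    have := hd 1 0
    have := hd 1 2
    have := hd 2 0
    have := hd 2 1
    clear hd hu
    rcases hs with rfl | rfl <;> omega
  rcases hcase with ⟨l, h0, h1, h2⟩ | ⟨k, h0, h1, h2⟩
  · exact .inl ⟨l, by refine pt_ext l ?_ ?_ ?_ <;> simp [eps_apply, *]⟩
  · have e1 : u + s • eps (k + 2) + s • (eps k - eps (k + 2)) = u + s • eps k := by
      simp only [smul_sub]; abel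
    have e2 : u + s • eps (k + 2) + s • (eps (k + 1) - eps (k + 2)) = u + s • eps (k + 1) := by
      simp only [smul_sub]; abel
    have e3 : t = u + s • eps k + s • eps (k + 1) - s • eps (k + 2) := by
      refine pt_ext k ?_ ?_ ?_ <;> simp [eps_apply, *]
    have e4 : u + s • eps (k + 2) + s • (eps k - eps (k + 2)) +
        s • (eps (k + 1) - eps (k + 2)) = t := by
      rw [e3]; simp only [smul_sub]; abel
    have hA : Acute (s • (eps k - eps (k + 2))) (s • (eps (k + 1) - eps (k + 2))) := by
      have : Acute (eps k - eps (k + 2)) (eps (k + 1) - eps (k + 2)) :=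
        ⟨k + 2, .inr (.inr (by simp))⟩
      rcases hs with rfl | rfl
      · simpa
      · simpa using this.neg
    have := h.flat hA (hu (k + 2)).1 (e4 ▸ ht.1)
    rw [e4, e1, e2] at this
    exact .inr ⟨k, e3, this (by
      rw [maxSet_eq (hu (k + 2)) ht, maxSet_eq (hu k) ht, maxSet_eq (hu (k + 1)) ht])⟩

end StrictHive

end

section

variable {n d : ℕ}

/-! ### Dual hives as concave functions -/

/-- Dual hives, with the inequalities for a pair of adjacent faces in one of their equivalent
forms. -/
structure Hive (C : HiveEdge n d → HiveColor) (L : HiveEdge n d → ℝ) (a : Fin 3 → Fin n → ℝ) :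
    Prop where
  pos_n : 0 < n
  colorMap : IsColorMap C
  pos : ∀ e, 0 < L e
  sum : ∀ (f : HiveFace n d) (l : Fin 3), L (f.edge l) + L (f.edge (l + 1)) + L (f.edge (l + 2)) = 1
  eq_of_m : ∀ (e : HiveEdge n d) (hs hl), C e = .m →
    L ((e.low hl).edge (e.type + 2)) = L ((e.up hs).edge (e.type + 2))
  lt_of_ne_m : ∀ (e : HiveEdge n d) (hs hl), C e ≠ .m →
    L ((e.low hl).edge (e.type + 2)) < L ((e.up hs).edge (e.type + 2))
  long_side : ∀ e : HiveEdge n d, e.OnLongSide → C e = .seg .zero ∧ L e = bdryValue a e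
  short_side : ∀ e : HiveEdge n d, e.OnShortSide → C e = .seg .one ∧ L e = 1 - bdryValue a e
  anti : ∀ i, StrictAnti (a i)

variable {C : HiveEdge n d → HiveColor} {L : HiveEdge n d → ℝ} {a : Fin 3 → Fin n → ℝ}

theorem hiveBoundary_anti {α β γ : Fin n → ℝ} (hα : α ∈ regularSpectra n)
    (hβ : β ∈ regularSpectra n) (hγ : γ ∈ regularSpectra n) (i : Fin 3) :
    StrictAnti (hiveBoundary α β γ i) := by
  fin_cases i
  · exact hβ.1
  · exact hα.1
  · intro j k hjk
    change 1 - γ k.rev < 1 - γ j.rev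
    have := hγ.1 (Fin.rev_lt_rev.2 hjk)
    linarith

theorem up_ne_low (e : HiveEdge n d) (hs hl) : e.up hs ≠ e.low hl := by
  simp [HiveEdge.up, HiveEdge.low]

theorem hive_iff (hn : 0 < n) {α β γ : Fin n → ℝ} : IsDualHive α β γ C L ∧
    (∀ i, StrictAnti (hiveBoundary α β γ i)) ↔ Hive C L (hiveBoundary α β γ) := by
  constructor
  · rintro ⟨h, ha⟩
    refine ⟨hn, h.colorMap, h.pos, fun f l => ?_, fun e hs hl hm => ?_, fun e hs hl hm => ?_,
      h.long_side, h.short_side, ha⟩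
    · rw [sum_rot l fun k => L (f.edge k), h.sum_face]
    · exact h.eq_of_m (e.low hl) (e.up hs) e.type (e.type + 2) (up_ne_low e hs hl).symm (by simp)
        (by simp) (by simpa using hm)
    · refine h.lt_of_ne_m (e.up hs) (e.low hl) e.type (e.type + 2) (up_ne_low e hs hl) (by simp)
        (by simp) (by simpa using hm) ?_
      simp [HiveEdge.height, HiveEdge.up, HiveEdge.low, eps_apply]
  · intro h
    have up : ∀ {f : HiveFace n d} {e : HiveEdge n d}, DualVertex.face f = e.plus → ∃ hs, f = e.up
        hs := by
      intro f e h
      unfold HiveEdge.plus at h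
      split_ifs at h with hs
      exact ⟨hs, by simpa using h⟩
    have low : ∀ {f : HiveFace n d} {e : HiveEdge n d}, DualVertex.face f = e.minus → ∃ hl, f =
        e.low hl := by
      intro f e h
      unfold HiveEdge.minus at h
      split_ifs at h with hs
      exact ⟨hs, by simpa using h⟩
    have key : ∀ (f g : HiveFace n d) (k : Fin 3), f ≠ g → f.edge k = g.edge k →
        ∃ (e : HiveEdge n d) (hs : _) (hl : _), e.type = k ∧
          ((f = e.up hs ∧ g = e.low hl) ∨ (g = e.up hs ∧ f = e.low hl)) := by
      intro f g k hne he
      rcases (incident_iff (x := .face f) (e := f.edge k)).1 ⟨k, rfl⟩ with h1 | h1 <;>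
        rcases (incident_iff (x := .face g) (e := f.edge k)).1 ⟨k, he.symm⟩ with h2 | h2
      · exact absurd (DualVertex.face.inj (h1.trans h2.symm)) hne
      · obtain ⟨⟨hs, h1⟩, hl, h2⟩ := And.intro (up h1) (low h2)
        exact ⟨_, hs, hl, face_type f k, .inl ⟨h1, h2⟩⟩
      · obtain ⟨⟨hl, h1⟩, hs, h2⟩ := And.intro (low h1) (up h2)
        exact ⟨_, hs, hl, face_type f k, .inr ⟨h2, h1⟩⟩
      · exact absurd (DualVertex.face.inj (h1.trans h2.symm)) hne
    refine ⟨⟨h.colorMap, h.pos, fun f => ?_, ?_, ?_, h.long_side, h.short_side⟩, h.anti⟩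
    · rw [← sum_rot 0 fun k => L (f.edge k)]; exact h.sum f 0
    · intro f g k l hne he hl hm
      have h1 := h.sum f k
      rw [he, ← h.sum g k] at h1
      have h2 : L (f.edge (k + 2)) = L (g.edge (k + 2)) := by
        obtain ⟨e, a, b, rfl, ⟨rfl, rfl⟩ | ⟨rfl, rfl⟩⟩ := key f g k hne he
        · exact (h.eq_of_m e a b (by simpa using hm)).symm
        · exact h.eq_of_m e a b (by simpa using hm)
      rcases idx_cases k l with rfl | rfl | rfl
      · exact absurd rfl hl
      · linarith
      · exact h2
    · intro f g k l hne he hl hm hh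
      obtain ⟨e, a, b, rfl, ⟨rfl, rfl⟩ | ⟨rfl, rfl⟩⟩ := key f g k hne he <;>
        obtain rfl | rfl | h3 := idx_cases e.type l <;>
        simp [HiveEdge.height, HiveEdge.up, HiveEdge.low, eps_apply, *] at hh hl
      · rw [h3]
        exact h.lt_of_ne_m e a b (by simpa using hm)
      · omega

end

section

variable {n d : ℕ}
variable {C : HiveEdge n d → HiveColor} {L : HiveEdge n d → ℝ} {a : Fin 3 → Fin n → ℝ}

/-! ### The concave function of a dual hive and a point of the plane -/

/-- The pairing of a lattice point with a point of the plane, given by its coordinates. -/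
def pairing (x : Fin 3 → ℝ) (v : Pt) : ℝ :=
  v 0 * ((x 0 - x 2) / 3) + v 1 * ((x 1 - x 0) / 3) + v 2 * ((x 2 - x 1) / 3)

theorem pairing_add (x : Fin 3 → ℝ) (v w : Pt) : pairing x (v + w) = pairing x v + pairing x w := by
  simp [pairing]; ring

theorem pairing_sub (x : Fin 3 → ℝ) (v w : Pt) : pairing x (v - w) = pairing x v - pairing x w := by
  simp [pairing]; ring

theorem pairing_eps (x : Fin 3 → ℝ) (l : Fin 3) : pairing x (eps l) = (x l - x (l + 2)) / 3 := by
  fin_cases l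
  · simp [pairing, eps_apply]
  · simp [pairing, eps_apply]
  · simp [pairing, eps_apply]

/-- A function on the lattice points with differences `1/3 - L e` along the edges. -/
def hivePotential (L : HiveEdge n d → ℝ) : Pt → ℝ :=
  Classical.epsilon fun c => ∀ e : HiveEdge n d, c e.finish - c e.start = 1 / 3 - L e

/-- The concave function on the hexagon attached to a dual hive and to a point `z`: the ends of an
edge at which it is maximal show the place of `z` in the honeycomb. -/
def hivePsi (L : HiveEdge n d → ℝ) (z : ℂ) (v : Pt) : ℝ :=
  hivePotential L v + pairing (coord z) v

/-- The ends of an edge determine it. -/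
theorem edge_eq_of_ends {e e' : HiveEdge n d} (h1 : e'.start = e.start ∨ e'.start = e.finish)
    (h2 : e'.finish = e.start ∨ e'.finish = e.finish) : e' = e := by
  have h0 : ∀ k : Fin 3, 0 ≠ eps k - eps (k + 1) := by decide
  have ht : ∀ k l : Fin 3, eps k - eps (k + 1) = eps l - eps (l + 1) → k = l := by decide
  have ht' : ∀ k l : Fin 3, -(eps k - eps (k + 1)) ≠ eps l - eps (l + 1) := by decide
  have hst : ∀ e : HiveEdge n d, e.finish - e.start = eps e.type - eps (e.type + 1) :=
    fun e => by rw [HiveEdge.finish]; abel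
  have h3 := hst e'
  rcases h1 with h1 | h1 <;> rcases h2 with h2 | h2
  · rw [h1, h2, sub_self] at h3; exact absurd h3 (h0 _)
  · rw [h1, h2, hst] at h3; exact HiveEdge.ext h1 (ht _ _ h3).symm
  · rw [h1, h2, ← neg_sub, hst] at h3; exact absurd h3 (ht' _ _)
  · rw [h1, h2, sub_self] at h3; exact absurd h3 (h0 _)

/-- The condition for `StrictHive` that the edge with the given ends has colour `m`. -/
def MEdge (C : HiveEdge n d → HiveColor) (v w : Pt) : Prop :=
  ∀ e : HiveEdge n d, (e.start = v ∧ e.finish = w) ∨ (e.start = w ∧ e.finish = v) → C e = .m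

/-- The vertices of a face. -/
def HiveFace.vertex : HiveFace n d → Fin 3 → Pt
  | .upper u _, l => u + eps l
  | .lower w _, l => w - eps l

theorem HiveFace.exists_sign (f : HiveFace n d) :
    ∃ (u : Pt) (s : ℤ), (s = 1 ∨ s = -1) ∧ ∀ l, f.vertex l = u + s • eps l := by
  rcases f with ⟨u, hu⟩ | ⟨w, hw⟩
  · exact ⟨u, 1, .inl rfl, fun l => by simp [vertex]⟩
  · exact ⟨w, -1, .inr rfl, fun l => by simp [vertex, sub_eq_add_neg]⟩

theorem HiveFace.vertex_mem (f : HiveFace n d) (l : Fin 3) : f.vertex l ∈ hiveVertices n d := by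
  rcases f with ⟨u, hu⟩ | ⟨w, hw⟩
  exacts [hu l, hw l]

theorem HiveFace.edge_ends (f : HiveFace n d) (l : Fin 3) :
    ((f.edge l).start = f.vertex l ∧ (f.edge l).finish = f.vertex (l + 1)) ∨
      ((f.edge l).start = f.vertex (l + 1) ∧ (f.edge l).finish = f.vertex l) := by
  rcases f with ⟨u, hu⟩ | ⟨w, hw⟩
  · exact .inr ⟨rfl, by simp only [HiveEdge.finish, vertex, upper_start, upper_type]; abel⟩
  · exact .inl ⟨rfl, by simp [HiveEdge.finish, vertex]⟩

theorem MEdge.color {f : HiveFace n d} {l : Fin 3} (h : MEdge C (f.vertex l) (f.vertex (l + 1))) :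
    C (f.edge l) = .m := h _ (f.edge_ends l)

theorem MEdge.symm {v w : Pt} (h : MEdge C v w) : MEdge C w v := fun e he => h e he.symm

namespace Hive

theorem psi_edge (h : Hive C L a) (z : ℂ) (e : HiveEdge n d) :
    hivePsi L z e.finish - hivePsi L z e.start = coord z e.type - L e := by
  have hp : ∀ e : HiveEdge n d, hivePotential L e.finish - hivePotential L e.start = 1 / 3 - L e :=
      by
    refine Classical.epsilon_spec
      (p := fun c : Pt → ℝ => ∀ e : HiveEdge n d, c e.finish - c e.start = 1 / 3 - L e) ?_
    apply exists_potential
    intro f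
    have := h.sum f 0
    simp only [zero_add] at this
    linarith
  have h1 := hp e
  have h2 := coord_sum e.type z
  unfold hivePsi
  have h3 : pairing (coord z) e.finish =
      pairing (coord z) e.start + (coord z e.type - coord z (e.type + 2)) / 3
        - (coord z (e.type + 1) - coord z e.type) / 3 := by
    rw [HiveEdge.finish, pairing_sub, pairing_add, pairing_eps, pairing_eps, idx_one_two]
  rw [h3]
  linarith

theorem psi_up (h : Hive C L a) (z : ℂ) (e : HiveEdge n d) (hs : ¬ e.OnShortSide) :
    hivePsi L z (e.start + (eps (e.type + 2) - eps (e.type + 1))) - hivePsi L z e.finish =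
      coord z (e.type + 2) - L ((e.up hs).edge (e.type + 2)) := by
  have := h.psi_edge z ((e.up hs).edge (e.type + 2))
  rw [face_type] at this
  have e1 : ((e.up hs).edge (e.type + 2)).start = e.finish := by
    simp [HiveEdge.up, HiveEdge.finish]; abel
  have e2 : ((e.up hs).edge (e.type + 2)).finish =
      e.start + (eps (e.type + 2) - eps (e.type + 1)) := by
    rw [HiveEdge.finish, e1]; simp [HiveEdge.finish]; abel
  rwa [e1, e2] at this

theorem psi_low (h : Hive C L a) (z : ℂ) (e : HiveEdge n d) (hl : ¬ e.OnLongSide) :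
    hivePsi L z e.start - hivePsi L z (e.start + (eps e.type - eps (e.type + 2))) =
      coord z (e.type + 2) - L ((e.low hl).edge (e.type + 2)) := by
  have := h.psi_edge z ((e.low hl).edge (e.type + 2))
  rw [face_type] at this
  have e1 : ((e.low hl).edge (e.type + 2)).start =
      e.start + (eps e.type - eps (e.type + 2)) := by
    simp [HiveEdge.low]; abel
  have e2 : ((e.low hl).edge (e.type + 2)).finish = e.start := by
    rw [HiveEdge.finish, e1]; simp; abel
  rwa [e1, e2] at this

/-- The short diagonal of a rhombus. -/
theorem exists_diagonal {b x y : Pt} {i : Fin 3} (hA : AcuteAt i x y) (ha : b ∈ hiveVertices n d)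
    (hb : b + x + y ∈ hiveVertices n d) : ∃ e : HiveEdge n d, e.type = i + 1 ∧ e.start = b + x ∧
      e.finish = b + y ∧ ¬ e.OnShortSide ∧ ¬ e.OnLongSide := by
  have h1 := (mem_hive i).1 ha
  have h2 := (mem_hive i).1 hb
  rcases hA with ⟨rfl, rfl⟩ | ⟨rfl, rfl⟩ <;> simp [eps_apply] at h2 <;>
    refine ⟨⟨_, i + 1, (mem_hive i).2 ?_, (mem_hive i).2 ?_⟩, rfl, rfl, ?_, ?_, ?_⟩ <;>
    simp [eps_apply, HiveEdge.OnShortSide, HiveEdge.OnLongSide, HiveEdge.finish] <;>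
    first | omega | abel

theorem psi_rhombus (h : Hive C L a) (z : ℂ) {x y : Pt} (hA : Acute x y) {b : Pt}
    (ha : b ∈ hiveVertices n d) (hb : b + x + y ∈ hiveVertices n d) :
    hivePsi L z b + hivePsi L z (b + x + y) ≤ hivePsi L z (b + x) + hivePsi L z (b + y) ∧
    (hivePsi L z b + hivePsi L z (b + x + y) = hivePsi L z (b + x) + hivePsi L z (b + y) →
      MEdge C (b + x) (b + y)) := by
  obtain ⟨i, hA⟩ := hA
  wlog hA' : AcuteAt i x y generalizing x y
  · rw [add_right_comm] at hb ⊢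
    have := this hb hA.symm (hA.resolve_left hA')
    rw [add_comm (hivePsi L z (b + x))]
    exact ⟨this.1, fun h => (this.2 h).symm⟩
  obtain ⟨e, ht, hst, hsp, hs, hl⟩ := exists_diagonal hA' ha hb
  have h1 := h.psi_up z e hs
  have h2 := h.psi_low z e hl
  have h3 : hivePsi L z b + hivePsi L z (b + x + y) =
      hivePsi L z (e.start + (eps (e.type + 2) - eps (e.type + 1))) +
        hivePsi L z (e.start + (eps e.type - eps (e.type + 2))) := by
    rw [hst, ht, idx_one_one, idx_one_two]
    rcases hA' with ⟨rfl, rfl⟩ | ⟨rfl, rfl⟩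
    · rw [add_comm]; congr 2 <;> abel
    · congr 2; abel
  rw [h3, ← hst, ← hsp]
  have hne := h.lt_of_ne_m e hs hl
  have he := h.eq_of_m e hs hl
  constructor
  · by_cases hm : C e = .m
    · linarith [he hm]
    · linarith [hne hm]
  · intro heq
    have hm : C e = .m := by
      by_contra hm
      linarith [hne hm]
    exact fun e' h' => edge_eq_of_ends (h'.imp And.left And.left) (h'.symm.imp And.right And.right)
        ▸ hm

theorem not_two_m (h : Hive C L a) (f : HiveFace n d) {k l : Fin 3} (hkl : k ≠ l) :
    ¬ (C (f.edge k) = .m ∧ C (f.edge l) = .m) := by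
  rintro ⟨h1, h2⟩
  have := m_face h.colorMap h1
  rcases idx_cases k l with rfl | rfl | rfl <;> simp_all

theorem not_two_acute (h : Hive C L a) {v x y : Pt} (hA : Acute x y) (hv : v ∈ hiveVertices n d)
    (hx : v + x ∈ hiveVertices n d) (hy : v + y ∈ hiveVertices n d) (h1 : MEdge C v (v + x)) :
    ¬ MEdge C v (v + y) := by
  intro h2
  obtain ⟨i, hA⟩ := hA
  wlog hA' : AcuteAt i x y generalizing x y
  · exact this hy hx h2 h1 hA.symm (hA.resolve_left hA')
  obtain ⟨f, h3, h4⟩ : ∃ f : HiveFace n d, f.vertex i = v ∧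
      (f.vertex (i + 1) = v + x ∧ f.vertex (i + 2) = v + y ∨
        f.vertex (i + 1) = v + y ∧ f.vertex (i + 2) = v + x) := by
    rcases hA' with ⟨rfl, rfl⟩ | ⟨rfl, rfl⟩
    · refine ⟨.lower (v + eps i) ((forall_idx i).2 ⟨?_, ?_, ?_⟩), ?_⟩ <;>
        simp_all [HiveFace.vertex, add_sub_assoc]
    · have e : ∀ w, v - eps i + w = v + (w - eps i) := fun w => by abel
      refine ⟨.upper (v - eps i) ((forall_idx i).2 ⟨?_, ?_, ?_⟩), ?_⟩ <;>
        simp_all [HiveFace.vertex]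
  refine h.not_two_m f (k := i) (l := i + 2) (by simp) ⟨MEdge.color ?_, MEdge.color ?_⟩ <;>
    rcases h4 with ⟨h4, h5⟩ | ⟨h4, h5⟩ <;> simp [h3, h4, h5, h1, h2, h1.symm, h2.symm]

/-- Strict concavity on lines: three consecutive points of a line are the middle of the long side
and the ends of the long side of a trapezoid made of two rhombi, which cannot both be flat. -/
theorem psi_line (h : Hive C L a) (z : ℂ) {x y : Pt} (hA : Acute x y) {b : Pt}
    (ha : b ∈ hiveVertices n d) (hb : b + x + x ∈ hiveVertices n d) :
    hivePsi L z b + hivePsi L z (b + x + x) < 2 * hivePsi L z (b + x) := by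
  wlog hy : b + y ∈ hiveVertices n d ∧ b + x + y ∈ hiveVertices n d generalizing y
  · refine this hA.sub ?_
    have hn := h.pos_n
    obtain ⟨i, (⟨rfl, rfl⟩ | ⟨rfl, rfl⟩) | ⟨rfl, rfl⟩ | ⟨rfl, rfl⟩⟩ := hA <;>
      simp only [mem_hive i] at * <;> simp [eps_apply] at * <;> omega
  have e1 : b + y + x = b + x + y := by abel
  have e2 : b + y + (x - y) = b + x := by abel
  have e3 : b + y + x + (x - y) = b + x + x := by abel
  have e4 : b + x + -(x - y) = b + y := by abel
  have r1 := h.psi_rhombus z hA ha hy.2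
  have r2 := h.psi_rhombus z hA.sub hy.1 (e3 ▸ hb)
  rw [e3, e1, e2] at r2
  refine lt_of_le_of_ne (by linarith [r1.1, r2.1]) fun heq => ?_
  have f1 := r1.2 (by linarith [r1.1, r2.1])
  have f2 := (r2.2 (by linarith [r1.1, r2.1])).symm
  have hA' : Acute (-(x - y)) y := by simpa using hA.symm.sub.symm
  rw [← e4] at f1
  exact h.not_two_acute hA' (hA.mem ha hy.2) (e4 ▸ hy.1) hy.2 f1 f2

theorem strictHive (h : Hive C L a) (z : ℂ) : StrictHive n d (hivePsi L z) (MEdge C) where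
  rhombus hA _ ha hb := (h.psi_rhombus z hA ha hb).1
  flat hA _ ha hb := (h.psi_rhombus z hA ha hb).2
  line hA _ ha hb := h.psi_line z hA ha hb

end Hive

end

section

variable {n d : ℕ}
variable {C : HiveEdge n d → HiveColor} {L : HiveEdge n d → ℝ} {a : Fin 3 → Fin n → ℝ}

/-! ### The points attached to faces and outer edges -/

/-- The position of `z` relative to the two ends of the segment dual to `e`: for `C e ≠ m` this says
that `z` lies on this segment. -/
def OnEdge (L : HiveEdge n d → ℝ) (e : HiveEdge n d) (z : ℂ) : Prop :=
  coord z e.type = L e ∧ coord (dualPoint L e.minus) (e.type + 2) ≤ coord z (e.type + 2) ∧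
    coord z (e.type + 2) ≤ coord (dualPoint L e.plus) (e.type + 2)

theorem plus_of_not_short {e : HiveEdge n d} (hs : ¬ e.OnShortSide) : e.plus = .face (e.up hs) := by
  rw [HiveEdge.plus, dif_neg hs]

theorem minus_of_not_long {e : HiveEdge n d} (hl : ¬ e.OnLongSide) :
    e.minus = .face (e.low hl) := by
  rw [HiveEdge.minus, dif_neg hl]

theorem plus_of_short {e : HiveEdge n d} (hs : e.OnShortSide) : e.plus = .outer e (.inr hs) := by
  rw [HiveEdge.plus, dif_pos hs]

theorem minus_of_long {e : HiveEdge n d} (hl : e.OnLongSide) : e.minus = .outer e (.inl hl) := by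
  rw [HiveEdge.minus, dif_pos hl]

theorem not_long_of_short (hn : 0 < n) {e : HiveEdge n d} (h : e.OnShortSide) :
    ¬ e.OnLongSide := by
  intro h'
  simp only [HiveEdge.OnShortSide, HiveEdge.OnLongSide] at h h'
  omega

theorem outerSide_long {e : HiveEdge n d} (h : e.OnLongSide) : e.outerSide = e.type + 2 := by
  rw [HiveEdge.outerSide, if_pos h]

theorem outerSide_short {e : HiveEdge n d} (h : ¬ e.OnLongSide) : e.outerSide = e.type + 1 := by
  rw [HiveEdge.outerSide, if_neg h]

namespace Hive

theorem face_coord (h : Hive C L a) (f : HiveFace n d) (l : Fin 3) :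
    coord (dualPoint L (.face f)) l = L (f.edge l) := by
  rw [dualPoint, coord_ofCoord]
  have := h.sum f 0
  simpa using this

theorem outer_coord (L : HiveEdge n d → ℝ) (e : HiveEdge n d) (he : e.IsOuter) :
    coord (dualPoint L (.outer e he)) e.type = L e ∧
    coord (dualPoint L (.outer e he)) e.outerSide = 0 := by
  have hne : e.type ≠ e.outerSide := by
    unfold HiveEdge.outerSide
    split_ifs <;> simp
  rw [dualPoint, coord_ofCoord]
  · simp [hne.symm]
  · rw [← sum_rot e.type fun l =>
      if l = e.type then L e else if l = e.outerSide then 0 else 1 - L e]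
    by_cases hl : e.OnLongSide
    · rw [outerSide_long hl]; simp
    · rw [outerSide_short hl]; simp

theorem long_coord (e : HiveEdge n d) (hl : e.OnLongSide) :
    coord (dualPoint L e.minus) (e.type + 2) = 0 := by
  rw [minus_of_long hl, ← outerSide_long hl]
  exact (outer_coord L e _).2

theorem short_coord (h : Hive C L a) (e : HiveEdge n d) (hs : e.OnShortSide) :
    coord (dualPoint L e.plus) (e.type + 1) = 0 := by
  rw [plus_of_short hs, ← outerSide_short (not_long_of_short h.pos_n hs)]
  exact (outer_coord L e _).2

theorem plus_coord (h : Hive C L a) (e : HiveEdge n d) :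
    coord (dualPoint L e.plus) e.type = L e := by
  by_cases hs : e.OnShortSide
  · rw [plus_of_short hs]; exact (outer_coord L e _).1
  · rw [plus_of_not_short hs, h.face_coord, up_edge]

theorem minus_coord (h : Hive C L a) (e : HiveEdge n d) :
    coord (dualPoint L e.minus) e.type = L e := by
  by_cases hs : e.OnLongSide
  · rw [minus_of_long hs]; exact (outer_coord L e _).1
  · rw [minus_of_not_long hs, h.face_coord, low_edge]

theorem plus_coord_two (h : Hive C L a) (e : HiveEdge n d) (hs : ¬ e.OnShortSide) :
    coord (dualPoint L e.plus) (e.type + 2) = L ((e.up hs).edge (e.type + 2)) := by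
  rw [plus_of_not_short hs, h.face_coord]

theorem minus_coord_two (h : Hive C L a) (e : HiveEdge n d) (hl : ¬ e.OnLongSide) :
    coord (dualPoint L e.minus) (e.type + 2) = L ((e.low hl).edge (e.type + 2)) := by
  rw [minus_of_not_long hl, h.face_coord]

theorem lt_one (h : Hive C L a) (e : HiveEdge n d) : L e < 1 := by
  have key : ∀ f : HiveFace n d, f.edge e.type = e → L e < 1 := by
    intro f hf
    have h1 := h.sum f e.type
    have h2 := h.pos (f.edge (e.type + 1))
    have h3 := h.pos (f.edge (e.type + 2))
    rw [hf] at h1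
    linarith
  by_cases hs : e.OnShortSide
  · exact key _ (low_edge e (not_long_of_short h.pos_n hs))
  · exact key _ (up_edge e hs)

theorem outer_not_m (h : Hive C L a) : NoOuterM C := by
  rintro e (he | he) hm
  · rw [(h.long_side e he).1] at hm; cases hm
  · rw [(h.short_side e he).1] at hm; cases hm

/-- The segment dual to an edge which is not coloured `m` has the type of the edge, and leads from
the lower to the upper side. -/
theorem arrow_edge (h : Hive C L a) {e : HiveEdge n d} (hm : C e ≠ .m) :
    Arrow e.type (dualPoint L e.minus) (dualPoint L e.plus) := by
  refine ⟨by rw [h.plus_coord, h.minus_coord], ?_⟩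
  by_cases hl : e.OnLongSide
  · have hs : ¬ e.OnShortSide := fun hs => not_long_of_short h.pos_n hs hl
    rw [long_coord e hl, h.plus_coord_two e hs]
    exact h.pos _
  · rw [h.minus_coord_two e hl]
    by_cases hs : e.OnShortSide
    · have h1 := coord_sum e.type (dualPoint L e.plus)
      rw [h.short_coord e hs, h.plus_coord] at h1
      have h2 := h.sum (e.low hl) e.type
      rw [low_edge] at h2
      have := h.pos ((e.low hl).edge (e.type + 1))
      linarith
    · rw [h.plus_coord_two e hs]
      exact h.lt_of_ne_m e hs hl hm

theorem dual_eq_of_m (h : Hive C L a) {e : HiveEdge n d} (hm : C e = .m) :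
    dualPoint L e.minus = dualPoint L e.plus := by
  have hs : ¬ e.OnShortSide := fun hs => h.outer_not_m e (.inr hs) hm
  have hl : ¬ e.OnLongSide := fun hs => h.outer_not_m e (.inl hs) hm
  refine coord_ext e.type ?_ ?_
  · rw [h.plus_coord, h.minus_coord]
  · rw [h.plus_coord_two e hs, h.minus_coord_two e hl, h.eq_of_m e hs hl hm]

theorem minus_le_plus (h : Hive C L a) (e : HiveEdge n d) :
    coord (dualPoint L e.minus) (e.type + 2) ≤ coord (dualPoint L e.plus) (e.type + 2) := by
  by_cases hm : C e = .m
  · rw [h.dual_eq_of_m hm]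
  · exact (h.arrow_edge hm).2.le

theorem onEdge_plus (h : Hive C L a) (e : HiveEdge n d) : OnEdge L e (dualPoint L e.plus) :=
  ⟨h.plus_coord e, h.minus_le_plus e, le_rfl⟩

theorem onEdge_minus (h : Hive C L a) (e : HiveEdge n d) : OnEdge L e (dualPoint L e.minus) :=
  ⟨h.minus_coord e, le_rfl, h.minus_le_plus e⟩

theorem onEdge_of_incident (h : Hive C L a) {e : HiveEdge n d} {x : DualVertex n d}
    (hx : x.Incident e) : OnEdge L e (dualPoint L x) := by
  rcases incident_iff.1 hx with rfl | rfl
  · exact h.onEdge_plus e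
  · exact h.onEdge_minus e

theorem face_pos (h : Hive C L a) (f : HiveFace n d) (l : Fin 3) :
    0 < coord (dualPoint L (.face f)) l := by
  rw [h.face_coord]; exact h.pos _

/-- The only coordinate of the point of an outer edge which vanishes is that of its side. -/
theorem outer_coord_pos (h : Hive C L a) (e : HiveEdge n d) (he : e.IsOuter) {l : Fin 3}
    (hl : l ≠ e.outerSide) : 0 < coord (dualPoint L (.outer e he)) l := by
  obtain ⟨h1, h2⟩ := outer_coord L e he
  have h3 := coord_sum e.type (dualPoint L (.outer e he))
  have h4 := h.pos e
  have h5 := h.lt_one e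
  rcases idx_cases e.type l with h6 | h6 | h6
  · rw [h6, h1]; exact h4
  · rw [h6] at hl ⊢
    have : e.outerSide = e.type + 2 := by
      by_cases hlo : e.OnLongSide
      · exact outerSide_long hlo
      · exact absurd (outerSide_short hlo).symm hl
    rw [this] at h2
    linarith
  · rw [h6] at hl ⊢
    have : e.outerSide = e.type + 1 := by
      by_cases hlo : e.OnLongSide
      · exact absurd (outerSide_long hlo).symm hl
      · exact outerSide_short hlo
    rw [this] at h2
    linarith

theorem dual_mem (h : Hive C L a) (x : DualVertex n d) : dualPoint L x ∈ triangle := by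
  rw [mem_triangle]
  intro i
  cases x with
  | face f => exact (h.face_pos f i).le
  | outer e he =>
    by_cases hi : i = e.outerSide
    · rw [hi, (outer_coord L e he).2]
    · exact (h.outer_coord_pos e he hi).le

theorem _root_.HoneyHive.HiveEdge.finish_eq (e : HiveEdge n d) :
    e.finish = e.start + (eps e.type - eps (e.type + 1)) := by rw [HiveEdge.finish]; abel

theorem _root_.HoneyHive.HiveEdge.long_iff (e : HiveEdge n d) :
    ¬ e.OnLongSide ↔ e.start + (eps e.type - eps (e.type + 2)) ∈ hiveVertices n d := by
  constructor
  · intro hl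
    simpa [add_sub_assoc] using e.low_mem hl (e.type + 2)
  · intro hm hl
    have := (hm.1 (e.type + 2)).1
    simp [eps_apply] at this
    simp only [HiveEdge.OnLongSide] at hl
    omega

theorem _root_.HoneyHive.HiveEdge.short_iff (e : HiveEdge n d) :
    ¬ e.OnShortSide ↔ e.start + (eps (e.type + 2) - eps (e.type + 1)) ∈ hiveVertices n d := by
  constructor
  · intro hs
    convert e.up_mem hs (e.type + 2) using 1
    abel
  · intro hm hl
    have := (hm.1 (e.type + 2)).2
    simp [eps_apply] at this
    simp only [HiveEdge.OnShortSide] at hl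
    omega

/-- A point of the triangle lies on the segment dual to an edge exactly if the concave function
attached to the point is maximal at both ends of the edge. -/
theorem onEdge_iff (h : Hive C L a) {e : HiveEdge n d} {z : ℂ} (hz : z ∈ triangle) :
    OnEdge L e z ↔ e.start ∈ maxSet n d (hivePsi L z) ∧ e.finish ∈ maxSet n d (hivePsi L z) := by
  have hz' := mem_triangle.1 hz
  have hp := h.psi_edge z e
  constructor
  · rintro ⟨h1, h2, h3⟩
    have h4 : hivePsi L z e.finish = hivePsi L z e.start := by linarith
    have h5 : e.start ∈ maxSet n d (hivePsi L z) := by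
      refine (h.strictHive z).edge_max (acute_eps e.type) e.start_mem (e.finish_eq ▸ e.finish_mem)
        (by rw [← e.finish_eq, h4]) (fun hm => ?_) fun hm => ?_
      · have hl := e.long_iff.2 hm
        have := h.psi_low z e hl
        rw [h.minus_coord_two e hl] at h2
        linarith
      · rw [sub_sub_sub_cancel_left] at hm ⊢
        have hs := e.short_iff.2 hm
        have := h.psi_up z e hs
        rw [h.plus_coord_two e hs] at h3
        linarith
    exact ⟨h5, mem_maxSet_of_eq h5 e.finish_mem h4.ge⟩
  · rintro ⟨h1, h2⟩
    have h3 := maxSet_eq h1 h2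
    have hk : coord z e.type = L e := by linarith
    refine ⟨hk, ?_, ?_⟩
    · by_cases hl : e.OnLongSide
      · rw [long_coord e hl]; exact hz' _
      · rw [h.minus_coord_two e hl]
        linarith [h.psi_low z e hl, h1.2 _ (e.long_iff.1 hl)]
    · by_cases hs : e.OnShortSide
      · have h4 := coord_sum e.type (dualPoint L e.plus)
        rw [h.short_coord e hs, h.plus_coord] at h4
        linarith [coord_sum e.type z, hz' (e.type + 1)]
      · rw [h.plus_coord_two e hs]
        linarith [h.psi_up z e hs, h2.2 _ (e.short_iff.1 hs)]

theorem eq_face_of_vertices (h : Hive C L a) {f : HiveFace n d} {z : ℂ}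
    (hf : ∀ l, f.vertex l ∈ maxSet n d (hivePsi L z)) : z = dualPoint L (.face f) := by
  refine coord_injective (funext fun l => ?_)
  have h1 := h.psi_edge z (f.edge l)
  have h2 := maxSet_eq (hf l) (hf (l + 1))
  rw [face_type] at h1
  rw [h.face_coord]
  rcases f.edge_ends l with ⟨h3, h4⟩ | ⟨h3, h4⟩ <;> rw [h3, h4] at h1 <;> linarith

theorem vertices_mem (h : Hive C L a) (f : HiveFace n d) (l : Fin 3) :
    f.vertex l ∈ maxSet n d (hivePsi L (dualPoint L (.face f))) := by
  have h1 := (h.onEdge_iff (e := f.edge l) (h.dual_mem (.face f))).1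
    (h.onEdge_of_incident ⟨l, rfl⟩)
  rcases f.edge_ends l with ⟨h3, h4⟩ | ⟨h3, h4⟩ <;> rw [h3, h4] at h1
  exacts [h1.1, h1.2]

/-- If a point lies on the segments dual to two edges, it is the point of a face, for each of these
edges. -/
theorem exists_face_of_two (h : Hive C L a) {e e' : HiveEdge n d} {z : ℂ} (hz : z ∈ triangle)
    (he : OnEdge L e z) (he' : OnEdge L e' z) (hne : e ≠ e') :
    ∃ f : HiveFace n d, f.edge e.type = e ∧ z = dualPoint L (.face f) := by
  obtain ⟨h1, h2⟩ := (h.onEdge_iff hz).1 he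
  obtain ⟨h1', h2'⟩ := (h.onEdge_iff hz).1 he'
  obtain ⟨t, ht, ht1, ht2⟩ : ∃ t ∈ maxSet n d (hivePsi L z), t ≠ e.start ∧ t ≠ e.finish := by
    by_contra! hcon
    exact hne (edge_eq_of_ends (or_iff_not_imp_left.2 (hcon _ h1'))
      (or_iff_not_imp_left.2 (hcon _ h2'))).symm
  rw [e.finish_eq] at h2 ht2
  rcases (h.strictHive z).third_vertex (acute_eps e.type) h1 h2 ht ht1 ht2 with h3 | h3
  · have hl := e.long_iff.2 h3.1
    refine ⟨e.low hl, low_edge e hl, h.eq_face_of_vertices ((forall_idx e.type).2 ⟨?_, ?_, ?_⟩)⟩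
    · simpa [HiveEdge.low, HiveFace.vertex] using h1
    · simpa [HiveEdge.low, HiveFace.vertex, add_sub_assoc] using h2
    · simpa [HiveEdge.low, HiveFace.vertex, add_sub_assoc] using h3
  · rw [sub_sub_sub_cancel_left] at h3
    have hs := e.short_iff.2 h3.1
    refine ⟨e.up hs, up_edge e hs, h.eq_face_of_vertices ((forall_idx e.type).2 ⟨?_, ?_, ?_⟩)⟩
    · convert h2 using 1; simp only [HiveEdge.up, HiveFace.vertex]; abel
    · convert h1 using 1; simp only [HiveEdge.up, HiveFace.vertex]; abel
    · convert h3 using 1; simp only [HiveEdge.up, HiveFace.vertex]; abel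

theorem edge_of_vertices {f : HiveFace n d} {e : HiveEdge n d} (h1 : ∃ k, e.start = f.vertex k)
    (h2 : ∃ l, e.finish = f.vertex l) : f.edge e.type = e := by
  obtain ⟨⟨k, h1⟩, l, h2⟩ := And.intro h1 h2
  have key : ∀ t k l : Fin 3, eps t - eps (t + 1) = eps l - eps k → l = t ∧ k = t + 1 := by decide
  have h3 := e.finish_eq
  rw [← sub_eq_iff_eq_add', h1, h2] at h3
  rcases f with ⟨u, hu⟩ | ⟨w, hw⟩
  · simp only [HiveFace.vertex, add_sub_add_left_eq_sub] at h1 h3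
    exact HiveEdge.ext (by rw [h1, (key _ _ _ h3.symm).2]; rfl) rfl
  · simp only [HiveFace.vertex, sub_sub_sub_cancel_left] at h1 h3
    exact HiveEdge.ext (by rw [h1, (key _ _ _ h3.symm).1]; rfl) rfl

/-- The other face of the lozenge around the side `f.edge k` of a face `f`. -/
theorem exists_other_face (h : Hive C L a) {f : HiveFace n d} {k : Fin 3}
    (hk : C (f.edge k) = .m) : ∃ g : HiveFace n d, f ≠ g ∧ g.edge k = f.edge k ∧
      ∀ p, p = f.vertex k ∨ p = f.vertex (k + 1) ∨
        p = f.vertex k + f.vertex (k + 1) - f.vertex (k + 2) → ∃ j, p = g.vertex j := by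
  rcases f with ⟨u, hu⟩ | ⟨w, hw⟩
  · have hl : ¬ ((HiveFace.upper u hu : HiveFace n d).edge k).OnLongSide :=
      fun hl => h.outer_not_m _ (.inl hl) hk
    refine ⟨HiveEdge.low _ hl, by simp [HiveEdge.low], low_edge _ hl, ?_⟩
    rintro p (rfl | rfl | rfl)
    exacts [⟨k + 1, by simp [HiveEdge.low, HiveFace.vertex]; abel⟩,
      ⟨k, by simp [HiveEdge.low, HiveFace.vertex]⟩,
      ⟨k + 2, by simp [HiveEdge.low, HiveFace.vertex]; abel⟩]
  · have hl : ¬ ((HiveFace.lower w hw : HiveFace n d).edge k).OnShortSide :=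
      fun hl => h.outer_not_m _ (.inr hl) hk
    refine ⟨HiveEdge.up _ hl, by simp [HiveEdge.up], up_edge _ hl, ?_⟩
    rintro p (rfl | rfl | rfl)
    exacts [⟨k + 1, by simp [HiveEdge.up, HiveFace.vertex]⟩,
      ⟨k, by simp [HiveEdge.up, HiveFace.vertex]; abel⟩,
      ⟨k + 2, by simp [HiveEdge.up, HiveFace.vertex]; abel⟩]

/-- The edges whose dual segments contain the point of a face: those of the face, and those of the
other face of its lozenge. -/
theorem edges_at_face (h : Hive C L a) {f : HiveFace n d} {e : HiveEdge n d}
    (he : OnEdge L e (dualPoint L (.face f))) : f.edge e.type = e ∨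
      ∃ (k : Fin 3) (g : HiveFace n d), C (f.edge k) = .m ∧ f ≠ g ∧ g.edge k = f.edge k ∧
        g.edge e.type = e := by
  obtain ⟨h1, h2⟩ := (h.onEdge_iff (h.dual_mem _)).1 he
  have hv := h.vertices_mem f
  obtain ⟨u, s, hs, hu⟩ := f.exists_sign
  have cls : ∀ t ∈ maxSet n d (hivePsi L (dualPoint L (.face f))), (∃ l, t = f.vertex l) ∨
      ∃ k, t = f.vertex k + f.vertex (k + 1) - f.vertex (k + 2) ∧ C (f.edge k) = .m := by
    intro t ht
    simp only [hu] at hv ⊢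
    refine ((h.strictHive _).maxSet_face hs hv ht).imp_right
      (Exists.imp fun k hk => ⟨by rw [hk.1]; abel, MEdge.color ?_⟩)
    simpa only [hu] using hk.2
  -- the vertex of the face opposite to the shared side is not joined to its reflection
  have far : ∀ q t : Fin 3, eps t - eps (t + 1) ≠ s • (eps q + eps (q + 1) - 2 • eps (q + 2)) ∧
      eps t - eps (t + 1) ≠ -(s • (eps q + eps (q + 1) - 2 • eps (q + 2))) := by
    rcases hs with rfl | rfl <;> decide
  have mix : ∀ v w q, (∃ l, v = f.vertex l) → w = f.vertex q + f.vertex (q + 1) - f.vertex (q + 2) →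
      C (f.edge q) = .m → (w = v + (eps e.type - eps (e.type + 1)) ∨
        v = w + (eps e.type - eps (e.type + 1))) →
      ∃ (k : Fin 3) (g : HiveFace n d), C (f.edge k) = .m ∧ f ≠ g ∧ g.edge k = f.edge k ∧
        (∃ j, v = g.vertex j) ∧ ∃ j, w = g.vertex j := by
    rintro v w q ⟨p, rfl⟩ hw hm hvw
    obtain ⟨g, g1, g2, g3⟩ := h.exists_other_face hm
    refine ⟨q, g, hm, g1, g2, g3 _ ?_, g3 _ (.inr (.inr hw))⟩
    rcases idx_cases q p with rfl | rfl | rfl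
    · exact .inl rfl
    · exact .inr (.inl rfl)
    · exfalso
      rw [← sub_eq_iff_eq_add', ← sub_eq_iff_eq_add', hw] at hvw
      rcases hvw with h3 | h3
      · refine (far q e.type).1 (h3.symm.trans ?_)
        simp only [hu]; module
      · refine (far q e.type).2 (h3.symm.trans ?_)
        simp only [hu]; module
  rcases cls _ h1 with hp | ⟨p, hp, hm⟩ <;> rcases cls _ h2 with hq | ⟨q, hq, hm'⟩
  · exact .inl (edge_of_vertices hp hq)
  · obtain ⟨k, g, g1, g2, g3, g4, g5⟩ := mix _ _ q hp hq hm' (.inl e.finish_eq)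
    exact .inr ⟨k, g, g1, g2, g3, edge_of_vertices g4 g5⟩
  · obtain ⟨k, g, g1, g2, g3, g4, g5⟩ := mix _ _ p hq hp hm (.inr e.finish_eq)
    exact .inr ⟨k, g, g1, g2, g3, edge_of_vertices g5 g4⟩
  · obtain rfl : p = q := by
      by_contra hne
      exact h.not_two_m f hne ⟨hm, hm'⟩
    have h3 := e.finish_eq
    have h0 : ∀ k : Fin 3, eps k - eps (k + 1) ≠ 0 := by decide
    rw [hp, hq, left_eq_add] at h3
    exact absurd h3 (h0 _)

theorem face_ne_outer (h : Hive C L a) (f : HiveFace n d) (e : HiveEdge n d) (he : e.IsOuter) :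
    dualPoint L (.face f) ≠ dualPoint L (.outer e he) := by
  intro hf
  have h1 := h.face_pos f e.outerSide
  rw [hf, (outer_coord L e he).2] at h1
  exact lt_irrefl _ h1

theorem edges_at_reduced (h : Hive C L a) {x : DualVertex n d} {e : HiveEdge n d}
    (hx : InReduced C x) (he : OnEdge L e (dualPoint L x)) : x.Incident e := by
  cases x with
  | face f =>
    rcases h.edges_at_face he with h1 | ⟨k, g, h1, -⟩
    · exact ⟨_, h1⟩
    · exact absurd h1 (hx k)
  | outer e' he' =>
    by_contra hne
    obtain ⟨f, -, hf⟩ := h.exists_face_of_two (h.dual_mem _)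
      (h.onEdge_of_incident (x := .outer e' he') rfl) he hne
    exact h.face_ne_outer _ _ _ hf.symm

/-- Different vertices of the reduced graph have different points. -/
theorem dual_injective (h : Hive C L a) {x y : DualVertex n d} (hx : InReduced C x)
    (hy : InReduced C y) (hxy : dualPoint L x = dualPoint L y) : x = y := by
  rcases x with f | ⟨e, he⟩ <;> rcases y with g | ⟨e', he'⟩
  · have key : ∀ l, f.edge l = g.edge l := by
      intro l
      obtain ⟨k, hk⟩ := h.edges_at_reduced hx
        (hxy ▸ h.onEdge_of_incident (x := .face g) (e := g.edge l) ⟨l, rfl⟩)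
      have := congrArg HiveEdge.type hk
      simp only [face_type] at this
      rwa [this] at hk
    rw [face_eq_of_edges (key 0) (key 1)]
  · exact absurd hxy (h.face_ne_outer _ _ _)
  · exact absurd hxy.symm (h.face_ne_outer _ _ _)
  · cases h.edges_at_reduced hy (hxy ▸ h.onEdge_of_incident (x := .outer e he) rfl)
    rfl

end Hive

end

section

variable {n d : ℕ}
variable {C : HiveEdge n d → HiveColor} {L : HiveEdge n d → ℝ} {a : Fin 3 → Fin n → ℝ}
variable {c : SegColor}

/-! ### The segments of maximal runs -/

theorem Arrow.trans {l : Fin 3} {v w x : ℂ} (h : Arrow l v w) (h' : Arrow l w x) : Arrow l v x :=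
  ⟨h.1.trans h'.1, h.2.trans h'.2⟩

theorem Arrow.segment_union {l : Fin 3} {v w x : ℂ} (h : Arrow l v w) (h' : Arrow l w x) :
    segment ℝ w x ∪ segment ℝ v w = segment ℝ v x := by
  ext z
  rw [Set.mem_union, h.mem_segment, h'.mem_segment, (h.trans h').mem_segment]
  have := h.1
  have := h.2
  have := h'.2
  constructor
  · rintro (⟨h1, h2, h3⟩ | ⟨h1, h2, h3⟩)
    · exact ⟨by rw [h1, h.1], by linarith, h3⟩
    · exact ⟨h1, h2, by linarith⟩
  · rintro ⟨h1, h2, h3⟩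
    rcases le_total (coord z (l + 2)) (coord w (l + 2)) with h4 | h4
    · exact .inr ⟨h1, h2, h4⟩
    · exact .inl ⟨by rw [h1, h.1], h4, h3⟩

/-- The colour of a run, and the uniqueness of the maximal run through an edge. -/
theorem MaxRun.unique (hC : IsColorMap C) {c' : SegColor} {e e' f f' g : HiveEdge n d}
    (h : MaxRun C c e e') (h' : MaxRun C c' f f') (h1 : Run C c e g) (h2 : Run C c g e')
    (h1' : Run C c' f g) (h2' : Run C c' g f') : c = c' ∧ e = f ∧ e' = f' := by
  have e1 := h1.color h.color
  have e2 := h1'.color h'.color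
  have : c = c' := by rw [e1] at e2; injection e2
  subst this
  exact ⟨rfl, h1.unique_plus hC h1' h.plus h'.plus, h2.unique_minus hC h2' h.minus h'.minus⟩

theorem MaxRun.color' {e e' : HiveEdge n d} (h : MaxRun C c e e') : C e' = .seg c :=
  h.run.color h.color

namespace Hive

theorem step_dual (h : Hive C L a) {e e' : HiveEdge n d} (hs : RunStep C c e e') :
    dualPoint L e.minus = dualPoint L e'.plus ∧ L e' = L e := by
  have ht := (hs.coords h.colorMap).1
  obtain ⟨μ, h1, h2, h3, h4, h5⟩ := hs
  have := h.dual_eq_of_m h3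
  rw [h4, h5] at this
  refine ⟨this, ?_⟩
  rw [← h.minus_coord e, this, ← ht, h.plus_coord]

theorem ne_m_of_seg {e : HiveEdge n d} (he : C e = .seg c) : C e ≠ .m := by rw [he]; simp

theorem run_label (h : Hive C L a) {e e' : HiveEdge n d} (hr : Run C c e e') : L e' = L e := by
  induction hr with
  | refl => rfl
  | tail _ h1 ih => rw [(h.step_dual h1).2, ih]

/-- The segment of a run is the union of the segments dual to its edges. -/
theorem run_arrow (h : Hive C L a) {e e' : HiveEdge n d} (hr : Run C c e e') (he : C e = .seg c) :
    Arrow e.type (dualPoint L e'.minus) (dualPoint L e.plus) ∧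
    ∀ z ∈ segment ℝ (dualPoint L e'.minus) (dualPoint L e.plus),
      ∃ e₁, Run C c e e₁ ∧ Run C c e₁ e' ∧ OnEdge L e₁ z := by
  induction hr using Relation.ReflTransGen.head_induction_on with
  | refl =>
    have ha := h.arrow_edge (ne_m_of_seg he)
    refine ⟨ha, fun z hz => ⟨e', .refl, .refl, ?_⟩⟩
    rw [ha.mem_segment, h.minus_coord] at hz
    exact hz
  | @head e b h1 h2 ih =>
    have hb : C b = .seg c := by obtain ⟨μ, h1⟩ := h1; exact h1.2.1
    obtain ⟨ih1, ih2⟩ := ih hb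
    obtain ⟨e1, e2⟩ := h.step_dual h1
    have ha := h.arrow_edge (ne_m_of_seg he)
    rw [(h1.coords h.colorMap).1, ← e1] at ih1
    rw [← e1] at ih2
    refine ⟨ih1.trans ha, fun z hz => ?_⟩
    rw [← ih1.segment_union ha] at hz
    rcases hz with hz | hz
    · rw [ha.mem_segment, h.minus_coord] at hz
      exact ⟨e, .refl, .head h1 h2, hz⟩
    · obtain ⟨e₁, h3, h4, h5⟩ := ih2 z hz
      exact ⟨e₁, .head h1 h3, h4, h5⟩

theorem dualSegment_eq (h : Hive C L a) (e : HiveEdge n d) :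
    dualSegment L e = segment ℝ (dualPoint L e.minus) (dualPoint L e.plus) := by
  ext z
  constructor
  · rintro ⟨v, v', hj, hz⟩
    rcases (joins_iff h.pos_n).1 hj with ⟨rfl, rfl⟩ | ⟨rfl, rfl⟩
    · rwa [segment_symm]
    · exact hz
  · intro hz
    exact ⟨e.minus, e.plus, (joins_iff h.pos_n).2 (.inr ⟨rfl, rfl⟩), hz⟩

theorem chain_union (h : Hive C L a) {x y : DualVertex n d} {es : List (HiveEdge n d)}
    (hc : IsChain C c x es y) : ∃ e e', C e = .seg c ∧ Run C c e e' ∧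
      (⋃ f ∈ es, dualSegment L f) = segment ℝ (dualPoint L e'.minus) (dualPoint L e.plus) ∧
      ((x = e.plus ∧ y = e'.minus) ∨ (x = e'.minus ∧ y = e.plus)) := by
  have two : ∀ (e μ : HiveEdge n d) (es : List (HiveEdge n d)),
      (⋃ f ∈ e :: μ :: es, dualSegment L f) =
        dualSegment L e ∪ (dualSegment L μ ∪ ⋃ f ∈ es, dualSegment L f) := by
    intro e μ es
    ext z; simp
  refine IsChain.exists_run h.pos_n (R := fun e e' es => (⋃ f ∈ es, dualSegment L f) =
    segment ℝ (dualPoint L e'.minus) (dualPoint L e.plus)) ?_ ?_ ?_ hc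
  · intro e he
    simp [h.dualSegment_eq]
  · intro μ e e₁ e' es hs hr ih
    have ha := h.arrow_edge (ne_m_of_seg hs.1)
    have hb := (h.run_arrow hr hs.2.1).1
    have hst : RunStep C c e e₁ := ⟨μ, hs⟩
    rw [(hst.coords h.colorMap).1, ← (h.step_dual hst).1] at hb
    have hμ : dualSegment L μ = {dualPoint L e.minus} := by
      rw [h.dualSegment_eq, h.dual_eq_of_m hs.2.2.1, segment_same, hs.2.2.2.2,
        (h.step_dual hst).1]
    rw [two, ih, h.dualSegment_eq, hμ, ← hb.segment_union ha, (h.step_dual hst).1]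
    congr 1
    rw [Set.singleton_union, Set.insert_eq_self]
    exact right_mem_segment ℝ _ _
  · intro μ e e₁ e' es hr hs he ih
    have ha := h.arrow_edge (ne_m_of_seg hs.2.1)
    have hst : RunStep C c e₁ e' := ⟨μ, hs⟩
    have hb := (h.run_arrow hr he).1
    rw [(hst.coords h.colorMap).1, hr.type_eq h.colorMap, ← (h.step_dual hst).1] at ha
    have hμ : dualSegment L μ = {dualPoint L e₁.minus} := by
      rw [h.dualSegment_eq, h.dual_eq_of_m hs.2.2.1, segment_same, hs.2.2.2.2,
        (h.step_dual hst).1]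
    rw [two, ih, h.dualSegment_eq, hμ, ← ha.segment_union hb, (h.step_dual hst).1, Set.union_comm]
    congr 1
    rw [Set.singleton_union, Set.insert_eq_self]
    rw [← (h.step_dual hst).1]
    exact left_mem_segment ℝ _ _

theorem mem_rho (h : Hive C L a) {p : Set ℂ × SegColor} : p ∈ rho C L ↔
    ∃ e e', MaxRun C p.2 e e' ∧
      p.1 = segment ℝ (dualPoint L e'.minus) (dualPoint L e.plus) := by
  constructor
  · rintro ⟨x, es, y, ⟨h1, h2, h3⟩, h4⟩
    obtain ⟨e, e', h5, h6, h7, ⟨rfl, rfl⟩ | ⟨rfl, rfl⟩⟩ := h.chain_union h3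
    · exact ⟨e, e', ⟨h5, h6, h1, h2⟩, h4.trans h7⟩
    · exact ⟨e, e', ⟨h5, h6, h2, h1⟩, h4.trans h7⟩
  · rintro ⟨e, e', h1, h2⟩
    obtain ⟨es, hes⟩ := h1.run.exists_chain h.pos_n h1.color
    refine ⟨e.plus, es, e'.minus, ⟨h1.plus, h1.minus, hes⟩, ?_⟩
    obtain ⟨f, f', h5, h6, h7, ⟨h8, h9⟩ | ⟨h8, h9⟩⟩ := h.chain_union hes
    · rw [h7, h2, h8, h9]
    · exact absurd h8 (plus_ne_minus h.pos_n _ _)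

theorem maxRun_arrow (h : Hive C L a) {e e' : HiveEdge n d} (hr : MaxRun C c e e') :
    Arrow e.type (dualPoint L e'.minus) (dualPoint L e.plus) :=
  (h.run_arrow hr.run hr.color).1

/-- An edge of a maximal run at a vertex of the reduced graph is the end of the run there. -/
theorem incident_end {e e' e₁ : HiveEdge n d} {x : DualVertex n d}
    (h1 : Run C c e e₁) (h2 : Run C c e₁ e') (hx : InReduced C x) (hi : x.Incident e₁) :
    (x = e.plus ∧ e₁ = e) ∨ (x = e'.minus ∧ e₁ = e') := by
  rcases incident_iff.1 hi with rfl | rfl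
  · have := h1.eq_of_reduced_plus hx
    subst this
    exact .inl ⟨rfl, rfl⟩
  · have := h2.eq_of_reduced hx
    subst this
    exact .inr ⟨rfl, rfl⟩

/-- At a vertex of the reduced graph, there is one edge of each type. -/
theorem incident_unique {x : DualVertex n d} {e f : HiveEdge n d} (he : x.Incident e)
    (hf : x.Incident f) (ht : e.type = f.type) : e = f := by
  cases x with
  | outer g hg =>
    have h1 : g = e := he
    have h2 : g = f := hf
    rw [← h1, h2]
  | face g =>
    obtain ⟨k, rfl⟩ := he
    obtain ⟨l, rfl⟩ := hf
    rw [face_type, face_type] at ht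
    rw [ht]

instance : Finite SegColor :=
  Finite.of_surjective (α := Fin 3) ![.zero, .one, .three] fun c => by
    cases c
    · exact ⟨0, rfl⟩
    · exact ⟨1, rfl⟩
    · exact ⟨2, rfl⟩

theorem rho_finite (h : Hive C L a) : (rho C L).Finite := by
  refine (Set.finite_range fun q : HiveEdge n d × HiveEdge n d × SegColor =>
    (segment ℝ (dualPoint L q.2.1.minus) (dualPoint L q.1.plus), q.2.2)).subset ?_
  intro p hp
  obtain ⟨e, e', h1, h2⟩ := h.mem_rho.1 hp
  exact ⟨(e, e', p.2), Prod.ext h2.symm rfl⟩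

/-- Opposite edges of a lozenge belong to the same run. -/
theorem lozenge_step {f g : HiveFace n d} {k t : Fin 3} (hfg : f ≠ g)
    (hk : C (f.edge k) = .m) (he : g.edge k = f.edge k) (hc : C (f.edge t) = .seg c)
    (hc' : C (g.edge t) = .seg c) : RunStep C c (f.edge t) (g.edge t) ∨
      RunStep C c (g.edge t) (f.edge t) := by
  rcases f with ⟨u, hu⟩ | ⟨u, hu⟩ <;> rcases g with ⟨w, hw⟩ | ⟨w, hw⟩
  · have := congrArg HiveEdge.start he
    simp only [upper_start, add_left_inj] at this
    subst this
    exact absurd rfl hfg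
  · exact .inr ⟨_, hc', hc, hk, by rw [← he, minus_lower, minus_lower],
      by rw [plus_upper, plus_upper]⟩
  · exact .inl ⟨_, hc, hc', hk, by rw [minus_lower, minus_lower],
      by rw [← he, plus_upper, plus_upper]⟩
  · have := congrArg HiveEdge.start he
    simp only [lower_start, sub_left_inj] at this
    subst this
    exact absurd rfl hfg

theorem rho_cross (h : Hive C L a) {e e' f f' : HiveEdge n d} {c' : SegColor} {z : ℂ}
    (hr : MaxRun C c e e') (hr' : MaxRun C c' f f')
    (hz : z ∈ segInterior (segment ℝ (dualPoint L e'.minus) (dualPoint L e.plus)))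
    (hz' : z ∈ segInterior (segment ℝ (dualPoint L f'.minus) (dualPoint L f.plus))) :
    (c = c' ∧ e = f ∧ e' = f') ∨ (c = .zero ∧ c' = .one ∧ f.type = e.type + 2) ∨
      (c' = .zero ∧ c = .one ∧ e.type = f.type + 2) := by
  have ha := h.maxRun_arrow hr
  have ha' := h.maxRun_arrow hr'
  have hzT : z ∈ triangle := by
    rw [mem_triangle]
    intro i
    obtain ⟨s, t, hs, ht, hst, rfl⟩ := hz.1
    rw [coord_combo hst]
    have h1 := mem_triangle.1 (h.dual_mem e'.minus) i
    have h2 := mem_triangle.1 (h.dual_mem e.plus) i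
    positivity
  obtain ⟨e₁, r1, r2, hon⟩ := (h.run_arrow hr.run hr.color).2 z hz.1
  obtain ⟨f₁, r1', r2', hon'⟩ := (h.run_arrow hr'.run hr'.color).2 z hz'.1
  by_cases hef : e₁ = f₁
  · subst hef
    exact .inl (hr.unique h.colorMap hr' r1 r2 r1' r2')
  obtain ⟨g, hg, rfl⟩ := h.exists_face_of_two hzT hon hon' hef
  have hnr : ¬ InReduced C (.face g) := by
    intro hx
    apply hz.2
    rw [ha.endpoints_eq]
    rcases incident_end r1 r2 hx ⟨_, hg⟩ with ⟨h1, -⟩ | ⟨h1, -⟩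
    · right; exact congrArg _ h1
    · left; exact congrArg _ h1
  simp only [InReduced, not_forall, not_not] at hnr
  obtain ⟨k, hk⟩ := hnr
  have ce := r1.color hr.color
  have cf := r1'.color hr'.color
  have key : ∀ g' : HiveFace n d, g'.edge k = g.edge k → g'.edge f₁.type = f₁ →
      (e₁.type = f₁.type ∧ c = c') ∨ (c = .zero ∧ c' = .one ∧ f₁.type = e₁.type + 2) ∨
      (c' = .zero ∧ c = .one ∧ e₁.type = f₁.type + 2) := by
    intro g' hg' hf
    have t1 := m_face_type h.colorMap hk (k := e₁.type) (c := c) (by rw [hg, ce])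
    have t2 := m_face_type h.colorMap (f := g') (t := k) (by rw [hg', hk]) (k := f₁.type) (c := c')
      (by rw [hf, cf])
    obtain ⟨t1, n1⟩ := t1
    obtain ⟨t2, n2⟩ := t2
    rw [t1] at t2
    cases c <;> cases c' <;> simp [mType] at t2 n1 n2 ⊢
    · exact t2
    · have := congrArg (· + 1) t2
      simp at this
      exact this.symm
    · have := congrArg (· + 1) t2
      simp at this
      exact this
    · exact t2
  have te := r1.type_eq h.colorMap
  have tf := r1'.type_eq h.colorMap
  rcases h.edges_at_face hon' with hf | ⟨k', g', hk', hgg, hg', hf⟩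
  · rcases key g rfl hf with ⟨h1, -⟩ | h1
    · rw [← hg, h1, hf] at hef; exact absurd rfl hef
    · right; rwa [te, tf] at h1
  · have : k' = k := by
      by_contra hne
      exact h.not_two_m g hne ⟨hk', hk⟩
    subst this
    rcases key g' hg' hf with ⟨h1, rfl⟩ | h1
    · left
      rcases lozenge_step hgg hk' hg' (t := e₁.type) (c := c) (by rw [hg, ce])
        (by rw [h1, hf, cf]) with hs | hs
      · rw [hg, h1, hf] at hs
        exact hr.unique h.colorMap hr' (r1.tail hs) (by
          have := hr.run
          rcases Relation.ReflTransGen.cases_head r2 with rfl | ⟨b, h3, h4⟩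
          · exfalso
            obtain ⟨μ, hs⟩ := hs
            exact hs.not_reduced.1 hr.minus
          · rw [← h3.unique h.colorMap hs]; exact h4) r1' r2'
      · rw [hg, h1, hf] at hs
        exact hr.unique h.colorMap hr' r1 r2 (r1'.tail hs) (by
          rcases Relation.ReflTransGen.cases_head r2' with rfl | ⟨b, h3, h4⟩
          · exfalso
            obtain ⟨μ, hs⟩ := hs
            exact hs.not_reduced.1 hr'.minus
          · rw [← h3.unique h.colorMap hs]; exact h4)
    · right; rwa [te, tf] at h1

/-- The colours at a face without edge coloured `m` are allowed for segments which meet. -/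
theorem reduced_colors (h : Hive C L a) {f : HiveFace n d} (hf : InReduced C (.face f))
    {t : Fin 3} {c c' : SegColor} (h1 : C (f.edge t) = .seg c)
    (h2 : C (f.edge (t + 1)) = .seg c') : (c, c') ∈ allowedPairs := by
  have key : (c = .zero ∧ c' = .zero) ∨ (c = .one ∧ c' = .one) ∨ (c = .zero ∧ c' = .one) ∨
      (c = .one ∧ c' = .three) ∨ (c = .three ∧ c' = .zero) := by
    rcases face_cases h.colorMap f with h3 | h3 | ⟨l, h3, h4, h5⟩ | ⟨l, -, h4, -⟩
    · rw [h3] at h1 h2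
      cases h1; cases h2; simp
    · rw [h3] at h1 h2
      cases h1; cases h2; simp
    · rcases idx_cases l t with rfl | rfl | rfl
      · rw [h3] at h1; rw [h4] at h2
        cases h1; cases h2; simp
      · rw [h4] at h1; rw [idx_one_one, h5] at h2
        cases h1; cases h2; simp
      · rw [h5] at h1; rw [idx_two_one, h3] at h2
        cases h1; cases h2; simp
    · exact absurd h4 (hf _)
  simp only [allowedPairs, Set.mem_insert_iff, Set.mem_singleton_iff, Prod.mk.injEq]
  exact key

/-- Two edges of maximal runs at a common face of the reduced graph. -/
theorem meet_aux (h : Hive C L a) {f : HiveFace n d} (hf : InReduced C (.face f))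
    {e e' : HiveEdge n d} {c c' : SegColor} (he : (DualVertex.face f).Incident e)
    (he' : (DualVertex.face f).Incident e') (h1 : C e = .seg c) (h2 : C e' = .seg c')
    (hne : e ≠ e') : ((c, c') ∈ allowedPairs ∧ e'.type = e.type + 1) ∨
      ((c', c) ∈ allowedPairs ∧ e.type = e'.type + 1) := by
  obtain ⟨t, rfl⟩ := he
  obtain ⟨s, rfl⟩ := he'
  rw [face_type, face_type]
  rcases idx_cases t s with rfl | rfl | rfl
  · exact absurd rfl hne
  · exact .inl ⟨h.reduced_colors hf h1 h2, rfl⟩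
  · exact .inr ⟨h.reduced_colors hf (t := t + 2) h2 (by simpa using h1), by simp⟩

theorem maxRun_ends (h : Hive C L a) {e e' : HiveEdge n d} (hr : MaxRun C c e e') {z : ℂ}
    (hz : z ∈ endpoints (segment ℝ (dualPoint L e'.minus) (dualPoint L e.plus))) :
    z = dualPoint L e'.minus ∨ z = dualPoint L e.plus := by
  rw [(h.maxRun_arrow hr).endpoints_eq] at hz
  exact hz

theorem not_outer_both {e e' : HiveEdge n d} (he : e.IsOuter) {x : DualVertex n d}
    (hx : x = .outer e he) (h : x.Incident e') : e = e' := by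
  subst hx; exact h

theorem rho_honeycomb (h : Hive C L a) : IsHoneycomb triangle (rho C L) where
  finite := h.rho_finite
  segments := by
    rintro ⟨s, c⟩ hp
    obtain ⟨e, e', h1, h2⟩ := h.mem_rho.1 hp
    simp only at h2
    rw [h2]
    exact (h.maxRun_arrow h1).isSegmentOf (h.dual_mem _) (h.dual_mem _)
  color_unique := by
    intro s c c' hp hp'
    obtain ⟨e, e', h1, h2⟩ := h.mem_rho.1 hp
    obtain ⟨f, f', h1', h2'⟩ := h.mem_rho.1 hp'
    simp only at h1 h2 h1' h2'
    obtain ⟨a1, a2, a3⟩ := (h.maxRun_arrow h1).unique (h.maxRun_arrow h1') (h2.symm.trans h2')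
    have a4 := h.dual_injective h1.plus h1'.plus a2
    have : e = f := incident_unique (plus_incident e) (a4 ▸ plus_incident f) a3
    have h3 := h1.color
    rw [this, h1'.color] at h3
    injection h3 with h3
    exact h3.symm
  cross := by
    rintro ⟨s, c⟩ hp ⟨s', c'⟩ hp' hne ⟨z, hz, hz'⟩
    obtain ⟨e, e', h1, h2⟩ := h.mem_rho.1 hp
    obtain ⟨f, f', h1', h2'⟩ := h.mem_rho.1 hp'
    simp only at h1 h2 h1' h2' hz hz'
    subst h2 h2'
    rcases h.rho_cross h1 h1' hz hz' with ⟨rfl, rfl, rfl⟩ | h3 | h3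
    · exact absurd rfl hne
    · exact .inl (((h.maxRun_arrow h1).crossOK_iff (h.maxRun_arrow h1')).2 h3)
    · exact .inr (((h.maxRun_arrow h1').crossOK_iff (h.maxRun_arrow h1)).2 h3)
  meet := by
    rintro ⟨s, c⟩ hp ⟨s', c'⟩ hp' v hv
    obtain ⟨e, e', h1, h2⟩ := h.mem_rho.1 hp
    obtain ⟨f, f', h1', h2'⟩ := h.mem_rho.1 hp'
    simp only at h1 h2 h1' h2' hv
    subst h2 h2'
    have ha := h.maxRun_arrow h1
    have ha' := h.maxRun_arrow h1'
    have te := h1.run.type_eq h.colorMap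
    have tf := h1'.run.type_eq h.colorMap
    -- the two runs are different, as their segments have only one end in common
    have hdiff : ∀ g, Run C c e g → Run C c g e' → Run C c' f g → Run C c' g f' → False := by
      intro g r1 r2 r1' r2'
      obtain ⟨rfl, rfl, rfl⟩ := h1.unique h.colorMap h1' r1 r2 r1' r2'
      rw [Set.inter_self, ha.endpoints_eq] at hv
      have m1 : dualPoint L e'.minus ∈ ({v} : Set ℂ) := hv ▸ Set.mem_insert _ _
      have m2 : dualPoint L e.plus ∈ ({v} : Set ℂ) := hv ▸ Set.mem_insert_of_mem _ rfl
      exact ha.ne (m1.trans m2.symm)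
    have hv' : v ∈ endpoints _ ∩ endpoints _ := hv.symm ▸ Set.mem_singleton v
    rcases h.maxRun_ends h1 hv'.1 with v1 | v1 <;> rcases h.maxRun_ends h1' hv'.2 with v2 | v2
    · have hx := h.dual_injective h1.minus h1'.minus (v1.symm.trans v2)
      have hne : e' ≠ f' := by
        rintro rfl
        exact hdiff e' h1.run .refl h1'.run .refl
      rcases minus_cases e' with ⟨u, hu, hm⟩ | ⟨ho, hm⟩
      · rcases h.meet_aux (hm ▸ h1.minus) (hm ▸ minus_incident e')
          (hm ▸ hx ▸ minus_incident f') h1.color' h1'.color' hne with h3 | h3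
        · rw [te, tf] at h3
          exact .inl ((ha.meetOK_iff ha').2 ⟨h3.1, h3.2, .inl ⟨v1, v2⟩⟩)
        · rw [te, tf] at h3
          exact .inr ((ha'.meetOK_iff ha).2 ⟨h3.1, h3.2, .inl ⟨v2, v1⟩⟩)
      · exact absurd (not_outer_both _ hm (hx ▸ minus_incident f')) hne
    · exact absurd (h.dual_injective h1.minus h1'.plus (v1.symm.trans v2)).symm
        (plus_ne_minus h.pos_n _ _)
    · exact absurd (h.dual_injective h1.plus h1'.minus (v1.symm.trans v2))
        (plus_ne_minus h.pos_n _ _)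
    · have hx := h.dual_injective h1.plus h1'.plus (v1.symm.trans v2)
      have hne : e ≠ f := by
        rintro rfl
        exact hdiff e .refl h1.run .refl h1'.run
      rcases plus_cases e with ⟨u, hu, hm⟩ | ⟨ho, hm⟩
      · rcases h.meet_aux (hm ▸ h1.plus) (hm ▸ plus_incident e)
          (hm ▸ hx ▸ plus_incident f) h1.color h1'.color hne with h3 | h3
        · exact .inl ((ha.meetOK_iff ha').2 ⟨h3.1, h3.2, .inr ⟨v1, v2⟩⟩)
        · exact .inr ((ha'.meetOK_iff ha).2 ⟨h3.1, h3.2, .inr ⟨v2, v1⟩⟩)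
      · exact absurd (not_outer_both _ hm (hx ▸ plus_incident f)) hne

end Hive

end

section

variable {n d : ℕ}
variable {C : HiveEdge n d → HiveColor} {L : HiveEdge n d → ℝ} {a : Fin 3 → Fin n → ℝ}
variable {c c' : SegColor}

/-! ### Isomorphisms and degrees -/

namespace ColoredGraph

variable {G G' : ColoredGraph}

theorem Iso.adj_iff (φ : G.Iso G') (u v : G.V) :
    G'.Adj (φ.toEquiv u) (φ.toEquiv v) ↔ G.Adj u v :=
  exists_congr fun c => φ.edge_iff c u v

theorem Iso.degree_eq (φ : G.Iso G') (u : G.V) : G'.degree (φ.toEquiv u) = G.degree u := by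
  have : {w | G'.Adj (φ.toEquiv u) w} = φ.toEquiv '' {w | G.Adj u w} := by
    ext w
    simp only [Set.mem_ofPred_eq, Set.mem_image]
    constructor
    · intro h
      refine ⟨φ.toEquiv.symm w, ?_, by simp⟩
      rw [← φ.adj_iff]
      simpa using h
    · rintro ⟨v, hv, rfl⟩
      exact (φ.adj_iff u v).2 hv
  rw [degree, this, Set.ncard_image_of_injective _ φ.toEquiv.injective]
  rfl

/-- The inverse isomorphism. -/
def Iso.symm (φ : G.Iso G') : G'.Iso G where
  toEquiv := φ.toEquiv.symm
  edge_iff c u v := by rw [← φ.edge_iff]; simp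
  bdryLT_iff u v hu hv := by
    have h1 := φ.degree_eq (φ.toEquiv.symm u)
    have h2 := φ.degree_eq (φ.toEquiv.symm v)
    rw [Equiv.apply_symm_apply] at h1 h2
    rw [← φ.bdryLT_iff _ _ (h1 ▸ hu) (h2 ▸ hv)]
    simp

/-- The composition of isomorphisms. -/
def Iso.trans {G'' : ColoredGraph} (φ : G.Iso G') (ψ : G'.Iso G'') : G.Iso G'' where
  toEquiv := φ.toEquiv.trans ψ.toEquiv
  edge_iff c u v := by simp [ψ.edge_iff, φ.edge_iff]
  bdryLT_iff u v hu hv := by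
    have h1 := φ.degree_eq u
    have h2 := φ.degree_eq v
    simp only [Equiv.trans_apply]
    rw [ψ.bdryLT_iff _ _ (h1.trans hu) (h2.trans hv), φ.bdryLT_iff _ _ hu hv]

end ColoredGraph

/-! ### Outer edges and boundary values -/

theorem outerRank_lt {e : HiveEdge n d} (he : e.IsOuter) : e.outerRank < n := by
  have h1 := (mem_hive e.type).1 e.start_mem
  have h2 := (mem_hive e.type).1 e.end_mem
  simp [eps_apply] at h2
  unfold HiveEdge.outerRank
  split_ifs with hl
  · simp only [HiveEdge.OnLongSide] at hl
    simp only [HiveEdge.height]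
    omega
  · have hs : e.OnShortSide := he.resolve_left hl
    simp only [HiveEdge.OnShortSide] at hs
    simp only [HiveEdge.height]
    omega

theorem rank_long {e : HiveEdge n d} (h : e.OnLongSide) : d ≤ e.outerRank := by
  have h1 := (mem_hive e.type).1 e.start_mem
  have h2 := (mem_hive e.type).1 e.end_mem
  simp [eps_apply] at h2
  rw [HiveEdge.outerRank, if_pos h]
  simp only [HiveEdge.OnLongSide] at h
  simp only [HiveEdge.height]
  omega

theorem rank_short (hn : 0 < n) {e : HiveEdge n d} (h : e.OnShortSide) : e.outerRank < d := by
  have h1 := (mem_hive e.type).1 e.start_mem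
  have h2 := (mem_hive e.type).1 e.end_mem
  simp [eps_apply] at h2
  rw [HiveEdge.outerRank, if_neg (not_long_of_short hn h)]
  simp only [HiveEdge.OnShortSide] at h
  simp only [HiveEdge.height]
  omega

theorem exists_outer (hn : 0 < n) (i : Fin 3) {j : ℕ} (hj : j < n) (hd : d ≤ n) :
    ∃ e : HiveEdge n d, e.IsOuter ∧ e.outerSide = i ∧ e.outerRank = j ∧
      (e.OnShortSide ↔ j < d) := by
  by_cases hjd : j < d
  · let s : Pt := (j : ℤ) • eps (i + 2) + (n : ℤ) • eps (i + 1) + ((d : ℤ) - j) • eps i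
    have hs : ∃ e : HiveEdge n d, e.start = s ∧ e.type = i + 2 := by
      refine ⟨⟨s, i + 2, ?_, ?_⟩, rfl, rfl⟩
      · rw [mem_hive i]; simp [s, eps_apply]; omega
      · rw [mem_hive i]; simp [s, eps_apply]; omega
    obtain ⟨e, h1, h2⟩ := hs
    have hsh : e.OnShortSide := by
      simp [HiveEdge.OnShortSide, h1, h2, s, eps_apply]
    refine ⟨e, .inr hsh, ?_, ?_, by simp [hsh, hjd]⟩
    · rw [outerSide_short (not_long_of_short hn hsh), h2]; simp
    · rw [HiveEdge.outerRank, if_neg (not_long_of_short hn hsh)]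
      simp [HiveEdge.height, h1, h2, s, eps_apply]
  · let s : Pt := ((n : ℤ) + d - 1 - j) • eps (i + 1) + ((j : ℤ) + 1) • eps (i + 2)
    have hs : ∃ e : HiveEdge n d, e.start = s ∧ e.type = i + 1 := by
      refine ⟨⟨s, i + 1, ?_, ?_⟩, rfl, rfl⟩
      · rw [mem_hive i]; simp [s, eps_apply]; omega
      · rw [mem_hive i]; simp [s, eps_apply]; omega
    obtain ⟨e, h1, h2⟩ := hs
    have hlo : e.OnLongSide := by
      simp [HiveEdge.OnLongSide, h1, h2, s, eps_apply]
    refine ⟨e, .inl hlo, ?_, ?_, ?_⟩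
    · rw [outerSide_long hlo, h2]; simp
    · rw [HiveEdge.outerRank, if_pos hlo]
      simp [HiveEdge.height, h1, h2, s, eps_apply]
    · simp only [hjd, iff_false]
      intro hsh
      exact not_long_of_short hn hsh hlo

/-- An outer edge is determined by its side and its rank. -/
theorem outer_unique (hn : 0 < n) {e f : HiveEdge n d} (he : e.IsOuter) (hf : f.IsOuter)
    (hs : e.outerSide = f.outerSide) (hr : e.outerRank = f.outerRank) : e = f := by
  have key : ∀ e : HiveEdge n d, (e.start e.type : ℤ) + e.start (e.type + 1) +
      e.start (e.type + 2) = n + d := fun e => ((mem_hive e.type).1 e.start_mem).2.2.2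
  have b1 := (mem_hive e.type).1 e.start_mem
  have b2 := (mem_hive f.type).1 f.start_mem
  by_cases hle : e.OnLongSide
  · by_cases hlf : f.OnLongSide
    · have ht : e.type = f.type := by
        rw [outerSide_long hle, outerSide_long hlf] at hs
        exact add_right_cancel hs
      simp only [HiveEdge.outerRank, if_pos hle, if_pos hlf, HiveEdge.height] at hr
      have s1 := (mem_hive e.type).1 e.end_mem
      have s2 := (mem_hive f.type).1 f.end_mem
      simp [eps_apply] at s1 s2
      simp only [HiveEdge.OnLongSide] at hle hlf
      refine HiveEdge.ext (pt_ext e.type ?_ ?_ ?_) ht <;> rw [← ht] at hr hlf s2 b2 <;> omega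
    · have hsf := hf.resolve_left hlf
      have := rank_long hle
      have := rank_short hn hsf
      omega
  · have hse := he.resolve_left hle
    by_cases hlf : f.OnLongSide
    · have := rank_long hlf
      have := rank_short hn hse
      omega
    · have hsf := hf.resolve_left hlf
      have ht : e.type = f.type := by
        rw [outerSide_short hle, outerSide_short hlf] at hs
        exact add_right_cancel hs
      simp only [HiveEdge.outerRank, if_neg hle, if_neg hlf, HiveEdge.height] at hr
      simp only [HiveEdge.OnShortSide] at hse hsf
      refine HiveEdge.ext (pt_ext e.type ?_ ?_ ?_) ht <;> rw [← ht] at hr hsf b2 <;> omega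

theorem bdryValue_eq {e : HiveEdge n d} (h : e.outerRank < n) :
    bdryValue a e = a e.outerSide ⟨e.outerRank, h⟩ := by
  rw [bdryValue, dif_pos h]

/-! ### Ports: maximal chains seen from their ends -/

/-- The sign of a vertex of the dual graph: it is `1` on the upper sides of edges and `-1` on the
lower sides. -/
def DualVertex.sign : DualVertex n d → ℝ
  | .face (.upper _ _) => 1
  | .face (.lower _ _) => -1
  | .outer e _ => open Classical in if e.OnLongSide then -1 else 1

theorem sign_plus (hn : 0 < n) (e : HiveEdge n d) : e.plus.sign = 1 := by
  rcases plus_cases e with ⟨u, hu, h1⟩ | ⟨h1, h2⟩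
  · rw [h1]; rfl
  · rw [h2]; exact if_neg (not_long_of_short hn h1)

theorem sign_minus (e : HiveEdge n d) : e.minus.sign = -1 := by
  rcases minus_cases e with ⟨u, hu, h1⟩ | ⟨h1, h2⟩
  · rw [h1]; rfl
  · rw [h2]; exact if_pos h1

theorem sign_adj (hn : 0 < n) {x y : (reducedGraph C).V} (hxy : (reducedGraph C).Adj x y) :
    y.1.sign = -x.1.sign := by
  obtain ⟨c, hc⟩ := hxy
  obtain ⟨g, g', -, ⟨h2, h3⟩ | ⟨h2, h3⟩⟩ := (reducedGraph_edge_iff hn).1 hc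
  · rw [h2, h3, sign_plus hn, sign_minus]
  · rw [h2, h3, sign_plus hn, sign_minus, neg_neg]

/-- A maximal chain of colour `c` leaves the vertex `x` of the reduced graph through the edge `g`
and arrives at `y` through the edge `g'`. -/
def Port (C : HiveEdge n d → HiveColor) (c : SegColor) (x : (reducedGraph C).V) (g : HiveEdge n d)
    (y : (reducedGraph C).V) (g' : HiveEdge n d) : Prop :=
  ∃ e e', MaxRun C c e e' ∧ ((x.1 = e.plus ∧ g = e ∧ y.1 = e'.minus ∧ g' = e') ∨
    (x.1 = e'.minus ∧ g = e' ∧ y.1 = e.plus ∧ g' = e))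

namespace Port

variable {x y z : (reducedGraph C).V} {g g' h h' : HiveEdge n d}

theorem symm (p : Port C c x g y g') : Port C c y g' x g := by
  obtain ⟨e, e', hr, h⟩ := p
  exact ⟨e, e', hr, by tauto⟩

theorem edge_iff (hn : 0 < n) : (reducedGraph C).edge c x y ↔ ∃ g g', Port C c x g y g' := by
  rw [reducedGraph_edge_iff hn]
  constructor
  · rintro ⟨e, e', hr, ⟨h1, h2⟩ | ⟨h1, h2⟩⟩
    · exact ⟨e, e', e, e', hr, .inl ⟨h1, rfl, h2, rfl⟩⟩
    · exact ⟨e', e, e, e', hr, .inr ⟨h1, rfl, h2, rfl⟩⟩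
  · rintro ⟨g, g', e, e', hr, h⟩
    exact ⟨e, e', hr, by tauto⟩

theorem adj (hn : 0 < n) (p : Port C c x g y g') : (reducedGraph C).Adj x y :=
  ⟨c, (edge_iff hn).2 ⟨g, g', p⟩⟩

theorem incident (p : Port C c x g y g') : x.1.Incident g := by
  obtain ⟨e, e', -, ⟨h, rfl, -⟩ | ⟨h, rfl, -⟩⟩ := p <;> rw [h]
  exacts [plus_incident _, minus_incident _]

theorem color (p : Port C c x g y g') : C g = .seg c := by
  obtain ⟨e, e', hr, ⟨-, rfl, -⟩ | ⟨-, rfl, -⟩⟩ := p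
  exacts [hr.color, hr.color']

theorem type_eq (hC : IsColorMap C) (p : Port C c x g y g') : g'.type = g.type := by
  obtain ⟨e, e', hr, ⟨-, rfl, -, rfl⟩ | ⟨-, rfl, -, rfl⟩⟩ := p
  exacts [hr.run.type_eq hC, (hr.run.type_eq hC).symm]

theorem unique (hC : IsColorMap C) (hn : 0 < n) (p : Port C c x g y g') (q : Port C c' x g z h) :
    c = c' ∧ y = z ∧ g' = h := by
  have hc := p.color.symm.trans q.color
  injection hc with hc
  subst hc
  obtain ⟨e, e', hr, ⟨h1, rfl, h2, rfl⟩ | ⟨h1, rfl, h2, rfl⟩⟩ := p <;>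
    obtain ⟨f, f', hs, ⟨k1, rfl, k2, rfl⟩ | ⟨k1, k3, k2, rfl⟩⟩ := q
  · have := hr.run.unique_minus hC hs.run hr.minus hs.minus
    exact ⟨rfl, Subtype.ext (by rw [h2, k2, this]), this⟩
  · exact absurd (h1.symm.trans k1) (plus_ne_minus hn _ _)
  · exact absurd (k1.symm.trans h1) (plus_ne_minus hn _ _)
  · subst k3
    have := hr.run.unique_plus hC hs.run hr.plus hs.plus
    exact ⟨rfl, Subtype.ext (by rw [h2, k2, this]), this⟩

theorem exists_of_incident (hC : IsColorMap C) (hm : NoOuterM C) (hg : x.1.Incident g) :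
    ∃ c y g', Port C c x g y g' := by
  have hx := x.2
  obtain ⟨c, hc⟩ : ∃ c, C g = .seg c := by
    have : C g ≠ .m := by
      rcases hx' : x.1 with f | ⟨e, he⟩ <;> rw [hx'] at hg hx
      · obtain ⟨l, rfl⟩ := hg; exact hx l
      · cases hg; exact hm _ he
    cases hc : C g with
    | seg c => exact ⟨c, rfl⟩
    | m => exact absurd hc this
  obtain ⟨e, e', hr, h1, h2⟩ := exists_maxRun hC hm g hc
  rcases incident_iff.1 hg with h | h
  · obtain rfl := h1.eq_of_reduced_plus (h ▸ hx)
    exact ⟨c, ⟨_, hr.minus⟩, e', e, e', hr, .inl ⟨h, rfl, rfl, rfl⟩⟩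
  · obtain rfl := h2.eq_of_reduced (h ▸ hx)
    exact ⟨c, ⟨_, hr.plus⟩, e, e, g, hr, .inr ⟨h, rfl, rfl, rfl⟩⟩

theorem exists_at (hC : IsColorMap C) (hm : NoOuterM C) (x : (reducedGraph C).V) :
    ∃ c g y g', Port C c x g y g' := by
  obtain ⟨g, hg⟩ : ∃ g, x.1.Incident g := by
    rcases x.1 with f | ⟨e, he⟩
    exacts [⟨f.edge 0, 0, rfl⟩, ⟨e, rfl⟩]
  obtain ⟨c, y, g', p⟩ := exists_of_incident hC hm hg
  exact ⟨c, g, y, g', p⟩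

theorem sign (hn : 0 < n) (p : Port C c x g y g') : y.1.sign = -x.1.sign := sign_adj hn (p.adj hn)

end Port

/-- Colour maps without `m` on the boundary, for which a pair of vertices of the reduced graph is
joined by at most one maximal chain. -/
structure IsSimple (C : HiveEdge n d → HiveColor) : Prop where
  pos_n : 0 < n
  colorMap : IsColorMap C
  outer : NoOuterM C
  simple : ∀ {x y g g' h h' c c'}, Port C c x g y g' → Port C c' x h y h' → g = h

namespace Hive

theorem outer_coord_next (h : Hive C L a) (e : HiveEdge n d) (he : e.IsOuter) :
    coord (dualPoint L (.outer e he)) (e.outerSide + 1) = bdryValue a e := by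
  obtain ⟨h1, h2⟩ := outer_coord L e he
  have h3 := coord_sum e.type (dualPoint L (.outer e he))
  by_cases hl : e.OnLongSide
  · rw [outerSide_long hl, idx_two_one, h1, (h.long_side e hl).2]
  · have hs := he.resolve_left hl
    rw [outerSide_short hl] at h2 ⊢
    rw [idx_one_one]
    have := (h.short_side e hs).2
    linarith

theorem outer_mem_side (h : Hive C L a) (e : HiveEdge n d) (he : e.IsOuter) {i : Fin 3} :
    dualPoint L (.outer e he) ∈ side i ↔ i = e.outerSide := by
  rw [mem_side]
  constructor
  · rintro ⟨-, h1⟩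
    by_contra hne
    exact absurd h1 (h.outer_coord_pos e he hne).ne'
  · rintro rfl
    exact ⟨mem_triangle.1 (h.dual_mem _), (outer_coord L e he).2⟩

/-- The segments dual to edges meet the boundary of the triangle only at outer edges. -/
theorem onEdge_side (h : Hive C L a) {e : HiveEdge n d} {z : ℂ} {i : Fin 3} (hz : OnEdge L e z)
    (hi : z ∈ side i) : ∃ he : e.IsOuter, z = dualPoint L (.outer e he) ∧ i = e.outerSide := by
  obtain ⟨hT, hi0⟩ := mem_side.1 hi
  obtain ⟨h1, h2, h3⟩ := hz
  have hs := coord_sum e.type z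
  suffices H : ∃ he : e.IsOuter, z = dualPoint L (.outer e he) by
    obtain ⟨he, rfl⟩ := H
    exact ⟨he, rfl, (h.outer_mem_side e he).1 hi⟩
  rcases idx_cases e.type i with hi' | hi' | hi' <;> rw [hi'] at hi0
  · exact absurd (h1.symm.trans hi0) (h.pos e).ne'
  · rcases plus_cases e with ⟨u, hu, hp⟩ | ⟨ho, hp⟩
    · exfalso
      have h4 := h.face_pos (.upper u hu) (e.type + 1)
      rw [← hp] at h4
      have h5 := coord_sum e.type (dualPoint L e.plus)
      rw [h.plus_coord] at h5
      linarith
    · refine ⟨.inr ho, coord_ext e.type ?_ ?_⟩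
      · rw [h1, ← hp, h.plus_coord]
      · have h4 := h.short_coord e ho
        have h5 := coord_sum e.type (dualPoint L e.plus)
        rw [h.plus_coord] at h5
        rw [← hp]
        linarith
  · rcases minus_cases e with ⟨u, hu, hp⟩ | ⟨ho, hp⟩
    · exfalso
      have h4 := h.face_pos (.lower u hu) (e.type + 2)
      rw [← hp] at h4
      linarith
    · refine ⟨.inl ho, coord_ext e.type ?_ ?_⟩
      · rw [h1, ← hp, h.minus_coord]
      · rw [← hp, long_coord e ho, hi0]

theorem run_at_plus (h : Hive C L a) {g : HiveEdge n d} (hg : C g = .seg c)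
    (hx : InReduced C g.plus) : ∃ e', MaxRun C c g e' := by
  obtain ⟨e₁, e₂, h1, h2, h3⟩ := exists_maxRun h.colorMap h.outer_not_m g hg
  rw [h2.eq_of_reduced_plus hx] at h1
  exact ⟨e₂, h1⟩

theorem port_arrow (h : Hive C L a)
    {x y : (reducedGraph C).V} {g g' : HiveEdge n d} (p : Port C c x g y g') :
    (x.1.sign = 1 ∧ Arrow g.type (dualPoint L y.1) (dualPoint L x.1)) ∨
      (x.1.sign = -1 ∧ Arrow g.type (dualPoint L x.1) (dualPoint L y.1)) := by
  obtain ⟨e, e', hr, ⟨h1, rfl, h2, rfl⟩ | ⟨h1, rfl, h2, rfl⟩⟩ := p <;> rw [h1, h2]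
  · exact .inl ⟨sign_plus h.pos_n _, h.maxRun_arrow hr⟩
  · refine .inr ⟨sign_minus _, ?_⟩
    rw [hr.run.type_eq h.colorMap]
    exact h.maxRun_arrow hr

theorem isSimple (h : Hive C L a) :
    IsSimple C := by
  refine ⟨h.pos_n, h.colorMap, h.outer_not_m, fun {x y g g' k k' c c'} p q => ?_⟩
  refine incident_unique p.incident q.incident ?_
  obtain ⟨h1, h2⟩ | ⟨h1, h2⟩ := h.port_arrow p <;> obtain ⟨k1, k2⟩ | ⟨k1, k2⟩ := h.port_arrow q
  · exact k2.type_unique h2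
  · linarith
  · linarith
  · exact k2.type_unique h2

/-- The maximal chains through the edges of a vertex lead to its distinct neighbours. -/
theorem exists_neighbours (h : Hive C L a) (x : (reducedGraph C).V) :
    ∃ o : {g : HiveEdge n d // x.1.Incident g} → (reducedGraph C).V,
      Function.Injective o ∧ (∀ w, (reducedGraph C).Adj x w ↔ w ∈ Set.range o) ∧
      ∀ g, ∃ c g', Port C c x g.1 (o g) g' := by
  choose c o g' p using fun g : {g : HiveEdge n d // x.1.Incident g} =>
    Port.exists_of_incident h.colorMap h.outer_not_m g.2
  refine ⟨o, fun g k hgk => Subtype.ext (h.isSimple.simple (p g) (hgk ▸ p k)), fun w => ⟨?_, ?_⟩,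
    fun g => ⟨c g, g' g, p g⟩⟩
  · rintro ⟨_, hw⟩
    obtain ⟨g, _, q⟩ := (Port.edge_iff h.pos_n).1 hw
    exact ⟨⟨g, q.incident⟩, ((p _).unique h.colorMap h.pos_n q).2.1⟩
  · rintro ⟨g, rfl⟩
    exact (p g).adj h.pos_n

theorem degree_eq (h : Hive C L a) (x : (reducedGraph C).V) :
    (reducedGraph C).degree x = {g : HiveEdge n d | x.1.Incident g}.ncard := by
  obtain ⟨oe, h1, h2, -⟩ := h.exists_neighbours x
  have : {w | (reducedGraph C).Adj x w} = Set.range oe := by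
    ext w; exact h2 w
  rw [ColoredGraph.degree, this, ← Set.image_univ, Set.ncard_image_of_injective _ h1,
    Set.ncard_univ]
  rfl

theorem degree_face (h : Hive C L a) {x : (reducedGraph C).V} {f : HiveFace n d}
    (hx : x.1 = .face f) : (reducedGraph C).degree x = 3 := by
  rw [h.degree_eq, hx]
  have : {g : HiveEdge n d | (DualVertex.face f).Incident g} = f.edge '' Set.univ := by
    ext g; simp [DualVertex.Incident]
  rw [this, Set.ncard_image_of_injective _ fun _ _ => edge_injective f, Set.ncard_univ]
  simp

theorem degree_outer (h : Hive C L a) {x : (reducedGraph C).V} {e : HiveEdge n d} {he}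
    (hx : x.1 = .outer e he) : (reducedGraph C).degree x = 1 := by
  rw [h.degree_eq, hx]
  have : {g : HiveEdge n d | (DualVertex.outer e he).Incident g} = {e} := by
    ext g; simp [DualVertex.Incident, eq_comm]
  rw [this, Set.ncard_singleton]

theorem degree_one_iff (h : Hive C L a) {x : (reducedGraph C).V} :
    (reducedGraph C).degree x = 1 ↔ ∃ e he, x.1 = .outer e he := by
  constructor
  · intro h1
    rcases hx : x.1 with f | ⟨e, he⟩
    · rw [h.degree_face hx] at h1; omega
    · exact ⟨e, he, rfl⟩
  · rintro ⟨e, he, hx⟩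
    exact h.degree_outer hx

/-- A face of every colour map with a dual hive has a neighbour in the graph: vertices of the
reduced graph are the ends of the segments. -/
theorem mem_vertexSet (h : Hive C L a) {z : ℂ} :
    z ∈ vertexSet (rho C L) ↔ ∃ x : (reducedGraph C).V, dualPoint L x.1 = z := by
  simp only [vertexSet, Set.mem_iUnion, exists_prop]
  constructor
  · rintro ⟨p, hp, hz⟩
    obtain ⟨e, e', h1, h2⟩ := h.mem_rho.1 hp
    rw [h2] at hz
    rcases h.maxRun_ends h1 hz with rfl | rfl
    · exact ⟨⟨_, h1.minus⟩, rfl⟩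
    · exact ⟨⟨_, h1.plus⟩, rfl⟩
  · rintro ⟨x, rfl⟩
    obtain ⟨c, _, y, _, e, e', h1, h2⟩ := Port.exists_at h.colorMap h.outer_not_m x
    refine ⟨(segment ℝ (dualPoint L e'.minus) (dualPoint L e.plus), c),
      h.mem_rho.2 ⟨e, e', h1, rfl⟩, ?_⟩
    rw [(h.maxRun_arrow h1).endpoints_eq]
    rcases h2 with ⟨h2, -⟩ | ⟨h2, -⟩
    · right; exact congrArg _ h2
    · left; exact congrArg _ h2

theorem rank_lt_iff (h : Hive C L a) {e e' : HiveEdge n d} (he : e.IsOuter)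
    (he' : e'.IsOuter) (hs : e.outerSide = e'.outerSide) :
    bdryValue a e' < bdryValue a e ↔ e.outerRank < e'.outerRank := by
  rw [bdryValue_eq (outerRank_lt he), bdryValue_eq (outerRank_lt he'), hs,
    (h.anti _).lt_iff_gt]
  rfl

/-- The structure graph of the honeycomb of a dual hive is the reduced graph. -/
def iso (h : Hive C L a) : (reducedGraph C).Iso (structureGraph (rho C L)) where
  toEquiv := Equiv.ofBijective
    (fun x => ⟨dualPoint L x.1, h.mem_vertexSet.2 ⟨x, rfl⟩⟩) (by
      constructor
      · intro x y hxy
        exact Subtype.ext (h.dual_injective x.2 y.2 (congrArg Subtype.val hxy))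
      · rintro ⟨z, hz⟩
        obtain ⟨x, hx⟩ := h.mem_vertexSet.1 hz
        exact ⟨x, Subtype.ext hx⟩)
  edge_iff c x y := by
    rw [reducedGraph_edge_iff h.pos_n]
    constructor
    · rintro ⟨h1, h2⟩
      obtain ⟨e, e', h3, h4⟩ := h.mem_rho.1 h2
      refine ⟨e, e', h3, ?_⟩
      rcases (h.maxRun_arrow h3).segment_eq h4 with ⟨h5, h6⟩ | ⟨h5, h6⟩
      · exact .inr ⟨h.dual_injective x.2 h3.minus h5, h.dual_injective y.2 h3.plus h6⟩
      · exact .inl ⟨h.dual_injective x.2 h3.plus h5, h.dual_injective y.2 h3.minus h6⟩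
    · rintro ⟨e, e', h1, h2⟩
      have ha := h.maxRun_arrow h1
      constructor
      · intro heq
        have h3 : dualPoint L x.1 = dualPoint L y.1 := congrArg Subtype.val heq
        rcases h2 with ⟨h4, h5⟩ | ⟨h4, h5⟩ <;> rw [h4, h5] at h3
        · exact ha.ne h3.symm
        · exact ha.ne h3
      · refine h.mem_rho.2 ⟨e, e', h1, ?_⟩
        change segment ℝ (dualPoint L x.1) (dualPoint L y.1) = _
        rcases h2 with ⟨h4, h5⟩ | ⟨h4, h5⟩ <;> rw [h4, h5]
        exact segment_symm ℝ _ _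
  bdryLT_iff x y hx hy := by
    obtain ⟨e, he, hx⟩ := h.degree_one_iff.1 hx
    obtain ⟨e', he', hy⟩ := h.degree_one_iff.1 hy
    have hR : (reducedGraph C).bdryLT x y ↔ (e.outerSide < e'.outerSide ∨
        e.outerSide = e'.outerSide ∧ e.outerRank < e'.outerRank) := by
      change outerLT x.1 y.1 ↔ _
      rw [hx, hy]
      rfl
    rw [hR]
    change (∃ i j : Fin 3, dualPoint L x.1 ∈ side i ∧ dualPoint L y.1 ∈ side j ∧ (i < j ∨ i = j ∧
      coord (dualPoint L y.1) (i + 1) < coord (dualPoint L x.1) (i + 1))) ↔ _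
    rw [hx, hy]
    constructor
    · rintro ⟨i, j, h1, h2, h3⟩
      obtain rfl := (h.outer_mem_side e he).1 h1
      obtain rfl := (h.outer_mem_side e' he').1 h2
      refine h3.imp_right fun ⟨h4, h5⟩ => ⟨h4, ?_⟩
      rw [h.outer_coord_next, h4, h.outer_coord_next] at h5
      exact (h.rank_lt_iff he he' h4).1 h5
    · intro h3
      refine ⟨_, _, (h.outer_mem_side e he).2 rfl, (h.outer_mem_side e' he').2 rfl,
        h3.imp_right fun ⟨h4, h5⟩ => ⟨h4, ?_⟩⟩
      rw [h.outer_coord_next, h4, h.outer_coord_next]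
      exact (h.rank_lt_iff he he' h4).2 h5

theorem iso_apply (h : Hive C L a) (x : (reducedGraph C).V) :
    (h.iso.toEquiv x).1 = dualPoint L x.1 := rfl

end Hive

end

section

variable {n d : ℕ}
variable {C : HiveEdge n d → HiveColor} {L : HiveEdge n d → ℝ} {a : Fin 3 → Fin n → ℝ}
variable {c : SegColor}

/-! ### The honeycomb of a dual hive -/

namespace Hive

theorem mem_support (h : Hive C L a) {z : ℂ} (hz : z ∈ support (rho C L)) :
    ∃ e, C e ≠ .m ∧ OnEdge L e z := by
  simp only [support, Set.mem_iUnion, exists_prop] at hz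
  obtain ⟨p, hp, hz⟩ := hz
  obtain ⟨e, e', h1, h2⟩ := h.mem_rho.1 hp
  rw [h2] at hz
  obtain ⟨e₁, h3, h4, h5⟩ := (h.run_arrow h1.run h1.color).2 z hz
  exact ⟨e₁, ne_m_of_seg (h3.color h1.color), h5⟩

theorem dual_mem_support (h : Hive C L a) (x : (reducedGraph C).V) :
    dualPoint L x.1 ∈ support (rho C L) := by
  have := h.mem_vertexSet.2 ⟨x, rfl⟩
  simp only [vertexSet, support, Set.mem_iUnion, exists_prop] at this ⊢
  obtain ⟨p, hp, w, hw⟩ := this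
  exact ⟨p, hp, hw ▸ left_mem_segment ℝ _ _⟩

theorem support_side (h : Hive C L a) {z : ℂ} {i : Fin 3} :
    z ∈ support (rho C L) ∩ side i ↔ ∃ e he, z = dualPoint L (.outer e he) ∧ i = e.outerSide := by
  constructor
  · rintro ⟨h1, h2⟩
    obtain ⟨e, -, h3⟩ := h.mem_support h1
    obtain ⟨he, h4⟩ := h.onEdge_side h3 h2
    exact ⟨e, he, h4⟩
  · rintro ⟨e, he, rfl, rfl⟩
    exact ⟨h.dual_mem_support ⟨.outer e he, trivial⟩, (h.outer_mem_side e he).2 rfl⟩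

/-- The colour and the type of a segment which meets a side. -/
theorem rho_side (h : Hive C L a) {p : Set ℂ × SegColor} (hp : p ∈ rho C L) {z : ℂ} {i : Fin 3}
    (hz : z ∈ p.1) (hi : z ∈ side i) : ∃ e he, z = dualPoint L (.outer e he) ∧ i = e.outerSide ∧
      C e = .seg p.2 ∧ ∃ v ∈ triangle, ∃ w, Arrow e.type v w ∧ p.1 = segment ℝ v w := by
  obtain ⟨e, e', h1, h2⟩ := h.mem_rho.1 hp
  rw [h2] at hz
  obtain ⟨e₁, h3, h4, h5⟩ := (h.run_arrow h1.run h1.color).2 z hz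
  obtain ⟨he, h6, h7⟩ := h.onEdge_side h5 hi
  refine ⟨e₁, he, h6, h7, h3.color h1.color, _, h.dual_mem _, _, ?_, h2⟩
  rw [h3.type_eq h.colorMap]
  exact h.maxRun_arrow h1

theorem rho_hasBoundary (h : Hive C L a) (hd : d ≤ n) : HasBoundary (rho C L) a := by
  intro i
  refine ⟨h.anti i, ?_⟩
  ext t
  simp only [Set.mem_image, Set.mem_range]
  constructor
  · rintro ⟨z, hz, rfl⟩
    obtain ⟨e, he, rfl, rfl⟩ := h.support_side.1 hz
    exact ⟨_, by rw [h.outer_coord_next, bdryValue_eq (outerRank_lt he)]⟩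
  · rintro ⟨j, rfl⟩
    obtain ⟨e, he, rfl, h2, -⟩ := exists_outer h.pos_n i j.2 hd
    refine ⟨_, h.support_side.2 ⟨e, he, rfl, rfl⟩, ?_⟩
    rw [h.outer_coord_next, bdryValue_eq (outerRank_lt he)]
    congr 1
    exact Fin.ext h2

theorem rho_triangular (h : Hive C L a) (hd : d ≤ n) : IsTriangular n (rho C L) where
  honeycomb := h.rho_honeycomb
  degrees := by
    intro v
    obtain ⟨x, rfl⟩ := h.iso.toEquiv.surjective v
    rw [h.iso.degree_eq]
    rcases hx : x.1 with f | ⟨e, he⟩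
    · exact .inr (h.degree_face hx)
    · exact .inl (h.degree_outer hx)
  boundary := by
    ext z
    rw [Set.mem_inter_iff, mem_triangleBoundary]
    constructor
    · rintro ⟨h1, i, h2⟩
      obtain ⟨e, he, rfl, -⟩ := h.support_side.1 ⟨h1, h2⟩
      refine ⟨h.iso.toEquiv ⟨.outer e he, trivial⟩, ?_, rfl⟩
      exact (h.iso.degree_eq _).trans (h.degree_outer rfl)
    · rintro ⟨v, hv, rfl⟩
      obtain ⟨x, rfl⟩ := h.iso.toEquiv.surjective v
      rw [h.iso.degree_eq] at hv
      obtain ⟨e, he, hx⟩ := h.degree_one_iff.1 hv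
      have := (h.support_side (z := dualPoint L x.1) (i := e.outerSide)).2 ⟨e, he, by rw [hx], rfl⟩
      exact ⟨this.1, _, this.2⟩
  types := by
    intro p hp
    obtain ⟨e, e', h1, h2⟩ := h.mem_rho.1 hp
    exact ⟨e.type, h2 ▸ ((h.maxRun_arrow h1).hasType_iff (h.dual_mem _)).2 rfl⟩
  side_card := by
    intro i
    have hinj : Set.InjOn (fun v => coord v (i + 1)) (support (rho C L) ∩ side i) := by
      rintro v ⟨-, hv⟩ w ⟨-, hw⟩ hvw
      have h1 := (mem_side.1 hv).2
      have h2 := (mem_side.1 hw).2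
      refine coord_ext (i + 1) hvw ?_
      rw [idx_one_two, h1, h2]
    rw [← hinj.ncard_image, (h.rho_hasBoundary hd i).2, ← Set.image_univ,
      Set.ncard_image_of_injective _ (h.anti i).injective, Set.ncard_univ]
    simp
  side_edges := by
    intro i p hp v hv hi
    have hvp : v ∈ p.1 := by obtain ⟨w, hw⟩ := hv; exact hw ▸ left_mem_segment ℝ v w
    obtain ⟨e, he, rfl, rfl, h1, v, hv, w, h2, h3⟩ := h.rho_side hp hvp hi
    rw [h3, h2.hasType_iff hv, h2.hasType_iff hv]
    by_cases hl : e.OnLongSide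
    · left
      rw [(h.long_side e hl).1] at h1
      injection h1 with h1
      exact ⟨h1.symm, by rw [outerSide_long hl]; simp⟩
    · right
      rw [(h.short_side e (he.resolve_left hl)).1] at h1
      injection h1 with h1
      exact ⟨h1.symm, by rw [outerSide_short hl]; simp⟩
  side_mono := by
    rintro i p hp q hq x ⟨hx, hxi⟩ y ⟨hy, hyi⟩ hlt
    obtain ⟨e, he, rfl, rfl, h1, -⟩ := h.rho_side hp hx hxi
    obtain ⟨f, hf, rfl, hs, h2, -⟩ := h.rho_side hq hy hyi
    by_cases hl : e.OnLongSide
    · rw [(h.long_side e hl).1] at h1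
      injection h1 with h1
      rw [← h1]
      exact Nat.zero_le _
    · have hse := he.resolve_left hl
      rw [(h.short_side e hse).1] at h1
      injection h1 with h1
      by_cases hlf : f.OnLongSide
      · exfalso
        rw [hs, h.outer_coord_next, ← hs, h.outer_coord_next, h.rank_lt_iff hf he hs.symm] at hlt
        have := rank_long hlf
        have := rank_short h.pos_n hse
        omega
      · rw [(h.short_side f (hf.resolve_left hlf)).1] at h2
        injection h2 with h2
        rw [← h1, ← h2]

theorem rho_mem_honey (h : Hive C L a) (hd : d ≤ n) : rho C L ∈ honey n d := by
  refine ⟨h.rho_triangular hd, 0, ?_⟩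
  have hex : ∀ j : Fin d, ∃ e : HiveEdge n d, ∃ he : e.IsOuter, e.outerSide = 0 ∧
      e.outerRank = j ∧ e.OnShortSide := by
    intro j
    obtain ⟨e, he, h1, h2, h3⟩ := exists_outer h.pos_n 0 (j.2.trans_le hd) hd
    exact ⟨e, he, h1, h2, h3.2 j.2⟩
  choose e he hs hr hsh using hex
  have hrun : ∀ j, ∃ e', MaxRun C .one (e j) e' := by
    intro j
    refine h.run_at_plus (h.short_side _ (hsh j)).1 ?_
    rw [plus_of_short (hsh j)]; trivial
  choose e' hm using hrun
  have harr := fun j => h.maxRun_arrow (hm j)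
  let S : Fin d → Set ℂ × SegColor := fun j =>
    (segment ℝ (dualPoint L (e' j).minus) (dualPoint L (e j).plus), .one)
  have hS : {p | p ∈ rho C L ∧ p.2 = .one ∧ (p.1 ∩ side 0).Nonempty} = S '' Set.univ := by
    ext p
    simp only [Set.mem_ofPred_eq, Set.image_univ, Set.mem_range]
    constructor
    · rintro ⟨hp, hc, z, hz, hi⟩
      obtain ⟨f, f', h1, h2⟩ := h.mem_rho.1 hp
      have hz' := hz
      rw [h2] at hz'
      obtain ⟨f₁, h3, h4, h5⟩ := (h.run_arrow h1.run h1.color).2 z hz'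
      obtain ⟨ho, h6, h7⟩ := h.onEdge_side h5 hi
      have hcf := h3.color h1.color
      have hshf : f₁.OnShortSide := by
        refine ho.resolve_left fun hl => ?_
        rw [(h.long_side _ hl).1, hc] at hcf
        cases hcf
      have hlt := rank_short h.pos_n hshf
      have heq : e ⟨f₁.outerRank, hlt⟩ = f₁ :=
        outer_unique h.pos_n (he _) ho ((hs _).trans h7) (hr _)
      have hf : f = f₁ := by
        refine h3.eq_of_reduced_plus ?_
        rw [plus_of_short hshf]; trivial
      refine ⟨⟨f₁.outerRank, hlt⟩, Prod.ext ?_ hc.symm⟩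
      have hru := (hm ⟨f₁.outerRank, hlt⟩).run
      have hrm := (hm ⟨f₁.outerRank, hlt⟩).minus
      rw [heq] at hru
      have hru' := h1.run
      rw [hf, hc] at hru'
      have := hru.unique_minus h.colorMap hru' hrm h1.minus
      simp only [S]
      rw [this, heq, h2, hf]
    · rintro ⟨j, rfl⟩
      refine ⟨h.mem_rho.2 ⟨e j, e' j, hm j, rfl⟩, rfl, dualPoint L (e j).plus,
        right_mem_segment ℝ _ _, ?_⟩
      rw [plus_of_short (hsh j)]
      exact (h.outer_mem_side _ _).2 (hs j).symm
  rw [hS, Set.ncard_image_of_injective _ ?_, Set.ncard_univ]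
  · simp
  · intro j k hjk
    have h1 := (harr j).unique (harr k) (congrArg Prod.fst hjk)
    have h2 := h.dual_injective (hm j).plus (hm k).plus h1.2.1
    rw [plus_of_short (hsh j), plus_of_short (hsh k)] at h2
    have h3 := DualVertex.outer.inj h2
    have h4 := hr j
    rw [h3, hr k] at h4
    exact Fin.ext h4.symm

theorem rho_mem (h : Hive C L a) (hd : d ≤ n) :
    rho C L ∈ honeyOnBdry d (reducedGraph C) a :=
  ⟨⟨h.rho_mem_honey hd, ⟨h.iso⟩⟩, h.rho_hasBoundary hd⟩

/-! ### Signs of the vertices of the honeycomb -/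

theorem exists_adj (h : Hive C L a) (x : (reducedGraph C).V) : ∃ y, (reducedGraph C).Adj x y := by
  obtain ⟨c, g, y, g', p⟩ := Port.exists_at h.colorMap h.outer_not_m x
  exact ⟨y, p.adj h.pos_n⟩

/-- Two outer vertices are not adjacent, as the long sides have colour `0` and sign `-1` and the
short sides have colour `1` and sign `1`. -/
theorem adj_outer (h : Hive C L a) {x y : (reducedGraph C).V} {e : HiveEdge n d} {he}
    (hx : x.1 = .outer e he) (hxy : (reducedGraph C).Adj x y) : ∃ f, y.1 = .face f := by
  rcases hy : y.1 with f | ⟨e', he'⟩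
  · exact ⟨f, rfl⟩
  have hs := sign_adj h.pos_n hxy
  obtain ⟨c, hc⟩ := hxy
  obtain ⟨g, g', p⟩ := (Port.edge_iff h.pos_n).1 hc
  have h1 := p.incident
  have h2 := p.symm.incident
  rw [hx] at h1 hs
  rw [hy] at h2 hs
  cases h1
  cases h2
  have h3 := p.color.trans p.symm.color.symm
  by_cases hl : e.OnLongSide <;> by_cases hl' : e'.OnLongSide
  · norm_num [DualVertex.sign, hl, hl'] at hs
  · simp [(h.long_side e hl).1, (h.short_side e' (he'.resolve_left hl')).1] at h3
  · simp [(h.long_side e' hl').1, (h.short_side e (he.resolve_left hl)).1] at h3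
  · norm_num [DualVertex.sign, hl, hl'] at hs

theorem vertexSign_iso (h : Hive C L a) (x : (reducedGraph C).V) :
    vertexSign (rho C L) (h.iso.toEquiv x) = x.1.sign := by
  have hinner : ∀ x : (reducedGraph C).V, innerSign (rho C L) (h.iso.toEquiv x) = x.1.sign := by
    intro x
    have hadj : ∀ w, (structureGraph (rho C L)).Adj (h.iso.toEquiv x) w →
        ∃ l, (x.1.sign = 1 ∧ Arrow l w.1 (dualPoint L x.1)) ∨
          (x.1.sign = -1 ∧ Arrow l (dualPoint L x.1) w.1) := by
      intro w hw
      obtain ⟨y, rfl⟩ := h.iso.toEquiv.surjective w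
      obtain ⟨c, hc⟩ := (h.iso.adj_iff _ _).1 hw
      obtain ⟨g, _, p⟩ := (Port.edge_iff h.pos_n).1 hc
      exact ⟨g.type, h.port_arrow p⟩
    obtain ⟨y, hy⟩ := h.exists_adj x
    replace hy := (h.iso.adj_iff _ _).2 hy
    obtain ⟨l, ⟨hs, -⟩ | ⟨hs, hl⟩⟩ := hadj _ hy
    · rw [innerSign, hs, if_pos]
      intro w hw
      obtain ⟨l, ⟨-, hl⟩ | ⟨hs', -⟩⟩ := hadj w hw
      · obtain ⟨r, hr, he⟩ := Arrow.iff_exists.1 hl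
        exact ⟨l, r, hr.le, by rw [h.iso_apply, he]; ring⟩
      · linarith
    · rw [innerSign, hs, if_neg]
      intro hall
      obtain ⟨k, r, hr, he⟩ := hall _ hy
      rcases hr.eq_or_lt with rfl | hr
      · exact hl.ne (by simpa [h.iso_apply] using he.symm)
      · refine hl.not_symm (k := k) (Arrow.iff_exists.2 ⟨r, hr, ?_⟩)
        rw [he, h.iso_apply]; ring
  unfold vertexSign
  rw [h.iso.degree_eq]
  rcases hx : x.1 with f | ⟨e, he⟩
  · rw [h.degree_face hx, if_neg (by norm_num), ← hx]
    exact hinner x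
  · rw [h.degree_outer hx, if_pos rfl]
    have hadj : ∀ y, (reducedGraph C).Adj x y → y.1.sign = -(DualVertex.outer e he).sign :=
      fun y hy => hx ▸ sign_adj h.pos_n hy
    obtain ⟨y, hy⟩ := h.exists_adj x
    have hs := hadj y hy
    by_cases hl : e.OnLongSide
    · have hse : (DualVertex.outer e he).sign = -1 := if_pos hl
      rw [hse] at hs ⊢
      refine if_pos ⟨h.iso.toEquiv y, (h.iso.adj_iff _ _).2 hy, ?_⟩
      rw [hinner y, hs]
      norm_num
    · have hse : (DualVertex.outer e he).sign = 1 := if_neg hl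
      rw [hse]
      refine if_neg ?_
      rintro ⟨w, hw, hw1⟩
      obtain ⟨y', rfl⟩ := h.iso.toEquiv.surjective w
      rw [h.iso.adj_iff] at hw
      rw [hinner y', hadj y' hw, hse] at hw1
      norm_num at hw1

end Hive

end

section

variable {n d : ℕ}
variable {C : HiveEdge n d → HiveColor} {L : HiveEdge n d → ℝ} {a : Fin 3 → Fin n → ℝ}
variable {c : SegColor}

/-! ### The flow of a dual hive -/

namespace Hive

theorem run_height (h : Hive C L a) {e e' : HiveEdge n d} (hr : MaxRun C c e e') :
    segHeight (segment ℝ (dualPoint L e.plus) (dualPoint L e'.minus)) = L e := by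
  rw [segment_symm, (h.maxRun_arrow hr).segHeight_eq (h.dual_mem _),
    (h.maxRun_arrow hr).1, h.plus_coord]

open Classical in
/-- The flow on the reduced graph defined by a dual hive: up to sign, it is the label of the maximal
chains. -/
def flow (h : Hive C L a) : (reducedGraph C).flows :=
  ⟨fun x y => if (reducedGraph C).Adj x y then
      x.1.sign * segHeight (segment ℝ (dualPoint L x.1) (dualPoint L y.1)) else 0, by
    refine ⟨fun x y => ?_, fun x y hxy => if_neg hxy⟩
    by_cases hxy : (reducedGraph C).Adj x y
    · refine (if_pos hxy).trans (Eq.trans ?_ (congrArg Neg.neg (if_pos hxy.symm)).symm)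
      rw [segment_symm]
      refine (congrArg (· * _) ?_).trans (neg_mul _ _)
      exact sign_adj h.pos_n hxy.symm
    · refine (if_neg hxy).trans (Eq.trans neg_zero.symm (congrArg Neg.neg (if_neg ?_)).symm)
      exact fun hyx => hxy hyx.symm⟩

theorem flow_adj (h : Hive C L a) {x y : (reducedGraph C).V} (hxy : (reducedGraph C).Adj x y) :
    h.flow.1 x y = x.1.sign * segHeight (segment ℝ (dualPoint L x.1) (dualPoint L y.1)) :=
  if_pos hxy

theorem flow_run (h : Hive C L a) {e e' : HiveEdge n d} (hr : MaxRun C c e e') :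
    h.flow.1 ⟨e.plus, hr.plus⟩ ⟨e'.minus, hr.minus⟩ = L e := by
  have hadj : (reducedGraph C).Adj ⟨e.plus, hr.plus⟩ ⟨e'.minus, hr.minus⟩ :=
    ⟨c, (reducedGraph_edge_iff h.pos_n).2 ⟨e, e', hr, .inl ⟨rfl, rfl⟩⟩⟩
  refine (if_pos hadj).trans ?_
  rw [h.run_height hr]
  exact (congrArg (· * L e) (sign_plus h.pos_n e)).trans (one_mul _)

theorem isFlowOf_iff (h : Hive C L a)
    (hid : ∀ φ : (reducedGraph C).Iso (reducedGraph C), ∀ x, φ.toEquiv x = x)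
    (ω : (reducedGraph C).flows) : IsFlowOf (reducedGraph C) (rho C L) ω ↔ ω = h.flow := by
  have key : ∀ x y, (reducedGraph C).Adj x y → h.flow.1 x y =
      vertexSign (rho C L) (h.iso.toEquiv x) *
        segHeight (segment ℝ (h.iso.toEquiv x).1 (h.iso.toEquiv y).1) := by
    intro x y hxy
    rw [h.vertexSign_iso]
    exact if_pos hxy
  constructor
  · rintro ⟨ι, hι⟩
    have hι' : ∀ x, ι.toEquiv x = h.iso.toEquiv x := by
      intro x
      have := hid (ι.trans h.iso.symm) x
      change h.iso.toEquiv.symm (ι.toEquiv x) = x at this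
      rw [Equiv.symm_apply_eq] at this
      exact this
    refine Subtype.ext (funext fun x => funext fun y => ?_)
    by_cases hxy : (reducedGraph C).Adj x y
    · rw [hι x y hxy, key x y hxy, hι', hι']
    · rw [ω.2.2 x y hxy, h.flow.2.2 x y hxy]
  · rintro rfl
    exact ⟨h.iso, key⟩

theorem flow_divergence (h : Hive C L a) : h.flow ∈ (reducedGraph C).flowsWithDiv (divergence C a)
    := by
  intro x
  obtain ⟨oe, h1, h2, h3⟩ := h.exists_neighbours x
  have hval : ∀ g, h.flow.1 x (oe g) = x.1.sign * L g.1 := by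
    intro g
    rw [h.flow_adj ((h2 _).2 ⟨g, rfl⟩)]
    congr 1
    obtain ⟨c, g', e, e', hr, ⟨h4, h5, h6, -⟩ | ⟨h4, h5, h6, -⟩⟩ := h3 g
    · rw [h6, h5, h4, h.run_height hr]
    · rw [h6, h5, h4, segment_symm, h.run_height hr, h.run_label hr.run]
  have hsum : ∑ᶠ y, h.flow.1 x y = ∑ᶠ g ∈ {g : HiveEdge n d | x.1.Incident g}, x.1.sign * L g := by
    rw [← finsum_mem_univ, finsum_mem_inter_support_eq' _ _ (Set.range oe) fun y hy => ?_,
      finsum_mem_range h1, finsum_congr hval]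
    · exact finsum_set_coe_eq_finsum_mem (f := fun g => x.1.sign * L g) {g | x.1.Incident g}
    · simpa using (h2 y).1 (by_contra fun hxy => hy (h.flow.2.2 x y hxy))
  rw [hsum]
  rcases hx : x.1 with f | ⟨e, he⟩
  · have : {g : HiveEdge n d | (DualVertex.face f).Incident g} = Set.range f.edge := by
      ext g; simp [DualVertex.Incident]
    rw [this, finsum_mem_range fun _ _ => edge_injective f, finsum_eq_sum_of_fintype,
      Fin.sum_univ_three, ← mul_add, ← mul_add]
    have := h.sum f 0
    simp only [zero_add] at this
    change L (f.edge 0) + L (f.edge 1) + L (f.edge 2) = 1 at this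
    rw [this, mul_one]
    rcases f with ⟨u, hu⟩ | ⟨u, hu⟩ <;> simp [divergence, hx, DualVertex.sign]
  · have : {g : HiveEdge n d | (DualVertex.outer e he).Incident g} = {e} := by
      ext g; simp [DualVertex.Incident, eq_comm]
    rw [this, finsum_mem_singleton]
    by_cases hl : e.OnLongSide
    · obtain ⟨h4, h5⟩ := h.long_side e hl
      simp [divergence, hx, DualVertex.sign, hl, h4, h5]
    · obtain ⟨h4, h5⟩ := h.short_side e (he.resolve_left hl)
      simp [divergence, hx, DualVertex.sign, hl, h4, h5]

end Hive

/-! ### Recovering the labels from the flow -/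

/-- The linear functionals on flows with integer coefficients. -/
def IntegralFunctional (G : ColoredGraph) : AddSubgroup (Module.Dual ℝ G.flows) where
  carrier := {ℓ | ∀ x y hxy, ∃ k : ℤ, ℓ (G.deltaFlow x y hxy) = k}
  zero_mem' _ _ _ := ⟨0, by simp⟩
  add_mem' h1 h2 x y hxy := by
    obtain ⟨k, hk⟩ := h1 x y hxy
    obtain ⟨l, hl⟩ := h2 x y hxy
    exact ⟨k + l, by simp [hk, hl]⟩
  neg_mem' h1 x y hxy := by
    obtain ⟨k, hk⟩ := h1 x y hxy
    exact ⟨-k, by simp [hk]⟩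

/-- The value of a flow at an oriented edge. -/
def flowEval (G : ColoredGraph) (x y : G.V) : Module.Dual ℝ G.flows :=
  LinearMap.proj y ∘ₗ LinearMap.proj x ∘ₗ G.flows.subtype

theorem flowEval_integral (G : ColoredGraph) (x y : G.V) : flowEval G x y ∈ IntegralFunctional G :=
    by
  intro b c hbc
  change ∃ k : ℤ, (G.deltaFlow b c hbc).1 x y = k
  simp only [ColoredGraph.deltaFlow]
  split_ifs
  · exact ⟨0, by simp⟩
  · exact ⟨1, by simp⟩
  · exact ⟨-1, by simp⟩
  · exact ⟨0, by simp⟩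

/-- Every label of a dual hive is an integral functional of its flow. An edge of colour `m` is the
third edge of a face whose other labels belong to chains, and the sum `1` of the labels of a face is
itself such a functional, because there is a face all of whose edges belong to chains. -/
theorem exists_functional (C : HiveEdge n d → HiveColor) (hd : d ≤ n) (e : HiveEdge n d) :
    ∃ ℓ ∈ IntegralFunctional (reducedGraph C),
      ∀ (L : HiveEdge n d → ℝ) (a : Fin 3 → Fin n → ℝ) (h : Hive C L a), ℓ h.flow = L e := by
  by_cases hex : ∃ L a, Hive C (n := n) (d := d) L a
  swap
  · exact ⟨0, zero_mem _, fun L a h => absurd ⟨L, a, h⟩ hex⟩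
  obtain ⟨L₀, a₀, h₀⟩ := hex
  have hseg : ∀ e : HiveEdge n d, C e ≠ .m → ∃ ℓ ∈ IntegralFunctional (reducedGraph C),
      ∀ (L : HiveEdge n d → ℝ) (a : Fin 3 → Fin n → ℝ) (h : Hive C L a), ℓ h.flow = L e := by
    intro e he
    obtain ⟨c, hc⟩ : ∃ c, C e = .seg c := by
      cases hc : C e with
      | seg c => exact ⟨c, rfl⟩
      | m => exact absurd hc he
    obtain ⟨e₁, e₂, h1, h2, h3⟩ := exists_maxRun h₀.colorMap h₀.outer_not_m e hc
    refine ⟨flowEval _ ⟨e₁.plus, h1.plus⟩ ⟨e₂.minus, h1.minus⟩, flowEval_integral _ _ _, ?_⟩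
    intro L a h
    exact (h.flow_run h1).trans (h.run_label h2).symm
  by_cases he : C e ≠ .m
  · exact hseg e he
  rw [not_not] at he
  obtain ⟨f, hf⟩ : ∃ f : HiveFace n d, InReduced C (.face f) := by
    obtain ⟨g, hg, -⟩ := exists_outer (d := d) h₀.pos_n 0 h₀.pos_n hd
    obtain ⟨y, hy⟩ := h₀.exists_adj ⟨.outer g hg, trivial⟩
    obtain ⟨f, hf⟩ := h₀.adj_outer rfl hy
    exact ⟨f, hf ▸ y.2⟩
  have hs : ¬ e.OnShortSide := fun hs => h₀.outer_not_m e (.inr hs) he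
  have hup : C ((e.up hs).edge e.type) = .m := by rwa [up_edge]
  have hne : ∀ k, k ≠ e.type → C ((e.up hs).edge k) ≠ .m := by
    intro k hk hm
    obtain ⟨h1, h2⟩ := m_face h₀.colorMap hup
    rcases idx_cases e.type k with rfl | rfl | rfl
    · exact hk rfl
    · rw [h1] at hm; cases hm
    · rw [h2] at hm; cases hm
  choose ℓ hℓ using fun k => hseg (f.edge k) (hf k)
  obtain ⟨ℓ₁, h1, h2⟩ := hseg _ (hne (e.type + 1) (by simp))
  obtain ⟨ℓ₂, h3, h4⟩ := hseg _ (hne (e.type + 2) (by simp))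
  refine ⟨ℓ 0 + ℓ 1 + ℓ 2 - ℓ₁ - ℓ₂, sub_mem (sub_mem (add_mem (add_mem (hℓ 0).1 (hℓ 1).1)
    (hℓ 2).1) h1) h3, fun L a h => ?_⟩
  simp only [LinearMap.sub_apply, LinearMap.add_apply]
  rw [(hℓ 0).2 L a h, (hℓ 1).2 L a h, (hℓ 2).2 L a h, h2 L a h, h4 L a h]
  have h5 := h.sum (e.up hs) e.type
  have h6 := h.sum f 0
  rw [up_edge] at h5
  change L (f.edge 0) + L (f.edge 1) + L (f.edge 2) = 1 at h6
  linarith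

theorem exists_integral_inverse (C : HiveEdge n d → HiveColor) (hd : d ≤ n) :
    ∃ M : (reducedGraph C).flows →ₗ[ℝ] (HiveEdge n d → ℝ), (reducedGraph C).IsIntegral M ∧
      ∀ (L : HiveEdge n d → ℝ) (a : Fin 3 → Fin n → ℝ) (h : Hive C L a), M h.flow = L := by
  choose ℓ h1 h2 using exists_functional C hd
  exact ⟨LinearMap.pi ℓ, fun x y hxy e => h1 e x y hxy, fun L a h => funext fun e => h2 e L a h⟩

end

section

variable {n d : ℕ} {a : Fin 3 → Fin n → ℝ}

/-! ### Honeycombs as webs -/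

/-- The combinatorial content of a triangular honeycomb with boundary values `a`: a family of
segments, oriented in the direction of their types. An interior endpoint is either the head of one
segment of each type or the tail of one segment of each type. -/
structure Web (n : ℕ) (a : Fin 3 → Fin n → ℝ) (ι : Type) where
  typ : ι → Fin 3
  col : ι → SegColor
  tail : ι → ℂ
  head : ι → ℂ
  arrow : ∀ p, Arrow (typ p) (tail p) (head p)
  tail_mem : ∀ p, tail p ∈ triangle
  head_mem : ∀ p, head p ∈ triangle
  cross : ∀ p q z, p ≠ q → z ∈ segInterior (segment ℝ (tail p) (head p)) →
    z ∈ segInterior (segment ℝ (tail q) (head q)) →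
    (col p = .zero ∧ col q = .one ∧ typ q = typ p + 2) ∨
      (col q = .zero ∧ col p = .one ∧ typ p = typ q + 2)
  head_meet : ∀ p q, p ≠ q → head p = head q →
    (typ q = typ p + 1 ∧ (col p, col q) ∈ allowedPairs) ∨
      (typ p = typ q + 1 ∧ (col q, col p) ∈ allowedPairs)
  tail_meet : ∀ p q, p ≠ q → tail p = tail q →
    (typ q = typ p + 1 ∧ (col p, col q) ∈ allowedPairs) ∨
      (typ p = typ q + 1 ∧ (col q, col p) ∈ allowedPairs)
  head_ne_tail : ∀ p q, head p ≠ tail q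
  head_full : ∀ p, (∀ i, 0 < coord (head p) i) → ∀ l, ∃ q, typ q = l ∧ head q = head p
  tail_full : ∀ p, (∀ i, 0 < coord (tail p) i) → ∀ l, ∃ q, typ q = l ∧ tail q = tail p
  head_side : ∀ p i, coord (head p) i = 0 → col p = .one ∧ typ p = i + 2
  tail_side : ∀ p i, coord (tail p) i = 0 → col p = .zero ∧ typ p = i + 1
  anti : ∀ i, StrictAnti (a i)
  bdry : ∀ i t, (∃ p, (coord (head p) i = 0 ∧ coord (head p) (i + 1) = t) ∨
    (coord (tail p) i = 0 ∧ coord (tail p) (i + 1) = t)) ↔ ∃ j, a i j = t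
  mono : ∀ i p q, coord (head p) i = 0 → coord (tail q) i = 0 →
    coord (tail q) (i + 1) < coord (head p) (i + 1)

theorem IsTriangular.exists_web {h : ColoredSegments} (ht : IsTriangular n h) (hb : HasBoundary h a)
    :
    ∃ W : Web n a h, ∀ p : h, p.1 = (segment ℝ (W.tail p) (W.head p), W.col p) := by
  have hex : ∀ p : h, ∃ (l : Fin 3) (v w : ℂ), v ∈ triangle ∧ w ∈ triangle ∧ Arrow l v w ∧
      p.1.1 = segment ℝ v w := by
    intro p
    obtain ⟨l, hl⟩ := ht.types p.1 p.2
    obtain ⟨v, hv, w, hw, h1, h2⟩ := exists_arrow (ht.honeycomb.segments p.1 p.2) hl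
    exact ⟨l, v, w, hv, hw, h1, h2⟩
  choose typ tail head htail hhead harr hseg using hex
  have hp1 : ∀ p : h, p.1 = (segment ℝ (tail p) (head p), p.1.2) := fun p => Prod.ext (hseg p) rfl
  have hends : ∀ p : h, endpoints p.1.1 = {tail p, head p} := fun p => by
    rw [hseg, (harr p).endpoints_eq]
  have hsame : ∀ p q : h, tail p = tail q → head p = head q → p = q := by
    intro p q h1 h2
    have h3 : p.1.1 = q.1.1 := by rw [hseg, hseg, h1, h2]
    exact Subtype.ext (Prod.ext h3 (ht.honeycomb.color_unique p.1.1 _ _ p.2 (by rw [h3]; exact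
        q.2)))
  have hmeet : ∀ p q : h, p ≠ q → ∀ v, endpoints p.1.1 ∩ endpoints q.1.1 = {v} →
      ((v = tail p ∧ v = tail q ∨ v = head p ∧ v = head q) ∧
        ((typ q = typ p + 1 ∧ (p.1.2, q.1.2) ∈ allowedPairs) ∨
          (typ p = typ q + 1 ∧ (q.1.2, p.1.2) ∈ allowedPairs))) := by
    intro p q hpq v hv
    rcases ht.honeycomb.meet p.1 p.2 q.1 q.2 v hv with h1 | h1
    · rw [hp1 p, hp1 q] at h1
      obtain ⟨h2, h3, h4⟩ := (Arrow.meetOK_iff (harr p) (harr q)).1 h1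
      exact ⟨h4, .inl ⟨h3, h2⟩⟩
    · rw [hp1 p, hp1 q] at h1
      obtain ⟨h2, h3, h4⟩ := (Arrow.meetOK_iff (harr q) (harr p)).1 h1
      exact ⟨h4.imp And.symm And.symm, .inr ⟨h3, h2⟩⟩
  have hne : ∀ p q : h, head p ≠ tail q := by
    intro p q h1
    by_cases hpq : p = q
    · subst hpq; exact (harr p).ne h1.symm
    by_cases h2 : tail p = head q
    · have := harr p
      rw [h2, h1] at this
      exact (harr q).not_symm this
    have h3 : endpoints p.1.1 ∩ endpoints q.1.1 = {head p} := by
      have h4 := (harr p).ne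
      rw [hends, hends]
      grind
    rcases (hmeet p q hpq _ h3).1 with ⟨h4, -⟩ | ⟨-, h4⟩
    · exact (harr p).ne h4.symm
    · exact (harr q).ne (h1.symm.trans h4)
  have hheads : ∀ p q : h, p ≠ q → head p = head q → endpoints p.1.1 ∩ endpoints q.1.1 = {head p} :=
      by
    intro p q hpq h1
    have h2 : tail p ≠ tail q := fun h => hpq (hsame p q h h1)
    have h3 := hne q p
    rw [hends, hends]
    grind
  have htails : ∀ p q : h, p ≠ q → tail p = tail q → endpoints p.1.1 ∩ endpoints q.1.1 = {tail p} :=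
      by
    intro p q hpq h1
    have h2 : head p ≠ head q := fun h => hpq (hsame p q h1 h)
    have h3 := hne p q
    rw [hends, hends]
    grind
  have hside : ∀ p : h, ∀ v ∈ endpoints p.1.1, v ∈ triangle → ∀ i, coord v i = 0 →
      (p.1.2 = .zero ∧ typ p = i + 1) ∨ (p.1.2 = .one ∧ typ p = i + 2) := by
    intro p v hv hT i hi
    have := ht.side_edges i p.1 p.2 v hv (mem_side.2 ⟨mem_triangle.1 hT, hi⟩)
    rw [hseg, (harr p).hasType_iff (htail p), (harr p).hasType_iff (htail p)] at this
    exact this.imp (And.imp_right Eq.symm) (And.imp_right Eq.symm)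
  have hheadside : ∀ p i, coord (head p) i = 0 → p.1.2 = .one ∧ typ p = i + 2 := by
    intro p i hi
    refine (hside p (head p) (by simp [hends]) (hhead p) i hi).resolve_left ?_
    rintro ⟨-, h1⟩
    have h2 := (harr p).2
    rw [h1, idx_one_two, hi] at h2
    exact absurd (mem_triangle.1 (htail p) i) (not_le.2 h2)
  have htailside : ∀ p i, coord (tail p) i = 0 → p.1.2 = .zero ∧ typ p = i + 1 := by
    intro p i hi
    refine (hside p (tail p) (by simp [hends]) (htail p) i hi).resolve_right ?_
    rintro ⟨-, h1⟩
    have h2 := (harr p).coord_one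
    rw [h1, idx_two_one, hi] at h2
    exact absurd (mem_triangle.1 (hhead p) i) (not_le.2 h2)
  have hty : ∀ p q : h, ((typ q = typ p + 1 ∧ (p.1.2, q.1.2) ∈ allowedPairs) ∨
          (typ p = typ q + 1 ∧ (q.1.2, p.1.2) ∈ allowedPairs)) → typ p ≠ typ q := by
    rintro p q (⟨h1, -⟩ | ⟨h1, -⟩) h2 <;> simp [h2] at h1
  have hfull : ∀ (p : h) (v : ℂ), v ∈ endpoints p.1.1 → (∀ i, 0 < coord v i) →
      (∀ l, ∃ q, typ q = l ∧ head q = v) ∨ ∀ l, ∃ q, typ q = l ∧ tail q = v := by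
    intro p v hp hpos
    have hv : v ∈ vertexSet h := Set.mem_biUnion p.2 hp
    have hdeg : (structureGraph h).degree ⟨v, hv⟩ = 3 := by
      refine (ht.degrees ⟨v, hv⟩).resolve_left fun h1 => ?_
      have : v ∈ support h ∩ triangleBoundary := by
        rw [ht.boundary]; exact ⟨_, h1, rfl⟩
      obtain ⟨i, hi⟩ := mem_triangleBoundary.1 this.2
      exact absurd (mem_side.1 hi).2 (hpos i).ne'
    have := (Set.finite_of_ncard_ne_zero (hdeg.trans_ne (by decide : 3 ≠ 0))).to_subtype
    let w := (Finite.equivFinOfCardEq hdeg).symm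
    have hadj : ∀ i, ∃ q : h, q.1.1 = segment ℝ v (w i).1.1 := fun i => by
      obtain ⟨c, -, hc⟩ := (w i).2
      exact ⟨⟨_, hc⟩, rfl⟩
    choose q hq using hadj
    have hcases : ∀ i, (tail (q i) = v ∧ head (q i) = (w i).1.1) ∨
        (head (q i) = v ∧ tail (q i) = (w i).1.1) := by
      intro i
      rcases (harr (q i)).segment_eq ((hseg _).symm.trans (hq i)).symm with ⟨h5, h6⟩ | ⟨h5, h6⟩
      · exact .inl ⟨h5.symm, h6.symm⟩
      · exact .inr ⟨h5.symm, h6.symm⟩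
    have hinj : Function.Injective q := by
      intro i j hij
      refine w.injective (Subtype.ext (Subtype.ext ?_))
      rcases hcases i with ⟨h5, h6⟩ | ⟨h5, h6⟩ <;> rcases hcases j with ⟨h7, h8⟩ | ⟨h7, h8⟩ <;>
        rw [hij] at h5 h6
      · exact h6.symm.trans h8
      · exact absurd (h7.trans h5.symm) (hne _ _)
      · exact absurd (h5.trans h7.symm) (hne _ _)
      · exact h6.symm.trans h8
    have hsurj : (∀ i j, i ≠ j → typ (q i) ≠ typ (q j)) → ∀ l, ∃ i, typ (q i) = l := fun hd =>
      Finite.surjective_of_injective fun i j hij => by_contra fun hne => hd i j hne hij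
    rcases hcases 0 with ⟨h5, -⟩ | ⟨h5, -⟩
    · have h1 : ∀ i, tail (q i) = v := fun i =>
        ((hcases i).resolve_right fun h7 => hne _ _ (h7.1.trans h5.symm)).1
      refine .inr fun l => (hsurj (fun i j hij => hty _ _ (hmeet _ _ (hinj.ne hij) _
        (htails _ _ (hinj.ne hij) ((h1 i).trans (h1 j).symm))).2) l).elim fun i hi => ⟨q i, hi, h1
            i⟩
    · have h1 : ∀ i, head (q i) = v := fun i =>
        ((hcases i).resolve_left fun h7 => hne _ _ (h5.trans h7.1.symm)).1
      refine .inl fun l => (hsurj (fun i j hij => hty _ _ (hmeet _ _ (hinj.ne hij) _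
        (hheads _ _ (hinj.ne hij) ((h1 i).trans (h1 j).symm))).2) l).elim fun i hi => ⟨q i, hi, h1
            i⟩
  refine ⟨⟨typ, fun p => p.1.2, tail, head, harr, htail, hhead, ?_, ?_, ?_, hne, ?_, ?_, hheadside,
    htailside, fun i => (hb i).1, ?_, ?_⟩, hp1⟩
  · intro p q z hpq h1 h2
    rw [← hseg] at h1 h2
    rcases ht.honeycomb.cross p.1 p.2 q.1 q.2 (fun h => hpq (Subtype.ext h)) ⟨z, h1, h2⟩ with h3 |
        h3
    · rw [hp1 p, hp1 q] at h3
      exact .inl ((Arrow.crossOK_iff (harr p) (harr q)).1 h3)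
    · rw [hp1 p, hp1 q] at h3
      exact .inr ((Arrow.crossOK_iff (harr q) (harr p)).1 h3)
  · exact fun p q hpq h1 => (hmeet p q hpq _ (hheads p q hpq h1)).2
  · exact fun p q hpq h1 => (hmeet p q hpq _ (htails p q hpq h1)).2
  · exact fun p hp => (hfull p (head p) (by simp [hends]) hp).resolve_right fun h1 =>
      (h1 0).elim fun _ h2 => hne _ _ h2.2.symm
  · exact fun p hp => (hfull p (tail p) (by simp [hends]) hp).resolve_left fun h1 =>
      (h1 0).elim fun _ h2 => hne _ _ h2.2
  · intro i t
    have hmem : ∀ z, z ∈ support h ∩ side i ↔ ∃ p : h, (z = head p ∨ z = tail p) ∧ coord z i = 0 :=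
        by
      intro z
      constructor
      · rintro ⟨h1, h2⟩
        have : z ∈ support h ∩ triangleBoundary := ⟨h1, mem_triangleBoundary.2 ⟨i, h2⟩⟩
        rw [ht.boundary] at this
        obtain ⟨v, -, rfl⟩ := this
        obtain ⟨p, hp, hv⟩ := Set.mem_iUnion₂.1 v.2
        rw [hends ⟨p, hp⟩] at hv
        exact ⟨⟨p, hp⟩, hv.symm, (mem_side.1 h2).2⟩
      · rintro ⟨p, h1, h2⟩
        have h3 : z ∈ p.1.1 ∧ z ∈ triangle := by
          rw [hseg]
          rcases h1 with rfl | rfl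
          · exact ⟨right_mem_segment ℝ _ _, hhead p⟩
          · exact ⟨left_mem_segment ℝ _ _, htail p⟩
        exact ⟨Set.mem_biUnion p.2 h3.1, mem_side.2 ⟨mem_triangle.1 h3.2, h2⟩⟩
    have h2 := Set.ext_iff.1 (hb i).2 t
    simp only [Set.mem_image, Set.mem_range] at h2
    rw [← h2]
    constructor
    · rintro ⟨p, ⟨h3, h4⟩ | ⟨h3, h4⟩⟩
      · exact ⟨_, (hmem _).2 ⟨p, .inl rfl, h3⟩, h4⟩
      · exact ⟨_, (hmem _).2 ⟨p, .inr rfl, h3⟩, h4⟩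
    · rintro ⟨z, hz, h4⟩
      obtain ⟨p, rfl | rfl, h5⟩ := (hmem z).1 hz
      · exact ⟨p, .inl ⟨h5, h4⟩⟩
      · exact ⟨p, .inr ⟨h5, h4⟩⟩
  · intro i p q h1 h2
    by_contra hlt
    rcases (not_lt.1 hlt).eq_or_lt with h3 | h3
    · refine hne p q (coord_ext (i + 1) h3 ?_)
      rw [idx_one_two, h1, h2]
    · have := ht.side_mono i p.1 p.2 q.1 q.2 (head p)
        ⟨by rw [hseg]; exact right_mem_segment ℝ _ _, mem_side.2 ⟨mem_triangle.1 (hhead p), h1⟩⟩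
        (tail q) ⟨by rw [hseg]; exact left_mem_segment ℝ _ _,
          mem_side.2 ⟨mem_triangle.1 (htail q), h2⟩⟩ h3
      rw [(hheadside p i h1).1, (htailside q i h2).1] at this
      simp [SegColor.toNat] at this

end

section

open Filter Topology

/-! ### Directional slopes of piecewise linear functions -/

/-- Along the ray from `x` in the direction `w`, the function `f` is initially affine with
slope `m`. -/
def HasSlope (f : (Fin 3 → ℝ) → ℝ) (x w : Fin 3 → ℝ) (m : ℝ) : Prop :=
  ∀ᶠ s in 𝓝[>] (0 : ℝ), f (x + s • w) = f x + s * m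

namespace HasSlope

variable {f g : (Fin 3 → ℝ) → ℝ} {x w : Fin 3 → ℝ} {m k : ℝ}

theorem unique (h : HasSlope f x w m) (h' : HasSlope f x w k) : m = k := by
  obtain ⟨s, h1, h2, h3⟩ := (h.and (h'.and self_mem_nhdsWithin)).exists
  have h3 : 0 < s := h3
  rw [h1] at h2
  have : s * m = s * k := by linarith
  exact mul_left_cancel₀ h3.ne' this

theorem add (h : HasSlope f x w m) (h' : HasSlope g x w k) :
    HasSlope (fun z => f z + g z) x w (m + k) := by
  filter_upwards [h, h'] with s h1 h2
  rw [h1, h2]; ring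

theorem sub (h : HasSlope f x w m) (h' : HasSlope g x w k) :
    HasSlope (fun z => f z - g z) x w (m - k) := by
  filter_upwards [h, h'] with s h1 h2
  rw [h1, h2]; ring

theorem sum {ι : Type*} (t : Finset ι) {f : ι → (Fin 3 → ℝ) → ℝ} {m : ι → ℝ}
    (h : ∀ i ∈ t, HasSlope (f i) x w (m i)) :
    HasSlope (fun z => ∑ i ∈ t, f i z) x w (∑ i ∈ t, m i) := by
  classical
  induction t using Finset.induction_on with
  | empty => exact Eventually.of_forall fun s => by simp
  | insert i t hi ih =>
    simp only [Finset.sum_insert hi]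
    exact (h i (by simp)).add (ih fun j hj => h j (by simp [hj]))

theorem max_lt (h : HasSlope f x w m) (h' : HasSlope g x w k) (hlt : g x < f x) :
    HasSlope (fun z => max (f z) (g z)) x w m := by
  have h1 : ∀ᶠ s in 𝓝[>] (0 : ℝ), g x + s * k < f x + s * m := by
    have : ContinuousAt (fun s : ℝ => f x + s * m - (g x + s * k)) 0 := by fun_prop
    have h2 := this.eventually (lt_mem_nhds (a := 0) (by simpa using hlt))
    filter_upwards [nhdsWithin_le_nhds h2] with s hs
    linarith
  filter_upwards [h, h', h1] with s h2 h3 h4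
  rw [h2, h3, max_eq_left h4.le, max_eq_left hlt.le]

theorem max_eq (h : HasSlope f x w m) (h' : HasSlope g x w k) (heq : g x = f x) :
    HasSlope (fun z => max (f z) (g z)) x w (max m k) := by
  filter_upwards [h, h', self_mem_nhdsWithin] with s h2 h3 h4
  have h4 : 0 < s := h4
  rw [h2, h3, heq, max_self, max_add_add_left, mul_max_of_nonneg _ _ h4.le]

theorem congr (h : HasSlope f x w m) (hm : m = k) : HasSlope f x w k := hm ▸ h

/-- If `f` has an opposite slope at least `-m` wherever it has a slope `m` inside a segment, then it
stays below its chords, and its initial slope is at most that of the chord. -/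
theorem le_chord (hf : Continuous f) {x w : Fin 3 → ℝ}
    (h : ∀ t : ℝ, 0 < t → t < 1 → ∃ m k, HasSlope f (x + t • w) w m ∧
      HasSlope f (x + t • w) (-w) k ∧ 0 ≤ m + k) {t : ℝ} (h0 : 0 ≤ t) (h1 : t ≤ 1) :
    f (x + t • w) ≤ f x + t * (f (x + w) - f x) := by
  set ψ : ℝ → ℝ := fun t => f (x + t • w) - (f x + t * (f (x + w) - f x)) with hψ
  suffices H : ∀ ε > 0, ψ t ≤ ε by
    have := le_of_forall_pos_le_add (a := ψ t) (b := 0) (fun ε hε => by simpa using H ε hε)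
    simp only [hψ] at this
    linarith
  intro ε hε
  have hcont : Continuous fun t => ψ t + ε * t ^ 2 := by
    simp only [hψ]
    fun_prop
  obtain ⟨t₀, ⟨ht0, ht1⟩, hmax⟩ := isCompact_Icc.exists_isMaxOn (s := Set.Icc (0 : ℝ) 1)
    ⟨0, by simp⟩ hcont.continuousOn
  have hle : ψ t ≤ ψ t₀ + ε * t₀ ^ 2 := by
    have h2 : ψ t + ε * t ^ 2 ≤ ψ t₀ + ε * t₀ ^ 2 := hmax ⟨h0, h1⟩
    have := mul_nonneg hε.le (sq_nonneg t)
    linarith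
  rcases ht0.eq_or_lt with rfl | ht0
  · have : ψ 0 = 0 := by simp [hψ]
    rw [this] at hle
    simp at hle
    linarith
  rcases ht1.eq_or_lt with rfl | ht1
  · have : ψ 1 = 0 := by simp [hψ]
    rw [this] at hle
    simpa using hle
  exfalso
  obtain ⟨m, k, hm, hk, hmk⟩ := h t₀ ht0 ht1
  have e1 : ∀ᶠ s in 𝓝[>] (0 : ℝ), t₀ + s ∈ Set.Icc (0 : ℝ) 1 ∧ t₀ - s ∈ Set.Icc (0 : ℝ) 1 := by
    have a1 : ∀ᶠ s in 𝓝 (0 : ℝ), s < min t₀ (1 - t₀) := gt_mem_nhds (lt_min ht0 (by linarith))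
    filter_upwards [nhdsWithin_le_nhds a1, self_mem_nhdsWithin] with s hs hs'
    have hs' : 0 < s := hs'
    obtain ⟨h2, h3⟩ := lt_min_iff.1 hs
    exact ⟨⟨by linarith, by linarith⟩, ⟨by linarith, by linarith⟩⟩
  obtain ⟨s, h2, h3, ⟨h4, h5⟩, h6⟩ := (hm.and (hk.and (e1.and self_mem_nhdsWithin))).exists
  have h6 : 0 < s := h6
  have m1 : ψ (t₀ + s) + ε * (t₀ + s) ^ 2 ≤ ψ t₀ + ε * t₀ ^ 2 := hmax h4
  have m2 : ψ (t₀ - s) + ε * (t₀ - s) ^ 2 ≤ ψ t₀ + ε * t₀ ^ 2 := hmax h5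
  have v1 : x + (t₀ + s) • w = x + t₀ • w + s • w := by rw [add_smul]; abel
  have v2 : x + (t₀ - s) • w = x + t₀ • w + s • -w := by rw [sub_smul, smul_neg]; abel
  simp only [hψ, v1, v2, h2, h3] at m1 m2
  have := mul_nonneg h6.le hmk
  have := mul_pos hε (mul_pos h6 h6)
  nlinarith

end HasSlope

/-! ### The support function of a small triangle -/

/-- The pairing with a basis vector of the lattice. -/
def lin (j : Fin 3) (z : Fin 3 → ℝ) : ℝ := (z j - z (j + 2)) / 3

theorem lin_sub (l : Fin 3) {z : Fin 3 → ℝ} (hz : z l + z (l + 1) + z (l + 2) = 0) :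
    lin l z - lin (l + 1) z = z l := by
  simp only [lin, idx_one_two]; linarith

theorem lin_neg (j : Fin 3) (z : Fin 3 → ℝ) : lin j (-z) = -lin j z := by
  simp [lin]; ring

theorem pairing_eq (l : Fin 3) (w : Fin 3 → ℝ) (v : Pt) :
    pairing w v = v l * lin l w + v (l + 1) * lin (l + 1) w + v (l + 2) * lin (l + 2) w := by
  rw [sum_rot l fun j => (v j : ℝ) * lin j w]; rfl

theorem pairing_lin (j : Fin 3) (w : Fin 3 → ℝ) : pairing w (eps j) = lin j w := pairing_eps w j

/-- The largest of the pairings with the basis vectors. -/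
def tri (z : Fin 3 → ℝ) : ℝ := max (lin 0 z) (max (lin 1 z) (lin 2 z))

theorem tri_eq (j : Fin 3) (z : Fin 3 → ℝ) :
    tri z = max (max (lin j z) (lin (j + 2) z)) (lin (j + 1) z) := by
  fin_cases j
  · change _ = max (max (lin 0 z) (lin 2 z)) (lin 1 z)
    rw [tri, max_assoc, max_comm (lin 2 z)]
  · change _ = max (max (lin 1 z) (lin 0 z)) (lin 2 z)
    rw [tri, max_right_comm, max_left_comm, max_assoc, max_comm (lin 0 z)]
  · change _ = max (max (lin 2 z) (lin 1 z)) (lin 0 z)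
    rw [tri, max_comm, max_comm (lin 1 z)]

theorem lin_le_tri (j : Fin 3) (z : Fin 3 → ℝ) : lin j z ≤ tri z := by
  rw [tri_eq j]; exact (le_max_left _ _).trans (le_max_left _ _)

theorem exists_lin_eq_tri (z : Fin 3 → ℝ) : ∃ j, lin j z = tri z := by
  unfold tri
  rcases max_choice (lin 0 z) (max (lin 1 z) (lin 2 z)) with h | h
  · exact ⟨0, h.symm⟩
  · rcases max_choice (lin 1 z) (lin 2 z) with h' | h'
    · exact ⟨1, (h.trans h').symm⟩
    · exact ⟨2, (h.trans h').symm⟩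

theorem HasSlope.lin (j : Fin 3) (y x w : Fin 3 → ℝ) : HasSlope (fun z => HoneyHive.lin j (z - y)) x
    w
    (HoneyHive.lin j w) := by
  refine Eventually.of_forall fun s => ?_
  simp [HoneyHive.lin]; ring

theorem HasSlope.neg_dir {f : (Fin 3 → ℝ) → ℝ} {x w y : Fin 3 → ℝ} {m : ℝ}
    (h : HasSlope f (y - x) (-w) m) : HasSlope (fun z => f (y - z)) x w m := by
  filter_upwards [h] with s hs
  rw [← hs]; congr 1; rw [smul_neg]; abel

/-- The slope of `tri` at `0`. -/
theorem hasSlope_tri_zero (w : Fin 3 → ℝ) : HasSlope tri 0 w (tri w) := by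
  filter_upwards [self_mem_nhdsWithin] with s hs
  have hs : 0 < s := hs
  have h0 : ∀ j, HoneyHive.lin j 0 = 0 := fun j => by simp [HoneyHive.lin]
  have h1 : ∀ j, HoneyHive.lin j (s • w) = s * HoneyHive.lin j w := fun j => by
    simp [HoneyHive.lin]; ring
  simp only [tri, h0, h1, zero_add, max_self, mul_max_of_nonneg _ _ hs.le]

/-- The sign patterns of a nonzero vector of sum zero. -/
theorem exists_sign_pattern {z : Fin 3 → ℝ} (hz : z 0 + z 1 + z 2 = 0) (h0 : z ≠ 0) :
    ∃ j, 0 < z j ∧ z (j + 2) ≤ 0 := by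
  by_contra hcon
  push Not at hcon
  have h1 : 0 < z 0 → 0 < z 2 := hcon 0
  have h2 : 0 < z 1 → 0 < z 0 := hcon 1
  have h3 : 0 < z 2 → 0 < z 1 := hcon 2
  exact h0 (funext fun j => by fin_cases j <;> simp <;> grind)

/-- The slope of `tri` at a point where it is not smooth only on the rays with `z l = 0`. -/
theorem hasSlope_tri {z w : Fin 3 → ℝ} (hz : z 0 + z 1 + z 2 = 0) (hw : w 0 + w 1 + w 2 = 0)
    {j : Fin 3} (h1 : 0 < z j) (h2 : z (j + 2) ≤ 0) :
    HasSlope tri z w (lin j w + if z (j + 2) = 0 then max (w (j + 2)) 0 else 0) := by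
  have hz' := sum_rot j z
  have hw' := sum_rot j w
  have d1 := lin_sub j (z := z) (by linarith)
  have d2 := lin_sub (j + 2) (z := z) (by simp; linarith)
  have d3 := lin_sub (j + 2) (z := w) (by simp; linarith)
  rw [idx_two_one] at d2 d3
  have hl : ∀ k, HasSlope (HoneyHive.lin k) z w (HoneyHive.lin k w) := fun k => by
    simpa using HasSlope.lin k 0 z w
  have key : HasSlope (fun z => max (HoneyHive.lin j z) (HoneyHive.lin (j + 2) z)) z w
      (HoneyHive.lin j w + if z (j + 2) = 0 then max (w (j + 2)) 0 else 0) := by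
    split_ifs with h
    · refine ((hl j).max_eq (hl (j + 2)) (by linarith)).congr ?_
      rw [max_comm (w (j + 2)), ← max_add_add_left, add_zero]
      congr 1
      linarith
    · rw [add_zero]
      exact (hl j).max_lt (hl (j + 2)) (by have := lt_of_le_of_ne h2 h; linarith)
  have : tri = fun z => max (max (HoneyHive.lin j z) (HoneyHive.lin (j + 2) z))
      (HoneyHive.lin (j + 1) z) := funext (tri_eq j)
  rw [this]
  exact key.max_lt (hl (j + 1)) (lt_of_lt_of_le (by linarith) (le_max_left _ _))

theorem exists_sign_pattern' {z : Fin 3 → ℝ} (hz : z 0 + z 1 + z 2 = 0) (h0 : z ≠ 0) :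
    ∃ j, 0 ≤ z j ∧ z (j + 2) < 0 := by
  by_contra hcon
  push Not at hcon
  have h1 : 0 ≤ z 0 → 0 ≤ z 2 := hcon 0
  have h2 : 0 ≤ z 1 → 0 ≤ z 0 := hcon 1
  have h3 : 0 ≤ z 2 → 0 ≤ z 1 := hcon 2
  exact h0 (funext fun j => by fin_cases j <;> simp <;> grind)

/-- The slope of `tri`, for the other choice of the smooth part. -/
theorem hasSlope_tri' {z w : Fin 3 → ℝ} (hz : z 0 + z 1 + z 2 = 0) (hw : w 0 + w 1 + w 2 = 0)
    {j : Fin 3} (h1 : 0 ≤ z j) (h2 : z (j + 2) < 0) :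
    HasSlope tri z w (lin j w + if z j = 0 then max (-w j) 0 else 0) := by
  have hz' := sum_rot j z
  have hw' := sum_rot j w
  have d1 := lin_sub j (z := z) (by linarith)
  have d2 := lin_sub (j + 2) (z := z) (by simp; linarith)
  have d3 := lin_sub j (z := w) (by linarith)
  rw [idx_two_one] at d2
  have hl : ∀ k, HasSlope (HoneyHive.lin k) z w (HoneyHive.lin k w) := fun k => by
    simpa using HasSlope.lin k 0 z w
  have key : HasSlope (fun z => max (HoneyHive.lin j z) (HoneyHive.lin (j + 1) z)) z w
      (HoneyHive.lin j w + if z j = 0 then max (-w j) 0 else 0) := by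
    split_ifs with h
    · refine ((hl j).max_eq (hl (j + 1)) (by linarith)).congr ?_
      rw [max_comm (-w j), ← max_add_add_left, add_zero]
      congr 1
      linarith
    · rw [add_zero]
      exact (hl j).max_lt (hl (j + 1)) (by have := lt_of_le_of_ne h1 (Ne.symm h); linarith)
  have : tri = fun z => max (max (HoneyHive.lin j z) (HoneyHive.lin (j + 1) z))
      (HoneyHive.lin (j + 2) z) := funext fun z => by rw [tri_eq j, max_right_comm]
  rw [this]
  exact key.max_lt (hl (j + 2)) (lt_of_lt_of_le (by linarith) (le_max_left _ _))

open Classical in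
/-- The smooth part of the slope at `x` of `tri (z - F)`. -/
def headVec (F x : Fin 3 → ℝ) : Pt := fun j => if F j < x j ∧ x (j + 2) ≤ F (j + 2) then 1 else 0

open Classical in
/-- The smooth part of the slope at `x` of `tri (G - z)`. -/
def tailVec (G x : Fin 3 → ℝ) : Pt := fun j => if x j ≤ G j ∧ G (j + 2) < x (j + 2) then -1 else 0

open Classical in
/-- Whether `x` is on the open ray of type `l` which ends at `F`. -/
def headRay (F x : Fin 3 → ℝ) (l : Fin 3) : ℝ := if x l = F l ∧ F (l + 1) < x (l + 1) then 1 else 0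

open Classical in
/-- Whether `x` is on the open ray of type `l` which starts at `G`. -/
def tailRay (G x : Fin 3 → ℝ) (l : Fin 3) : ℝ := if x l = G l ∧ x (l + 1) < G (l + 1) then 1 else 0

open Classical in
/-- The smooth part of the slope at `x` of the negative of `max (z l - t) 0`. -/
def lineVec (l : Fin 3) (t : ℝ) (x : Fin 3 → ℝ) : Pt := if t < x l then eps (l + 1) - eps l else 0

variable {F x w : Fin 3 → ℝ}

theorem headVec_eq {j : Fin 3} (h1 : F j < x j) (h2 : x (j + 2) ≤ F (j + 2)) :
    headVec F x = eps j := by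
  refine pt_ext j ?_ ?_ ?_
  · simp [headVec, eps_apply, h1, h2]
  · simp [headVec, eps_apply, h1]
  · simp [headVec, eps_apply, h2]

theorem tailVec_eq {j : Fin 3} (h1 : x j ≤ F j) (h2 : F (j + 2) < x (j + 2)) :
    tailVec F x = -eps j := by
  refine pt_ext j ?_ ?_ ?_
  · simp [tailVec, eps_apply, h1, h2]
  · simp [tailVec, eps_apply, h1]
  · simp [tailVec, eps_apply, h2]

theorem eps_sum (j : Fin 3) : eps j 0 + eps j 1 + eps j 2 = 1 := by
  fin_cases j <;> simp [eps_apply]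

open Classical in
theorem headVec_sum (hF : F 0 + F 1 + F 2 = 1) (hx : x 0 + x 1 + x 2 = 1) :
    headVec F x 0 + headVec F x 1 + headVec F x 2 = if x = F then 0 else 1 := by
  split_ifs with h0
  · subst h0; simp [headVec]
  · have hz : (x - F) 0 + (x - F) 1 + (x - F) 2 = 0 := by simp; linarith
    obtain ⟨j, h1, h2⟩ := exists_sign_pattern hz (sub_ne_zero.2 h0)
    simp only [Pi.sub_apply, sub_pos, sub_nonpos] at h1 h2
    rw [headVec_eq h1 h2, eps_sum]

open Classical in
theorem tailVec_sum (hF : F 0 + F 1 + F 2 = 1) (hx : x 0 + x 1 + x 2 = 1) :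
    tailVec F x 0 + tailVec F x 1 + tailVec F x 2 = if x = F then 0 else -1 := by
  split_ifs with h0
  · subst h0; simp [tailVec]
  · have hz : (F - x) 0 + (F - x) 1 + (F - x) 2 = 0 := by simp; linarith
    obtain ⟨j, h1, h2⟩ := exists_sign_pattern' hz (sub_ne_zero.2 fun h => h0 h.symm)
    simp only [Pi.sub_apply, sub_nonneg, sub_neg] at h1 h2
    rw [tailVec_eq h1 h2]
    have := eps_sum j
    simp only [Pi.neg_apply]
    omega

theorem lineVec_sum (l : Fin 3) (t : ℝ) (x : Fin 3 → ℝ) :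
    lineVec l t x 0 + lineVec l t x 1 + lineVec l t x 2 = 0 := by
  unfold lineVec
  have := eps_sum l
  have := eps_sum (l + 1)
  split_ifs
  · simp only [Pi.sub_apply]; omega
  · simp

open Classical in
theorem hasSlope_head (hF : F 0 + F 1 + F 2 = 1) (hx : x 0 + x 1 + x 2 = 1)
    (hw : w 0 + w 1 + w 2 = 0) : HasSlope (fun z => tri (z - F)) x w
      (pairing w (headVec F x) + ∑ l, headRay F x l * max (w l) 0 +
        if x = F then tri w else 0) := by
  have hcomp : ∀ {m}, HasSlope tri (x - F) w m → HasSlope (fun z => tri (z - F)) x w m := by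
    intro m h
    filter_upwards [h] with s hs
    rw [← hs]; congr 1; abel
  apply hcomp
  by_cases h0 : x = F
  · subst h0
    rw [sub_self, if_pos rfl]
    refine (hasSlope_tri_zero w).congr ?_
    have : headVec x x = 0 := by funext j; simp [headVec]
    simp [this, headRay, pairing]
  · rw [if_neg h0, add_zero]
    have hz : (x - F) 0 + (x - F) 1 + (x - F) 2 = 0 := by simp; linarith
    obtain ⟨j, h1, h2⟩ := exists_sign_pattern hz (sub_ne_zero.2 h0)
    refine (hasSlope_tri hz hw h1 h2).congr ?_
    simp only [Pi.sub_apply, sub_pos, sub_nonpos, sub_eq_zero] at h1 h2 ⊢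
    have e1 := headVec_eq h1 h2
    rw [e1, pairing_lin, Fin.sum_univ_three, ← sum_rot j fun l => headRay F x l * max (w l) 0]
    have e2 : headRay F x j = 0 := if_neg fun h => h1.ne' h.1
    have e3 : headRay F x (j + 1) = 0 := if_neg fun h => by
      rw [idx_one_one] at h; exact absurd h.2 (not_lt.2 h2)
    have e4 : headRay F x (j + 2) = if x (j + 2) = F (j + 2) then 1 else 0 := by
      simp [headRay, h1]
    rw [e2, e3, e4]
    split_ifs <;> simp

open Classical in
theorem hasSlope_tail (hF : F 0 + F 1 + F 2 = 1) (hx : x 0 + x 1 + x 2 = 1)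
    (hw : w 0 + w 1 + w 2 = 0) : HasSlope (fun z => tri (F - z)) x w
      (pairing w (tailVec F x) + ∑ l, tailRay F x l * max (w l) 0 +
        if x = F then tri (-w) else 0) := by
  apply HasSlope.neg_dir
  have hw' : (-w) 0 + (-w) 1 + (-w) 2 = 0 := by simp only [Pi.neg_apply]; linarith
  by_cases h0 : x = F
  · subst h0
    rw [sub_self, if_pos rfl]
    refine (hasSlope_tri_zero (-w)).congr ?_
    have : tailVec x x = 0 := by funext j; simp [tailVec]
    simp [this, tailRay, pairing]
  · rw [if_neg h0, add_zero]
    have hz : (F - x) 0 + (F - x) 1 + (F - x) 2 = 0 := by simp; linarith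
    obtain ⟨j, h1, h2⟩ := exists_sign_pattern' hz (sub_ne_zero.2 fun h => h0 h.symm)
    refine (hasSlope_tri' hz hw' h1 h2).congr ?_
    have h3 : F j - x j + (F (j + 1) - x (j + 1)) + (F (j + 2) - x (j + 2)) = 0 := by
      have := sum_rot j (F - x)
      simp only [Pi.sub_apply] at this hz
      linarith
    simp only [Pi.sub_apply, sub_nonneg, sub_neg, sub_eq_zero, Pi.neg_apply, neg_neg] at h1 h2 ⊢
    have e1 := tailVec_eq h1 h2
    have e1' : pairing w (-eps j) = lin j (-w) := by
      rw [lin_neg, ← pairing_lin]; simp [pairing]; ring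
    rw [e1, e1', Fin.sum_univ_three, ← sum_rot j fun l => tailRay F x l * max (w l) 0]
    have e2 : tailRay F x (j + 2) = 0 := if_neg fun h => h2.ne' h.1
    have e3 : tailRay F x (j + 1) = 0 := if_neg fun h => by
      rw [idx_one_one] at h; exact absurd h.2 (not_lt.2 h2.le)
    have e4 : tailRay F x j = if F j = x j then 1 else 0 := by
      unfold tailRay
      by_cases h : F j = x j
      · rw [if_pos ⟨h.symm, by linarith⟩, if_pos h]
      · rw [if_neg fun h' => h h'.1.symm, if_neg h]
    rw [e2, e3, e4]
    split_ifs <;> simp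

open Classical in
theorem hasSlope_line (l : Fin 3) (t : ℝ) (hw : w 0 + w 1 + w 2 = 0) :
    HasSlope (fun z => max (z l - t) 0) x w
      (-pairing w (lineVec l t x) + (if x l = t then 1 else 0) * max (w l) 0) := by
  have h1 : HasSlope (fun z => z l - t) x w (w l) :=
    Eventually.of_forall fun s => by simp; ring
  have h2 : HasSlope (fun _ => (0 : ℝ)) x w 0 := Eventually.of_forall fun s => by simp
  have h3 := lin_sub l (z := w) (by rw [sum_rot l w]; exact hw)
  rcases lt_trichotomy (x l) t with h | h | h
  · have := h2.max_lt h1 (by linarith)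
    simp only [max_comm (0 : ℝ)] at this
    refine this.congr ?_
    simp [lineVec, h.not_gt, h.ne, pairing]
  · refine (h1.max_eq h2 (by linarith)).congr ?_
    simp [lineVec, h, pairing]
  · refine (h1.max_lt h2 (by linarith)).congr ?_
    rw [lineVec, if_pos h, if_neg h.ne', pairing_sub, pairing_lin, pairing_lin]
    linarith

end

section

variable {n d : ℕ} {a : Fin 3 → Fin n → ℝ} {ι : Type}

/-! ### The convex function of a web -/

namespace Web

variable (W : Web n a ι)

/-- The head of the segment is a vertex inside the triangle. -/
def HeadIn (p : ι) : Prop := ∀ i, 0 < coord (W.head p) i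

/-- The tail of the segment is a vertex inside the triangle. -/
def TailIn (p : ι) : Prop := ∀ i, 0 < coord (W.tail p) i

/-- The segment as a subset of the plane. -/
def seg (p : ι) : Set ℂ := segment ℝ (W.tail p) (W.head p)

/-- `x` is on the segment, and not at one of its ends inside the triangle. -/
def Thru (p : ι) (x : ℂ) : Prop :=
  x ∈ W.seg p ∧ (x = W.head p → ¬ W.HeadIn p) ∧ (x = W.tail p → ¬ W.TailIn p)

variable {W}

theorem not_headIn {p : ι} (h : ¬ W.HeadIn p) : ∃ i, coord (W.head p) i = 0 := by
  simp only [HeadIn, not_forall, not_lt] at h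
  exact h.imp fun i hi => le_antisymm hi (mem_triangle.1 (W.head_mem p) i)

theorem not_tailIn {p : ι} (h : ¬ W.TailIn p) : ∃ i, coord (W.tail p) i = 0 := by
  simp only [TailIn, not_forall, not_lt] at h
  exact h.imp fun i hi => le_antisymm hi (mem_triangle.1 (W.tail_mem p) i)

theorem head_side_iff (p : ι) (i : Fin 3) :
    coord (W.head p) i = 0 ↔ ¬ W.HeadIn p ∧ W.typ p = i + 2 := by
  constructor
  · exact fun h => ⟨fun h' => (h' i).ne' h, (W.head_side p i h).2⟩
  · rintro ⟨h1, h2⟩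
    obtain ⟨k, hk⟩ := not_headIn h1
    have := (W.head_side p k hk).2
    rw [h2, add_right_cancel_iff] at this
    rwa [this]

theorem tail_side_iff (p : ι) (i : Fin 3) :
    coord (W.tail p) i = 0 ↔ ¬ W.TailIn p ∧ W.typ p = i + 1 := by
  constructor
  · exact fun h => ⟨fun h' => (h' i).ne' h, (W.tail_side p i h).2⟩
  · rintro ⟨h1, h2⟩
    obtain ⟨k, hk⟩ := not_tailIn h1
    have := (W.tail_side p k hk).2
    rw [h2, add_right_cancel_iff] at this
    rwa [this]

theorem headIn_or_tailIn (p : ι) : W.HeadIn p ∨ W.TailIn p := by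
  by_contra hcon
  push Not at hcon
  obtain ⟨i, hi⟩ := not_headIn hcon.1
  obtain ⟨k, hk⟩ := not_tailIn hcon.2
  have h1 := (W.head_side p i hi).1
  have h2 := (W.tail_side p k hk).1
  rw [h1] at h2
  cases h2

theorem head_inj {p q : ι} (h : W.head p = W.head q) (ht : W.typ p = W.typ q) : p = q := by
  by_contra hpq
  rcases W.head_meet p q hpq h with ⟨h1, -⟩ | ⟨h1, -⟩
  · rw [ht] at h1; simp at h1
  · rw [ht] at h1; simp at h1

theorem tail_inj {p q : ι} (h : W.tail p = W.tail q) (ht : W.typ p = W.typ q) : p = q := by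
  by_contra hpq
  rcases W.tail_meet p q hpq h with ⟨h1, -⟩ | ⟨h1, -⟩
  · rw [ht] at h1; simp at h1
  · rw [ht] at h1; simp at h1

theorem mem_seg {p : ι} {x : ℂ} : x ∈ W.seg p ↔ coord x (W.typ p) = coord (W.head p) (W.typ p) ∧
    coord (W.head p) (W.typ p + 1) ≤ coord x (W.typ p + 1) ∧
    coord x (W.typ p + 1) ≤ coord (W.tail p) (W.typ p + 1) := by
  rw [seg, (W.arrow p).mem_segment, (W.arrow p).1]
  have h1 := coord_sum (W.typ p) x
  have h2 := coord_sum (W.typ p) (W.head p)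
  have h3 := coord_sum (W.typ p) (W.tail p)
  have h4 := (W.arrow p).1
  constructor
  · rintro ⟨h5, h6, h7⟩; exact ⟨h5, by linarith, by linarith⟩
  · rintro ⟨h5, h6, h7⟩; exact ⟨h5, by linarith, by linarith⟩

theorem mem_segInterior {p : ι} {x : ℂ} : x ∈ segInterior (segment ℝ (W.tail p) (W.head p)) ↔
    x ∈ W.seg p ∧ x ≠ W.head p ∧ x ≠ W.tail p := by
  rw [segInterior, Set.mem_sdiff, (W.arrow p).endpoints_eq]
  simp only [Set.mem_insert_iff, Set.mem_singleton_iff, not_or, seg]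
  tauto

theorem head_mem_seg (p : ι) : W.head p ∈ W.seg p := right_mem_segment ℝ _ _

theorem tail_mem_seg (p : ι) : W.tail p ∈ W.seg p := left_mem_segment ℝ _ _

theorem seg_subset {p : ι} {x : ℂ} (h : x ∈ W.seg p) : x ∈ triangle := by
  obtain ⟨b, c, hb, hc, hbc, rfl⟩ := h
  refine mem_triangle.2 fun k => ?_
  rw [coord_combo hbc]
  have := mem_triangle.1 (W.head_mem p) k
  have := mem_triangle.1 (W.tail_mem p) k
  positivity

/-- A point of a segment on the boundary of the triangle is one of its ends. -/
theorem eq_of_side {p : ι} {x : ℂ} (h : x ∈ W.seg p) {i : Fin 3} (hi : coord x i = 0) :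
    x = W.head p ∨ x = W.tail p := by
  by_contra hcon
  push Not at hcon
  have hcon' := hcon
  obtain ⟨b, c, hb, hc, hbc, rfl⟩ := h
  rw [coord_combo hbc] at hi
  have h1 := mem_triangle.1 (W.head_mem p) i
  have h2 := mem_triangle.1 (W.tail_mem p) i
  have hb' : b ≠ 0 := by
    rintro rfl
    obtain rfl : c = 1 := by linarith
    exact hcon.1 (by simp)
  have hc' : c ≠ 0 := by
    rintro rfl
    obtain rfl : b = 1 := by linarith
    exact hcon.2 (by simp)
  have hb0 := lt_of_le_of_ne hb hb'.symm
  have hc0 := lt_of_le_of_ne hc hc'.symm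
  have h3 : coord (W.tail p) i = 0 := by
    have := mul_nonneg hb h2
    have := mul_nonneg hc h1
    have : b * coord (W.tail p) i = 0 := by linarith
    exact (mul_eq_zero.1 this).resolve_left hb'
  have h4 : coord (W.head p) i = 0 := by
    rw [h3, mul_zero, zero_add] at hi
    exact (mul_eq_zero.1 hi).resolve_left hc'
  have := (W.head_side p i h4).1
  rw [(W.tail_side p i h3).1] at this
  cases this

/-- Segments of the same type do not overlap. -/
theorem thru_unique {p q : ι} {x : ℂ} (hp : W.Thru p x) (hq : W.Thru q x)
    (ht : W.typ p = W.typ q) : p = q := by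
  by_contra hpq
  have hint : ∀ {p : ι}, W.Thru p x → ¬ (x ≠ W.head p ∧ x ≠ W.tail p) →
      ∃ i, coord x i = 0 := by
    intro p hp h
    by_cases h1 : x = W.head p
    · rw [h1]; exact not_headIn (hp.2.1 h1)
    · have h2 : x = W.tail p := by
        by_contra h2; exact h ⟨h1, h2⟩
      rw [h2]; exact not_tailIn (hp.2.2 h2)
  by_cases hb : ∃ i, coord x i = 0
  · obtain ⟨i, hi⟩ := hb
    rcases W.eq_of_side hp.1 hi with h1 | h1 <;> rcases W.eq_of_side hq.1 hi with h2 | h2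
    · exact hpq (head_inj (h1.symm.trans h2) ht)
    · exact W.head_ne_tail p q (h1.symm.trans h2)
    · exact W.head_ne_tail q p (h2.symm.trans h1)
    · exact hpq (tail_inj (h1.symm.trans h2) ht)
  · have h1 : x ≠ W.head p ∧ x ≠ W.tail p := by
      by_contra h; exact hb (hint hp h)
    have h2 : x ≠ W.head q ∧ x ≠ W.tail q := by
      by_contra h; exact hb (hint hq h)
    rcases W.cross p q x hpq (mem_segInterior.2 ⟨hp.1, h1⟩) (mem_segInterior.2 ⟨hq.1, h2⟩) with
      ⟨-, -, h3⟩ | ⟨-, -, h3⟩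
    · rw [ht] at h3; simp at h3
    · rw [ht] at h3; simp at h3

/-- Two segments through a point cross there. -/
theorem thru_cross {p q : ι} {x : ℂ} (hp : W.Thru p x) (hq : W.Thru q x) (hpq : p ≠ q) :
    (∀ i, 0 < coord x i) ∧ ((W.col p = .zero ∧ W.col q = .one ∧ W.typ q = W.typ p + 2) ∨
      (W.col q = .zero ∧ W.col p = .one ∧ W.typ p = W.typ q + 2)) := by
  have hb : ∀ i, coord x i ≠ 0 := by
    intro i hi
    rcases W.eq_of_side hp.1 hi with h1 | h1 <;> rcases W.eq_of_side hq.1 hi with h2 | h2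
    · refine hpq (head_inj (h1.symm.trans h2) ?_)
      rw [(W.head_side p i (h1 ▸ hi)).2, (W.head_side q i (h2 ▸ hi)).2]
    · exact W.head_ne_tail p q (h1.symm.trans h2)
    · exact W.head_ne_tail q p (h2.symm.trans h1)
    · refine hpq (tail_inj (h1.symm.trans h2) ?_)
      rw [(W.tail_side p i (h1 ▸ hi)).2, (W.tail_side q i (h2 ▸ hi)).2]
  have hpos : ∀ i, 0 < coord x i := fun i =>
    lt_of_le_of_ne (mem_triangle.1 (W.seg_subset hp.1) i) (hb i).symm
  have hint : ∀ {p : ι}, W.Thru p x → x ∈ segInterior (segment ℝ (W.tail p) (W.head p)) := by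
    intro p hp
    refine mem_segInterior.2 ⟨hp.1, fun h => hp.2.1 h ?_, fun h => hp.2.2 h ?_⟩
    · intro i; rw [← h]; exact hpos i
    · intro i; rw [← h]; exact hpos i
  exact ⟨hpos, W.cross p q x hpq (hint hp) (hint hq)⟩

/-- No segment passes through a vertex, as it would overlap with a segment at this vertex. -/
theorem not_thru_head {p q : ι} (hp : W.HeadIn p) (h : W.Thru q (W.head p)) : False := by
  obtain ⟨r, hr, hrp⟩ := W.head_full p hp (W.typ q)
  have hqr : q ≠ r := by
    rintro rfl
    exact h.2.1 hrp.symm (by unfold HeadIn; rw [hrp]; exact hp)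
  have h0 : W.head p ≠ W.head q := fun h1 => h.2.1 h1 (by unfold HeadIn; rw [← h1]; exact hp)
  obtain ⟨h1, h2, h3⟩ := mem_seg.1 h.1
  rw [← hrp] at h1 h2 h3 h0
  have h4 : coord (W.head r) (W.typ q + 1) < coord (W.tail q) (W.typ q + 1) :=
    lt_of_le_of_ne h3 fun h4 => W.head_ne_tail r q (coord_ext (W.typ q + 1) h4
      (by rw [idx_one_two, h1, (W.arrow q).1]))
  have h5 := (W.arrow r).coord_one
  rw [hr] at h5
  -- a point of the overlap of the two segments
  set t := (coord (W.head r) (W.typ q + 1) +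
    min (coord (W.tail q) (W.typ q + 1)) (coord (W.tail r) (W.typ q + 1))) / 2 with ht
  have h6 := lt_min h4 h5
  have h7 := min_le_left (coord (W.tail q) (W.typ q + 1)) (coord (W.tail r) (W.typ q + 1))
  have h8 := min_le_right (coord (W.tail q) (W.typ q + 1)) (coord (W.tail r) (W.typ q + 1))
  have hsum := coord_sum (W.typ q) (W.head r)
  have hz := coord_add_typeDir (W.head r) (coord (W.head r) (W.typ q + 1) - t) (W.typ q)
  set z := W.head r + ((coord (W.head r) (W.typ q + 1) - t : ℝ) : ℂ) * typeDir (W.typ q)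
  obtain ⟨z1, z2, -⟩ := hz
  have z2' : coord z (W.typ q + 1) = t := by rw [z2]; ring
  have hzq : z ∈ segInterior (segment ℝ (W.tail q) (W.head q)) := by
    refine mem_segInterior.2 ⟨mem_seg.2 ⟨z1.trans h1, by linarith, by linarith⟩, ?_, ?_⟩
    · intro h; rw [h] at z2'; linarith
    · intro h; rw [h] at z2'; linarith
  have hzr : z ∈ segInterior (segment ℝ (W.tail r) (W.head r)) := by
    refine mem_segInterior.2 ⟨mem_seg.2 ?_, ?_, ?_⟩
    · rw [hr]; exact ⟨z1, by linarith, by linarith⟩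
    · intro h; rw [h] at z2'; linarith
    · intro h; rw [h] at z2'; linarith
  rcases W.cross q r z hqr hzq hzr with ⟨-, -, h9⟩ | ⟨-, -, h9⟩ <;> rw [hr] at h9 <;> simp at h9

theorem not_thru_tail {p q : ι} (hp : W.TailIn p) (h : W.Thru q (W.tail p)) : False := by
  obtain ⟨r, hr, hrp⟩ := W.tail_full p hp (W.typ q)
  have hqr : q ≠ r := by
    rintro rfl
    exact h.2.2 hrp.symm (by unfold TailIn; rw [hrp]; exact hp)
  obtain ⟨h1, h2, h3⟩ := mem_seg.1 h.1
  rw [← hrp] at h1 h2 h3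
  have h4 : coord (W.head q) (W.typ q + 1) < coord (W.tail r) (W.typ q + 1) :=
    lt_of_le_of_ne h2 fun h4 => W.head_ne_tail q r (coord_ext (W.typ q + 1) h4
      (by rw [idx_one_two, h1]))
  have h5 := (W.arrow r).coord_one
  rw [hr] at h5
  set t := (coord (W.tail r) (W.typ q + 1) +
    max (coord (W.head q) (W.typ q + 1)) (coord (W.head r) (W.typ q + 1))) / 2 with ht
  have h6 := max_lt h4 h5
  have h7 := le_max_left (coord (W.head q) (W.typ q + 1)) (coord (W.head r) (W.typ q + 1))
  have h8 := le_max_right (coord (W.head q) (W.typ q + 1)) (coord (W.head r) (W.typ q + 1))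
  have hz := coord_add_typeDir (W.tail r) (coord (W.tail r) (W.typ q + 1) - t) (W.typ q)
  set z := W.tail r + ((coord (W.tail r) (W.typ q + 1) - t : ℝ) : ℂ) * typeDir (W.typ q)
  obtain ⟨z1, z2, -⟩ := hz
  have z2' : coord z (W.typ q + 1) = t := by rw [z2]; ring
  have hzq : z ∈ segInterior (segment ℝ (W.tail q) (W.head q)) := by
    refine mem_segInterior.2 ⟨mem_seg.2 ⟨z1.trans h1, by linarith, by linarith⟩, ?_, ?_⟩
    · intro h; rw [h] at z2'; linarith
    · intro h; rw [h] at z2'; linarith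
  have harr := (W.arrow r).1
  rw [hr] at harr
  have hzr : z ∈ segInterior (segment ℝ (W.tail r) (W.head r)) := by
    refine mem_segInterior.2 ⟨mem_seg.2 ?_, ?_, ?_⟩
    · rw [hr]; exact ⟨z1.trans harr, by linarith, by linarith⟩
    · intro h; rw [h] at z2'; linarith
    · intro h; rw [h] at z2'; linarith
  rcases W.cross q r z hqr hzq hzr with ⟨-, -, h9⟩ | ⟨-, -, h9⟩ <;> rw [hr] at h9 <;> simp at h9

variable [Fintype ι] (W)

open Classical in
/-- The vertices inside the triangle at which the segments end. -/
def heads : Finset (Fin 3 → ℝ) := (Finset.univ.filter W.HeadIn).image fun p => coord (W.head p)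

open Classical in
/-- The vertices inside the triangle at which the segments start. -/
def tails : Finset (Fin 3 → ℝ) := (Finset.univ.filter W.TailIn).image fun p => coord (W.tail p)

open Classical in
/-- The segments which do not meet the boundary of the triangle. -/
def inner : Finset ι := Finset.univ.filter fun p => W.HeadIn p ∧ W.TailIn p

/-- A convex function which is linear off the segments and has the same bend along all of them:
every vertex contributes a function which bends along three rays, and what these rays have in excess
of the segments is a union of complete lines. -/
def pot (z : Fin 3 → ℝ) : ℝ :=
  ∑ F ∈ W.heads, tri (z - F) + ∑ G ∈ W.tails, tri (G - z) -
    ∑ p ∈ W.inner, max (z (W.typ p) - coord (W.head p) (W.typ p)) 0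

/-- The smooth part of the slope of the potential, as a lattice point. -/
def base (d : ℕ) (x : Fin 3 → ℝ) : Pt := fun i =>
  (∑ F ∈ W.heads, headVec F x i + ∑ G ∈ W.tails, tailVec G x i +
    ∑ p ∈ W.inner, lineVec (W.typ p) (coord (W.head p) (W.typ p)) x i) + d

variable {W}

theorem continuous_pot : Continuous W.pot := by
  unfold pot tri lin
  fun_prop

open Classical in
theorem sum_heads {M : Type*} [AddCommMonoid M] (l : Fin 3) (f : (Fin 3 → ℝ) → M) :
    ∑ F ∈ W.heads, f F = ∑ p with W.typ p = l ∧ W.HeadIn p, f (coord (W.head p)) := by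
  have : W.heads = (Finset.univ.filter fun p => W.typ p = l ∧ W.HeadIn p).image
      fun p => coord (W.head p) := by
    ext F
    simp only [heads, Finset.mem_image, Finset.mem_filter, Finset.mem_univ, true_and]
    constructor
    · rintro ⟨p, hp, rfl⟩
      obtain ⟨q, hq, hqp⟩ := W.head_full p hp l
      exact ⟨q, ⟨hq, by unfold HeadIn; rw [hqp]; exact hp⟩, by rw [hqp]⟩
    · rintro ⟨p, hp, rfl⟩
      exact ⟨p, hp.2, rfl⟩
  rw [this, Finset.sum_image]
  intro p hp q hq hpq
  simp only [Finset.coe_filter, Finset.mem_univ, true_and, Set.mem_ofPred_eq] at hp hq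
  exact head_inj (coord_injective hpq) (hp.1.trans hq.1.symm)

open Classical in
theorem sum_tails {M : Type*} [AddCommMonoid M] (l : Fin 3) (f : (Fin 3 → ℝ) → M) :
    ∑ G ∈ W.tails, f G = ∑ p with W.typ p = l ∧ W.TailIn p, f (coord (W.tail p)) := by
  have : W.tails = (Finset.univ.filter fun p => W.typ p = l ∧ W.TailIn p).image
      fun p => coord (W.tail p) := by
    ext F
    simp only [tails, Finset.mem_image, Finset.mem_filter, Finset.mem_univ, true_and]
    constructor
    · rintro ⟨p, hp, rfl⟩
      obtain ⟨q, hq, hqp⟩ := W.tail_full p hp l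
      exact ⟨q, ⟨hq, by unfold TailIn; rw [hqp]; exact hp⟩, by rw [hqp]⟩
    · rintro ⟨p, hp, rfl⟩
      exact ⟨p, hp.2, rfl⟩
  rw [this, Finset.sum_image]
  intro p hp q hq hpq
  simp only [Finset.coe_filter, Finset.mem_univ, true_and, Set.mem_ofPred_eq] at hp hq
  exact tail_inj (coord_injective hpq) (hp.1.trans hq.1.symm)

open Classical in
theorem sum_inner {M : Type*} [AddCommMonoid M] (l : Fin 3) (f : ι → M) :
    ∑ p ∈ W.inner, (if W.typ p = l then f p else 0) =
      ∑ p with W.typ p = l, if W.HeadIn p ∧ W.TailIn p then f p else 0 := by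
  rw [inner, Finset.sum_filter, Finset.sum_filter]
  refine Finset.sum_congr rfl fun p _ => ?_
  split_ifs <;> rfl

end Web

end

section

variable {n d : ℕ} {a : Fin 3 → Fin n → ℝ} {ι : Type}

namespace Web

variable {W : Web n a ι}

theorem coord_total (x : ℂ) : coord x 0 + coord x 1 + coord x 2 = 1 := coord_sum 0 x

/-- The pairing with a fixed direction as a homomorphism. -/
def pairingHom (w : Fin 3 → ℝ) : Pt →+ ℝ where
  toFun := pairing w
  map_zero' := by simp [pairing]
  map_add' := pairing_add w

theorem pairing_const (w : Fin 3 → ℝ) (k : ℤ) : pairing w (fun _ => k) = 0 := by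
  simp [pairing]; ring

open Classical in
/-- The rays and the line which belong to a segment cancel off the segment. -/
theorem ray_count (p : ι) {x : ℂ} (hx : x ∈ triangle) :
    (if W.HeadIn p then headRay (coord (W.head p)) (coord x) (W.typ p) else 0) +
      (if W.TailIn p then tailRay (coord (W.tail p)) (coord x) (W.typ p) else 0) -
      (if W.HeadIn p ∧ W.TailIn p then
        (if coord x (W.typ p) = coord (W.head p) (W.typ p) then 1 else 0) else 0) =
      if W.Thru p x then 1 else 0 := by
  have hline := (W.arrow p).1
  have hlt := (W.arrow p).coord_one
  by_cases hx0 : coord x (W.typ p) = coord (W.head p) (W.typ p)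
  swap
  · have h1 : ¬ W.Thru p x := fun h => hx0 (mem_seg.1 h.1).1
    simp [headRay, tailRay, hx0, hline, h1]
  have e1 : x = W.head p ↔ coord x (W.typ p + 1) = coord (W.head p) (W.typ p + 1) :=
    ⟨fun h => by rw [h], fun h => coord_ext (W.typ p + 1) h (by rw [idx_one_two, hx0])⟩
  have e2 : x = W.tail p ↔ coord x (W.typ p + 1) = coord (W.tail p) (W.typ p + 1) :=
    ⟨fun h => by rw [h], fun h => coord_ext (W.typ p + 1) h (by rw [idx_one_two, hx0, hline])⟩
  have hT : W.Thru p x ↔ (coord (W.head p) (W.typ p + 1) ≤ coord x (W.typ p + 1) ∧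
      coord x (W.typ p + 1) ≤ coord (W.tail p) (W.typ p + 1)) ∧
      (coord x (W.typ p + 1) = coord (W.head p) (W.typ p + 1) → ¬ W.HeadIn p) ∧
      (coord x (W.typ p + 1) = coord (W.tail p) (W.typ p + 1) → ¬ W.TailIn p) := by
    rw [Thru, mem_seg, e1, e2]
    simp [hx0]
  have b1 : ¬ W.HeadIn p → coord (W.head p) (W.typ p + 1) ≤ coord x (W.typ p + 1) := by
    intro h
    rw [(W.head_side_iff p (W.typ p + 1)).2 ⟨h, by simp⟩]
    exact mem_triangle.1 hx _
  have b2 : ¬ W.TailIn p → coord x (W.typ p + 1) ≤ coord (W.tail p) (W.typ p + 1) := by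
    intro h
    have h1 := (W.tail_side_iff p (W.typ p + 2)).2 ⟨h, by simp⟩
    have h2 := coord_sum (W.typ p) x
    have h3 := coord_sum (W.typ p) (W.tail p)
    have h4 := mem_triangle.1 hx (W.typ p + 2)
    linarith
  rw [hT]
  simp only [headRay, tailRay, hx0, hline, true_and, if_true]
  have h0 := W.headIn_or_tailIn p
  by_cases hh : W.HeadIn p <;> by_cases hv : W.TailIn p
  · simp only [hh, hv, if_true, and_self, not_true]
    rcases lt_or_ge (coord (W.head p) (W.typ p + 1)) (coord x (W.typ p + 1)) with c1 | c1
    · rcases lt_or_ge (coord x (W.typ p + 1)) (coord (W.tail p) (W.typ p + 1)) with c2 | c2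
      · simp [c1, c2, c1.le, c2.le, c1.ne', c2.ne]
      · rw [if_pos c1, if_neg c2.not_gt, if_neg]
        · norm_num
        · rintro ⟨⟨-, c3⟩, -, c4⟩; exact c4 (le_antisymm c3 c2)
    · have c2 := c1.trans_lt hlt
      rw [if_neg c1.not_gt, if_pos c2, if_neg]
      · norm_num
      · rintro ⟨⟨c3, -⟩, c4, -⟩; exact c4 (le_antisymm c1 c3)
  · simp only [hh, hv, if_true, if_false, and_false, not_true, not_false_iff, implies_true,
      and_true, b2 hv, add_zero, sub_zero]
    refine if_congr ?_ rfl rfl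
    constructor
    · exact fun h => ⟨h.le, h.ne'⟩
    · exact fun h => lt_of_le_of_ne h.1 (Ne.symm h.2)
  · simp only [hh, hv, if_true, if_false, false_and, not_true, not_false_iff, implies_true,
      true_and, b1 hh, zero_add, sub_zero]
    refine if_congr ?_ rfl rfl
    constructor
    · exact fun h => ⟨h.le, h.ne⟩
    · exact fun h => lt_of_le_of_ne h.1 h.2
  · exact absurd h0 (by simp [hh, hv])

theorem side_end (i : Fin 3) (j : Fin n) : ∃ p, (¬ W.HeadIn p ∧ W.typ p = i + 2 ∧
    coord (W.head p) (i + 1) = a i j) ∨ (¬ W.TailIn p ∧ W.typ p = i + 1 ∧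
    coord (W.tail p) (i + 1) = a i j) := by
  obtain ⟨p, ⟨h1, h2⟩ | ⟨h1, h2⟩⟩ := (W.bdry i _).2 ⟨j, rfl⟩
  · obtain ⟨h3, h4⟩ := (W.head_side_iff p i).1 h1
    exact ⟨p, .inl ⟨h3, h4, h2⟩⟩
  · obtain ⟨h3, h4⟩ := (W.tail_side_iff p i).1 h1
    exact ⟨p, .inr ⟨h3, h4, h2⟩⟩

variable (W) in
/-- The `j`-th boundary point on the side `i` is the head of a segment. -/
def IsOne (i : Fin 3) (j : Fin n) : Prop :=
  ∃ p, ¬ W.HeadIn p ∧ W.typ p = i + 2 ∧ coord (W.head p) (i + 1) = a i j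

variable (W) in
/-- The `j`-th boundary point on the side `i` is the tail of a segment. -/
def IsZero (i : Fin 3) (j : Fin n) : Prop :=
  ∃ p, ¬ W.TailIn p ∧ W.typ p = i + 1 ∧ coord (W.tail p) (i + 1) = a i j

theorem IsOne.lt {i : Fin 3} {j k : Fin n} (hj : W.IsOne i j) (hk : W.IsZero i k) : j < k := by
  obtain ⟨p, h1, h2, h3⟩ := hj
  obtain ⟨q, h4, h5, h6⟩ := hk
  have := W.mono i p q ((W.head_side_iff p i).2 ⟨h1, h2⟩) ((W.tail_side_iff q i).2 ⟨h4, h5⟩)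
  rw [h3, h6] at this
  exact (W.anti i).lt_iff_gt.1 this

theorem not_isOne {i : Fin 3} {j : Fin n} : ¬ W.IsOne i j ↔ W.IsZero i j := by
  constructor
  · intro h
    obtain ⟨p, h1 | h1⟩ := W.side_end i j
    · exact absurd ⟨p, h1⟩ h
    · exact ⟨p, h1⟩
  · exact fun h1 h2 => lt_irrefl _ (h2.lt h1)

variable [Fintype ι]

theorem pairing_base (w x : Fin 3 → ℝ) : pairing w (W.base d x) =
    ∑ F ∈ W.heads, pairing w (headVec F x) + ∑ G ∈ W.tails, pairing w (tailVec G x) +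
      ∑ p ∈ W.inner, pairing w (lineVec (W.typ p) (coord (W.head p) (W.typ p)) x) := by
  have : W.base d x = (∑ F ∈ W.heads, headVec F x + ∑ G ∈ W.tails, tailVec G x +
      ∑ p ∈ W.inner, lineVec (W.typ p) (coord (W.head p) (W.typ p)) x) + fun _ => (d : ℤ) := by
    funext i
    simp [base, Finset.sum_apply]
  rw [this, pairing_add, pairing_const, add_zero]
  change pairingHom w _ = _
  simp only [map_add, map_sum]
  rfl

open Classical in
/-- The potential bends by one along every segment. -/
theorem hasSlope_pot {x : ℂ} (hx : x ∈ triangle) {w : Fin 3 → ℝ} (hw : w 0 + w 1 + w 2 = 0) :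
    HasSlope W.pot (coord x) w (pairing w (W.base d (coord x)) +
      ∑ l, (if ∃ p, W.typ p = l ∧ W.Thru p x then max (w l) 0 else 0) +
      (if coord x ∈ W.heads then tri w else 0) + (if coord x ∈ W.tails then tri (-w) else 0)) := by
  have hsum : ∀ F ∈ W.heads, F 0 + F 1 + F 2 = 1 := by
    intro F hF
    simp only [heads, Finset.mem_image] at hF
    obtain ⟨p, -, rfl⟩ := hF
    exact coord_total _
  have hsum' : ∀ F ∈ W.tails, F 0 + F 1 + F 2 = 1 := by
    intro F hF
    simp only [tails, Finset.mem_image] at hF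
    obtain ⟨p, -, rfl⟩ := hF
    exact coord_total _
  have h1 := HasSlope.sum W.heads fun F hF => hasSlope_head (hsum F hF) (coord_total x) hw
  have h2 := HasSlope.sum W.tails fun F hF => hasSlope_tail (hsum' F hF) (coord_total x) hw
  have h3 := HasSlope.sum W.inner (x := coord x) fun p _ =>
    hasSlope_line (W.typ p) (coord (W.head p) (W.typ p)) hw
  refine ((h1.add h2).sub h3).congr ?_
  have hrays : ∀ l, ∑ F ∈ W.heads, headRay F (coord x) l + ∑ G ∈ W.tails, tailRay G (coord x) l -
      ∑ p ∈ W.inner, (if W.typ p = l then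
        (if coord x (W.typ p) = coord (W.head p) (W.typ p) then (1 : ℝ) else 0) else 0) =
      if ∃ p, W.typ p = l ∧ W.Thru p x then 1 else 0 := by
    intro l
    rw [sum_heads l, sum_tails l, sum_inner l, ← Finset.filter_filter, ← Finset.filter_filter,
      Finset.sum_filter (p := W.HeadIn), Finset.sum_filter (p := W.TailIn),
      ← Finset.sum_add_distrib, ← Finset.sum_sub_distrib]
    have : ∀ p ∈ Finset.univ.filter (fun p => W.typ p = l),
        ((if W.HeadIn p then headRay (coord (W.head p)) (coord x) l else 0) +
      (if W.TailIn p then tailRay (coord (W.tail p)) (coord x) l else 0) -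
      (if W.HeadIn p ∧ W.TailIn p then
        (if coord x (W.typ p) = coord (W.head p) (W.typ p) then (1 : ℝ) else 0) else 0)) =
      if W.Thru p x then 1 else 0 := by
      intro p hp
      obtain rfl := (Finset.mem_filter.1 hp).2
      exact ray_count p hx
    rw [Finset.sum_congr rfl this]
    split_ifs with h
    · obtain ⟨p, rfl, hp⟩ := h
      rw [Finset.sum_eq_single p]
      · exact if_pos hp
      · intro q hq hqp
        exact if_neg fun hq' => hqp (thru_unique hq' hp (Finset.mem_filter.1 hq).2)
      · simp
    · refine Finset.sum_eq_zero fun p hp => if_neg fun hp' => h ⟨p, (Finset.mem_filter.1 hp).2, hp'⟩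
  have hlines : ∑ p ∈ W.inner, (if coord x (W.typ p) = coord (W.head p) (W.typ p) then (1 : ℝ) else
      0)
      * max (w (W.typ p)) 0 = ∑ l, (∑ p ∈ W.inner, (if W.typ p = l then
        (if coord x (W.typ p) = coord (W.head p) (W.typ p) then (1 : ℝ) else 0) else 0)) *
          max (w l) 0 := by
    simp only [Finset.sum_mul]
    rw [Finset.sum_comm]
    refine Finset.sum_congr rfl fun p _ => ?_
    simp only [ite_mul, zero_mul]
    rw [Finset.sum_ite_eq]
    simp
  have hfin : ∑ l, (if ∃ p, W.typ p = l ∧ W.Thru p x then max (w l) 0 else 0) =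
      ∑ l, (∑ F ∈ W.heads, headRay F (coord x) l) * max (w l) 0 +
      ∑ l, (∑ G ∈ W.tails, tailRay G (coord x) l) * max (w l) 0 -
      ∑ l, (∑ p ∈ W.inner, (if W.typ p = l then
        (if coord x (W.typ p) = coord (W.head p) (W.typ p) then (1 : ℝ) else 0) else 0)) *
          max (w l) 0 := by
    rw [← Finset.sum_add_distrib, ← Finset.sum_sub_distrib]
    refine Finset.sum_congr rfl fun l _ => ?_
    rw [← add_mul, ← sub_mul, hrays l, ite_mul, one_mul, zero_mul]
  rw [hfin, ← hlines, pairing_base]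
  simp only [Finset.sum_add_distrib, Finset.sum_neg_distrib, Finset.sum_ite_eq, Finset.sum_mul]
  rw [Finset.sum_comm (s := W.heads), Finset.sum_comm (s := W.tails)]
  ring

/-! ### Counting the boundary points -/

theorem sum_side (i : Fin 3) (ha : (a i).Injective) {M : Type*} [AddCommMonoid M] (f : ℝ → M) {P : ι
    → Prop} {u : ι → ℂ}
    {Q : Fin n → Prop} [DecidablePred P] [DecidablePred Q] (hQ : ∀ j, Q j ↔ ∃ p, P p ∧ coord (u p)
        (i + 1) = a i j)
    (hP : ∀ p, P p → ∃ j, a i j = coord (u p) (i + 1))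
    (hinj : ∀ p q, P p → P q → coord (u p) (i + 1) = coord (u q) (i + 1) → p = q) :
    ∑ p with P p, f (coord (u p) (i + 1)) = ∑ j with Q j, f (a i j) := by
  rw [← Finset.sum_image (g := fun p => coord (u p) (i + 1)) (f := f) fun p hp q hq =>
      hinj p q (Finset.mem_filter.1 hp).2 (Finset.mem_filter.1 hq).2,
    ← Finset.sum_image (g := a i) (f := f) ha.injOn]
  congr 1
  ext r
  simp only [Finset.mem_image, Finset.mem_filter, Finset.mem_univ, true_and, hQ]
  constructor
  · rintro ⟨p, hp, rfl⟩
    obtain ⟨j, hj⟩ := hP p hp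
    exact ⟨j, ⟨p, hp, hj.symm⟩, hj⟩
  · rintro ⟨j, ⟨p, hp, hj⟩, rfl⟩
    exact ⟨p, hp, hj⟩

open Classical in
theorem sum_ones (i : Fin 3) {M : Type*} [AddCommMonoid M] (f : ℝ → M) :
    ∑ p with W.typ p = i + 2 ∧ ¬ W.HeadIn p, f (coord (W.head p) (i + 1)) =
      ∑ j with W.IsOne i j, f (a i j) := by
  have h0 : ∀ p, W.typ p = i + 2 ∧ ¬ W.HeadIn p → coord (W.head p) i = 0 := fun p hp =>
    (W.head_side_iff p i).2 hp.symm
  refine sum_side i (W.anti i).injective f (fun j => exists_congr fun p =>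
    ⟨fun h => ⟨⟨h.2.1, h.1⟩, h.2.2⟩, fun h => ⟨h.1.2, h.1.1, h.2⟩⟩)
    (fun p hp => (W.bdry i _).1 ⟨p, .inl ⟨h0 p hp, rfl⟩⟩) fun p q hp hq h =>
      head_inj (coord_ext (i + 1) h (by rw [idx_one_two, h0 p hp, h0 q hq])) (hp.1.trans hq.1.symm)

open Classical in
theorem sum_zeros (i : Fin 3) {M : Type*} [AddCommMonoid M] (f : ℝ → M) :
    ∑ p with W.typ p = i + 1 ∧ ¬ W.TailIn p, f (coord (W.tail p) (i + 1)) =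
      ∑ j with ¬ W.IsOne i j, f (a i j) := by
  have h0 : ∀ p, W.typ p = i + 1 ∧ ¬ W.TailIn p → coord (W.tail p) i = 0 := fun p hp =>
    (W.tail_side_iff p i).2 hp.symm
  refine sum_side i (W.anti i).injective f (fun j => not_isOne.trans (exists_congr fun p =>
    ⟨fun h => ⟨⟨h.2.1, h.1⟩, h.2.2⟩, fun h => ⟨h.1.2, h.1.1, h.2⟩⟩))
    (fun p hp => (W.bdry i _).1 ⟨p, .inr ⟨h0 p hp, rfl⟩⟩) fun p q hp hq h =>
      tail_inj (coord_ext (i + 1) h (by rw [idx_one_two, h0 p hp, h0 q hq])) (hp.1.trans hq.1.symm)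

open Classical in
variable (W) in
/-- The number of heads of segments on a side. -/
def ones (i : Fin 3) : ℕ := (Finset.univ.filter fun j => W.IsOne i j).card

open Classical in
/-- Counting the segments of one type by their heads and by their tails. -/
theorem card_type (l : Fin 3) : W.heads.card + W.ones (l + 1) + W.ones (l + 2) = W.tails.card + n :=
    by
  have h1 := sum_heads (W := W) l fun _ => (1 : ℕ)
  have h2 := sum_tails (W := W) l fun _ => (1 : ℕ)
  have h3 := sum_ones (W := W) (l + 1) fun _ => (1 : ℕ)
  have h4 := sum_zeros (W := W) (l + 2) fun _ => (1 : ℕ)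
  simp only [Finset.sum_const, smul_eq_mul, mul_one, idx_one_two, idx_two_one] at h1 h2 h3 h4
  have h5 := Finset.card_filter_add_card_filter_not (s := Finset.univ.filter fun p => W.typ p = l)
      W.HeadIn
  have h6 := Finset.card_filter_add_card_filter_not (s := Finset.univ.filter fun p => W.typ p = l)
      W.TailIn
  have h7 := Finset.card_filter_add_card_filter_not (s := (Finset.univ : Finset (Fin n)))
    (fun j => W.IsOne (l + 2) j)
  rw [Finset.filter_filter, Finset.filter_filter] at h5 h6
  rw [Finset.card_univ, Fintype.card_fin] at h7
  unfold ones
  omega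

theorem ones_eq (i : Fin 3) : W.ones i = W.ones 0 := by
  have h0 := W.card_type 0
  have h1 := W.card_type 1
  have h2 := W.card_type 2
  simp only [zero_add] at h0
  have e1 : (1 : Fin 3) + 1 = 2 := rfl
  have e2 : (1 : Fin 3) + 2 = 0 := rfl
  have e3 : (2 : Fin 3) + 1 = 0 := rfl
  have e4 : (2 : Fin 3) + 2 = 1 := rfl
  rw [e1, e2] at h1
  rw [e3, e4] at h2
  fin_cases i
  · rfl
  · change W.ones 1 = _; omega
  · change W.ones 2 = _; omega

/-- The first boundary points on a side are heads, the other ones are tails. -/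
theorem isOne_iff (hd : W.ones 0 = d) (i : Fin 3) (j : Fin n) : W.IsOne i j ↔ (j : ℕ) < d := by
  classical
  have hc : (Finset.univ.filter fun j => W.IsOne i j).card = d := (W.ones_eq i).trans hd
  have hdown : ∀ j k, W.IsOne i j → k < j → W.IsOne i k := by
    intro j k hj hk
    by_contra h
    exact lt_asymm hk (hj.lt (not_isOne.1 h))
  constructor
  · intro hj
    have : Finset.Iic j ⊆ (Finset.univ.filter fun j => W.IsOne i j) := by
      intro k hk
      rcases (Finset.mem_Iic.1 hk).eq_or_lt with rfl | h
      · simpa using hj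
      · simpa using hdown j k hj h
    have := Finset.card_le_card this
    rw [hc, Fin.card_Iic] at this
    omega
  · intro hj
    by_contra h
    have : (Finset.univ.filter fun j => W.IsOne i j) ⊆ Finset.Iio j := by
      intro k hk
      exact Finset.mem_Iio.2 (IsOne.lt (Finset.mem_filter.1 hk).2 (not_isOne.1 h))
    have := Finset.card_le_card this
    rw [hc, Fin.card_Iio] at this
    omega

end Web

end

section

variable {n d : ℕ} {a : Fin 3 → Fin n → ℝ} {ι : Type}

/-! ### Subdifferentials -/

theorem pairing_neg (w : Fin 3 → ℝ) (v : Pt) : pairing (-w) v = -pairing w v := by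
  simp [pairing]; ring

theorem pairing_smul (t : ℝ) (w : Fin 3 → ℝ) (v : Pt) : pairing (t • w) v = t * pairing w v := by
  simp [pairing]; ring

/-- The direction with pairing `v i`, up to a constant. -/
def testDir (i : Fin 3) : Fin 3 → ℝ := fun k => if k = i then 1 else if k = i + 2 then -1 else 0

theorem testDir_sum (i : Fin 3) : testDir i 0 + testDir i 1 + testDir i 2 = 0 := by
  rw [← sum_rot i (testDir i)]
  simp [testDir]

theorem pairing_testDir (i : Fin 3) (v : Pt) :
    pairing (testDir i) v = v i - ((v 0 + v 1 + v 2 : ℤ) : ℝ) / 3 := by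
  rw [pairing_eq i, ← sum_rot i v]
  simp [testDir, lin]
  ring

namespace Web

variable (W : Web n a ι) [Fintype ι]

/-- The lattice points which are subgradients of the potential at `x`. -/
def Sub (d : ℕ) (x : ℂ) : Set Pt :=
  {v | v 0 + v 1 + v 2 = n + d ∧ ∀ w : Fin 3 → ℝ, w 0 + w 1 + w 2 = 0 →
    ∀ m, HasSlope W.pot (coord x) w m → pairing w v ≤ m}

/-- `W.Germ d x lo hi` describes the web near `x`, and gives the coordinatewise bounds `lo` and `hi`
for the subgradients at `x`. -/
inductive Germ (d : ℕ) (x : ℂ) : Pt → Pt → Prop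
  | none (h : ∀ p, x ∉ W.seg p) : Germ d x (W.base d (coord x)) (W.base d (coord x))
  | edge (p : ι) (h : W.Thru p x) (hu : ∀ q, x ∈ W.seg q → q = p) :
      Germ d x (W.base d (coord x) - eps (W.typ p + 1)) (W.base d (coord x) + eps (W.typ p))
  | cross (p q : ι) (hp : W.Thru p x) (hq : W.Thru q x) (hcp : W.col p = .zero)
      (hcq : W.col q = .one) (ht : W.typ q = W.typ p + 2) (hu : ∀ r, x ∈ W.seg r → r = p ∨ r = q) :
      Germ d x (W.base d (coord x) - eps (W.typ p + 1) - eps (W.typ p))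
        (W.base d (coord x) + eps (W.typ p) + eps (W.typ p + 2))
  | head (p : ι) (hp : W.HeadIn p) (hx : x = W.head p) (hu : ∀ q, x ∈ W.seg q → x = W.head q) :
      Germ d x (W.base d (coord x)) (W.base d (coord x) + 1)
  | tail (p : ι) (hp : W.TailIn p) (hx : x = W.tail p) (hu : ∀ q, x ∈ W.seg q → x = W.tail q) :
      Germ d x (W.base d (coord x) - 1) (W.base d (coord x))

variable {W}

/-- The subgradients at `x` are the lattice points in a box, and they determine the slopes. -/
def IsBox (W : Web n a ι) (d : ℕ) (x : ℂ) (lo hi : Pt) : Prop :=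
  (∀ v, v ∈ W.Sub d x ↔ v 0 + v 1 + v 2 = n + d ∧ ∀ i, lo i ≤ v i ∧ v i ≤ hi i) ∧
  ∀ w : Fin 3 → ℝ, w 0 + w 1 + w 2 = 0 → ∃ v ∈ W.Sub d x, HasSlope W.pot (coord x) w (pairing w v)

theorem isBox_of {x : ℂ} {lo hi : Pt} {val : (Fin 3 → ℝ) → ℝ}
    (h1 : ∀ w : Fin 3 → ℝ, w 0 + w 1 + w 2 = 0 → HasSlope W.pot (coord x) w (val w))
    (h2 : ∀ v : Pt, v 0 + v 1 + v 2 = n + d → (∀ i, lo i ≤ v i ∧ v i ≤ hi i) →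
      ∀ w : Fin 3 → ℝ, w 0 + w 1 + w 2 = 0 → pairing w v ≤ val w)
    (h3 : ∀ w : Fin 3 → ℝ, w 0 + w 1 + w 2 = 0 → ∃ v : Pt, v 0 + v 1 + v 2 = n + d ∧
      (∀ i, lo i ≤ v i ∧ v i ≤ hi i) ∧ pairing w v = val w) : IsBox W d x lo hi := by
  have key : ∀ v : Pt, v 0 + v 1 + v 2 = n + d → (∀ i, lo i ≤ v i ∧ v i ≤ hi i) →
      v ∈ W.Sub d x := by
    intro v hv hb
    refine ⟨hv, fun w hw m hm => ?_⟩
    rw [hm.unique (h1 w hw)]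
    exact h2 v hv hb w hw
  refine ⟨fun v => ⟨?_, fun h => key v h.1 h.2⟩, fun w hw => ?_⟩
  · rintro ⟨hv, hs⟩
    refine ⟨hv, fun i => ?_⟩
    obtain ⟨u, u1, u2, u3⟩ := h3 _ (testDir_sum i)
    have hw : (-testDir i) 0 + (-testDir i) 1 + (-testDir i) 2 = 0 := by
      have := testDir_sum i
      simp only [Pi.neg_apply]; linarith
    obtain ⟨u', u1', u2', u3'⟩ := h3 _ hw
    have e1 := hs _ (testDir_sum i) _ (h1 _ (testDir_sum i))
    have e2 := hs _ hw _ (h1 _ hw)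
    rw [← u3, pairing_testDir, pairing_testDir, hv, u1] at e1
    rw [← u3', pairing_neg, pairing_neg, pairing_testDir, pairing_testDir, hv, u1'] at e2
    have e1 : (v i : ℝ) ≤ u i := by linarith
    have e2 : (u' i : ℝ) ≤ v i := by linarith
    exact ⟨(u2' i).1.trans (by exact_mod_cast e2), le_trans (by exact_mod_cast e1) (u2 i).2⟩
  · obtain ⟨v, hv, hb, he⟩ := h3 w hw
    exact ⟨v, key v hv hb, he ▸ h1 w hw⟩

theorem isBox_none {x : ℂ} {b : Pt} (hb : b 0 + b 1 + b 2 = n + d)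
    (h1 : ∀ w : Fin 3 → ℝ, w 0 + w 1 + w 2 = 0 → HasSlope W.pot (coord x) w (pairing w b)) :
    IsBox W d x b b := by
  refine isBox_of h1 ?_ fun w _ => ⟨b, hb, fun i => ⟨le_rfl, le_rfl⟩, rfl⟩
  intro v _ hv w _
  have : v = b := funext fun i => le_antisymm (hv i).2 (hv i).1
  rw [this]

theorem isBox_edge {x : ℂ} {b : Pt} (l : Fin 3) (hb : b 0 + b 1 + b 2 = n + d)
    (h1 : ∀ w : Fin 3 → ℝ, w 0 + w 1 + w 2 = 0 →
      HasSlope W.pot (coord x) w (pairing w b + max (w l) 0)) :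
    IsBox W d x (b - eps (l + 1)) (b + eps l) := by
  have hb' := sum_rot l b
  refine isBox_of h1 ?_ fun w hw => ?_
  · intro v hv hbox w hw
    have hv' := sum_rot l v
    have hd := lin_sub l (z := w) (by rw [sum_rot l w]; exact hw)
    rw [forall_idx l] at hbox
    simp [eps_apply] at hbox
    have hor : v = b ∨ v = b + eps l - eps (l + 1) := by
      have h := fun (u : Pt) (h : v l = u l ∧ v (l + 1) = u (l + 1) ∧ v (l + 2) = u (l + 2)) =>
        pt_ext l h.1 h.2.1 h.2.2
      refine Or.imp (h _) (h _) ?_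
      simp [eps_apply]
      omega
    rcases hor with rfl | rfl
    · linarith [le_max_right (w l) 0]
    · rw [pairing_sub, pairing_add, pairing_lin, pairing_lin]
      linarith [le_max_left (w l) 0]
  · have hd := lin_sub l (z := w) (by rw [sum_rot l w]; exact hw)
    rcases le_total (w l) 0 with h | h
    · refine ⟨b, hb, ?_, by rw [max_eq_right h, add_zero]⟩
      rw [forall_idx l]; simp [eps_apply]
    · refine ⟨b + eps l - eps (l + 1), ?_, ?_, ?_⟩
      · rw [← sum_rot l (b + eps l - eps (l + 1))]; simp [eps_apply]; omega
      · rw [forall_idx l]; simp [eps_apply]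
      · rw [pairing_sub, pairing_add, pairing_lin, pairing_lin, max_eq_left h]; linarith

theorem isBox_cross {x : ℂ} {b : Pt} (k : Fin 3) (hb : b 0 + b 1 + b 2 = n + d)
    (h1 : ∀ w : Fin 3 → ℝ, w 0 + w 1 + w 2 = 0 →
      HasSlope W.pot (coord x) w (pairing w b + (max (w k) 0 + max (w (k + 2)) 0))) :
    IsBox W d x (b - eps (k + 1) - eps k) (b + eps k + eps (k + 2)) := by
  have hb' := sum_rot k b
  have hlin : ∀ w : Fin 3 → ℝ, w 0 + w 1 + w 2 = 0 → lin k w - lin (k + 1) w = w k ∧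
      lin (k + 2) w - lin k w = w (k + 2) := by
    intro w hw
    have h2 := sum_rot k w
    refine ⟨lin_sub k (by linarith), ?_⟩
    have := lin_sub (k + 2) (z := w) (by simp; linarith)
    rwa [idx_two_one] at this
  refine isBox_of h1 ?_ fun w hw => ?_
  · intro v hv hbox w hw
    have hv' := sum_rot k v
    obtain ⟨d1, d2⟩ := hlin w hw
    have m1 := le_max_left (w k) 0
    have m2 := le_max_right (w k) 0
    have m3 := le_max_left (w (k + 2)) 0
    have m4 := le_max_right (w (k + 2)) 0
    rw [forall_idx k] at hbox
    simp [eps_apply] at hbox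
    have hor : v = b ∨ v = b + eps k - eps (k + 1) ∨ v = b + eps (k + 2) - eps k ∨
        v = b + eps (k + 2) - eps (k + 1) := by
      have h := fun (u : Pt) (h : v k = u k ∧ v (k + 1) = u (k + 1) ∧ v (k + 2) = u (k + 2)) =>
        pt_ext k h.1 h.2.1 h.2.2
      refine Or.imp (h _) (Or.imp (h _) (Or.imp (h _) (h _))) ?_
      simp [eps_apply]
      omega
    rcases hor with rfl | rfl | rfl | rfl
    · linarith
    all_goals
      rw [pairing_sub, pairing_add, pairing_lin, pairing_lin]
      linarith
  · obtain ⟨d1, d2⟩ := hlin w hw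
    rcases le_total (w k) 0 with h | h <;> rcases le_total (w (k + 2)) 0 with h' | h'
    · refine ⟨b, hb, ?_, by rw [max_eq_right h, max_eq_right h']; ring⟩
      rw [forall_idx k]; simp [eps_apply]
    · refine ⟨b + eps (k + 2) - eps k, ?_, ?_, ?_⟩
      · rw [← sum_rot k (b + eps (k + 2) - eps k)]; simp [eps_apply]; omega
      · rw [forall_idx k]; simp [eps_apply]; omega
      · rw [pairing_sub, pairing_add, pairing_lin, pairing_lin, max_eq_right h, max_eq_left h']
        linarith
    · refine ⟨b + eps k - eps (k + 1), ?_, ?_, ?_⟩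
      · rw [← sum_rot k (b + eps k - eps (k + 1))]; simp [eps_apply]; omega
      · rw [forall_idx k]; simp [eps_apply]; omega
      · rw [pairing_sub, pairing_add, pairing_lin, pairing_lin, max_eq_left h, max_eq_right h']
        linarith
    · refine ⟨b + eps (k + 2) - eps (k + 1), ?_, ?_, ?_⟩
      · rw [← sum_rot k (b + eps (k + 2) - eps (k + 1))]; simp [eps_apply]; omega
      · rw [forall_idx k]; simp [eps_apply]
      · rw [pairing_sub, pairing_add, pairing_lin, pairing_lin, max_eq_left h, max_eq_left h']
        linarith

theorem exists_eq_eps {u : Pt} (h0 : ∀ i, 0 ≤ u i) (hs : u 0 + u 1 + u 2 = 1) : ∃ j, u = eps j := by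
  have h := fun (v : Pt) (h : u 0 = v 0 ∧ u 1 = v 1 ∧ u 2 = v 2) => pt_ext 0 h.1 h.2.1 h.2.2
  have : u = eps 0 ∨ u = eps 1 ∨ u = eps 2 := by
    refine Or.imp (h _) (Or.imp (h _) (h _)) ?_
    have := h0 0
    have := h0 1
    have := h0 2
    simp [eps_apply]
    omega
  rcases this with h | h | h
  exacts [⟨0, h⟩, ⟨1, h⟩, ⟨2, h⟩]

theorem isBox_head {x : ℂ} {b : Pt} (hb : b 0 + b 1 + b 2 + 1 = n + d)
    (h1 : ∀ w : Fin 3 → ℝ, w 0 + w 1 + w 2 = 0 →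
      HasSlope W.pot (coord x) w (pairing w b + tri w)) : IsBox W d x b (b + 1) := by
  refine isBox_of h1 ?_ fun w hw => ?_
  · intro v hv hbox w hw
    obtain ⟨j, hj⟩ := exists_eq_eps (u := v - b) (fun i => sub_nonneg.2 (hbox i).1)
      (by simp only [Pi.sub_apply]; omega)
    obtain rfl : v = b + eps j := by rw [← hj]; abel
    rw [pairing_add, pairing_lin]
    linarith [lin_le_tri j w]
  · obtain ⟨j, hj⟩ := exists_lin_eq_tri w
    refine ⟨b + eps j, ?_, fun i => ?_, by rw [pairing_add, pairing_lin, hj]⟩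
    · have := eps_sum j
      simp only [Pi.add_apply]; omega
    · simp only [Pi.add_apply, eps_apply, Pi.one_apply]
      split_ifs <;> omega

theorem isBox_tail {x : ℂ} {b : Pt} (hb : b 0 + b 1 + b 2 = n + d + 1)
    (h1 : ∀ w : Fin 3 → ℝ, w 0 + w 1 + w 2 = 0 →
      HasSlope W.pot (coord x) w (pairing w b + tri (-w))) : IsBox W d x (b - 1) b := by
  refine isBox_of h1 ?_ fun w hw => ?_
  · intro v hv hbox w hw
    obtain ⟨j, hj⟩ := exists_eq_eps (u := b - v) (fun i => sub_nonneg.2 (hbox i).2)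
      (by simp only [Pi.sub_apply]; omega)
    obtain rfl : v = b - eps j := by rw [← hj]; abel
    rw [pairing_sub, pairing_lin]
    have := lin_le_tri j (-w)
    rw [lin_neg] at this
    linarith
  · obtain ⟨j, hj⟩ := exists_lin_eq_tri (-w)
    rw [lin_neg] at hj
    refine ⟨b - eps j, ?_, fun i => ?_, by rw [pairing_sub, pairing_lin]; linarith⟩
    · have := eps_sum j
      simp only [Pi.sub_apply]; omega
    · simp only [Pi.sub_apply, eps_apply, Pi.one_apply]
      split_ifs <;> omega

open Classical in
theorem base_sum (hd : W.ones 0 = d) (x : ℂ) :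
    W.base d (coord x) 0 + W.base d (coord x) 1 + W.base d (coord x) 2 +
      (if coord x ∈ W.heads then 1 else 0) = n + d + if coord x ∈ W.tails then 1 else 0 := by
  have h1 : ∑ F ∈ W.heads, (headVec F (coord x) 0 + headVec F (coord x) 1 + headVec F (coord x) 2) =
      W.heads.card - if coord x ∈ W.heads then 1 else 0 := by
    have : ∀ F ∈ W.heads, headVec F (coord x) 0 + headVec F (coord x) 1 + headVec F (coord x) 2 =
        1 - if coord x = F then 1 else 0 := by
      intro F hF
      rw [headVec_sum _ (coord_total x)]
      · split_ifs <;> rfl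
      · simp only [heads, Finset.mem_image] at hF
        obtain ⟨p, -, rfl⟩ := hF
        exact coord_total _
    rw [Finset.sum_congr rfl this, Finset.sum_sub_distrib, Finset.sum_ite_eq]
    simp
  have h2 : ∑ F ∈ W.tails, (tailVec F (coord x) 0 + tailVec F (coord x) 1 + tailVec F (coord x) 2) =
      (if coord x ∈ W.tails then 1 else 0) - W.tails.card := by
    have : ∀ F ∈ W.tails, tailVec F (coord x) 0 + tailVec F (coord x) 1 + tailVec F (coord x) 2 =
        (if coord x = F then 1 else 0) - 1 := by
      intro F hF
      rw [tailVec_sum _ (coord_total x)]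
      · split_ifs <;> rfl
      · simp only [tails, Finset.mem_image] at hF
        obtain ⟨p, -, rfl⟩ := hF
        exact coord_total _
    rw [Finset.sum_congr rfl this, Finset.sum_sub_distrib, Finset.sum_ite_eq]
    simp
  have h3 : ∑ p ∈ W.inner, (lineVec (W.typ p) (coord (W.head p) (W.typ p)) (coord x) 0 +
      lineVec (W.typ p) (coord (W.head p) (W.typ p)) (coord x) 1 +
      lineVec (W.typ p) (coord (W.head p) (W.typ p)) (coord x) 2) = 0 :=
    Finset.sum_eq_zero fun p _ => lineVec_sum _ _ _
  have h4 := W.card_type 0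
  have h5 := W.ones_eq 1
  have h6 := W.ones_eq 2
  simp only [zero_add] at h4
  simp only [Finset.sum_add_distrib] at h1 h2 h3
  simp only [base]
  omega

theorem mem_heads {x : ℂ} : coord x ∈ W.heads ↔ ∃ p, W.HeadIn p ∧ x = W.head p := by
  simp only [heads, Finset.mem_image, Finset.mem_filter, Finset.mem_univ, true_and]
  exact exists_congr fun p => and_congr_right fun _ =>
    ⟨fun h => coord_injective h.symm, fun h => by rw [h]⟩

theorem mem_tails {x : ℂ} : coord x ∈ W.tails ↔ ∃ p, W.TailIn p ∧ x = W.tail p := by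
  simp only [tails, Finset.mem_image, Finset.mem_filter, Finset.mem_univ, true_and]
  exact exists_congr fun p => and_congr_right fun _ =>
    ⟨fun h => coord_injective h.symm, fun h => by rw [h]⟩

/-- The shape of the web and the subgradients at a point of the triangle. -/
theorem exists_germ (hd : W.ones 0 = d) {x : ℂ} (hx : x ∈ triangle) :
    ∃ lo hi, W.Germ d x lo hi ∧ IsBox W d x lo hi := by
  classical
  have hsum := W.base_sum hd x
  have hslope := fun (w : Fin 3 → ℝ) (hw : w 0 + w 1 + w 2 = 0) => W.hasSlope_pot (d := d) hx hw
  have hseg : ∀ q, x ∈ W.seg q → W.Thru q x ∨ (x = W.head q ∧ W.HeadIn q) ∨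
      (x = W.tail q ∧ W.TailIn q) := by
    intro q hq
    by_cases h1 : x = W.head q ∧ W.HeadIn q
    · exact .inr (.inl h1)
    · by_cases h2 : x = W.tail q ∧ W.TailIn q
      · exact .inr (.inr h2)
      · exact .inl ⟨hq, fun h h' => h1 ⟨h, h'⟩, fun h h' => h2 ⟨h, h'⟩⟩
  have hzero : (∀ q, ¬ W.Thru q x) → ∀ w : Fin 3 → ℝ,
      ∑ l, (if ∃ p, W.typ p = l ∧ W.Thru p x then max (w l) 0 else 0) = 0 := by
    intro h w
    refine Finset.sum_eq_zero fun l _ => if_neg ?_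
    rintro ⟨p, -, hp⟩
    exact h p hp
  by_cases hh : coord x ∈ W.heads
  · obtain ⟨p, hp, rfl⟩ := mem_heads.1 hh
    have ht : coord (W.head p) ∉ W.tails := by
      rw [mem_tails]
      rintro ⟨q, -, hq⟩
      exact W.head_ne_tail p q hq
    have hno : ∀ q, ¬ W.Thru q (W.head p) := fun q hq => W.not_thru_head hp hq
    rw [if_pos hh, if_neg ht] at hsum
    refine ⟨_, _, .head p hp rfl fun q hq => ?_, isBox_head (by omega) fun w hw => ?_⟩
    · rcases hseg q hq with h | ⟨h, -⟩ | ⟨h, -⟩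
      · exact absurd h (hno q)
      · exact h
      · exact absurd h (W.head_ne_tail p q)
    · refine (hslope w hw).congr ?_
      rw [hzero hno, if_pos hh, if_neg ht]; ring
  by_cases ht : coord x ∈ W.tails
  · obtain ⟨p, hp, rfl⟩ := mem_tails.1 ht
    have hno : ∀ q, ¬ W.Thru q (W.tail p) := fun q hq => W.not_thru_tail hp hq
    rw [if_neg hh, if_pos ht] at hsum
    refine ⟨_, _, .tail p hp rfl fun q hq => ?_, isBox_tail (by omega) fun w hw => ?_⟩
    · rcases hseg q hq with h | ⟨h, -⟩ | ⟨h, -⟩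
      · exact absurd h (hno q)
      · exact absurd h.symm (W.head_ne_tail q p)
      · exact h
    · refine (hslope w hw).congr ?_
      rw [hzero hno, if_neg hh, if_pos ht]; ring
  rw [if_neg hh, if_neg ht] at hsum
  have hthru : ∀ q, x ∈ W.seg q → W.Thru q x := by
    intro q hq
    rcases hseg q hq with h | ⟨h, h'⟩ | ⟨h, h'⟩
    · exact h
    · exact absurd (mem_heads.2 ⟨q, h', h⟩) hh
    · exact absurd (mem_tails.2 ⟨q, h', h⟩) ht
  simp only [if_neg hh, if_neg ht, add_zero] at hslope
  by_cases h0 : ∀ q, ¬ W.Thru q x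
  · refine ⟨_, _, .none fun q hq => h0 q (hthru q hq), isBox_none (by omega) fun w hw => ?_⟩
    refine (hslope w hw).congr ?_
    rw [hzero h0, add_zero]
  push Not at h0
  obtain ⟨p, hp⟩ := h0
  by_cases h1 : ∀ q, W.Thru q x → q = p
  · refine ⟨_, _, .edge p hp fun q hq => h1 q (hthru q hq),
      isBox_edge (W.typ p) (by omega) fun w hw => ?_⟩
    refine (hslope w hw).congr ?_
    congr 1
    rw [Finset.sum_eq_single (W.typ p), if_pos ⟨p, rfl, hp⟩]
    · intro l _ hl
      refine if_neg ?_
      rintro ⟨q, rfl, hq⟩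
      exact hl (by rw [h1 q hq])
    · simp
  push Not at h1
  obtain ⟨q, hq, hqp⟩ := h1
  have key : ∀ p q, W.Thru p x → W.Thru q x → p ≠ q → W.col p = .zero → W.col q = .one →
      W.typ q = W.typ p + 2 → ∃ lo hi, W.Germ d x lo hi ∧ IsBox W d x lo hi := by
    intro p q hp hq hpq hcp hcq ht
    have honly : ∀ r, W.Thru r x → r = p ∨ r = q := by
      intro r hr
      by_contra hcon
      push Not at hcon
      rcases (thru_cross hr hp hcon.1).2 with ⟨c1, c2, -⟩ | ⟨c1, c2, -⟩
      · rw [hcp] at c2; cases c2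
      · rcases (thru_cross hr hq hcon.2).2 with ⟨c3, c4, -⟩ | ⟨c3, c4, -⟩
        · rw [c2] at c3; cases c3
        · rw [hcq] at c3; cases c3
    refine ⟨_, _, .cross p q hp hq hcp hcq ht fun r hr => honly r (hthru r hr),
      isBox_cross (W.typ p) (by omega) fun w hw => ?_⟩
    refine (hslope w hw).congr ?_
    congr 1
    have hno : ¬ ∃ r, W.typ r = W.typ p + 1 ∧ W.Thru r x := by
      rintro ⟨r, hr, hr'⟩
      rcases honly r hr' with rfl | rfl
      · simp at hr
      · rw [ht] at hr; simp at hr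
    rw [Fin.sum_univ_three, ← sum_rot (W.typ p) fun l =>
      if ∃ p, W.typ p = l ∧ W.Thru p x then max (w l) 0 else 0]
    rw [if_pos ⟨p, rfl, hp⟩, if_neg hno, if_pos ⟨q, ht, hq⟩]
    ring
  rcases (thru_cross hp hq hqp.symm).2 with ⟨c1, c2, c3⟩ | ⟨c1, c2, c3⟩
  · exact key p q hp hq hqp.symm c1 c2 c3
  · exact key q p hq hp hqp c1 c2 c3

end Web

end

section

variable {n d : ℕ} {a : Fin 3 → Fin n → ℝ} {ι : Type}

open Filter Topology

namespace Web

variable {W : Web n a ι} [Fintype ι] {x y z : ℂ} {u v : Pt}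

/-! ### Convexity of the potential -/

theorem exists_point (hx : x ∈ triangle) (hy : y ∈ triangle) {t : ℝ} (h0 : 0 ≤ t) (h1 : t ≤ 1) :
    ∃ z ∈ triangle, coord z = coord x + t • (coord y - coord x) := by
  have hc : ∀ k, coord ((1 - t) • x + t • y) k = (1 - t) * coord x k + t * coord y k :=
    coord_combo (by ring) x y
  refine ⟨(1 - t) • x + t • y, mem_triangle.2 fun k => ?_, funext fun k => ?_⟩
  · rw [hc]
    have := mul_nonneg (sub_nonneg.2 h1) (mem_triangle.1 hx k)
    have := mul_nonneg h0 (mem_triangle.1 hy k)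
    linarith
  · rw [hc]; simp; ring

theorem sub_total (x y : ℂ) : (coord y - coord x) 0 + (coord y - coord x) 1 +
    (coord y - coord x) 2 = 0 := by
  have := coord_total x
  have := coord_total y
  simp only [Pi.sub_apply]; linarith

theorem pot_le_chord (hd : W.ones 0 = d) (hx : x ∈ triangle) (hy : y ∈ triangle) {t : ℝ}
    (h0 : 0 ≤ t) (h1 : t ≤ 1) : W.pot (coord x + t • (coord y - coord x)) ≤
      W.pot (coord x) + t * (W.pot (coord y) - W.pot (coord x)) := by
  have := HasSlope.le_chord (f := W.pot) (x := coord x) (w := coord y - coord x) continuous_pot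
    ?_ h0 h1
  · rwa [add_sub_cancel] at this
  · intro t h0 h1
    obtain ⟨z, hz, hc⟩ := exists_point hx hy h0.le h1.le
    obtain ⟨_, _, -, hb⟩ := exists_germ hd hz
    obtain ⟨v, hv, h2⟩ := hb.2 _ (sub_total x y)
    obtain ⟨u, hu, h3⟩ := hb.2 (-(coord y - coord x))
      (by have := sub_total x y; simp only [Pi.neg_apply]; linarith)
    have := hv.2 _ (by have := sub_total x y; simp only [Pi.neg_apply]; linarith) _ h3
    rw [hc] at h2 h3
    rw [pairing_neg] at this
    exact ⟨_, _, h2, h3, by linarith⟩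

theorem sub_le (hd : W.ones 0 = d) (hv : v ∈ W.Sub d x) (hx : x ∈ triangle) (hy : y ∈ triangle) :
    pairing (coord y - coord x) v ≤ W.pot (coord y) - W.pot (coord x) := by
  obtain ⟨_, _, -, hb⟩ := exists_germ hd hx
  obtain ⟨u, hu, hs⟩ := hb.2 _ (sub_total x y)
  refine (hv.2 _ (sub_total x y) _ hs).trans ?_
  have h1 : ∀ᶠ s in 𝓝[>] (0 : ℝ), s < 1 := nhdsWithin_le_nhds (gt_mem_nhds one_pos)
  obtain ⟨s, h2, h3, h4⟩ := (hs.and (h1.and self_mem_nhdsWithin)).exists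
  have h4 : 0 < s := h4
  have h5 := pot_le_chord hd hx hy h4.le h3.le
  rw [h2] at h5
  exact le_of_mul_le_mul_left (by linarith) h4

theorem sub_antitone (hd : W.ones 0 = d) (hv : v ∈ W.Sub d x) (hu : u ∈ W.Sub d y)
    (hx : x ∈ triangle) (hy : y ∈ triangle) : pairing (coord y - coord x) (v - u) ≤ 0 := by
  have h1 := sub_le hd hv hx hy
  have h2 := sub_le hd hu hy hx
  rw [← neg_sub, pairing_neg] at h2
  rw [pairing_sub]; linarith

theorem le_slope_of_min {w : Fin 3 → ℝ} {m : ℝ}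
    (hmin : ∀ y ∈ triangle, W.pot (coord x) - pairing (coord x) v ≤
      W.pot (coord y) - pairing (coord y) v) (hw : w 0 + w 1 + w 2 = 0)
    (hm : HasSlope W.pot (coord x) w m)
    (hdir : ∀ i, 0 < coord x i ∨ 0 ≤ coord x i ∧ 0 ≤ w i) : pairing w v ≤ m := by
  have h1 : ∀ᶠ s in 𝓝[>] (0 : ℝ), ∀ i, 0 ≤ coord x i + s * w i := eventually_all.2 fun i => by
    rcases hdir i with h | ⟨h, h'⟩
    · have : ContinuousAt (fun s : ℝ => coord x i + s * w i) 0 := by fun_prop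
      exact ((this.eventually (lt_mem_nhds (by simpa using h))).filter_mono
        nhdsWithin_le_nhds).mono fun s hs => le_of_lt hs
    · filter_upwards [self_mem_nhdsWithin] with s hs
      exact add_nonneg h (mul_nonneg (le_of_lt hs) h')
  obtain ⟨s, h2, h3, h4⟩ := (hm.and (h1.and self_mem_nhdsWithin)).exists
  have h4 : 0 < s := h4
  have hc : coord (ofCoord (coord x + s • w)) = coord x + s • w := coord_ofCoord (by
    have := coord_total x
    simp only [Pi.add_apply, Pi.smul_apply, smul_eq_mul]
    linear_combination this + s * hw)
  have h5 := hmin (ofCoord (coord x + s • w)) (mem_triangle.2 fun i => by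
    rw [hc]; simpa using h3 i)
  have h6 : pairing (coord x + s • w) v = pairing (coord x) v + s * pairing w v := by
    simp [pairing]; ring
  rw [hc, h2, h6] at h5
  exact le_of_mul_le_mul_left (by linarith) h4

theorem sub_between (hd : W.ones 0 = d) (hx : x ∈ triangle) (hy : y ∈ triangle) (h1 : v ∈ W.Sub d x)
    (h2 : v ∈ W.Sub d y) {t : ℝ} (ht0 : 0 ≤ t) (ht1 : t ≤ 1)
    (hz : coord z = coord x + t • (coord y - coord x)) (hpos : ∀ i, 0 < coord z i) :
    v ∈ W.Sub d z := by
  refine ⟨h1.1, fun w hw m hm => le_slope_of_min (fun q hq => ?_) hw hm fun i => .inl (hpos i)⟩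
  have e1 := pot_le_chord hd hx hy ht0 ht1
  have e2 := sub_le hd h2 hy hx
  have e3 := sub_le hd h1 hx hq
  have e4 : ∀ p q : Fin 3 → ℝ, pairing (p - q) v = pairing p v - pairing q v := by
    intro p q; simp [pairing]; ring
  have e5 : pairing (coord z) v = pairing (coord x) v + t * pairing (coord y - coord x) v := by
    rw [hz]; simp [pairing]; ring
  rw [← hz] at e1
  rw [e4] at e2 e3 e5
  nlinarith

theorem pairing_edge (l : Fin 3) {w : Fin 3 → ℝ} (hw : w 0 + w 1 + w 2 = 0) :
    pairing w (eps l - eps (l + 1)) = w l := by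
  rw [pairing_sub, pairing_lin, pairing_lin, lin_sub l (by rw [sum_rot l w, hw])]

theorem coord_eq_of_sub (hd : W.ones 0 = d) (hx : x ∈ triangle) (hy : y ∈ triangle) {l : Fin 3}
    {v' : Pt} (he : v' - v = eps l - eps (l + 1))
    (h1 : v ∈ W.Sub d x) (h2 : v' ∈ W.Sub d x) (h3 : v ∈ W.Sub d y) (h4 : v' ∈ W.Sub d y) :
    coord x l = coord y l := by
  have e1 := sub_antitone hd h2 h3 hx hy
  have e2 := sub_antitone hd h4 h1 hy hx
  rw [he, pairing_edge l (sub_total _ _)] at e1 e2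
  simp only [Pi.sub_apply] at e1 e2
  linarith

/-! ### Subgradients on the boundary -/

open Classical in
theorem base_side {i : Fin 3} (hi : coord y i = 0) :
    W.base d (coord y) i = d - ∑ j with W.IsOne i j, (if 1 - a i j < coord y (i + 2) then 1 else 0)
        ∧
    W.base d (coord y) (i + 1) =
      d + ∑ j with ¬ W.IsOne i j, if a i j < coord y (i + 1) then 1 else 0 := by
  have hH : ∀ F ∈ W.heads, 0 ≤ F i := by
    intro F hF
    simp only [heads, Finset.mem_image] at hF
    obtain ⟨p, -, rfl⟩ := hF
    exact mem_triangle.1 (W.head_mem p) i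
  have hT : ∀ F ∈ W.tails, 0 ≤ F i := by
    intro F hF
    simp only [tails, Finset.mem_image] at hF
    obtain ⟨p, -, rfl⟩ := hF
    exact mem_triangle.1 (W.tail_mem p) i
  have hl : ∀ p, ¬ coord (W.head p) i < 0 := fun p => not_lt.2 (mem_triangle.1 (W.head_mem p) i)
  constructor
  · have h1 : ∑ F ∈ W.heads, headVec F (coord y) i = 0 := Finset.sum_eq_zero fun F hF =>
      if_neg fun h => by rw [hi] at h; exact absurd h.1 (not_lt.2 (hH F hF))
    have h2 : ∑ F ∈ W.tails, tailVec F (coord y) i =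
        ∑ F ∈ W.tails, if F (i + 2) < coord y (i + 2) then -1 else 0 :=
      Finset.sum_congr rfl fun F hF => by simp [tailVec, hi, hT F hF]
    have h3 : ∑ p ∈ W.inner, lineVec (W.typ p) (coord (W.head p) (W.typ p)) (coord y) i =
        ∑ p ∈ W.inner, if W.typ p = i + 2 then
          (if coord (W.head p) (i + 2) < coord y (i + 2) then 1 else 0) else 0 :=
      Finset.sum_congr rfl fun p _ => by
        rcases idx_cases i (W.typ p) with h | h | h
        · simp [lineVec, h, hi, hl]
        · unfold lineVec; rw [h]; split_ifs <;> simp_all [eps_apply]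
        · unfold lineVec; rw [h]; split_ifs <;> simp_all [eps_apply]
    rw [base, h1, h2, h3, sum_tails (i + 2), sum_inner (i + 2), zero_add]
    rw [← sum_ones i fun t => if 1 - t < coord y (i + 2) then (1 : ℤ) else 0]
    simp only [Finset.sum_filter]
    rw [← sub_eq_zero, sub_sub_eq_add_sub, add_right_comm _ (d : ℤ), ← Finset.sum_add_distrib,
      ← Finset.sum_add_distrib, add_sub_cancel_right]
    refine Finset.sum_eq_zero fun p _ => ?_
    by_cases ht : W.typ p = i + 2
    swap
    · simp [ht]
    have h4 := (W.arrow p).1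
    rw [ht] at h4
    have h6 := W.headIn_or_tailIn p
    by_cases hh : W.HeadIn p
    · by_cases ht' : W.TailIn p <;> simp [hh, ht, ht', h4]
      split_ifs <;> simp
    · have h5 := (W.head_side_iff p i).2 ⟨hh, ht⟩
      have := coord_sum i (W.head p)
      have h7 : 1 - coord (W.head p) (i + 1) = coord (W.head p) (i + 2) := by linarith
      have ht' := h6.resolve_left hh
      simp [hh, ht, ht', h4, h7]
      split_ifs <;> simp
  · have h1 : ∑ F ∈ W.tails, tailVec F (coord y) (i + 1) = 0 := Finset.sum_eq_zero fun F hF =>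
      if_neg fun h => by rw [idx_one_two, hi] at h; exact absurd h.2 (not_lt.2 (hT F hF))
    have h2 : ∑ F ∈ W.heads, headVec F (coord y) (i + 1) =
        ∑ F ∈ W.heads, if F (i + 1) < coord y (i + 1) then 1 else 0 :=
      Finset.sum_congr rfl fun F hF => by simp [headVec, hi, hH F hF]
    have h3 : ∑ p ∈ W.inner, lineVec (W.typ p) (coord (W.head p) (W.typ p)) (coord y) (i + 1) =
        ∑ p ∈ W.inner, if W.typ p = i + 1 then
          (if coord (W.head p) (i + 1) < coord y (i + 1) then -1 else 0) else 0 :=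
      Finset.sum_congr rfl fun p _ => by
        rcases idx_cases i (W.typ p) with h | h | h
        · simp [lineVec, h, hi, hl]
        · unfold lineVec; rw [h]; split_ifs <;> simp_all [eps_apply]
        · unfold lineVec; rw [h]; split_ifs <;> simp_all [eps_apply]
    rw [base, h1, h2, h3, sum_heads (i + 1), sum_inner (i + 1), add_zero, add_comm (d : ℤ)]
    rw [← sum_zeros i fun t => if t < coord y (i + 1) then (1 : ℤ) else 0]
    simp only [Finset.sum_filter]
    rw [add_left_inj, ← Finset.sum_add_distrib]
    refine Finset.sum_congr rfl fun p _ => ?_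
    by_cases ht : W.typ p = i + 1
    swap
    · simp [ht]
    have h4 := (W.arrow p).1
    rw [ht] at h4
    have h6 := W.headIn_or_tailIn p
    by_cases ht' : W.TailIn p
    · by_cases hh : W.HeadIn p <;> simp [hh, ht, ht']
      split_ifs <;> simp
    · have hh := h6.resolve_right ht'
      simp [hh, ht, ht', h4]

/-- The shape of the web at a point of a side. -/
theorem germ_side (hd : W.ones 0 = d) {i : Fin 3} (hy : y ∈ triangle) (hi : coord y i = 0) :
    (W.base d (coord y) 0 + W.base d (coord y) 1 + W.base d (coord y) 2 = n + d) ∧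
    (((∀ p, y ∉ W.seg p) ∧ IsBox W d y (W.base d (coord y)) (W.base d (coord y))) ∨
    (∃ p j, y = W.head p ∧ W.IsOne i j ∧ coord y (i + 1) = a i j ∧
      IsBox W d y (W.base d (coord y) - eps i) (W.base d (coord y) + eps (i + 2))) ∨
    ∃ p j, y = W.tail p ∧ ¬ W.IsOne i j ∧ coord y (i + 1) = a i j ∧
      IsBox W d y (W.base d (coord y) - eps (i + 2)) (W.base d (coord y) + eps (i + 1))) := by
  classical
  have hsum := W.base_sum hd y
  rw [if_neg, if_neg] at hsum
  rotate_left
  · rw [mem_tails]; rintro ⟨p, hp, rfl⟩; exact (hp i).ne' hi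
  · rw [mem_heads]; rintro ⟨p, hp, rfl⟩; exact (hp i).ne' hi
  refine ⟨by omega, ?_⟩
  obtain ⟨lo, hi', hg, hb⟩ := exists_germ hd hy
  cases hg with
  | none h => exact .inl ⟨h, hb⟩
  | edge p h hu =>
    right
    rcases W.eq_of_side h.1 hi with rfl | rfl
    · obtain ⟨h1, h2⟩ := (W.head_side_iff p i).1 hi
      obtain ⟨j, hj⟩ := (W.bdry i _).1 ⟨p, .inl ⟨hi, rfl⟩⟩
      rw [h2, idx_two_one] at hb
      exact .inl ⟨p, j, rfl, ⟨p, h1, h2, hj.symm⟩, hj.symm, hb⟩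
    · obtain ⟨h1, h2⟩ := (W.tail_side_iff p i).1 hi
      obtain ⟨j, hj⟩ := (W.bdry i _).1 ⟨p, .inr ⟨hi, rfl⟩⟩
      rw [h2, idx_one_one] at hb
      exact .inr ⟨p, j, rfl, W.not_isOne.2 ⟨p, h1, h2, hj.symm⟩, hj.symm, hb⟩
  | cross p q hp hq hcp hcq =>
    have hpq : p ≠ q := by rintro rfl; rw [hcp] at hcq; cases hcq
    exact absurd hi ((thru_cross hp hq hpq).1 i).ne'
  | head p hp hx => exact absurd hi (by rw [hx]; exact (hp i).ne')
  | tail p hp hx => exact absurd hi (by rw [hx]; exact (hp i).ne')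

end Web

end

section

variable {n d : ℕ} {a : Fin 3 → Fin n → ℝ} {ι : Type}

namespace Web

variable {W : Web n a ι} [Fintype ι] {x y z : ℂ} {u v : Pt}

theorem sum_ite_lt {J : Type*} (s : Finset J) (P : J → Prop) [DecidablePred P] :
    (∑ j ∈ s, (if P j then 1 else 0) : ℤ) ≤ s.card ∧
      ((∑ j ∈ s, (if P j then 1 else 0) : ℤ) < s.card ↔ ∃ j ∈ s, ¬ P j) := by
  rw [Finset.sum_boole, ← Finset.filter_ssubset, Nat.cast_lt]
  refine ⟨mod_cast Finset.card_filter_le s P, fun h => ?_, Finset.card_lt_card⟩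
  exact (Finset.filter_subset P s).ssubset_of_ne fun he => by rw [he] at h; exact lt_irrefl _ h

/-- The constraints on the subgradients at a point of a side. -/
theorem sub_side (hd : W.ones 0 = d) {i : Fin 3} (hy : y ∈ triangle) (hi : coord y i = 0)
    (hv : v ∈ W.Sub d y) : (0 ≤ v i ∧ v (i + 1) ≤ n) ∧
      (1 ≤ v i → ∃ j, W.IsOne i j ∧ a i j ≤ coord y (i + 1)) ∧
      (v (i + 1) + 1 ≤ n → ∃ k, ¬ W.IsOne i k ∧ coord y (i + 1) ≤ a i k) := by
  classical
  obtain ⟨b1, b2⟩ := W.base_side (d := d) hi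
  obtain ⟨s1, s2⟩ := sum_ite_lt (Finset.univ.filter fun j => W.IsOne i j)
    fun j => 1 - a i j < coord y (i + 2)
  obtain ⟨s3, s4⟩ := sum_ite_lt (Finset.univ.filter fun j => ¬ W.IsOne i j)
    fun j => a i j < coord y (i + 1)
  have hc := Finset.card_filter_add_card_filter_not (s := (Finset.univ : Finset (Fin n)))
    (fun j => W.IsOne i j)
  have hc' : (Finset.univ.filter fun j => W.IsOne i j).card = d := (W.ones_eq i).trans hd
  rw [hc', Finset.card_univ, Fintype.card_fin] at hc
  rw [hc'] at s1 s2
  simp only [Finset.mem_filter, Finset.mem_univ, true_and, not_lt] at s2 s4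
  have hsum := coord_sum i y
  have t2 := fun h => s2.1 h
  have t4 := fun h => s4.1 h
  have hv' := hv
  obtain ⟨-, ⟨-, h⟩ | ⟨p, j, -, h1, h2, h⟩ | ⟨p, j, -, h1, h2, h⟩⟩ := germ_side hd hy hi
  all_goals
    have hb := ((h.1 v).1 hv).2
    rw [forall_idx i] at hb
    try simp [eps_apply] at hb
  · refine ⟨⟨by omega, by omega⟩, fun h => ?_, fun h => t4 (by omega)⟩
    obtain ⟨j, h1, h2⟩ := t2 (by omega)
    exact ⟨j, h1, by linarith⟩
  · have := s2.2 ⟨j, h1, by linarith⟩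
    exact ⟨⟨by omega, by omega⟩, fun _ => ⟨j, h1, h2.ge⟩, fun h => t4 (by omega)⟩
  · have := s4.2 ⟨j, h1, h2.le⟩
    refine ⟨⟨by omega, by omega⟩, fun h => ?_, fun h => ⟨j, h1, h2.le⟩⟩
    obtain ⟨j, h1, h2⟩ := t2 (by omega)
    exact ⟨j, h1, by linarith⟩

theorem exists_sub (hd : W.ones 0 = d) (hx : x ∈ triangle) : ∃ v, v ∈ W.Sub d x := by
  obtain ⟨_, _, -, hb⟩ := exists_germ hd hx
  obtain ⟨v, hv, -⟩ := hb.2 0 (by simp)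
  exact ⟨v, hv⟩

theorem testDir_sub (i : Fin 3) (hu : u ∈ W.Sub d x) (hv : v ∈ W.Sub d y) (c : ℝ) :
    pairing (c • testDir i) (u - v) = c * (u i - v i) := by
  rw [pairing_smul, pairing_sub, pairing_testDir, pairing_testDir, hu.1, hv.1]; ring

/-- The subgradients are in the hexagon: they are monotone along the way to a side. -/
theorem sub_subset (hd : W.ones 0 = d) (hx : x ∈ triangle) (hv : v ∈ W.Sub d x) :
    v ∈ hiveVertices n d := by
  have hx' := mem_triangle.1 hx
  have move : ∀ (i : Fin 3) (c : ℝ), 0 ≤ coord x i + c → 0 ≤ coord x (i + 2) - c →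
      ∃ y ∈ triangle, coord y i = coord x i + c ∧ coord y (i + 2) = coord x (i + 2) - c ∧
        coord y - coord x = c • testDir i := by
    intro i c h1 h2
    have hc : coord (ofCoord (coord x + c • testDir i)) = coord x + c • testDir i :=
      coord_ofCoord (by
        have := coord_total x
        have := testDir_sum i
        simp only [Pi.add_apply, Pi.smul_apply, smul_eq_mul]
        linear_combination coord_total x + c * testDir_sum i)
    refine ⟨ofCoord (coord x + c • testDir i), mem_triangle.2 ((forall_idx i).2 ?_), ?_, ?_, ?_⟩
    · rw [hc]
      simpa [testDir, h1, h2, ← sub_eq_add_neg] using hx' (i + 1)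
    · rw [hc]; simp [testDir]
    · rw [hc]; simp [testDir]; ring
    · rw [hc, add_sub_cancel_left]
  refine ⟨fun i => ⟨?_, ?_⟩, hv.1⟩
  · rcases (hx' i).eq_or_lt with h0 | h0
    · exact (sub_side hd hx h0.symm hv).1.1
    obtain ⟨y, hy, h1, -, h2⟩ := move i (-coord x i) (by simp) (by linarith [hx' (i + 2)])
    obtain ⟨u, hu⟩ := exists_sub hd hy
    have h3 := sub_antitone hd hv hu hx hy
    rw [h2, testDir_sub i hv hu] at h3
    have h4 := (sub_side hd hy (by rw [h1]; ring) hu).1.1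
    have : (u i : ℝ) ≤ v i := by nlinarith
    exact h4.trans (by exact_mod_cast this)
  · rcases (hx' (i + 2)).eq_or_lt with h0 | h0
    · have := (sub_side hd hx h0.symm hv).1.2
      rwa [idx_two_one] at this
    obtain ⟨y, hy, -, h1, h2⟩ := move i (coord x (i + 2)) (by linarith [hx' i]) (by simp)
    obtain ⟨u, hu⟩ := exists_sub hd hy
    have h3 := sub_antitone hd hv hu hx hy
    rw [h2, testDir_sub i hv hu] at h3
    have h4 := (sub_side hd hy (by rw [h1]; ring) hu).1.2
    rw [idx_two_one] at h4
    have : (v i : ℝ) ≤ u i := by nlinarith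
    exact le_trans (by exact_mod_cast this) h4

/-- The potential minus a linear function whose slope is inside the hexagon is not minimal on the
boundary. -/
theorem exists_min (hd : W.ones 0 = d) {r : Fin 3 → ℝ}
    (hr : ∀ i, (r i : ℝ) = u i - ((u 0 + u 1 + u 2 : ℤ) : ℝ) / 3 + (n + d) / 3)
    (h0 : ∀ i, 0 < r i) (h1 : ∀ i, r i < n) : ∃ x ∈ triangle, (∀ i, 0 < coord x i) ∧
      ∀ i, (∃ v ∈ W.Sub d x, r i ≤ v i) ∧ ∃ v ∈ W.Sub d x, v i ≤ r i := by
  have hcont : Continuous fun z => W.pot z - pairing z u := by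
    have := W.continuous_pot
    unfold pairing
    fun_prop
  obtain ⟨z, hz, hmin⟩ := (isCompact_stdSimplex ℝ (Fin 3)).exists_isMinOn
    ⟨_, ite_eq_mem_stdSimplex ℝ (0 : Fin 3)⟩ hcont.continuousOn
  have hzs : z 0 + z 1 + z 2 = 1 := by rw [← Fin.sum_univ_three]; exact hz.2
  have hc := coord_ofCoord hzs
  set x := ofCoord z
  have hx : x ∈ triangle := mem_triangle.2 fun i => by rw [hc]; exact hz.1 i
  have hmin' : ∀ y ∈ triangle, W.pot (coord x) - pairing (coord x) u ≤
      W.pot (coord y) - pairing (coord y) u := fun y hy => by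
    rw [hc]
    exact hmin ⟨mem_triangle.1 hy, by rw [Fin.sum_univ_three]; exact coord_total y⟩
  obtain ⟨_, _, -, hb⟩ := exists_germ hd hx
  have hneg : ∀ i, (-testDir i) 0 + (-testDir i) 1 + (-testDir i) 2 = 0 := fun i => by
    have := testDir_sum i
    simp only [Pi.neg_apply]; linarith
  have hup : ∀ i, 0 < coord x (i + 2) → ∃ v ∈ W.Sub d x, r i ≤ v i := by
    intro i hi
    obtain ⟨v, hv, hs⟩ := hb.2 _ (testDir_sum i)
    have := le_slope_of_min hmin' (testDir_sum i) hs ((forall_idx i).2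
      ⟨.inr ⟨mem_triangle.1 hx i, by simp [testDir]⟩,
        .inr ⟨mem_triangle.1 hx _, by simp [testDir]⟩, .inl hi⟩)
    rw [pairing_testDir, pairing_testDir, hv.1] at this
    refine ⟨v, hv, ?_⟩
    rw [hr]; push_cast at this ⊢; linarith
  have hdown : ∀ i, 0 < coord x i → ∃ v ∈ W.Sub d x, v i ≤ r i := by
    intro i hi
    obtain ⟨v, hv, hs⟩ := hb.2 _ (hneg i)
    have := le_slope_of_min hmin' (hneg i) hs ((forall_idx i).2
      ⟨.inl hi, .inr ⟨mem_triangle.1 hx _, by simp [testDir]⟩,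
        .inr ⟨mem_triangle.1 hx _, by simp [testDir]⟩⟩)
    rw [pairing_neg, pairing_neg, pairing_testDir, pairing_testDir, hv.1] at this
    refine ⟨v, hv, ?_⟩
    rw [hr]; push_cast at this ⊢; linarith
  have hzero : ∀ i, coord x i = 0 → 0 < coord x (i + 1) →
      ∃ k, ¬ W.IsOne i k ∧ coord x (i + 1) ≤ a i k := by
    intro i hi h2
    obtain ⟨v, hv, h3⟩ := hdown (i + 1) h2
    refine (sub_side hd hx hi hv).2.2 ?_
    have : (v (i + 1) : ℝ) < n := h3.trans_lt (h1 _)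
    exact_mod_cast this
  have hcorner : ∀ i, coord x i = 0 → coord x (i + 2) = 0 → False := by
    intro i hi hi2
    have hs := coord_sum i x
    obtain ⟨k, hk, h3⟩ := hzero i hi (by linarith)
    obtain ⟨p, h4, h5, h6⟩ := not_isOne.1 hk
    have h7 := (W.tail_side_iff p i).2 ⟨h4, h5⟩
    have h8 := coord_sum i (W.tail p)
    have h9 := (W.tail_side_iff p (i + 2)).1 (le_antisymm (by linarith)
      (mem_triangle.1 (W.tail_mem p) _))
    rw [h5] at h9
    simp at h9
  have hpos : ∀ i, 0 < coord x i := by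
    intro i
    refine lt_of_le_of_ne (mem_triangle.1 hx i) fun hi => ?_
    have p2 : 0 < coord x (i + 2) :=
      lt_of_le_of_ne (mem_triangle.1 hx _) fun h => hcorner i hi.symm h.symm
    have p1 : 0 < coord x (i + 1) := lt_of_le_of_ne (mem_triangle.1 hx _) fun h =>
      hcorner (i + 1) h.symm (by rw [idx_one_two]; exact hi.symm)
    obtain ⟨k, hk, h3⟩ := hzero i hi.symm p1
    obtain ⟨v, hv, h4⟩ := hup i p2
    have h5 : (0 : ℝ) < v i := (h0 i).trans_le h4
    obtain ⟨j, hj, h6⟩ := (sub_side hd hx hi.symm hv).2.1 (by exact_mod_cast h5)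
    exact absurd (h6.trans h3) (not_le.2 (W.anti i (hj.lt (not_isOne.1 hk))))
  exact ⟨x, hx, hpos, fun i => ⟨hup i (hpos _), hdown i (hpos i)⟩⟩

/-- Every face of the hexagon is in the subdifferential of a point inside the triangle. -/
theorem exists_face_point (hd : W.ones 0 = d) (f : HiveFace n d) :
    ∃ x ∈ triangle, (∀ i, 0 < coord x i) ∧ ∀ l, f.vertex l ∈ W.Sub d x := by
  obtain ⟨u, s, hs, hu⟩ := f.exists_sign
  have hf := fun l => hu l ▸ f.vertex_mem l
  have hsum : u 0 + u 1 + u 2 = n + d - s := by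
    have := (hf 0).2
    simp [eps_apply] at this; omega
  have hbd : ∀ i, 0 < 3 * u i + s ∧ 3 * u i + s < 3 * n := fun i => by
    have h1 := (hf i).1 i
    have h2 := (hf (i + 1)).1 i
    simp [eps_apply] at h1 h2
    omega
  have hbd' : ∀ i, (0 : ℝ) < 3 * u i + s ∧ 3 * u i + s < 3 * (n : ℝ) := fun i => by
    exact_mod_cast hbd i
  obtain ⟨x, hx, h1, h2⟩ := exists_min (W := W) (u := u) hd (r := fun i => u i + s / 3)
    (fun i => by rw [hsum]; push_cast; ring) (fun i => by linarith [(hbd' i).1])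
    (fun i => by linarith [(hbd' i).2])
  refine ⟨x, hx, h1, fun l => ?_⟩
  obtain ⟨lo, hi, -, hb⟩ := exists_germ hd hx
  rw [hu]
  refine (hb.1 _).2 ⟨(hf l).2, fun i => ?_⟩
  obtain ⟨⟨v, hv, h3⟩, v', hv', h4⟩ := h2 i
  have h5 : 3 * u i + s ≤ 3 * v i := by
    exact_mod_cast (by linarith : (3 * u i + s : ℝ) ≤ 3 * v i)
  have h6 : 3 * v' i ≤ 3 * u i + s := by
    exact_mod_cast (by linarith : (3 * v' i : ℝ) ≤ 3 * u i + s)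
  have h7 := ((hb.1 v).1 hv).2 i
  have h8 := ((hb.1 v').1 hv').2 i
  simp only [Pi.add_apply, Pi.smul_apply, eps_apply]
  split_ifs <;> simp <;> omega

theorem face_point_unique (hd : W.ones 0 = d) {f : HiveFace n d} (hx : x ∈ triangle)
    (hy : y ∈ triangle) (h1 : ∀ l, f.vertex l ∈ W.Sub d x) (h2 : ∀ l, f.vertex l ∈ W.Sub d y) :
    x = y := by
  refine coord_injective (funext fun l => ?_)
  rcases f with ⟨u, hu⟩ | ⟨u, hu⟩
  · exact coord_eq_of_sub hd hx hy (add_sub_add_left_eq_sub _ _ u) (h1 (l + 1)) (h1 l)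
      (h2 (l + 1)) (h2 l)
  · exact coord_eq_of_sub hd hx hy (sub_sub_sub_cancel_left _ _ u) (h1 l) (h1 (l + 1))
      (h2 l) (h2 (l + 1))

end Web

end

section

variable {n d : ℕ} {a : Fin 3 → Fin n → ℝ} {ι : Type}

namespace Web

variable {W : Web n a ι} [Fintype ι] {x y z : ℂ} {u v : Pt}

/-! ### The dual hive of a web -/

theorem outer_point (hd : W.ones 0 = d) {e : HiveEdge n d} (he : e.IsOuter) :
    ∃ x ∈ triangle, coord x e.outerSide = 0 ∧ coord x (e.outerSide + 1) = bdryValue a e ∧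
      e.start ∈ W.Sub d x ∧ e.finish ∈ W.Sub d x := by
  classical
  have hn : 0 < n := (outerRank_lt he).pos
  have hst : e.finish = e.start + eps e.type - eps (e.type + 1) := rfl
  have hv := (mem_hive e.type).1 e.start_mem
  have hv' := (mem_hive e.type).1 e.end_mem
  obtain ⟨j, hj⟩ : ∃ j : Fin n, (j : ℕ) = e.outerRank := ⟨⟨_, outerRank_lt he⟩, rfl⟩
  have hbv : bdryValue a e = a e.outerSide j := by
    rw [bdryValue_eq (outerRank_lt he)]; congr 1; exact Fin.ext hj.symm
  rw [hbv]
  obtain ⟨p, hp⟩ := (W.bdry e.outerSide _).2 ⟨j, rfl⟩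
  obtain ⟨z, hz, h0, h3, hzp⟩ : ∃ z ∈ triangle, coord z e.outerSide = 0 ∧
      coord z (e.outerSide + 1) = a e.outerSide j ∧ z ∈ W.seg p := by
    rcases hp with hp | hp
    exacts [⟨_, W.head_mem p, hp.1, hp.2, W.head_mem_seg p⟩,
      ⟨_, W.tail_mem p, hp.1, hp.2, W.tail_mem_seg p⟩]
  have hs := coord_sum e.outerSide z
  have hlt := fun k l => (W.anti e.outerSide).lt_iff_gt (a := k) (b := l)
  obtain ⟨b1, b2⟩ := W.base_side (d := d) h0
  have e1 : ∀ k, W.IsOne e.outerSide k ∧ 1 - a e.outerSide k < coord z (e.outerSide + 2) ↔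
      (k : ℕ) < min d j := fun k => by
    have : 1 - a e.outerSide k < coord z (e.outerSide + 2) ↔ k < j := by
      rw [← hlt]; constructor <;> intro h <;> linarith
    rw [this, W.isOne_iff hd, Fin.lt_def, lt_min_iff]
  have e2 : ∀ k, ¬ W.IsOne e.outerSide k ∧ a e.outerSide k < coord z (e.outerSide + 1) ↔
      ¬ (k : ℕ) < max d (j + 1) := fun k => by
    rw [h3, hlt, W.isOne_iff hd, Fin.lt_def, lt_max_iff]; omega
  have hc := Finset.card_filter_add_card_filter_not (s := (Finset.univ : Finset (Fin n)))
    (fun k => (k : ℕ) < max d (j + 1))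
  rw [Fin.card_filter_val_lt, Finset.card_univ, Fintype.card_fin] at hc
  simp only [Finset.sum_boole, Finset.filter_filter, e1, e2, Fin.card_filter_val_lt] at b1 b2
  generalize (Finset.univ.filter fun k : Fin n => ¬ (k : ℕ) < max d (j + 1)).card = m at hc b2
  have hjn := j.2
  have hdn : d ≤ n := hd ▸ (Finset.card_filter_le _ _).trans_eq (by simp)
  obtain ⟨hsum, ⟨h, -⟩ | ⟨q, k, -, hk, hjk, hb⟩ | ⟨q, k, -, hk, hjk, hb⟩⟩ := germ_side hd hz h0
  · exact absurd hzp (h p)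
  all_goals
    obtain rfl := (W.anti _).injective (h3.symm.trans hjk)
    rw [W.isOne_iff hd] at hk
    refine ⟨z, hz, h0, h3, (hb.1 _).2 ⟨e.start_mem.2, ?_⟩, (hb.1 _).2 ⟨e.finish_mem.2, ?_⟩⟩
  all_goals
    rw [← sum_rot e.outerSide (W.base d _)] at hsum
    rw [forall_idx e.outerSide]
    by_cases hl : e.OnLongSide
    · have hi := outerSide_long hl
      have hdj := (rank_long hl).trans_eq hj.symm
      have h4 : e.start (e.type + 2) = 0 := hl
      rw [HiveEdge.outerRank, if_pos hl, HiveEdge.height] at hj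
      rw [min_eq_left hdj] at b1
      rw [max_eq_right (by omega)] at hc
      simp [hi, hst, eps_apply] at hsum b1 b2 hv' ⊢
      omega
    · have hi := outerSide_short hl
      have hdj := hj.trans_lt (rank_short hn (he.resolve_left hl))
      have h4 : e.start (e.type + 2) = n := he.resolve_left hl
      rw [HiveEdge.outerRank, if_neg hl, HiveEdge.height] at hj
      rw [min_eq_right hdj.le] at b1
      rw [max_eq_left hdj] at hc
      simp [hi, hst, eps_apply] at hsum b1 b2 hv' ⊢
      omega

end Web

end

section

variable {n d : ℕ} {a : Fin 3 → Fin n → ℝ} {ι : Type}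

theorem plus_or_minus_face (hn : 0 < n) (e : HiveEdge n d) : (∃ f, e.plus = .face f) ∨
    ∃ f, e.minus = .face f := by
  by_cases hs : e.OnShortSide
  · exact .inr ⟨_, minus_of_not_long (not_long_of_short hn hs)⟩
  · exact .inl ⟨_, plus_of_not_short hs⟩

namespace Web

variable {W : Web n a ι} [Fintype ι] {x y z : ℂ} {u v : Pt}

/-- A point for each vertex of the dual graph: for a face, the point whose subdifferential contains
the face; for an outer edge, the corresponding boundary point. -/
structure Dual (W : Web n a ι) (X : DualVertex n d → ℂ) : Prop where
  mem : ∀ x, X x ∈ triangle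
  pos : ∀ f i, 0 < coord (X (.face f)) i
  vertex : ∀ f l, f.vertex l ∈ W.Sub d (X (.face f))
  side : ∀ e he, coord (X (.outer e he)) e.outerSide = 0
  next : ∀ e he, coord (X (.outer e he)) (e.outerSide + 1) = bdryValue a e
  ends : ∀ e he, e.start ∈ W.Sub d (X (.outer e he)) ∧ e.finish ∈ W.Sub d (X (.outer e he))

theorem exists_dual (hd : W.ones 0 = d) : ∃ X : DualVertex n d → ℂ, W.Dual X := by
  choose F h1 h2 h3 using fun f => exists_face_point (W := W) hd f
  choose G g1 g2 g3 g4 using fun (e : HiveEdge n d) (he : e.IsOuter) => outer_point (W := W) hd he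
  refine ⟨fun x => match x with | .face f => F f | .outer e he => G e he, ?_, h2, h3, g2, g3, g4⟩
  rintro (f | ⟨e, he⟩)
  · exact h1 f
  · exact g1 e he

/-- The segments `p` and `q` cross at `x`. -/
structure CrossAt (W : Web n a ι) (p q : ι) (x : ℂ) : Prop where
  left : W.Thru p x
  right : W.Thru q x
  col_left : W.col p = .zero
  col_right : W.col q = .one
  typ : W.typ q = W.typ p + 2
  only : ∀ r, x ∈ W.seg r → r = p ∨ r = q

/-- If the ends of an edge are subgradients at `z`, then `z` is inside a segment of the same type,
or a face with this edge is in the subdifferential. -/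
theorem edge_germ (hd : W.ones 0 = d) (hz : z ∈ triangle) {e : HiveEdge n d}
    (h1 : e.start ∈ W.Sub d z) (h2 : e.finish ∈ W.Sub d z) :
    (∃ p, W.typ p = e.type ∧ W.Thru p z) ∨
      e.start - eps (e.type + 1) + eps (e.type + 2) ∈ W.Sub d z ∨
      e.start + eps e.type - eps (e.type + 2) ∈ W.Sub d z := by
  have hst : e.finish = e.start + eps e.type - eps (e.type + 1) := rfl
  obtain ⟨lo, hi, hg, hb⟩ := exists_germ hd hz
  have hs : ∀ i, (lo i ≤ e.start i ∧ e.start i ≤ hi i) := ((hb.1 _).1 h1).2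
  have ht : ∀ i, (lo i ≤ e.finish i ∧ e.finish i ≤ hi i) := ((hb.1 _).1 h2).2
  have hsum := h1.1
  rw [← sum_rot e.type e.start] at hsum
  rw [hb.1, hb.1, ← sum_rot e.type, ← sum_rot e.type (e.start + _ - _), forall_idx e.type,
    forall_idx e.type]
  rw [forall_idx e.type] at hs ht
  rw [hst] at ht
  simp [eps_apply] at ht hs ⊢
  have hbs := sum_rot e.type (W.base d (coord z))
  have hB := W.base_sum hd z
  cases hg with
  | none h => omega
  | edge p h hu =>
    left
    refine ⟨p, ?_, h⟩
    rcases idx_cases e.type (W.typ p) with h3 | h3 | h3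
    · exact h3
    · rw [h3] at hs ht; simp [eps_apply] at hs ht; omega
    · rw [h3] at hs ht; simp [eps_apply] at hs ht; omega
  | cross p q hp hq hcp hcq htq hu =>
    right
    rcases idx_cases e.type (W.typ p) with h3 | h3 | h3 <;>
      (rw [h3] at hs ht ⊢; simp [eps_apply] at hs ht ⊢; omega)
  | head p hp hx hu =>
    right
    rw [if_pos (mem_heads.2 ⟨p, hp, hx⟩), if_neg (by
      rw [mem_tails]; rintro ⟨q, -, hq⟩; exact W.head_ne_tail p q (hx.symm.trans hq))] at hB
    simp at hs ht ⊢
    omega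
  | tail p hp hx hu =>
    right
    rw [if_pos (mem_tails.2 ⟨p, hp, hx⟩), if_neg (by
      rw [mem_heads]; rintro ⟨q, -, hq⟩; exact W.head_ne_tail q p (hq.symm.trans hx))] at hB
    simp at hs ht ⊢
    omega

namespace Dual

variable {X : DualVertex n d → ℂ}

theorem ends_mem (hX : W.Dual X) (e : HiveEdge n d) : (e.start ∈ W.Sub d (X e.plus) ∧ e.finish ∈
    W.Sub d (X e.plus)) ∧
    e.start ∈ W.Sub d (X e.minus) ∧ e.finish ∈ W.Sub d (X e.minus) := by
  constructor
  · by_cases hs : e.OnShortSide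
    · rw [plus_of_short hs]; exact hX.ends e _
    · rw [plus_of_not_short hs]
      have h1 := hX.vertex (e.up hs) (e.type + 1)
      have h2 := hX.vertex (e.up hs) e.type
      simp only [HiveEdge.up, HiveFace.vertex, sub_add_cancel] at h1 h2
      rw [sub_add_eq_add_sub] at h2
      exact ⟨h1, h2⟩
  · by_cases hs : e.OnLongSide
    · rw [minus_of_long hs]; exact hX.ends e _
    · rw [minus_of_not_long hs]
      have h1 := hX.vertex (e.low hs) (e.type + 1)
      have h2 := hX.vertex (e.low hs) e.type
      simp only [HiveEdge.low, HiveFace.vertex, add_sub_cancel_right] at h1 h2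
      exact ⟨h2, h1⟩

theorem coord_type (hX : W.Dual X) (hd : W.ones 0 = d) (e : HiveEdge n d) :
    coord (X e.plus) e.type = coord (X e.minus) e.type := by
  obtain ⟨⟨h1, h2⟩, h3, h4⟩ := hX.ends_mem e
  refine coord_eq_of_sub hd (hX.mem _) (hX.mem _) (v := e.start) (v' := e.finish) ?_ h1 h2 h3 h4
  rw [HiveEdge.finish]; abel

theorem coord_le (hX : W.Dual X) (hd : W.ones 0 = d) (e : HiveEdge n d) :
    coord (X e.minus) (e.type + 2) ≤ coord (X e.plus) (e.type + 2) := by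
  by_cases hl : e.OnLongSide
  · have := hX.side e (.inl hl)
    rw [outerSide_long hl] at this
    rw [minus_of_long hl, this]
    exact mem_triangle.1 (hX.mem _) _
  · have h1 := hX.vertex (e.low hl) (e.type + 2)
    rw [← minus_of_not_long hl] at h1
    have h2 := sub_antitone hd h1 (hX.ends_mem e).1.1 (hX.mem _) (hX.mem _)
    have h3 : (e.low hl).vertex (e.type + 2) - e.start = -(eps (e.type + 2) - eps (e.type + 2 + 1))
        := by
      simp only [HiveEdge.low, HiveFace.vertex, idx_two_one]; abel
    rw [h3, ← zero_sub, pairing_sub, pairing_edge _ (sub_total _ _)] at h2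
    simp [pairing] at h2
    linarith

/-- The points strictly between the two points of an edge are inside segments. -/
theorem between (hX : W.Dual X) (hn : 0 < n) (hd : W.ones 0 = d) (e : HiveEdge n d)
    (h0 : coord z e.type = coord (X e.minus) e.type)
    (h1 : coord (X e.minus) (e.type + 2) < coord z (e.type + 2))
    (h2 : coord z (e.type + 2) < coord (X e.plus) (e.type + 2)) :
    (∀ i, 0 < coord z i) ∧ ∃ p, W.typ p = e.type ∧ W.Thru p z := by
  have hc := hX.coord_type hd e
  have s1 := coord_sum e.type z
  have s2 := coord_sum e.type (X e.plus)
  have s3 := coord_sum e.type (X e.minus)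
  have hp := mem_triangle.1 (hX.mem e.plus)
  have hm := mem_triangle.1 (hX.mem e.minus)
  have hpos : ∀ i, 0 < coord z i := by
    refine (forall_idx e.type).2 ⟨?_, by linarith [hp (e.type + 1)], by linarith [hm (e.type + 2)]⟩
    rw [h0]
    rcases plus_or_minus_face hn e with ⟨f, hf⟩ | ⟨f, hf⟩
    · rw [← hc, hf]; exact hX.pos f _
    · rw [hf]; exact hX.pos f _
  refine ⟨hpos, ?_⟩
  have hz : z ∈ triangle := mem_triangle.2 fun i => (hpos i).le
  obtain ⟨⟨a1, a2⟩, a3, a4⟩ := hX.ends_mem e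
  set t := (coord z (e.type + 2) - coord (X e.minus) (e.type + 2)) /
    (coord (X e.plus) (e.type + 2) - coord (X e.minus) (e.type + 2)) with ht
  have hlt : 0 < coord (X e.plus) (e.type + 2) - coord (X e.minus) (e.type + 2) := by linarith
  have ht0 : 0 ≤ t := div_nonneg (by linarith) hlt.le
  have ht1 : t ≤ 1 := (div_le_one hlt).2 (by linarith)
  have hmul : t * (coord (X e.plus) (e.type + 2) - coord (X e.minus) (e.type + 2)) =
    coord z (e.type + 2) - coord (X e.minus) (e.type + 2) := div_mul_cancel₀ _ hlt.ne'
  have hcz : coord z = coord (X e.minus) + t • (coord (X e.plus) - coord (X e.minus)) := by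
    refine funext ((forall_idx e.type).2 ⟨?_, ?_, ?_⟩)
    · simp [hc, h0]
    · simp only [Pi.add_apply, Pi.smul_apply, Pi.sub_apply, smul_eq_mul]
      linear_combination s1 - s3 - h0 - t * s2 + t * s3 + hmul + t * hc
    · simp only [Pi.add_apply, Pi.smul_apply, Pi.sub_apply, smul_eq_mul]
      linarith
  have b1 := sub_between hd (hX.mem _) (hX.mem _) a3 a1 ht0 ht1 hcz hpos
  have b2 := sub_between hd (hX.mem _) (hX.mem _) a4 a2 ht0 ht1 hcz hpos
  rcases edge_germ hd hz b1 b2 with h | h | h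
  · exact h
  · exfalso
    by_cases hs : e.OnShortSide
    · have h3 : e.start (e.type + 2) = n := hs
      have := ((sub_subset hd hz h).1 (e.type + 2)).2
      simp [eps_apply] at this
      omega
    · refine h2.ne (congrArg (fun q => coord q _) ?_)
      have hall : ∀ k, (e.up hs).vertex k ∈ W.Sub d z := by
        refine (forall_idx e.type).2 ⟨?_, ?_, h⟩
        · simp only [HiveEdge.up, HiveFace.vertex, sub_add_eq_add_sub]; exact b2
        · simp only [HiveEdge.up, HiveFace.vertex, sub_add_cancel]; exact b1
      have := hX.vertex (e.up hs)
      rw [← plus_of_not_short hs] at this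
      exact face_point_unique hd hz (hX.mem _) hall this
  · exfalso
    by_cases hs : e.OnLongSide
    · have h3 : e.start (e.type + 2) = 0 := hs
      have := ((sub_subset hd hz h).1 (e.type + 2)).1
      simp [eps_apply] at this
      omega
    · refine h1.ne (congrArg (fun q => coord q _) ?_)
      have hall : ∀ k, (e.low hs).vertex k ∈ W.Sub d z := by
        refine (forall_idx e.type).2 ⟨?_, ?_, h⟩
        · simp only [HiveEdge.low, HiveFace.vertex, add_sub_cancel_right]; exact b1
        · exact b2
      have := hX.vertex (e.low hs)
      rw [← minus_of_not_long hs] at this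
      exact face_point_unique hd (hX.mem _) hz this hall

/-- Two different points of an edge are on a common segment. -/
theorem covered (hX : W.Dual X) (hn : 0 < n) (hd : W.ones 0 = d) (e : HiveEdge n d) (hne : X e.plus
    ≠ X e.minus) :
    ∃ p, W.typ p = e.type ∧ X e.minus ∈ W.seg p ∧ X e.plus ∈ W.seg p := by
  have hc := hX.coord_type hd e
  have hlt : coord (X e.minus) (e.type + 2) < coord (X e.plus) (e.type + 2) :=
    lt_of_le_of_ne (hX.coord_le hd e) fun h => hne (coord_ext e.type hc h.symm)
  obtain ⟨z, -, hz⟩ := exists_point (hX.mem e.minus) (hX.mem e.plus) (t := 1 / 2) (by norm_num)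
    (by norm_num)
  have hzc : ∀ i, coord z i = (coord (X e.minus) i + coord (X e.plus) i) / 2 := fun i => by
    rw [hz]; simp; ring
  have z0 : coord z e.type = coord (X e.minus) e.type := by rw [hzc, hc]; ring
  have z1 : coord (X e.minus) (e.type + 2) < coord z (e.type + 2) := by rw [hzc]; linarith
  have z2 : coord z (e.type + 2) < coord (X e.plus) (e.type + 2) := by rw [hzc]; linarith
  obtain ⟨-, p, hp, hT⟩ := hX.between hn hd e z0 z1 z2
  have hm : ∀ w, w ∈ W.seg p ↔ _ := fun w => (W.arrow p).mem_segment
  obtain ⟨m1, m2, m3⟩ := (hm z).1 hT.1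
  have harr := (W.arrow p).1
  rw [hp] at m1 m2 m3 harr
  have k1 : coord (X e.plus) (e.type + 2) ≤ coord (W.head p) (e.type + 2) := by
    by_contra! hcon
    obtain ⟨h1, r, -, h2⟩ := hX.between hn hd e (z := W.head p) (by linarith) (by linarith) hcon
    exact not_thru_head h1 h2
  have k2 : coord (W.tail p) (e.type + 2) ≤ coord (X e.minus) (e.type + 2) := by
    by_contra! hcon
    obtain ⟨h1, r, -, h2⟩ := hX.between hn hd e (z := W.tail p) (by linarith) hcon (by linarith)
    exact not_thru_tail h1 h2
  refine ⟨p, hp, (hm _).2 ?_, (hm _).2 ?_⟩ <;> rw [hp]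
  · exact ⟨by linarith, k2, by linarith⟩
  · exact ⟨by linarith, by linarith, k1⟩

theorem face_germ (hX : W.Dual X) (hd : W.ones 0 = d) (f : HiveFace n d) :
    (∃ p q, W.CrossAt p q (X (.face f))) ∨
    (∃ u hu, f = .upper u hu ∧ ∃ p, W.HeadIn p ∧ X (.face f) = W.head p ∧
      ∀ q, X (.face f) ∈ W.seg q → X (.face f) = W.head q) ∨
    ∃ u hu, f = .lower u hu ∧ ∃ p, W.TailIn p ∧ X (.face f) = W.tail p ∧
      ∀ q, X (.face f) ∈ W.seg q → X (.face f) = W.tail q := by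
  obtain ⟨lo, hi, hg, hb⟩ := exists_germ hd (hX.mem (.face f))
  have hv := fun l => ((hb.1 _).1 (hX.vertex f l)).2
  have hs := ((hb.1 _).1 (hX.vertex f 0)).1
  have hB := W.base_sum hd (X (.face f))
  have hdiff : ∀ i, lo i < hi i := by
    intro i
    have h1 := hv i i
    have h2 := hv (i + 1) i
    rcases f with ⟨u, hu⟩ | ⟨u, hu⟩ <;> simp [HiveFace.vertex, eps_apply] at h1 h2 <;> omega
  cases hg with
  | none h => exact absurd (hdiff 0) (lt_irrefl _)
  | edge p h hu =>
    have := hdiff (W.typ p + 2)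
    simp [eps_apply] at this
  | cross p q hp hq hcp hcq htq hu => exact .inl ⟨p, q, hp, hq, hcp, hcq, htq, hu⟩
  | head p hp hx hu =>
    rcases f with ⟨u, hu'⟩ | ⟨u, hu'⟩
    · exact .inr (.inl ⟨u, hu', rfl, p, hp, hx, hu⟩)
    · rw [if_pos (mem_heads.2 ⟨p, hp, hx⟩), if_neg (by
        rw [mem_tails]; rintro ⟨q, -, hq⟩; exact W.head_ne_tail p q (hx.symm.trans hq))] at hB
      have h0 := hv 0
      have h1 := hv 1
      have h2 := hv 2
      rw [forall_idx 0] at h0 h1 h2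
      simp [HiveFace.vertex, eps_apply] at h0 h1 h2 hs
      omega
  | tail p hp hx hu =>
    rcases f with ⟨u, hu'⟩ | ⟨u, hu'⟩
    · rw [if_pos (mem_tails.2 ⟨p, hp, hx⟩), if_neg (by
        rw [mem_heads]; rintro ⟨q, -, hq⟩; exact W.head_ne_tail q p (hq.symm.trans hx))] at hB
      have h0 := hv 0
      have h1 := hv 1
      have h2 := hv 2
      rw [forall_idx 0] at h0 h1 h2
      simp [HiveFace.vertex, eps_apply] at h0 h1 h2 hs
      omega
    · exact .inr (.inr ⟨u, hu', rfl, p, hp, hx, hu⟩)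

theorem seg_unique (hX : W.Dual X) (hd : W.ones 0 = d) (f : HiveFace n d) {p q : ι} (hp : X (.face
    f) ∈ W.seg p)
    (hq : X (.face f) ∈ W.seg q) (ht : W.typ p = W.typ q) : p = q := by
  rcases hX.face_germ hd f with ⟨r, s, h⟩ | ⟨u, hu, -, r, -, -, h⟩ | ⟨u, hu, -, r, -, -, h⟩
  · have := h.typ
    rcases h.only p hp with rfl | rfl <;> rcases h.only q hq with rfl | rfl <;> simp_all
  · exact head_inj ((h p hp).symm.trans (h q hq)) ht
  · exact tail_inj ((h p hp).symm.trans (h q hq)) ht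

theorem outer_ne (hX : W.Dual X) (hn : 0 < n) {e : HiveEdge n d} (he : e.IsOuter) : X e.plus ≠ X
    e.minus := by
  intro h
  by_cases hl : e.OnLongSide
  · have hs : ¬ e.OnShortSide := fun hs => not_long_of_short hn hs hl
    rw [plus_of_not_short hs, minus_of_long hl] at h
    exact (hX.pos (e.up hs) e.outerSide).ne' (by rw [h]; exact hX.side e _)
  · have hs := he.resolve_left hl
    rw [minus_of_not_long hl, plus_of_short hs] at h
    exact (hX.pos (e.low hl) e.outerSide).ne' (by rw [← h]; exact hX.side e _)

theorem cross_of_eq (hX : W.Dual X) (hn : 0 < n) (hd : W.ones 0 = d) (e : HiveEdge n d) (h : X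
    e.plus = X e.minus) :
    ∃ p q, W.CrossAt p q (X e.plus) ∧ e.type = W.typ p + 1 := by
  have ho : ¬ e.IsOuter := fun he => hX.outer_ne hn he h
  have hs : ¬ e.OnShortSide := fun h => ho (.inr h)
  have hl : ¬ e.OnLongSide := fun h => ho (.inl h)
  obtain ⟨lo, hi, hg, hb⟩ := exists_germ hd (hX.mem e.plus)
  have h1 := hX.vertex (e.up hs) (e.type + 2)
  have h2 := hX.vertex (e.low hl) (e.type + 2)
  rw [← plus_of_not_short hs] at h1
  rw [← minus_of_not_long hl, ← h] at h2
  have h3 := (((hb.1 _).1 h1).2 (e.type + 2)).2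
  have h4 := (((hb.1 _).1 h2).2 (e.type + 2)).1
  simp [HiveEdge.up, HiveEdge.low, HiveFace.vertex, eps_apply] at h3 h4
  have hdiff : lo (e.type + 2) + 2 ≤ hi (e.type + 2) := by omega
  clear h3 h4
  cases hg with
  | none h => omega
  | edge p h hu => simp [eps_apply] at hdiff; split_ifs at hdiff <;> omega
  | cross p q hp hq hcp hcq htq hu =>
    refine ⟨p, q, ⟨hp, hq, hcp, hcq, htq, hu⟩, ?_⟩
    rcases idx_cases e.type (W.typ p) with h3 | h3 | h3 <;> rw [h3] at hdiff ⊢ <;>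
      (simp [eps_apply] at hdiff ⊢; try omega)
  | head p hp hx hu => simp at hdiff
  | tail p hp hx hu => simp at hdiff; omega

end Dual

end Web

end

section

variable {n d : ℕ} {a : Fin 3 → Fin n → ℝ} {ι : Type}

theorem allowed_cycle {c : Fin 3 → SegColor} (h : ∀ l, (c l, c (l + 1)) ∈ allowedPairs) :
    ∃ l, (HiveColor.seg (c l), HiveColor.seg (c (l + 2)), HiveColor.seg (c (l + 1))) ∈
      allowedTriples := by
  have h0 : (c 0, c 1) ∈ allowedPairs := h 0
  have h1 : (c 1, c 2) ∈ allowedPairs := h 1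
  have h2 : (c 2, c 0) ∈ allowedPairs := h 2
  by_cases hone : ∃ l, c l = .one ∧ c (l + 1) = .three
  · obtain ⟨l, h3, h4⟩ := hone
    have h5 := h (l + 1)
    refine ⟨l, ?_⟩
    rw [h4, idx_one_one] at h5
    rw [h3, h4]
    cases hc : c (l + 2) <;> simp [hc, allowedPairs, allowedTriples] at h5 ⊢
  · push Not at hone
    have k0 : c 0 = .one → c 1 ≠ .three := hone 0
    have k1 : c 1 = .one → c 2 ≠ .three := hone 1
    have k2 : c 2 = .one → c 0 ≠ .three := hone 2
    refine ⟨0, ?_⟩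
    simp only [zero_add]
    cases e0 : c 0 <;> cases e1 : c 1 <;> cases e2 : c 2 <;>
      simp_all [allowedPairs, allowedTriples]

namespace Web

variable {W : Web n a ι} {x y z : ℂ} {u v : Pt}

open Classical in
/-- The colour of the segment of the same type through the two points of an edge, and `m` if there
is none. -/
def color (W : Web n a ι) (X : DualVertex n d → ℂ) (e : HiveEdge n d) : HiveColor :=
  if h : ∃ p, W.typ p = e.type ∧ X e.minus ∈ W.seg p ∧ X e.plus ∈ W.seg p then
    .seg (W.col h.choose) else .m

namespace Dual

variable [Fintype ι] {X : DualVertex n d → ℂ}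

theorem color_eq (hX : W.Dual X) (hn : 0 < n) (hd : W.ones 0 = d) {e : HiveEdge n d} {p : ι}
    (h : W.typ p = e.type ∧ X e.minus ∈ W.seg p ∧ X e.plus ∈ W.seg p) :
    W.color X e = .seg (W.col p) := by
  have hex : ∃ p, W.typ p = e.type ∧ X e.minus ∈ W.seg p ∧ X e.plus ∈ W.seg p := ⟨p, h⟩
  rw [color, dif_pos hex]
  obtain ⟨h1, h2, h3⟩ := hex.choose_spec
  generalize hex.choose = q at h1 h2 h3
  congr 2
  rcases plus_or_minus_face hn e with ⟨f, hf⟩ | ⟨f, hf⟩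
  · rw [hf] at h h3
    exact hX.seg_unique hd f h3 h.2.2 (h1.trans h.1.symm)
  · rw [hf] at h h2
    exact hX.seg_unique hd f h2 h.2.1 (h1.trans h.1.symm)

theorem exists_of_color {W : Web n a ι} {X : DualVertex n d → ℂ} {e : HiveEdge n d} {c : SegColor}
    (h : W.color X e = .seg c) :
    ∃ p, W.typ p = e.type ∧ X e.minus ∈ W.seg p ∧ X e.plus ∈ W.seg p := by
  by_contra hcon
  rw [color, dif_neg hcon] at h
  cases h

theorem color_m_iff (hX : W.Dual X) (hn : 0 < n) (hd : W.ones 0 = d) (e : HiveEdge n d) :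
    W.color X e = .m ↔ X e.plus = X e.minus := by
  constructor
  · intro h
    by_contra hne
    rw [hX.color_eq hn hd (hX.covered hn hd e hne).choose_spec] at h
    cases h
  · intro h
    obtain ⟨p, q, hc, ht⟩ := hX.cross_of_eq hn hd e h
    refine dif_neg ?_
    rintro ⟨r, h1, -, h3⟩
    have := hc.typ
    rcases hc.only r h3 with rfl | rfl <;> simp_all

theorem plus_or_minus (f : HiveFace n d) (l : Fin 3) :
    DualVertex.face f = (f.edge l).plus ∨ DualVertex.face f = (f.edge l).minus :=
  incident_iff.1 ⟨l, rfl⟩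

theorem face_color (hX : W.Dual X) (hn : 0 < n) (hd : W.ones 0 = d) {f : HiveFace n d} {p : ι}
    (hp : X (.face f) ∈ W.seg p) : W.color X (f.edge (W.typ p)) = .seg (W.col p) := by
  have hty : (f.edge (W.typ p)).type = W.typ p := by cases f <;> rfl
  have hor := plus_or_minus f (W.typ p)
  by_cases he : X (f.edge (W.typ p)).plus = X (f.edge (W.typ p)).minus
  · obtain ⟨r, s, hc, ht⟩ := hX.cross_of_eq hn hd _ he
    have := hc.typ
    have h1 : X (f.edge (W.typ p)).plus ∈ W.seg p := by
      rcases hor with h | h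
      · rwa [← h]
      · rwa [he, ← h]
    rw [hty] at ht
    rcases hc.only p h1 with rfl | rfl
    · simp at ht
    · rw [ht] at this; simp at this
  · obtain ⟨r, h1, h2, h3⟩ := hX.covered hn hd _ he
    have : r = p := by
      rcases hor with h | h
      · rw [← h] at h3; exact hX.seg_unique hd f h3 hp (h1.trans hty)
      · rw [← h] at h2; exact hX.seg_unique hd f h2 hp (h1.trans hty)
    subst this
    exact hX.color_eq hn hd ⟨hty.symm, h2, h3⟩

theorem cross_color {f : HiveFace n d} {p q : ι}
    (hc : W.CrossAt p q (X (.face f))) : W.color X (f.edge (W.typ p + 1)) = .m := by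
  refine dif_neg ?_
  have hty : (f.edge (W.typ p + 1)).type = W.typ p + 1 := by cases f <;> rfl
  rintro ⟨r, h1, h2, h3⟩
  rw [hty] at h1
  have hr : X (.face f) ∈ W.seg r := by
    rcases plus_or_minus f (W.typ p + 1) with h | h <;> rwa [h]
  have := hc.typ
  rcases hc.only r hr with rfl | rfl
  · simp at h1
  · rw [h1] at this; simp at this

theorem isColorMap (hX : W.Dual X) (hn : 0 < n) (hd : W.ones 0 = d) : IsColorMap (W.color X) := by
  intro f
  have cyc : ∀ r : Fin 3 → ι, (∀ l, W.typ (r l) = l ∧ X (.face f) ∈ W.seg (r l)) →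
      (∀ l, (W.col (r l), W.col (r (l + 1))) ∈ allowedPairs) → ∃ l : Fin 3,
        (W.color X (f.edge l), W.color X (f.edge (l + 2)), W.color X (f.edge (l + 1))) ∈
          allowedTriples := by
    intro r hr hp
    obtain ⟨l, hl⟩ := allowed_cycle hp
    have hc : ∀ k, W.color X (f.edge k) = .seg (W.col (r k)) := fun k => by
      have := hX.face_color hn hd (hr k).2
      rwa [(hr k).1] at this
    exact ⟨l, by rw [hc, hc, hc]; exact hl⟩
  rcases hX.face_germ hd f with ⟨p, q, hc⟩ | ⟨u, hu, -, p, hp, hx, -⟩ | ⟨u, hu, -, p, hp, hx, -⟩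
  · refine ⟨W.typ p, ?_⟩
    rw [cross_color hc, hX.face_color hn hd hc.left.1, ← hc.typ,
      hX.face_color hn hd hc.right.1, hc.col_left, hc.col_right]
    simp [allowedTriples]
  · choose r h1 h2 using W.head_full p hp
    refine cyc r (fun l => ⟨h1 l, ?_⟩) fun l => ?_
    · rw [hx, ← h2 l]; exact W.head_mem_seg _
    · have hne : r l ≠ r (l + 1) := fun h => by
        have := h1 (l + 1)
        rw [← h, h1 l] at this; simp at this
      rcases W.head_meet _ _ hne ((h2 l).trans (h2 _).symm) with ⟨-, h⟩ | ⟨h, -⟩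
      · exact h
      · rw [h1, h1] at h; simp at h
  · choose r h1 h2 using W.tail_full p hp
    refine cyc r (fun l => ⟨h1 l, ?_⟩) fun l => ?_
    · rw [hx, ← h2 l]; exact W.tail_mem_seg _
    · have hne : r l ≠ r (l + 1) := fun h => by
        have := h1 (l + 1)
        rw [← h, h1 l] at this; simp at this
      rcases W.tail_meet _ _ hne ((h2 l).trans (h2 _).symm) with ⟨-, h⟩ | ⟨h, -⟩
      · exact h
      · rw [h1, h1] at h; simp at h

/-- The end of a segment at an outer vertex. -/
theorem outer_end (hX : W.Dual X) {e : HiveEdge n d} {p : ι} (ht : W.typ p = e.type) {he}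
    (hp : X (.outer e he) ∈ W.seg p) :
    (e.OnLongSide → X (.outer e he) = W.tail p ∧ W.col p = .zero) ∧
      (¬ e.OnLongSide → X (.outer e he) = W.head p ∧ W.col p = .one) := by
  have h0 := hX.side e he
  constructor
  · intro hl
    rw [outerSide_long hl] at h0
    rcases W.eq_of_side hp h0 with h | h
    · rw [h] at h0
      have := (W.head_side p _ h0).2
      rw [ht] at this; simp at this
    · exact ⟨h, (W.tail_side p _ (h ▸ h0)).1⟩
  · intro hl
    rw [outerSide_short hl] at h0
    rcases W.eq_of_side hp h0 with h | h
    · exact ⟨h, (W.head_side p _ (h ▸ h0)).1⟩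
    · rw [h] at h0
      have := (W.tail_side p _ h0).2
      rw [ht] at this; simp at this

theorem outer_color (hX : W.Dual X) (hn : 0 < n) (hd : W.ones 0 = d) {e : HiveEdge n d}
    (he : e.IsOuter) : W.color X e = .seg (open Classical in if e.OnLongSide then .zero else .one)
        := by
  obtain ⟨p, h1, h2, h3⟩ := hX.covered hn hd e (hX.outer_ne hn he)
  rw [hX.color_eq hn hd ⟨h1, h2, h3⟩]
  by_cases hl : e.OnLongSide
  · rw [minus_of_long hl] at h2
    rw [if_pos hl, ((hX.outer_end h1 h2).1 hl).2]
  · rw [plus_of_short (he.resolve_left hl)] at h3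
    rw [if_neg hl, ((hX.outer_end h1 h3).2 hl).2]

/-- The dual hive of a web. -/
theorem hive (hX : W.Dual X) (hn : 0 < n) (hd : W.ones 0 = d) :
    Hive (W.color X) (fun e => coord (X e.plus) e.type) a := by
  have hface : ∀ (f : HiveFace n d) (l : Fin 3),
      coord (X (f.edge l).plus) (f.edge l).type = coord (X (.face f)) l := by
    intro f l
    have hty : (f.edge l).type = l := by cases f <;> rfl
    rcases plus_or_minus f l with h | h
    · rw [h, hty]
    · rw [hX.coord_type hd, h, hty]
  refine ⟨hn, hX.isColorMap hn hd, fun e => ?_, fun f l => ?_, fun e hs hl hm => ?_,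
    fun e hs hl hm => ?_, fun e he => ⟨?_, ?_⟩, fun e he => ⟨?_, ?_⟩, W.anti⟩
  · rcases plus_or_minus_face hn e with ⟨f, hf⟩ | ⟨f, hf⟩
    · rw [hf]; exact hX.pos f _
    · rw [hX.coord_type hd, hf]; exact hX.pos f _
  · rw [hface, hface, hface]; exact coord_sum l _
  · rw [hface, hface, ← minus_of_not_long, ← plus_of_not_short, (hX.color_m_iff hn hd e).1 hm]
  · rw [hface, hface, ← minus_of_not_long, ← plus_of_not_short]
    exact lt_of_le_of_ne (hX.coord_le hd e) fun h => hm ((hX.color_m_iff hn hd e).2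
      (coord_ext e.type (hX.coord_type hd e) h.symm))
  · rw [hX.outer_color hn hd (.inl he), if_pos he]
  · rw [hX.coord_type hd, minus_of_long he, ← hX.next e (.inl he), outerSide_long he, idx_two_one]
  · rw [hX.outer_color hn hd (.inr he), if_neg (not_long_of_short hn he)]
  · have h1 := hX.next e (.inr he)
    have h2 := hX.side e (.inr he)
    rw [outerSide_short (not_long_of_short hn he)] at h1 h2
    rw [idx_one_one] at h1
    have h3 := coord_sum e.type (X (.outer e (.inr he)))
    rw [plus_of_short he]
    linarith

theorem dualPoint_eq (hX : W.Dual X) (hn : 0 < n) (hd : W.ones 0 = d) (x : DualVertex n d) :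
    dualPoint (fun e => coord (X e.plus) e.type) x = X x := by
  rcases x with f | ⟨e, he⟩
  · refine coord_injective (funext fun l => ?_)
    have hty : (f.edge l).type = l := by cases f <;> rfl
    rw [(hX.hive hn hd).face_coord]
    rcases plus_or_minus f l with h | h
    · rw [h, hty]
    · rw [hX.coord_type hd, h, hty]
  · obtain ⟨h1, h2⟩ := Hive.outer_coord (fun e => coord (X e.plus) e.type) e he
    have h3 := hX.side e he
    by_cases hl : e.OnLongSide
    · rw [hX.coord_type hd, minus_of_long hl] at h1
      rw [outerSide_long hl] at h2 h3
      exact coord_ext e.type h1 (h2.trans h3.symm)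
    · rw [plus_of_short (he.resolve_left hl)] at h1
      rw [outerSide_short hl] at h2 h3
      exact coord_ext (e.type + 1) (h2.trans h3.symm) (by rwa [idx_one_two])

/-- The end of a segment at a vertex of the reduced graph. -/
theorem reduced_end (hX : W.Dual X) (hn : 0 < n) (hd : W.ones 0 = d) {e : HiveEdge n d} {p : ι}
    (ht : W.typ p = e.type) :
    (X e.plus ∈ W.seg p → InReduced (W.color X) e.plus → X e.plus = W.head p) ∧
      (X e.minus ∈ W.seg p → InReduced (W.color X) e.minus → X e.minus = W.tail p) := by
  have hcross : ∀ {f : HiveFace n d} {p q}, W.CrossAt p q (X (.face f)) →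
      ¬ InReduced (W.color X) (.face f) := fun h h' => h' _ (cross_color h)
  constructor
  · intro hp hr
    rcases plus_cases e with ⟨u, hu, h⟩ | ⟨hs, h⟩ <;> rw [h] at hp hr ⊢
    · rcases hX.face_germ hd (.upper u hu) with ⟨_, _, hc⟩ | ⟨-, -, -, -, -, -, h1⟩ | ⟨_, _, h1, -⟩
      · exact absurd hr (hcross hc)
      · exact h1 p hp
      · cases h1
    · exact ((hX.outer_end ht hp).2 (not_long_of_short hn hs)).1
  · intro hp hr
    rcases minus_cases e with ⟨u, hu, h⟩ | ⟨hl, h⟩ <;> rw [h] at hp hr ⊢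
    · rcases hX.face_germ hd (.lower u hu) with ⟨_, _, hc⟩ | ⟨_, _, h1, -⟩ | ⟨-, -, -, -, -, -, h1⟩
      · exact absurd hr (hcross hc)
      · cases h1
      · exact h1 p hp
    · exact ((hX.outer_end ht hp).1 hl).1

theorem run_seg (hX : W.Dual X) (hn : 0 < n) (hd : W.ones 0 = d) {e e' : HiveEdge n d} {c :
    SegColor}
    (hr : MaxRun (W.color X) c e e') : ∃ p, W.typ p = e.type ∧ W.col p = c ∧ X e.plus = W.head p ∧
      X e'.minus = W.tail p := by
  obtain ⟨p, h1, h2, h3⟩ := exists_of_color hr.color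
  have hh := hX.hive hn hd
  have key : W.typ p = e'.type ∧ X e'.minus ∈ W.seg p ∧ X e'.plus ∈ W.seg p := by
    have hrun := hr.run
    clear hr
    induction hrun with
    | refl => exact ⟨h1, h2, h3⟩
    | @tail e₁ e₂ _ hs ih =>
      have hst := (hh.step_dual hs).1
      rw [hX.dualPoint_eq hn hd, hX.dualPoint_eq hn hd] at hst
      have hty := (hs.coords hh.colorMap).1
      obtain ⟨μ, hμ⟩ := hs
      obtain ⟨q, q1, q2, q3⟩ := exists_of_color hμ.2.1
      have hm := hμ.not_reduced.1
      rcases minus_cases e₁ with ⟨u, hu, h⟩ | ⟨hl, h⟩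
      · rw [← hst, h] at q3
        have := hX.seg_unique hd _ q3 (h ▸ ih.2.1) (by rw [q1, hty, ih.1])
        subst this
        exact ⟨q1, q2, by rw [← hst, h]; exact q3⟩
      · rw [h] at hm; exact absurd trivial hm
  have hc := hX.color_eq hn hd ⟨h1, h2, h3⟩
  rw [hr.color] at hc
  injection hc with hc
  exact ⟨p, h1, hc.symm, (hX.reduced_end hn hd h1).1 h3 hr.plus,
    (hX.reduced_end hn hd key.1).2 key.2.1 hr.minus⟩

/-- Every segment starts at a vertex of the reduced graph. -/
theorem exists_edge (hX : W.Dual X) (hn : 0 < n) (hd : W.ones 0 = d) (hdn : d ≤ n) (p : ι) :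
    ∃ e : HiveEdge n d, e.type = W.typ p ∧ X e.plus = W.head p ∧ W.color X e = .seg (W.col p) ∧
      InReduced (W.color X) e.plus := by
  by_cases hp : W.HeadIn p
  · obtain ⟨lo, hi, hg, hb⟩ := exists_germ hd (W.head_mem p)
    have hB := W.base_sum hd (W.head p)
    rw [if_pos (mem_heads.2 ⟨p, hp, rfl⟩), if_neg (by
      rw [mem_tails]; rintro ⟨q, -, hq⟩; exact W.head_ne_tail p q hq)] at hB
    cases hg with
    | none h => exact absurd (W.head_mem_seg p) (h p)
    | edge q h hu => exact (not_thru_head hp h).elim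
    | cross q r h => exact (not_thru_head hp h).elim
    | tail q _ hx => exact absurd hx (W.head_ne_tail p q)
    | head q _ _ _ =>
      have hmem : ∀ j, W.base d (coord (W.head p)) + eps j ∈ W.Sub d (W.head p) := by
        refine fun j => (hb.1 _).2 ⟨?_, fun i => ?_⟩
        · have := eps_sum j
          simp only [Pi.add_apply]; omega
        · simp only [Pi.add_apply, eps_apply, Pi.one_apply]
          split_ifs <;> omega
      set f : HiveFace n d := .upper _ fun j => sub_subset hd (W.head_mem p) (hmem j)
      have hf : X (.face f) = W.head p :=
        face_point_unique hd (hX.mem _) (W.head_mem p) (hX.vertex f) hmem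
      have hc : ∀ l, ∃ r, W.typ r = l ∧ X (.face f) ∈ W.seg r := fun l => by
        obtain ⟨r, h1, h2⟩ := W.head_full p hp l
        exact ⟨r, h1, by rw [hf, ← h2]; exact W.head_mem_seg r⟩
      refine ⟨f.edge (W.typ p), rfl, ?_, ?_, ?_⟩
      · rw [plus_upper]; exact hf
      · exact hX.face_color hn hd (by rw [hf]; exact W.head_mem_seg p)
      · rw [plus_upper]
        intro l
        obtain ⟨r, rfl, h2⟩ := hc l
        rw [hX.face_color hn hd h2]; simp
  · obtain ⟨i, hi⟩ := not_headIn hp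
    obtain ⟨hc, ht⟩ := W.head_side p i hi
    obtain ⟨j, hj⟩ := (W.bdry i _).1 ⟨p, .inl ⟨hi, rfl⟩⟩
    obtain ⟨e, he, h1, h2, h3⟩ := exists_outer hn i j.2 hdn
    have hs := h3.2 ((W.isOne_iff hd i j).1 ⟨p, hp, ht, hj.symm⟩)
    have hl := not_long_of_short hn hs
    have hside := outerSide_short hl
    refine ⟨e, ?_, ?_, ?_, ?_⟩
    · rw [ht, ← h1, hside, idx_one_two]
    · rw [plus_of_short hs]
      have h4 := hX.next e he
      have h5 := hX.side e he
      rw [bdryValue_eq (outerRank_lt he)] at h4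
      subst h1
      refine coord_ext (e.outerSide + 1) (h4.trans ((congrArg _ (Fin.ext h2)).trans hj)) ?_
      rw [idx_one_two, hi]
      exact h5
    · rw [hX.outer_color hn hd he, if_neg hl, hc]
    · rw [plus_of_short hs]; trivial

/-- The honeycomb of the dual hive of a web is the web. -/
theorem mem_rho_iff (hX : W.Dual X) (hn : 0 < n) (hd : W.ones 0 = d) (hdn : d ≤ n)
    {s : Set ℂ × SegColor} : s ∈ rho (W.color X) (fun e => coord (X e.plus) e.type) ↔
      ∃ p, s = (segment ℝ (W.tail p) (W.head p), W.col p) := by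
  have hh := hX.hive hn hd
  rw [hh.mem_rho]
  simp only [hX.dualPoint_eq hn hd]
  constructor
  · rintro ⟨e, e', h1, h2⟩
    obtain ⟨p, -, h3, h4, h5⟩ := hX.run_seg hn hd h1
    exact ⟨p, Prod.ext (by rw [h2, h4, h5]) h3.symm⟩
  · rintro ⟨p, rfl⟩
    obtain ⟨e, h1, h2, h3, h4⟩ := hX.exists_edge hn hd hdn p
    obtain ⟨e', hr⟩ := hh.run_at_plus h3 h4
    obtain ⟨q, h5, h6, h7, h8⟩ := hX.run_seg hn hd hr
    obtain rfl := head_inj (h7.symm.trans h2) (h5.trans h1)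
    exact ⟨e, e', hr, by rw [h7, h8]⟩

end Dual

end Web

/-- Every triangular honeycomb comes from a dual hive. -/
theorem exists_hive (hn : 0 < n) (hdn : d ≤ n) {h : ColoredSegments} (hh : h ∈ honey n d)
    (hb : HasBoundary h a) : ∃ C L, Hive (n := n) (d := d) C L a ∧ rho C L = h := by
  obtain ⟨ht, i, hi⟩ := hh
  obtain ⟨W, hW⟩ := ht.exists_web hb
  have := ht.honeycomb.finite.fintype
  have hd : W.ones 0 = d := by
    classical
    rw [← W.ones_eq i, ← hi, Web.ones]
    have h1 := W.sum_ones i fun _ => (1 : ℕ)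
    simp only [Finset.sum_const, smul_eq_mul, mul_one] at h1
    rw [← h1, ← Set.ncard_coe_finset, ← Set.ncard_image_of_injective _ Subtype.val_injective]
    congr 1
    ext s
    simp only [Set.mem_image, Finset.mem_coe, Finset.mem_filter, Finset.mem_univ, true_and,
      Set.mem_ofPred_eq]
    constructor
    · rintro ⟨p, ⟨h2, h3⟩, rfl⟩
      have h4 := (W.head_side_iff p i).2 ⟨h3, h2⟩
      refine ⟨p.2, ?_, W.head p, ?_, W.head_mem p, h4⟩
      · rw [hW p]; exact (W.head_side p i h4).1
      · rw [hW p]; exact W.head_mem_seg p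
    · rintro ⟨h2, h3, z, h4, h5⟩
      have h6 := hW ⟨s, h2⟩
      have h7 : s = (segment ℝ _ _, _) := h6
      rw [h7] at h3 h4
      refine ⟨⟨s, h2⟩, ?_, rfl⟩
      rcases W.eq_of_side h4 h5.2 with rfl | rfl
      · exact ((W.head_side_iff _ i).1 h5.2).symm
      · have := (W.tail_side _ i h5.2).1
        cases h3.symm.trans this
  obtain ⟨X, hX⟩ := W.exists_dual hd
  refine ⟨_, _, hX.hive hn hd, Set.ext fun s => ?_⟩
  rw [hX.mem_rho_iff hn hd hdn]
  constructor
  · rintro ⟨p, hp⟩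
    rw [hp, ← hW p]; exact p.2
  · exact fun hs => ⟨⟨s, hs⟩, hW ⟨s, hs⟩⟩

/-- The boundary values of a triangular honeycomb. -/
theorem IsTriangular.exists_boundary (hn : 0 < n) {h : ColoredSegments}
    (ht : IsTriangular n h) :
    ∃ a : Fin 3 → Fin n → ℝ, HasBoundary h a := by
  suffices H : ∀ i, ∃ b : Fin n → ℝ, StrictAnti b ∧
      (fun v => coord v (i + 1)) '' (support h ∩ side i) = Set.range b by
    choose b hb using H
    exact ⟨b, hb⟩
  intro i
  have hinj : Set.InjOn (fun v => coord v (i + 1)) (support h ∩ side i) := fun x hx y hy hxy =>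
    coord_ext (i + 1) hxy (by rw [idx_one_two, hx.2.2, hy.2.2])
  have hcard : ((fun v => coord v (i + 1)) '' (support h ∩ side i)).ncard = n := by
    rw [hinj.ncard_image, ht.side_card]
  have hfin : ((fun v => coord v (i + 1)) '' (support h ∩ side i)).Finite :=
    Set.finite_of_ncard_pos (hcard ▸ hn)
  rw [Set.ncard_eq_toFinset_card _ hfin] at hcard
  refine ⟨fun j => hfin.toFinset.orderEmbOfFin hcard j.rev, fun j k hjk => ?_, ?_⟩
  · simpa using hjk
  · have h2 := Finset.range_orderEmbOfFin hfin.toFinset hcard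
    exact (hfin.coe_toFinset.symm.trans h2.symm).trans (Fin.rev_surjective.range_comp _).symm

end

section

variable {n d : ℕ} {C C' : HiveEdge n d → HiveColor} {c c' : SegColor}

/-! ### Isomorphisms of reduced graphs: boundary vertices -/

variable (φ : (reducedGraph C).Iso (reducedGraph C'))

/-- The numbering of the boundary vertices by side and rank forces an isomorphism of reduced graphs
to fix them. -/
theorem Hive.iso_outer {L : HiveEdge n d → ℝ} {a : Fin 3 → Fin n → ℝ} (h : Hive C L a)
    (hC' : IsColorMap C') (e : HiveEdge n d) (he : e.IsOuter) :
    φ.toEquiv ⟨.outer e he, trivial⟩ = ⟨.outer e he, trivial⟩ := by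
  have hn := h.pos_n
  have hdeg : ∀ e he, (reducedGraph C').degree ⟨.outer e he, trivial⟩ ≤ 1 := by
    intro e he
    refine (Set.ncard_le_one (Set.Finite.of_finite_image (f := Subtype.val) (Set.toFinite _)
        Subtype.val_injective.injOn)).2 ?_
    rintro y ⟨c, hy⟩ z ⟨c', hz⟩
    obtain ⟨g, g', p⟩ := (Port.edge_iff hn).1 hy
    obtain ⟨k, k', q⟩ := (Port.edge_iff hn).1 hz
    obtain rfl : e = g := p.incident
    obtain rfl : e = k := q.incident
    exact (p.unique hC' hn q).2.1
  let O := {e : HiveEdge n d // e.IsOuter}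
  have hψ : ∀ e : O, ∃ e' : O, φ.toEquiv ⟨.outer e'.1 e'.2, trivial⟩ = ⟨.outer e.1 e.2, trivial⟩ :=
      by
    intro e
    obtain ⟨x, hx⟩ := φ.toEquiv.surjective ⟨.outer e.1 e.2, trivial⟩
    have h1 := hdeg e.1 e.2
    rw [← hx, φ.degree_eq] at h1
    rcases h2 : x.1 with f | ⟨e', he'⟩
    · rw [h.degree_face h2] at h1; omega
    · exact ⟨⟨e', he'⟩, by rw [← hx]; exact congrArg _ (Subtype.ext h2.symm)⟩
  choose ψ hψ using hψ
  let k : O → Fin 3 ×ₗ ℕ := fun e => toLex (e.1.outerSide, e.1.outerRank)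
  have hk : Function.Injective k := fun e f h => by
    have h' := toLex.injective h
    exact Subtype.ext (outer_unique hn e.2 f.2 (congrArg Prod.fst h') (congrArg Prod.snd h'))
  let _ : LinearOrder O := LinearOrder.lift' k hk
  have hlt : ∀ e f : O, e < f ↔ outerLT (.outer e.1 e.2) (.outer f.1 f.2) := fun e f =>
    (Prod.Lex.lt_iff (x := k e) (y := k f))
  have hmono : StrictMono ψ := fun e f hef => by
    have hd1 : ∀ e : O, (reducedGraph C).degree ⟨.outer e.1 e.2, trivial⟩ = 1 :=
      fun _ => h.degree_outer rfl
    refine (hlt _ _).2 ((φ.bdryLT_iff ⟨.outer (ψ e).1 (ψ e).2, trivial⟩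
      ⟨.outer (ψ f).1 (ψ f).2, trivial⟩ (hd1 _) (hd1 _)).1 ?_)
    rw [hψ, hψ]
    exact (hlt _ _).1 hef
  have : ψ ⟨e, he⟩ = ⟨e, he⟩ := le_antisymm (hmono.apply_le) (hmono.le_apply)
  have h1 := hψ ⟨e, he⟩
  rwa [this] at h1

end

section

variable {n d : ℕ} {C C' : HiveEdge n d → HiveColor} {c c' : SegColor}
variable {L : HiveEdge n d → ℝ} {a : Fin 3 → Fin n → ℝ}

/-! ### Balanced vector fields on a honeycomb -/

namespace Hive

theorem outer_transport (h : Hive C L a) (hC' : IsColorMap C')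
    (φ : (reducedGraph C).Iso (reducedGraph C')) {e : HiveEdge n d} (he : e.IsOuter) :
    C' e = C e := by
  obtain ⟨c, y, g, p⟩ := Port.exists_of_incident (x := ⟨.outer e he, trivial⟩) (g := e) h.colorMap
    h.outer_not_m rfl
  have h1 := (φ.edge_iff _ _ _).2 ((Port.edge_iff h.pos_n).2 ⟨_, _, p⟩)
  rw [h.iso_outer φ hC'] at h1
  obtain ⟨k, k', q⟩ := (Port.edge_iff h.pos_n).1 h1
  obtain rfl : e = k := q.incident
  rw [p.color, q.color]

theorem transport_isSimple (h : Hive C L a) (hC' : IsColorMap C')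
    (φ : (reducedGraph C).Iso (reducedGraph C')) : IsSimple C' := by
  classical
  have hm : NoOuterM C' := fun e he => by rw [h.outer_transport hC' φ he]; exact h.outer_not_m e he
  refine ⟨h.pos_n, hC', hm, fun {x y g g' k k' c c'} p q => ?_⟩
  have hx := p.incident
  have hx' := q.incident
  rcases hf : x.1 with f | ⟨e, he⟩
  swap
  · rw [hf] at hx hx'
    exact (hx : e = g).symm.trans hx'
  rw [hf] at hx hx'
  obtain ⟨l, rfl⟩ := hx
  obtain ⟨l', rfl⟩ := hx'
  choose c₀ Y g₀ hY using fun l => Port.exists_of_incident (x := x) (g := f.edge l) hC' hm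
    (by rw [hf]; exact ⟨l, rfl⟩)
  have hsub : {w | (reducedGraph C').Adj x w} ⊆ (Finset.univ.image Y : Finset _) := by
    rintro w ⟨c, hw⟩
    obtain ⟨g, g', r⟩ := (Port.edge_iff h.pos_n).1 hw
    have hr := r.incident
    rw [hf] at hr
    obtain ⟨j, rfl⟩ := hr
    simpa using ⟨j, ((hY j).unique hC' h.pos_n r).2.1⟩
  have hdeg : (reducedGraph C').degree x = 3 := by
    obtain ⟨z, rfl⟩ := φ.toEquiv.surjective x
    rw [φ.degree_eq]
    rcases hz : z.1 with f' | ⟨e, he⟩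
    · exact h.degree_face hz
    · rw [show z = ⟨.outer e he, trivial⟩ from Subtype.ext hz, h.iso_outer φ hC'] at hf
      cases hf
  have hcard := (Set.ncard_le_ncard hsub (Finset.finite_toSet _)).trans_eq (Set.ncard_coe_finset _)
  have hinj := Finset.card_image_iff.1 (le_antisymm Finset.card_image_le
    ((by rw [ColoredGraph.degree] at hdeg; simp [hdeg]) |> hcard.trans' : Finset.card Finset.univ ≤
        _))
  congr 1
  refine hinj (Finset.mem_coe.2 (Finset.mem_univ _)) (Finset.mem_coe.2 (Finset.mem_univ _)) ?_
  rw [((hY l).unique hC' h.pos_n p).2.1, ((hY l').unique hC' h.pos_n q).2.1]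

/-- Summation by parts. If `J` is an involution of the pairs of a vertex and an edge at it, and the
vectors `V p` are opposite for `p` and `J p` and have sum zero at every vertex, then the total of
the inner products of `V p` with the displacement from `J p` to `p` is zero. In particular, if none
of these products is negative, then they all are zero. -/
theorem virial {R : DualVertex n d → Prop}
    (J : {x // R x} × HiveEdge n d → {x // R x} × HiveEdge n d)
    (V : {x // R x} × HiveEdge n d → Fin 3 → ℝ)
    (hJ : ∀ p, p.1.1.Incident p.2 → (J p).1.1.Incident (J p).2 ∧ J (J p) = p ∧ V (J p) = -V p)
    (hf : ∀ x f, x.1 = .face f → ∑ l, V (x, f.edge l) = 0)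
    (ho : ∀ x e he, x.1 = .outer e he → V (x, e) = 0)
    (hp : ∀ p, p.1.1.Incident p.2 →
      0 ≤ ∑ i, V p i * (coord (dualPoint L p.1.1) i - coord (dualPoint L (J p).1.1) i))
    (p) (hpi : p.1.1.Incident p.2) :
    ∑ i, V p i * (coord (dualPoint L p.1.1) i - coord (dualPoint L (J p).1.1) i) = 0 := by
  classical
  have := Fintype.ofFinite {x : DualVertex n d // R x}
  have := Fintype.ofFinite (HiveEdge n d)
  set s : Finset ({x // R x} × HiveEdge n d) := Finset.univ.filter fun p => p.1.1.Incident p.2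
  have hs : ∀ p, p ∈ s ↔ p.1.1.Incident p.2 := fun p => by simp [s]
  set X : {x // R x} → Fin 3 → ℝ := fun x => coord (dualPoint L x.1)
  have hzero : ∑ p ∈ s, ∑ i, V p i * X p.1 i = 0 := by
    rw [Finset.sum_filter, Fintype.sum_prod_type]
    refine Finset.sum_eq_zero fun x _ => ?_
    rw [← Finset.sum_filter]
    rcases hx : x.1 with f | ⟨e, he⟩
    · have : (Finset.univ.filter fun g => DualVertex.Incident g (.face f)) =
          Finset.univ.image f.edge := by
        ext g; rw [Finset.mem_filter_univ]; simp [DualVertex.Incident]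
      simp only [hx, this]
      rw [Finset.sum_image fun _ _ _ _ h => edge_injective f h, Finset.sum_comm]
      refine Finset.sum_eq_zero fun i _ => ?_
      have h1 := congrFun (hf x f hx) i
      rw [Finset.sum_apply] at h1
      rw [← Finset.sum_mul, h1, Pi.zero_apply, zero_mul]
    · have : (Finset.univ.filter fun g => DualVertex.Incident g (.outer e he)) = {e} := by
        ext g; rw [Finset.mem_filter_univ]; simp [DualVertex.Incident, eq_comm]
      simp only [hx, this]
      simp [ho x e he hx]
  have hzero' : ∑ p ∈ s, ∑ i, V p i * X (J p).1 i = 0 := by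
    have h1 : ∑ p ∈ s, ∑ i, V p i * X (J p).1 i = ∑ p ∈ s, -∑ i, V p i * X p.1 i := by
      refine Finset.sum_nbij' J J (fun p h => (hs _).2 (hJ p ((hs p).1 h)).1)
        (fun p h => (hs _).2 (hJ p ((hs p).1 h)).1) (fun p h => (hJ p ((hs p).1 h)).2.1)
        (fun p h => (hJ p ((hs p).1 h)).2.1) fun p h => ?_
      rw [(hJ p ((hs p).1 h)).2.2]
      simp
    rw [h1, Finset.sum_neg_distrib, hzero, neg_zero]
  refine (Finset.sum_eq_zero_iff_of_nonneg (fun q h => hp q ((hs q).1 h))).1 ?_ p ((hs p).2 hpi)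
  simp only [mul_sub, Finset.sum_sub_distrib]
  exact (congrArg₂ (· - ·) hzero hzero').trans (sub_zero 0)

theorem sum_arrow {v w : ℂ} {t : Fin 3} (h : Arrow t v w) (V : Fin 3 → ℝ) :
    ∃ r : ℝ, 0 < r ∧ ∑ i, V i * (coord w i - coord v i) = r * (V (t + 2) - V (t + 1)) := by
  refine ⟨coord w (t + 2) - coord v (t + 2), sub_pos.2 h.2, ?_⟩
  have h1 := coord_sum t w
  have h2 := coord_sum t v
  have h3 := h.1
  rw [Fin.sum_univ_three, ← sum_rot t fun i => V i * (coord w i - coord v i), h3,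
    show coord w (t + 1) = coord v (t + 1) + coord v (t + 2) - coord w (t + 2) by linarith]
  ring

/-- The case of the reduced graph. -/
theorem graph_virial (h : Hive C L a) (V : (reducedGraph C).V → HiveEdge n d → Fin 3 → ℝ)
    (hV : ∀ {c x g y g'}, Port C c x g y g' → V y g' = -V x g)
    (hf : ∀ (x : (reducedGraph C).V) f, x.1 = .face f → ∑ l, V x (f.edge l) = 0)
    (ho : ∀ (x : (reducedGraph C).V) e he, x.1 = .outer e he → V x e = 0)
    (hp : ∀ {c x g y g'}, Port C c x g y g' →
      0 ≤ x.1.sign * (V x g (g.type + 2) - V x g (g.type + 1)))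
    {x g y g'} (p : Port C c x g y g') : V x g (g.type + 2) = V x g (g.type + 1) := by
  classical
  have hex : ∀ p : (reducedGraph C).V × HiveEdge n d, ∃ q : (reducedGraph C).V × HiveEdge n d,
      p.1.1.Incident p.2 → ∃ c, Port C c p.1 p.2 q.1 q.2 := fun p => by
    by_cases hp : p.1.1.Incident p.2
    · obtain ⟨c, y, g', q⟩ := Port.exists_of_incident h.colorMap h.outer_not_m hp
      exact ⟨(y, g'), fun _ => ⟨c, q⟩⟩
    · exact ⟨p, fun h => absurd h hp⟩
  choose J hJ using hex
  have key : ∀ p, p.1.1.Incident p.2 → ∃ r : ℝ, 0 < r ∧ ∑ i, V p.1 p.2 i *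
      (coord (dualPoint L p.1.1) i - coord (dualPoint L (J p).1.1) i) =
        r * (p.1.1.sign * (V p.1 p.2 (p.2.type + 2) - V p.1 p.2 (p.2.type + 1))) := by
    intro p hpi
    obtain ⟨c, q⟩ := hJ p hpi
    obtain ⟨h1, h2⟩ | ⟨h1, h2⟩ := h.port_arrow q
    · obtain ⟨r, hr, h3⟩ := sum_arrow h2 (V p.1 p.2)
      exact ⟨r, hr, by rw [h3, h1, one_mul]⟩
    · obtain ⟨r, hr, h3⟩ := sum_arrow h2 (-V p.1 p.2)
      refine ⟨r, hr, ?_⟩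
      rw [h1, show ∀ u v : ℝ, r * (-1 * (u - v)) = r * (-u - -v) by intros; ring]
      refine Eq.trans (Finset.sum_congr rfl fun i _ => ?_) h3
      rw [Pi.neg_apply]; ring
  have := virial (L := L) J (fun p => V p.1 p.2) (fun p hpi => ?_) hf ho (fun p hpi => ?_) (x, g)
      p.incident
  · obtain ⟨r, hr, h1⟩ := key (x, g) p.incident
    have hs : x.1.sign ≠ 0 := by rcases h.port_arrow p with h | h <;> rw [h.1] <;> norm_num
    have := (mul_eq_zero.1 ((mul_eq_zero.1 (h1.symm.trans this)).resolve_left hr.ne')).resolve_left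
        hs
    exact sub_eq_zero.1 this
  · obtain ⟨c, q⟩ := hJ p hpi
    obtain ⟨c', q'⟩ := hJ _ q.symm.incident
    obtain ⟨-, h1, h2⟩ := q.symm.unique h.colorMap h.pos_n q'
    exact ⟨q.symm.incident, Prod.ext h1.symm h2.symm, hV q⟩
  · obtain ⟨r, hr, h1⟩ := key p hpi
    obtain ⟨c, q⟩ := hJ p hpi
    rw [h1]
    exact mul_nonneg hr.le (hp q)

/-- The case of all faces. -/
theorem hive_virial (h : Hive C L a) (W : HiveEdge n d → Fin 3 → ℝ)
    (hf : ∀ f : HiveFace n d, ∑ l, W (f.edge l) = 0) (ho : ∀ e, e.IsOuter → W e = 0)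
    (hp : ∀ e, C e ≠ .m → 0 ≤ W e (e.type + 2) - W e (e.type + 1)) {e} (he : C e ≠ .m) :
    W e (e.type + 2) = W e (e.type + 1) := by
  classical
  let J : {_x : DualVertex n d // True} × HiveEdge n d → {_x : DualVertex n d // True} × HiveEdge n
      d :=
    fun p => (⟨if p.1.1 = p.2.plus then p.2.minus else p.2.plus, trivial⟩, p.2)
  have hne : ∀ e : HiveEdge n d, ¬ e.minus = e.plus := fun e h' => plus_ne_minus h.pos_n e e h'.symm
  have key : ∀ p : {_x : DualVertex n d // True} × HiveEdge n d, p.1.1.Incident p.2 →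
      ∑ i, (p.1.1.sign • W p.2) i * (coord (dualPoint L p.1.1) i - coord (dualPoint L (J p).1.1) i)
          =
        ∑ i, W p.2 i * (coord (dualPoint L p.2.plus) i - coord (dualPoint L p.2.minus) i) := by
    rintro ⟨⟨x, hx⟩, e⟩ hpi
    refine Finset.sum_congr rfl fun i _ => ?_
    obtain h0 | h0 : x = e.plus ∨ x = e.minus := incident_iff.1 hpi <;> subst h0
    · simp [J, sign_plus h.pos_n]
    · simp [J, sign_minus, hne]; ring
  have key2 : ∀ e, C e ≠ .m → ∃ r : ℝ, 0 < r ∧ ∑ i, W e i * (coord (dualPoint L e.plus) i -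
      coord (dualPoint L e.minus) i) = r * (W e (e.type + 2) - W e (e.type + 1)) :=
    fun e he => sum_arrow (h.arrow_edge he) _
  have := virial (L := L) J (fun p => p.1.1.sign • W p.2) ?_ (fun x f _ => ?_) (fun x e he _ => ?_)
      ?_
    (⟨e.plus, trivial⟩, e) (plus_incident e)
  · rw [key _ (plus_incident e)] at this
    obtain ⟨r, hr, h1⟩ := key2 e he
    exact sub_eq_zero.1 ((mul_eq_zero.1 (h1.symm.trans this)).resolve_left hr.ne')
  · rintro ⟨⟨x, hx⟩, e⟩ hpi
    obtain h0 | h0 : x = e.plus ∨ x = e.minus := incident_iff.1 hpi <;> subst h0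
    · simp [J, sign_plus h.pos_n, sign_minus, hne, minus_incident]
    · simp [J, sign_plus h.pos_n, sign_minus, hne, plus_incident]
  · simp only [← Finset.smul_sum, hf, smul_zero]
  · simp only [ho e he, smul_zero]
  · intro p hpi
    rw [key p hpi]
    by_cases hm : C p.2 = .m
    · simp [h.dual_eq_of_m hm]
    · obtain ⟨r, hr, h1⟩ := key2 p.2 hm
      rw [h1]
      exact mul_nonneg hr.le (hp _ hm)

end Hive

end

section

variable {n d : ℕ} {C C' : HiveEdge n d → HiveColor} {c c' : SegColor}
variable {L : HiveEdge n d → ℝ} {a : Fin 3 → Fin n → ℝ}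

/-! ### Isomorphisms of reduced graphs preserve directions -/

/-- The direction of the lines of type `t`, in coordinates. -/
def dirVec (t : Fin 3) : Fin 3 → ℝ := Pi.single (t + 2) 1 - Pi.single (t + 1) 1

theorem sum_dirVec : ∑ t, dirVec t = 0 := by
  funext i
  rw [Finset.sum_apply, Fin.sum_univ_three]
  fin_cases i <;> simp [dirVec]

theorem dirVec_self (t : Fin 3) : dirVec t (t + 2) = 1 ∧ dirVec t (t + 1) = -1 := by
  fin_cases t <;> simp [dirVec]

theorem dirVec_one (t : Fin 3) : dirVec (t + 1) (t + 2) = -1 ∧ dirVec (t + 1) (t + 1) = 0 := by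
  fin_cases t <;> simp [dirVec]

theorem dirVec_two (t : Fin 3) : dirVec (t + 2) (t + 2) = 0 ∧ dirVec (t + 2) (t + 1) = 1 := by
  fin_cases t <;> simp [dirVec]

theorem sign_cases (x : DualVertex n d) : x.sign = 1 ∨ x.sign = -1 := by
  rcases x with (⟨u, hu⟩ | ⟨u, hu⟩) | ⟨e, he⟩
  · exact .inl rfl
  · exact .inr rfl
  · simp only [DualVertex.sign]; split_ifs <;> simp

/-- `μ x g` is the edge through which the image under `φ` of the chain that leaves `x` through `g`
leaves the image of `x`. -/
def IsTransport (φ : (reducedGraph C).Iso (reducedGraph C'))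
    (μ : (reducedGraph C).V → HiveEdge n d → HiveEdge n d) : Prop :=
  ∀ {c x g y g'}, Port C c x g y g' → Port C' c (φ.toEquiv x) (μ x g) (φ.toEquiv y) (μ y g')

theorem exists_transport (hC : IsSimple C) (hC' : IsSimple C')
    (φ : (reducedGraph C).Iso (reducedGraph C')) : ∃ μ, IsTransport φ μ := by
  have hex : ∀ x g, ∃ k, ∀ {c y g'}, Port C c x g y g' →
      ∃ k', Port C' c (φ.toEquiv x) k (φ.toEquiv y) k' := by
    intro x g
    by_cases hg : ∃ c y g', Port C c x g y g'
    · obtain ⟨c, y, g', p⟩ := hg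
      obtain ⟨k, k', q⟩ := (Port.edge_iff hC.pos_n).1
        ((φ.edge_iff _ _ _).2 ((Port.edge_iff hC.pos_n).2 ⟨_, _, p⟩))
      refine ⟨k, fun p' => ?_⟩
      obtain ⟨rfl, rfl, -⟩ := p.unique hC.colorMap hC.pos_n p'
      exact ⟨k', q⟩
    · exact ⟨g, fun p => absurd ⟨_, _, _, p⟩ hg⟩
  choose μ hμ using hex
  refine ⟨μ, fun {c x g y g'} p => ?_⟩
  obtain ⟨k, h1⟩ := hμ x g p
  obtain ⟨k', h2⟩ := hμ y g' p.symm
  have h3 := hC'.simple h1 h2.symm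
  rw [← h3] at h2
  obtain ⟨-, -, rfl⟩ := h1.unique hC'.colorMap hC'.pos_n h2.symm
  exact h1

variable {φ : (reducedGraph C).Iso (reducedGraph C')}
  {μ : (reducedGraph C).V → HiveEdge n d → HiveEdge n d}

namespace Hive

theorem exists_face (h : Hive C L a) (hC' : IsColorMap C') {x : (reducedGraph C).V}
    {f : HiveFace n d} (hx : x.1 = .face f) : ∃ f', (φ.toEquiv x).1 = .face f' := by
  rcases h1 : (φ.toEquiv x).1 with f' | ⟨e, he⟩
  · exact ⟨f', rfl⟩
  · have h2 := h.iso_outer φ hC' e he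
    have h3 : φ.toEquiv x = ⟨.outer e he, trivial⟩ := Subtype.ext h1
    rw [← h3] at h2
    rw [← φ.toEquiv.injective h2] at hx
    cases hx

theorem transport_outer (h : Hive C L a) (hC' : IsColorMap C') (hμ : IsTransport φ μ)
    {x : (reducedGraph C).V} {e : HiveEdge n d} {he} (hx : x.1 = .outer e he) : μ x e = e := by
  obtain ⟨c, y, g', p⟩ := Port.exists_of_incident (x := x) (g := e) h.colorMap h.outer_not_m
    (by rw [hx]; rfl)
  have q := (hμ p).incident
  rw [show x = ⟨.outer e he, trivial⟩ from Subtype.ext hx, h.iso_outer φ hC'] at q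
  rw [show x = ⟨.outer e he, trivial⟩ from Subtype.ext hx]
  exact Eq.symm q

/-- An isomorphism from the reduced graph of a dual hive preserves types and signs. The sum of the
displacements along all the edges, each multiplied by the direction of its image, does not depend on
the isomorphism, and it is largest when all directions are preserved. -/
theorem transport_type (h : Hive C L a) (hC' : IsColorMap C') (hμ : IsTransport φ μ)
    {x y g g'} (p : Port C c x g y g') :
    (μ x g).type = g.type ∧ (φ.toEquiv x).1.sign = x.1.sign := by
  have hn := h.pos_n
  have S' := h.transport_isSimple hC' φ
  have hval : ∀ t t' : Fin 3, dirVec t' (t + 2) - dirVec t' (t + 1) = if t' = t then 2 else -1 := by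
    intro t t'
    rcases idx_cases t t' with rfl | rfl | rfl
    · rw [(dirVec_self t').1, (dirVec_self t').2, if_pos rfl]; norm_num
    · rw [(dirVec_one t).1, (dirVec_one t).2, if_neg (by simp)]; norm_num
    · rw [(dirVec_two t).1, (dirVec_two t).2, if_neg (by simp)]; norm_num
  have key := h.graph_virial
    (fun x g => x.1.sign • dirVec g.type - (φ.toEquiv x).1.sign • dirVec (μ x g).type)
    (fun {c x g y g'} p => ?_) (fun x f hx => ?_) (fun x e he hx => ?_) (fun {c x g y g'} p => ?_) p
  · have h1 := hval g.type g.type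
    have h2 := hval g.type (μ x g).type
    rw [if_pos rfl] at h1
    simp only [Pi.sub_apply, Pi.smul_apply, smul_eq_mul] at key
    have h3 : x.1.sign * 2 =
        (φ.toEquiv x).1.sign * (if (μ x g).type = g.type then 2 else -1) := by
      linear_combination key - x.1.sign * h1 + (φ.toEquiv x).1.sign * h2
    rcases sign_cases x.1 with s | s <;> rcases sign_cases (φ.toEquiv x).1 with s' | s' <;>
      rw [s, s'] at h3 ⊢ <;> split_ifs at h3 with ht <;> first | exact ⟨ht, rfl⟩ | norm_num at h3
  · have q := hμ p
    rw [p.sign hn, p.type_eq h.colorMap, q.sign hn, q.type_eq hC']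
    simp only [neg_smul]; abel
  · obtain ⟨f', hf'⟩ := h.exists_face (φ := φ) hC' hx
    have hinj : Function.Injective fun l => (μ x (f.edge l)).type := by
      intro l l' hl
      obtain ⟨c, y, g', p⟩ := Port.exists_of_incident (x := x) (g := f.edge l) h.colorMap
        h.outer_not_m (by rw [hx]; exact ⟨l, rfl⟩)
      obtain ⟨c', y', k', p'⟩ := Port.exists_of_incident (x := x) (g := f.edge l') h.colorMap
        h.outer_not_m (by rw [hx]; exact ⟨l', rfl⟩)
      have q := hμ p
      rw [incident_unique q.incident (hμ p').incident hl] at q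
      obtain rfl := φ.toEquiv.injective (q.unique hC' hn (hμ p')).2.1
      exact edge_injective f (h.isSimple.simple p p')
    have h1 := (Finite.injective_iff_bijective.1 hinj).sum_comp dirVec
    rw [Finset.sum_sub_distrib, ← Finset.smul_sum, ← Finset.smul_sum, h1]
    simp only [face_type, sum_dirVec, smul_zero, sub_zero]
  · rw [h.transport_outer hC' hμ hx, show x = ⟨.outer e he, trivial⟩ from Subtype.ext hx,
      h.iso_outer φ hC', sub_self]
  · have h1 := hval g.type g.type
    have h2 := hval g.type (μ x g).type
    rw [if_pos rfl] at h1
    simp only [Pi.sub_apply, Pi.smul_apply, smul_eq_mul]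
    rw [show ∀ s s' u v u' v' : ℝ, s * (s * u - s' * u' - (s * v - s' * v')) =
      s * (s * (u - v) - s' * (u' - v')) by intros; ring, h1, h2]
    rcases sign_cases x.1 with s | s <;> rcases sign_cases (φ.toEquiv x).1 with s' | s' <;>
      rw [s, s'] <;> split_ifs <;> norm_num

theorem transport_edge (h : Hive C L a) (hC' : IsColorMap C') (hμ : IsTransport φ μ)
    {x : (reducedGraph C).V} {f f' : HiveFace n d} (hx : x.1 = .face f)
    (hx' : (φ.toEquiv x).1 = .face f') (l : Fin 3) :
    μ x (f.edge l) = f'.edge l ∧ C' (f'.edge l) = C (f.edge l) := by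
  obtain ⟨c, y, g', p⟩ := Port.exists_of_incident (x := x) (g := f.edge l) h.colorMap
    h.outer_not_m (by rw [hx]; exact ⟨l, rfl⟩)
  have h1 := (h.transport_type hC' hμ p).1
  have q := hμ p
  have h2 := q.incident
  rw [hx'] at h2
  obtain ⟨k, hk⟩ := h2
  rw [← hk, face_type, face_type] at h1
  subst h1
  exact ⟨hk.symm, by rw [hk, q.color, p.color]⟩

end Hive

end

section

variable {n d : ℕ} {C C' : HiveEdge n d → HiveColor} {c c' : SegColor}
variable {L : HiveEdge n d → ℝ} {a : Fin 3 → Fin n → ℝ}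

/-! ### Isomorphisms of reduced graphs preserve the position of edges of colour `3` -/

/-- A function on lattice points that is constant along the edges of one of the colours `0` and `1`
is constant along the chains of the other colour. -/
theorem Run.potential_eq (hC : IsColorMap C) {A : Type*} {P : Pt → A} {b : SegColor}
    (hP : ∀ e : HiveEdge n d, C e = .seg b → P e.finish = P e.start) (hb : b ≠ .three) (hcb : c ≠ b)
    {e e' : HiveEdge n d} (hr : Run C c e e') : P e'.start = P e.start := by
  induction hr with
  | refl => rfl
  | @tail e e' _ hs ih =>
    rw [← ih]
    obtain ⟨μ, hs⟩ := hs
    obtain ⟨u, hu, w, hw, h1, h2, h3, h4, h5, h6, h7, h8⟩ := hs.faces hC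
    have hm := hs.2.2.1
    have e4 := congrArg HiveEdge.start h4
    have e5 := congrArg HiveEdge.start h5
    rw [lower_start] at e4
    rw [upper_start, h6] at e5
    rw [h7] at h1
    rw [e4, e5, h1]
    cases c with
    | zero =>
      cases b with
      | zero => exact absurd rfl hcb
      | one =>
        rw [h3] at hm
        have := hP _ (m_face hC hm).1
        rw [HiveEdge.finish, lower_start, face_type, h1, h7] at this
        simp only [mType, idx_one_one, idx_two_one] at this ⊢
        convert this.symm using 2 <;> abel
      | three => exact absurd rfl hb
    | one =>
      cases b with
      | zero =>
        rw [h2] at hm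
        have := hP _ (m_face hC hm).2
        rw [HiveEdge.finish, upper_start, face_type, h7] at this
        simp only [mType, idx_one_one, idx_two_one, idx_two_two] at this ⊢
        convert this using 2 <;> abel
      | one => exact absurd rfl hcb
      | three => exact absurd rfl hb
    | three => exact absurd rfl h8

variable {φ : (reducedGraph C).Iso (reducedGraph C')}
  {μ : (reducedGraph C).V → HiveEdge n d → HiveEdge n d}

/-- Two potentials with the same increments, one for each of two colour maps, which agree on the
boundary and are constant along edges of colour `b`, agree at corresponding edges of colour `3`. The
weights `val` are those of a balanced vector field on the part of the honeycomb where the potentials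
disagree. -/
theorem Hive.potential_transport (h : Hive C L a) (hC' : IsColorMap C') (hμ : IsTransport φ μ)
    {b : SegColor} (hb : b ≠ .three) {P P' : Pt → Pt} {S : HiveColor → Fin 3 → Pt}
    (hP : ∀ e : HiveEdge n d, P e.finish - P e.start = S (C e) e.type)
    (hP' : ∀ e : HiveEdge n d, P' e.finish - P' e.start = S (C' e) e.type)
    (hS : ∀ t, S (.seg b) t = 0) (hbd : ∀ e : HiveEdge n d, e.IsOuter → P e.start = P' e.start)
    (val : HiveColor → Fin 3 → Fin 3 → ℝ) (hb0 : ∀ t, val (.seg b) t = 0)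
    (hval : ∀ f : HiveFace n d, (∀ l, C (f.edge l) ≠ .m) → ∑ l, val (C (f.edge l)) l = 0)
    (hpos : ∀ c t, 0 ≤ val (.seg c) t (t + 2) - val (.seg c) t (t + 1))
    (hthree : ∀ t, val (.seg .three) t (t + 2) ≠ val (.seg .three) t (t + 1))
    {x y g g'} (p : Port C .three x g y g') : P g.start = P' (μ x g).start := by
  classical
  have S' := h.transport_isSimple hC' φ
  have hrun : ∀ {C : HiveEdge n d → HiveColor} {P : Pt → Pt}, IsColorMap C →
      (∀ e : HiveEdge n d, P e.finish - P e.start = S (C e) e.type) → ∀ {c}, c ≠ b →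
      ∀ {x g y g'}, Port C c x g y g' → P g'.start = P g.start := by
    intro C P hC hP c hc x g y g' p
    have h0 : ∀ e : HiveEdge n d, C e = .seg b → P e.finish = P e.start := fun e he => by
      rw [← sub_eq_zero, hP, he, hS]
    obtain ⟨e, e', hr, ⟨-, rfl, -, rfl⟩ | ⟨-, rfl, -, rfl⟩⟩ := p
    · exact hr.run.potential_eq hC h0 hb hc
    · exact (hr.run.potential_eq hC h0 hb hc).symm
  by_contra hbad
  have key := h.graph_virial
    (fun x g => if P g.start = P' (μ x g).start then 0 else x.1.sign • val (C g) g.type)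
    (fun {c x g y g'} p => ?_) (fun x f hx => ?_) (fun x e he hx => ?_) (fun {c x g y g'} p => ?_) p
  · have hs : x.1.sign ≠ 0 := by rcases sign_cases x.1 with s | s <;> rw [s] <;> norm_num
    simp only [if_neg hbad, p.color, Pi.smul_apply, smul_eq_mul] at key
    exact hthree _ (mul_left_cancel₀ hs key)
  · have hcol : C g' = C g := p.symm.color.trans p.color.symm
    rw [hcol, p.type_eq h.colorMap, p.sign h.pos_n]
    by_cases hc : c = b
    · rw [p.color, hc, hb0]; simp
    · rw [hrun h.colorMap hP hc p, hrun hC' hP' hc (hμ p)]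
      split_ifs <;> simp
  · obtain ⟨f', hf'⟩ := h.exists_face (φ := φ) hC' hx
    have hred : ∀ l, C (f.edge l) ≠ .m := by have := x.2; rwa [hx] at this
    have he := h.transport_edge hC' hμ hx hf'
    obtain ⟨c, y, g', q⟩ := Port.exists_of_incident (x := x) (g := f.edge 0) h.colorMap
      h.outer_not_m (by rw [hx]; exact ⟨0, rfl⟩)
    have hsign := (h.transport_type hC' hμ q).2
    -- The increments of both potentials around corresponding faces are equal.
    have hall : ∀ l k, P (f.edge l).start = P' (f'.edge l).start →
        P (f.edge k).start = P' (f'.edge k).start := by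
      have hstep : ∃ j : Fin 3, j ≠ 0 ∧ ∀ l, P (f.edge l).start = P' (f'.edge l).start →
          P (f.edge (l + j)).start = P' (f'.edge (l + j)).start := by
        have hinc : ∀ l, P (f.edge l).start = P' (f'.edge l).start →
            P (f.edge l).finish = P' (f'.edge l).finish := fun l hl => by
          have h1 := hP (f.edge l)
          have h2 := hP' (f'.edge l)
          rw [face_type] at h1 h2
          rw [(he l).2, ← h1, hl] at h2
          exact (sub_left_inj.1 h2).symm
        rw [hx, hf'] at hsign
        rcases f with ⟨u, hu⟩ | ⟨u, hu⟩ <;> rcases f' with ⟨w, hw⟩ | ⟨w, hw⟩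
        · refine ⟨2, by decide, fun l hl => ?_⟩
          have := hinc l hl
          simpa [HiveEdge.finish, add_right_comm] using this
        · norm_num [DualVertex.sign] at hsign
        · norm_num [DualVertex.sign] at hsign
        · refine ⟨1, by decide, fun l hl => ?_⟩
          have := hinc l hl
          simpa [HiveEdge.finish] using this
      obtain ⟨j, hj, hstep⟩ := hstep
      intro l k
      have : k = l ∨ k = l + j ∨ k = l + j + j := by clear hstep; revert j l k; decide
      intro hl
      rcases this with rfl | rfl | rfl
      exacts [hl, hstep _ hl, hstep _ (hstep _ hl)]
    by_cases h0 : P (f.edge 0).start = P' (f'.edge 0).start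
    · exact Finset.sum_eq_zero fun l _ => if_pos (by rw [(he l).1]; exact hall 0 l h0)
    · rw [Finset.sum_congr rfl fun l _ => if_neg (by
        rw [(he l).1]; exact fun hl => h0 (hall l 0 hl)), ← Finset.smul_sum]
      simp only [face_type, hval f hred, smul_zero]
  · rw [h.transport_outer hC' hμ hx]
    exact if_pos (hbd e he)
  · by_cases hg : P g.start = P' (μ x g).start
    · simp [hg]
    · simp only [if_neg hg, p.color, Pi.smul_apply, smul_eq_mul, ← mul_sub, ← mul_assoc]
      refine mul_nonneg (mul_self_nonneg _) (hpos c g.type)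

/-- A function on lattice points that is constant along outer edges is constant on the boundary. -/
theorem boundary_connected (hdn : d ≤ n) {A : Type*} {P : Pt → A}
    (hP : ∀ e : HiveEdge n d, e.IsOuter → P e.finish = P e.start) {e f : HiveEdge n d}
    (he : e.IsOuter) (hf : f.IsOuter) : P e.start = P f.start := by
  have line : ∀ (t : Fin 3) (k : ℕ) (v : Pt), (v (t + 2) = 0 ∨ v (t + 2) = n) →
      v ∈ hiveVertices n d → v + k • (eps t - eps (t + 1)) ∈ hiveVertices n d →
      P (v + k • (eps t - eps (t + 1))) = P v := by
    intro t k
    induction k with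
    | zero => intro v _ _ _; simp
    | succ k ih =>
      intro v h0 hv hk
      have h1 := (mem_hive t).1 hv
      have h2 := (mem_hive t).1 hk
      simp [eps_apply] at h2
      have hmid : v + eps t - eps (t + 1) ∈ hiveVertices n d := by
        rw [mem_hive t]
        simp [eps_apply]
        omega
      have h3 := hP ⟨v, t, hv, hmid⟩ h0
      have h4 : v + (k + 1) • (eps t - eps (t + 1)) =
        v + eps t - eps (t + 1) + k • (eps t - eps (t + 1)) := by rw [add_smul, one_smul]; abel
      rw [h4] at hk ⊢
      rw [ih _ (by simpa [eps_apply] using h0) hmid hk]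
      exact h3
  have seg : ∀ (t : Fin 3) (v w : Pt), v (t + 2) = w (t + 2) → (v (t + 2) = 0 ∨ v (t + 2) = n) →
      v ∈ hiveVertices n d → w ∈ hiveVertices n d → P v = P w := by
    intro t v w h1 h2 hv hw
    wlog h3 : v t ≤ w t generalizing v w
    · exact (this w v h1.symm (h1 ▸ h2) hw hv (le_of_not_ge h3)).symm
    obtain ⟨k, hk⟩ := Int.le.dest h3
    have hv' := (mem_hive t).1 hv
    have hw' := (mem_hive t).1 hw
    have : w = v + k • (eps t - eps (t + 1)) := by
      refine pt_ext t ?_ ?_ ?_ <;> simp [eps_apply] <;> omega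
    rw [this] at hw ⊢
    exact (line t k v h2 hv hw).symm
  -- `Q t` and `R t` are the ends of the short side on which the coordinate of index `t` is `n`.
  let Q : Fin 3 → Pt := fun t i => if i = t then n else if i = t + 1 then d else 0
  let R : Fin 3 → Pt := fun t i => if i = t then n else if i = t + 2 then d else 0
  have hQ : ∀ t, Q t ∈ hiveVertices n d := fun t => by
    rw [mem_hive t]; simp [Q]; omega
  have hR : ∀ t, R t ∈ hiveVertices n d := fun t => by
    rw [mem_hive t]; simp [R]; omega
  have hQR : ∀ t, P (Q t) = P (R t) := fun t =>
    seg (t + 1) _ _ (by simp [Q, R]) (.inr (by simp [Q])) (hQ t) (hR t)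
  have hRQ : ∀ t, P (Q t) = P (R (t + 1)) := fun t =>
    seg t _ _ (by simp [Q, R]) (.inl (by simp [Q])) (hQ t) (hR _)
  have hall : ∀ t, P (Q t) = P (Q 0) := by
    have h1 : P (Q 0) = P (Q 1) := (hRQ 0).trans (hQR 1).symm
    have h2 : P (Q 1) = P (Q 2) := (hRQ 1).trans (hQR 2).symm
    intro t
    fin_cases t
    exacts [rfl, h1.symm, (h1.trans h2).symm]
  have main : ∀ e : HiveEdge n d, e.IsOuter → P e.start = P (Q 0) := by
    intro e he
    rcases he with h | h
    · rw [← hall e.type]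
      exact seg e.type _ _ (by rw [show _ = _ from h]; simp [Q]) (.inl h) e.start_mem (hQ _)
    · rw [← hall (e.type + 2)]
      exact seg e.type _ _ (by rw [show _ = _ from h]; simp [Q]) (.inr h) e.start_mem (hQ _)
  rw [main e he, main f hf]

end

section

variable {n d : ℕ} {C C' : HiveEdge n d → HiveColor} {c c' : SegColor}
variable {L : HiveEdge n d → ℝ} {a : Fin 3 → Fin n → ℝ}

/-! ### Rigidity of reduced graphs -/

theorem sum_idx {A : Type*} [AddCommMonoid A] (l : Fin 3) (f : Fin 3 → A) :
    ∑ i, f i = f l + f (l + 1) + f (l + 2) := (Fin.sum_univ_three f).trans (sum_rot l f).symm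

/-- The increments of the potential that is constant along the edges of colour `1`. -/
def zeroStep : HiveColor → Fin 3 → Pt
  | .seg .zero, t => eps t - eps (t + 1)
  | .seg .one, _ => 0
  | .seg .three, t => eps (t + 2) - eps (t + 1)
  | .m, t => eps t - eps (t + 2)

theorem exists_zeroPotential (hC : IsColorMap C) :
    ∃ P : Pt → Pt, ∀ e : HiveEdge n d, P e.finish - P e.start = zeroStep (C e) e.type := by
  refine exists_potential (fun e => zeroStep (C e) e.type) fun f => ?_
  simp only [face_type]
  rcases face_cases hC f with h | h | ⟨l, h1, h2, h3⟩ | ⟨l, h1, h2, h3⟩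
  · simp only [h, zeroStep]
    rw [show (0 : Fin 3) + 1 = 1 from rfl, show (1 : Fin 3) + 1 = 2 from rfl,
      show (2 : Fin 3) + 1 = 0 from rfl]
    abel
  · simp only [h, zeroStep, add_zero]
  all_goals
    rw [← sum_rot l fun t => zeroStep (C (f.edge t)) t, h1, h2, h3]
    simp only [zeroStep, idx_one_one, idx_one_two, idx_two_one]
    abel

variable {φ : (reducedGraph C).Iso (reducedGraph C')}
  {μ : (reducedGraph C).V → HiveEdge n d → HiveEdge n d}

theorem port_three (hC : IsSimple C) {e : HiveEdge n d} (he : C e = .seg .three) :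
    ∃ x y, Port C .three x e y e := by
  obtain ⟨e₁, e₂, hr, h1, h2⟩ := exists_maxRun hC.colorMap hC.outer e he
  have hrefl : ∀ {e e' : HiveEdge n d}, Run C .three e e' → e = e' := fun h => by
    rcases h.cases_head with h | ⟨b, h, -⟩
    · exact h
    · exact absurd rfl (h.coords hC.colorMap).2.2
  obtain rfl := hrefl h1
  obtain rfl := hrefl h2
  exact ⟨⟨_, hr.plus⟩, ⟨_, hr.minus⟩, e₁, e₁, hr, .inl ⟨rfl, rfl, rfl, rfl⟩⟩

namespace Hive

theorem transport_three (h : Hive C L a) (hdn : d ≤ n) (hC' : IsColorMap C')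
    (hμ : IsTransport φ μ) {x y g g'} (p : Port C .three x g y g') : μ x g = g := by
  obtain ⟨P, hP⟩ := exists_zeroPotential h.colorMap
  obtain ⟨P₁, hP₁⟩ := exists_zeroPotential hC'
  obtain ⟨e₀, he₀, -⟩ := exists_outer h.pos_n 0 h.pos_n hdn
  let P' : Pt → Pt := fun v => P₁ v - P₁ e₀.start + P e₀.start
  have hP' : ∀ e : HiveEdge n d, P' e.finish - P' e.start = zeroStep (C' e) e.type := fun e => by
    rw [← hP₁ e]; simp only [P']; abel
  have hbd : ∀ e : HiveEdge n d, e.IsOuter → P e.start = P' e.start := by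
    intro e he
    have := boundary_connected hdn (P := fun v => P v - P' v) (fun e he => by
      rw [← sub_eq_zero, sub_sub_sub_comm, hP, hP', h.outer_transport hC' φ he, sub_self]) he he₀
    simpa [P', sub_eq_zero] using this
  have h0 := h.potential_transport hC' hμ (b := .one) (by simp) hP hP' (fun _ => rfl) hbd
    (fun c t => match c with
      | .seg .zero => dirVec t
      | .seg .three => -dirVec (t + 1)
      | _ => 0) (fun _ => rfl) (fun f hf => ?_) (fun c t => ?_) (fun t => ?_) p
  · have hid : ∀ e : HiveEdge n d, e.finish - e.start = eps e.type - eps (e.type + 1) := fun e => by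
      rw [HiveEdge.finish]; abel
    have h1 := h.potential_transport hC' hμ (b := .zero) (P := fun v => v - P v)
      (P' := fun v => v - P' v) (S := fun c t => eps t - eps (t + 1) - zeroStep c t) (by simp)
      (fun e => by rw [sub_sub_sub_comm, hP, hid]) (fun e => by rw [sub_sub_sub_comm, hP', hid])
      (fun t => sub_self _) (fun e he => by rw [hbd e he])
      (fun c t => match c with
        | .seg .one => dirVec t
        | .seg .three => -dirVec (t + 2)
        | _ => 0) (fun _ => rfl) (fun f hf => ?_) (fun c t => ?_) (fun t => ?_) p
    · rw [h0, sub_left_inj] at h1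
      exact HiveEdge.ext h1.symm (h.transport_type hC' hμ p).1
    · rcases face_cases h.colorMap f with k | k | ⟨l, h1, h2, h3⟩ | ⟨l, h1, h2, h3⟩
      · simp [k]
      · simp only [k, sum_dirVec]
      · rw [sum_idx l, h1, h2, h3]
        simp
      · exact absurd h2 (hf _)
    · cases c <;> norm_num [dirVec_self, dirVec_two]
    · norm_num [dirVec_two]
  · rcases face_cases h.colorMap f with k | k | ⟨l, h1, h2, h3⟩ | ⟨l, h1, h2, h3⟩
    · simp only [k, sum_dirVec]
    · simp [k]
    · rw [sum_idx l, h1, h2, h3]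
      simp
    · exact absurd h2 (hf _)
  · cases c <;> norm_num [dirVec_self, dirVec_one]
  · norm_num [dirVec_one]

theorem color_three_iff (h : Hive C L a) (hdn : d ≤ n) (hC' : IsColorMap C')
    (φ : (reducedGraph C).Iso (reducedGraph C')) (e : HiveEdge n d) :
    C' e = .seg .three ↔ C e = .seg .three := by
  have S' := h.transport_isSimple hC' φ
  obtain ⟨μ, hμ⟩ := exists_transport h.isSimple S' φ
  constructor
  · intro he
    obtain ⟨x', y', q⟩ := port_three S' he
    obtain ⟨x, rfl⟩ := φ.toEquiv.surjective x'
    obtain ⟨y, rfl⟩ := φ.toEquiv.surjective y'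
    obtain ⟨g, g', p⟩ := (Port.edge_iff h.pos_n).1
      ((φ.edge_iff _ _ _).1 ((Port.edge_iff h.pos_n).2 ⟨_, _, q⟩))
    have h1 := S'.simple (hμ p) q
    rw [h.transport_three hdn hC' hμ p] at h1
    rw [← h1, p.color]
  · intro he
    obtain ⟨x, y, p⟩ := port_three h.isSimple he
    have h1 := (hμ p).color
    rwa [h.transport_three hdn hC' hμ p] at h1

/-- A balanced vector field on the edges, orthogonal to the edges of colours `0` and `1`. -/
def crossField : HiveColor → Fin 3 → Fin 3 → ℝ
  | .seg .zero, t => Pi.single t 3 - 1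
  | .seg .one, t => 1 - Pi.single t 3
  | .seg .three, t => (3 : ℝ) • dirVec t
  | .m, t => -(3 : ℝ) • dirVec t

theorem sum_crossField (hC : IsColorMap C) (f : HiveFace n d) :
    ∑ l, crossField (C (f.edge l)) l = 0 := by
  have hsum : ∑ l : Fin 3, (Pi.single l 3 - 1 : Fin 3 → ℝ) = 0 := by
    funext i
    rw [Finset.sum_apply, Fin.sum_univ_three]
    fin_cases i <;> simp <;> norm_num
  rcases face_cases hC f with h | h | ⟨l, h1, h2, h3⟩ | ⟨l, h1, h2, h3⟩
  · simp only [h, crossField, hsum]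
  · simp only [h, crossField]
    rw [← neg_eq_zero, ← hsum, ← Finset.sum_neg_distrib]
    exact Finset.sum_congr rfl fun l _ => neg_sub _ _
  all_goals
    rw [sum_idx l, h1, h2, h3]
    funext i
    simp only [crossField, dirVec, idx_one_one, idx_one_two, Pi.add_apply, Pi.sub_apply,
      Pi.smul_apply, smul_eq_mul, Pi.single_apply, Pi.zero_apply, Pi.one_apply]
    split_ifs <;> norm_num

theorem crossField_pairing (c : HiveColor) (t : Fin 3) :
    crossField c t (t + 2) - crossField c t (t + 1) =
      match c with
      | .seg .three => 6
      | .m => -6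
      | _ => 0 := by
  rcases c with (_ | _ | _) | _ <;>
    simp [crossField, (dirVec_self t).1, (dirVec_self t).2] <;> norm_num

theorem color_m_of (h : Hive C L a) (hdn : d ≤ n) (hC' : IsColorMap C')
    (φ : (reducedGraph C).Iso (reducedGraph C')) {e : HiveEdge n d} (he : C' e = .m) : C e = .m :=
        by
  by_contra hm
  have h3 := h.color_three_iff hdn hC' φ
  have key := h.hive_virial (fun e => crossField (C e) e.type - crossField (C' e) e.type)
    (fun f => ?_) (fun e he => by rw [h.outer_transport hC' φ he, sub_self]) (fun e he => ?_) hm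
  · have h1 := crossField_pairing (C e) e.type
    have h2 := crossField_pairing (C' e) e.type
    have h4 : C e ≠ .seg .three := fun h' => by rw [(h3 e).2 h'] at he; cases he
    simp only [Pi.sub_apply] at key
    rw [he] at h2 key
    rcases hc : C e with (_ | _ | _) | _ <;> rw [hc] at h1 key
    · simp only at h1 h2; linarith
    · simp only at h1 h2; linarith
    · exact h4 hc
    · exact hm hc
  · simp only [face_type, Finset.sum_sub_distrib, sum_crossField h.colorMap, sum_crossField hC',
      sub_self]
  · simp only [Pi.sub_apply]
    rw [sub_sub_sub_comm, crossField_pairing, crossField_pairing]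
    have h4 := h3 e
    rcases hc : C e with (_ | _ | _) | _ <;> rcases hc' : C' e with (_ | _ | _) | _ <;>
      simp [hc, hc'] at h4 he ⊢

theorem color_m_iff (h : Hive C L a) (hdn : d ≤ n) (hC' : IsColorMap C')
    (φ : (reducedGraph C).Iso (reducedGraph C')) (e : HiveEdge n d) : C' e = .m ↔ C e = .m := by
  refine ⟨h.color_m_of hdn hC' φ, fun he => ?_⟩
  -- The two colour maps have the same number of faces without an edge of colour `m`.
  have hsub : {x | InReduced C x} ⊆ {x | InReduced C' x} := by
    rintro (f | ⟨e, he⟩) hx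
    · exact fun l hl => hx l (h.color_m_of hdn hC' φ hl)
    · exact hx
  have heq := Set.eq_of_subset_of_ncard_le hsub (Nat.card_congr φ.toEquiv).ge (Set.toFinite _)
  have hl : ¬ e.OnShortSide := fun hs => h.outer_not_m e (.inr hs) he
  have h1 : ¬ InReduced C (.face (e.up hl)) := fun h' => h' e.type (by rw [up_edge]; exact he)
  have h2 : ¬ InReduced C' (.face (e.up hl)) := fun h' => h1 (heq.symm.subset (show DualVertex.face
      _ ∈ {x | InReduced C' x} from h'))
  simp only [InReduced] at h2
  push Not at h2
  obtain ⟨k, hk⟩ := h2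
  have h3 := h.color_m_of hdn hC' φ hk
  have h4 := m_face h.colorMap h3
  rcases idx_cases k e.type with h5 | h5 | h5
  · rwa [← h5, up_edge] at hk
  · rw [← h5, up_edge, he] at h4; cases h4.1
  · rw [← h5, up_edge, he] at h4; cases h4.2

/-- A colour map with a dual hive is determined by its reduced graph. -/
theorem color_eq (h : Hive C L a) (hdn : d ≤ n) (hC' : IsColorMap C')
    (φ : (reducedGraph C).Iso (reducedGraph C')) : C' = C := by
  classical
  have h3 := h.color_three_iff hdn hC' φ
  have hm := h.color_m_iff hdn hC' φ
  have hface : ∀ f : HiveFace n d, (∀ l, C' (f.edge l) = C (f.edge l)) ∨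
      ∃ c c', ∀ l, C (f.edge l) = c ∧ C' (f.edge l) = c' := by
    intro f
    rcases face_cases h.colorMap f with k | k | ⟨l, h1, h2, h3'⟩ | ⟨l, h1, h2, h3'⟩
    · rcases face_cases hC' f with k' | k' | ⟨l, -, h2, -⟩ | ⟨l, -, h2, -⟩
      · exact .inr ⟨_, _, fun l => ⟨k l, k' l⟩⟩
      · exact .inr ⟨_, _, fun l => ⟨k l, k' l⟩⟩
      · rw [h3, k] at h2; cases h2
      · rw [hm, k] at h2; cases h2
    · rcases face_cases hC' f with k' | k' | ⟨l, -, h2, -⟩ | ⟨l, -, h2, -⟩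
      · exact .inr ⟨_, _, fun l => ⟨k l, k' l⟩⟩
      · exact .inr ⟨_, _, fun l => ⟨k l, k' l⟩⟩
      · rw [h3, k] at h2; cases h2
      · rw [hm, k] at h2; cases h2
    · have := three_face hC' ((h3 _).2 h2)
      rw [idx_one_one, idx_one_two] at this
      exact .inl ((forall_idx l).2 ⟨this.2.trans h1.symm, ((h3 _).2 h2).trans h2.symm,
        this.1.trans h3'.symm⟩)
    · have := m_face hC' ((hm _).2 h2)
      rw [idx_one_one, idx_one_two] at this
      exact .inl ((forall_idx l).2 ⟨this.2.trans h1.symm, ((hm _).2 h2).trans h2.symm,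
        this.1.trans h3'.symm⟩)
  funext e
  rcases hc : C e with c | _
  swap
  · exact (hm e).2 hc
  by_contra hne
  have key := h.hive_virial
    (fun e => if C e = .seg c ∧ C' e ≠ .seg c then dirVec e.type else 0) (fun f => ?_)
    (fun e he => if_neg fun h' => h'.2 (by rw [h.outer_transport hC' φ he, h'.1]))
    (fun e _ => ?_) (e := e) (by rw [hc]; simp)
  · simp only [if_pos (show C e = .seg c ∧ C' e ≠ .seg c from ⟨hc, hne⟩), (dirVec_self _).1,
      (dirVec_self _).2] at key
    norm_num at key
  · simp only [face_type]
    rcases hface f with k | ⟨c₁, c₂, k⟩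
    · exact Finset.sum_eq_zero fun l _ => if_neg fun h' => h'.2 (by rw [k, h'.1])
    · simp only [(k _).1, (k _).2]
      split_ifs
      · exact sum_dirVec
      · exact Finset.sum_const_zero
  · split_ifs
    · rw [(dirVec_self _).1, (dirVec_self _).2]; norm_num
    · simp

/-- The reduced graph of a dual hive has no automorphism except the identity. -/
theorem iso_eq_id (h : Hive C L a) (φ : (reducedGraph C).Iso (reducedGraph C))
    (x : (reducedGraph C).V) : φ.toEquiv x = x := by
  classical
  obtain ⟨μ, hμ⟩ := exists_transport h.isSimple h.isSimple φ
  have step : ∀ {c x g y g'}, Port C c x g y g' → φ.toEquiv x = x → φ.toEquiv y = y := by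
    intro c x g y g' p hx
    have q := hμ p
    rw [hx] at q
    rw [incident_unique q.incident p.incident (h.transport_type h.colorMap hμ p).1] at q
    exact (q.unique h.colorMap h.pos_n p).2.1
  obtain ⟨c, g, y, g', p⟩ := Port.exists_at h.colorMap h.outer_not_m x
  by_contra hne
  have hs : ∀ x : DualVertex n d, x.sign * x.sign = 1 := fun x => by
    rcases sign_cases x with s | s <;> rw [s] <;> norm_num
  have hpair : ∀ (x : DualVertex n d) (g : Fin 3),
      x.sign * ((x.sign • dirVec g) (g + 2) - (x.sign • dirVec g) (g + 1)) = 2 := fun x g => by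
      simp only [Pi.smul_apply, smul_eq_mul, (dirVec_self g).1, (dirVec_self g).2]
      linear_combination 2 * hs x
  have key := h.graph_virial
    (fun x g => if φ.toEquiv x = x then 0 else x.1.sign • dirVec g.type)
    (fun {c x g y g'} p => ?_) (fun x f hx => ?_) (fun x e he hx => ?_) (fun {c x g y g'} p => ?_) p
  · have h1 := hpair x.1 g.type
    simp only [if_neg hne] at key
    rw [key, sub_self, mul_zero] at h1
    norm_num at h1
  · have hiff : φ.toEquiv y = y ↔ φ.toEquiv x = x := ⟨step p.symm, step p⟩
    simp only [hiff, p.sign h.pos_n, p.type_eq h.colorMap]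
    split_ifs <;> simp
  · split_ifs
    · exact Finset.sum_const_zero
    · simp only [← Finset.smul_sum, face_type, sum_dirVec, smul_zero]
  · exact if_pos (by rw [show x = ⟨.outer e he, trivial⟩ from Subtype.ext hx,
      h.iso_outer φ h.colorMap])
  · by_cases hx : φ.toEquiv x = x
    · simp [hx]
    · simp only [if_neg hx]
      exact (hpair _ _).ge.trans' zero_le_two

end Hive

end

end HoneyHive
end

theorem mainTheorem4 (n d : ℕ) (hn : 3 ≤ n) (hd : d ≤ n) :
    (honey n d = ⋃ C : ColorMap n d, honeyOn n d (reducedGraph C.1)) ∧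
    (∀ C C' : ColorMap n d, C ≠ C' →
      Disjoint (honeyOn n d (reducedGraph C.1)) (honeyOn n d (reducedGraph C'.1))) ∧
    ∀ C : ColorMap n d,
      (∀ α ∈ regularSpectra n, ∀ β ∈ regularSpectra n, ∀ γ ∈ regularSpectra n,
        Set.BijOn (rho C.1) (dualHives C α β γ)
          (honeyOnBdry d (reducedGraph C.1) (hiveBoundary α β γ))) ∧
      ∃ M : (reducedGraph C.1).flows →ₗ[ℝ] (HiveEdge n d → ℝ),
        (reducedGraph C.1).IsIntegral M ∧
        ∀ α ∈ regularSpectra n, ∀ β ∈ regularSpectra n, ∀ γ ∈ regularSpectra n,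
          ∀ L ∈ dualHives C α β γ,
            ∃ ω ∈ (reducedGraph C.1).flowsWithDiv (divergence C.1 (hiveBoundary α β γ)),
              (∀ ω', IsFlowOf (reducedGraph C.1) (rho C.1 L) ω' ↔ ω' = ω) ∧ M ω = L := by
  have hn0 : 0 < n := by omega
  have hhive : ∀ {C : ColorMap n d} {α β γ : Fin n → ℝ}, α ∈ regularSpectra n →
      β ∈ regularSpectra n → γ ∈ regularSpectra n → ∀ {L}, L ∈ dualHives C α β γ →
        Hive C.1 L (hiveBoundary α β γ) := fun hα hβ hγ L hL =>
    (hive_iff hn0).1 ⟨hL, hiveBoundary_anti hα hβ hγ⟩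
  -- A honeycomb with reduced graph `G^C` comes from a dual hive with colour map `C`.
  have hsurj : ∀ (C : ColorMap n d) {h a}, h ∈ honeyOn n d (reducedGraph C.1) →
      HasBoundary h a → ∃ L, Hive C.1 L a ∧ rho C.1 L = h := by
    rintro C h a ⟨hh, ⟨ψ⟩⟩ hb
    obtain ⟨C₁, L, hL, rfl⟩ := exists_hive hn0 hd hh hb
    have hC := hL.color_eq hd C.2 (hL.iso.trans ψ.symm)
    exact ⟨L, hC ▸ hL, by rw [hC]⟩
  refine ⟨Set.Subset.antisymm (fun h hh => ?_) (Set.iUnion_subset fun C h hh => hh.1), ?_,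
    fun C => ⟨fun α hα β hβ γ hγ => ⟨?_, ?_, ?_⟩, ?_⟩⟩
  · obtain ⟨a, ha⟩ := hh.1.exists_boundary hn0
    obtain ⟨C, L, hL, rfl⟩ := exists_hive hn0 hd hh ha
    exact Set.mem_iUnion.2 ⟨⟨C, hL.colorMap⟩, (hL.rho_mem hd).1⟩
  · refine fun C C' hne => Set.disjoint_left.2 fun h h1 h2 => hne ?_
    obtain ⟨a, ha⟩ := h1.1.1.exists_boundary hn0
    obtain ⟨L, hL, -⟩ := hsurj C h1 ha
    obtain ⟨⟨ψ⟩, ⟨ψ'⟩⟩ := And.intro h1.2 h2.2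
    exact Subtype.ext (hL.color_eq hd C'.2 (ψ.trans ψ'.symm)).symm
  · exact fun L hL => (hhive hα hβ hγ hL).rho_mem hd
  · intro L hL L' hL' heq
    have h1 := hhive hα hβ hγ hL
    have h2 := hhive hα hβ hγ hL'
    obtain ⟨M, -, hM⟩ := exists_integral_inverse C.1 hd
    have h3 := (h1.isFlowOf_iff h1.iso_eq_id _).2 rfl
    rw [heq] at h3
    rw [← hM L _ h1, ← hM L' _ h2, (h2.isFlowOf_iff h2.iso_eq_id _).1 h3]
  · intro h hh
    obtain ⟨L, hL, rfl⟩ := hsurj C hh.1 hh.2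
    exact ⟨L, ((hive_iff hn0).2 hL).1, rfl⟩
  · obtain ⟨M, hM, hM'⟩ := exists_integral_inverse C.1 hd
    refine ⟨M, hM, fun α hα β hβ γ hγ L hL => ?_⟩
    have h1 := hhive hα hβ hγ hL
    exact ⟨h1.flow, h1.flow_divergence, h1.isFlowOf_iff h1.iso_eq_id, hM' L _ h1⟩
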